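/- Let $T>0$, $\sigma,m,\epsilon_0>0$ and $q\in\mathbb R\setminus\{0\}$. Let $B_{\rm ext}\in C^2_b(\mathbb R^2)$ (bounded derivatives of order $0,1,2$) with $\inf_{\mathbb R^2}B_{\rm ext}=B_0>0$, and put $\omega_c=qB_{\rm ext}/m$. Let $D\in L^1(\mathbb R^2)\cap W^{1,\infty}(\mathbb R^2)$ with $|x|D\in L^1(\mathbb R^2)$, and let $n_0\ge 0$ satisfy $n_0\in W^{1,1}(\mathbb R^2)\cap W^{1,\infty}(\mathbb R^2)$, $|x|n_0\in L^1(\mathbb R^2)$ and $\int_{\mathbb R^2} n_0\,dx=\int_{\mathbb R^2} D\,dx$. Consider, for $n=n(t,x)$ and $E=(E_1,E_2)(t,x)$ on $(0,T)\times\mathbb R^2$, the system $$\partial_t n+\operatorname{div}_x\!\left[n\begin{pmatrix}\frac{E_2}{B_{\rm ext}}-\frac{\sigma}{\omega_c}\frac{\partial_{x_2}n}{n}\\[2pt]-\frac{E_1}{B_{\rm ext}}+\frac{\sigma}{\omega_c}\frac{\partial_{x_1}n}{n}\end{pmatrix}\right]=0,\qquad \epsilon_0(\partial_{x_1}E_1+\partial_{x_2}E_2)=q(n-D),\qquad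 \partial_{x_1}E_2-\partial_{x_2}E_1=0,\qquad n(0,\cdot)=n_0,$$ where $n\,\frac{\nabla_x n}{n}$ is read as $\nabla_x n$. A nonnegative regular solution is a pair $(n,E)$, continuous on $[0,T]\times\mathbb R^2$, with $n\ge 0$, $n,E\in W^{1,\infty}((0,T)\times\mathbb R^2)$ and $E\in L^\infty(0,T;L^2(\mathbb R^2))$, which satisfies the equations in the sense of distributions on $(0,T)\times\mathbb R^2$ and the initial condition almost everywhere. Then there is a unique nonnegative regular solution $(n,E)$ on $[0,T]\times\mathbb R^2$, and it has the following properties: $n(t,\cdot)\in L^1(\mathbb R^2)$ and $\int_{\mathbb R^2}n(t,x)\,dx=\int_{\mathbb R^2}D\,dx$ for all $t\in[0,T]$; $$n\in W^{1,\infty}(0,T;L^1(\mathbb R^2))\cap W^{1,\infty}((0,T)\times\mathbb R^2),\qquad |x|n\in L^\infty(0,T;L^1(\mathbb R^2)),$$ $$E\in W^{1,\infty}((0,T)\times\mathbb R^2),\qquad E,\ \partial_tE\in L^\infty(0,T;L^2(\mathbb R^2)).$$ Moreover, if in addition $B_{\rm ext}\in C^3_b(\mathbb R^2)$, $D\in W^{1,1}(\mathbb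 R^2)\cap W^{2,\infty}(\mathbb R^2)$, $n_0\in W^{2,1}(\mathbb R^2)\cap W^{2,\infty}(\mathbb R^2)$, $n_0>0$ almost everywhere, and $\ln n_0$ is locally integrable with weak gradient $\nabla\ln n_0\in W^{1,\infty}(\mathbb R^2)$, then $n>0$ on $[0,T]\times\mathbb R^2$ and $$k[n]=\sigma\frac{\nabla_x n}{n}-\frac{q}{m}E\in W^{1,\infty}((0,T)\times\mathbb R^2).$$ -/

import Mathlib

open MeasureTheory Set
open scoped ENNReal ContDiff

noncomputable section

namespace DriftLimit

/-- The plane `ℝ²` with its Euclidean norm. -/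
abbrev Plane : Type := EuclideanSpace ℝ (Fin 2)

section Sobolev

variable {V : Type*} [NormedAddCommGroup V] [NormedSpace ℝ V] [MeasureSpace V]
variable {F : Type*} [NormedAddCommGroup F] [NormedSpace ℝ F]

/-- `φ ∈ C_c^∞(Ω)`. -/
def IsTestFunction (Ω : Set V) (φ : V → ℝ) : Prop :=
  ContDiff ℝ ∞ φ ∧ HasCompactSupport φ ∧ tsupport φ ⊆ Ω

/-- `g` is the weak derivative on the open set `Ω` of the locally integrable function `u`
in the direction `v`. The values may lie in any Banach space (Bochner integrals). -/
def HasWeakDeriv (Ω : Set V) (v : V) (u g : V → F) : Prop :=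
  LocallyIntegrableOn u Ω volume ∧ LocallyIntegrableOn g Ω volume ∧
    ∀ φ : V → ℝ, IsTestFunction Ω φ →
      ∫ z in Ω, (fderiv ℝ φ z v) • u z = - ∫ z in Ω, φ z • g z

/-- The Sobolev space `W^{k,p}(Ω)`: the function and its weak derivatives of order at most `k`
lie in `L^p(Ω)`. -/
def MemSobolev (p : ℝ≥0∞) (Ω : Set V) : ℕ → (V → F) → Prop
  | 0, u => MemLp u p (volume.restrict Ω)
  | k + 1, u => MemLp u p (volume.restrict Ω) ∧
      ∀ v : V, ∃ g : V → F, HasWeakDeriv Ω v u g ∧ MemSobolev p Ω k g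

/-- `C^k_b`: `k` times continuously differentiable with bounded derivatives of order `0, …, k`. -/
def IsCkBounded (k : ℕ) (b : V → ℝ) : Prop :=
  ContDiff ℝ k b ∧ ∀ j ≤ k, ∃ C : ℝ, ∀ x, ‖iteratedFDeriv ℝ j b x‖ ≤ C

/-- `f ∈ W^{k,∞}(0,T; L^p(ℝ²))`: the map `t ↦ f(t,·)` agrees for almost every `t` with an
`L^p`-valued map of class `W^{k,∞}` on `(0,T)`. For `k = 0` this is `L^∞(0,T; L^p(ℝ²))`. -/
def MemTimeSobolev (T : ℝ) (k : ℕ) (p : ℝ≥0∞) [Fact (1 ≤ p)] (f : ℝ → Plane → F) : Prop :=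
  ∃ N : ℝ → Lp F p (volume : Measure Plane),
    (∀ᵐ t ∂(volume.restrict (Ioo 0 T)), N t =ᵐ[volume] f t) ∧ MemSobolev ∞ (Ioo 0 T) k N

end Sobolev

/-- The open space-time slab `(0,T) × ℝ²`. -/
def slab (T : ℝ) : Set (ℝ × Plane) := Ioo 0 T ×ˢ univ

/-- The weak time derivative of `u` on the slab is `r`. -/
def HasWeakTimeDeriv {F : Type*} [NormedAddCommGroup F] [NormedSpace ℝ F]
    (T : ℝ) (u r : ℝ → Plane → F) : Prop :=
  HasWeakDeriv (slab T) ((1 : ℝ), (0 : Plane)) (Function.uncurry u) (Function.uncurry r)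

/-- The weak gradient of `u` in the space variables on the slab is `g`. -/
def HasWeakSpaceGrad (T : ℝ) (u : ℝ → Plane → ℝ) (g : ℝ → Plane → Plane) : Prop :=
  ∀ i : Fin 2, HasWeakDeriv (slab T) ((0 : ℝ), (EuclideanSpace.single i 1 : Plane))
    (Function.uncurry u) (fun z => g z.1 z.2 i)

/-- `div_x F = ρ` on the slab in the sense of distributions. The derivative of the test function
in the direction `(0, F)` is `F · ∇_x φ`. -/
def HasWeakSpaceDiv (T : ℝ) (F : ℝ → Plane → Plane) (ρ : ℝ → Plane → ℝ) : Prop :=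
  LocallyIntegrableOn (Function.uncurry F) (slab T) volume ∧
  LocallyIntegrableOn (Function.uncurry ρ) (slab T) volume ∧
    ∀ φ : ℝ × Plane → ℝ, IsTestFunction (slab T) φ →
      ∫ z in slab T, fderiv ℝ φ z ((0 : ℝ), F z.1 z.2) = - ∫ z in slab T, φ z * ρ z.1 z.2

/-- The scalar curl `∂₁F₂ - ∂₂F₁` vanishes on the slab in the sense of distributions. -/
def WeakCurlFree (T : ℝ) (F : ℝ → Plane → Plane) : Prop :=
  HasWeakSpaceDiv T (fun t x => !₂[F t x 1, - F t x 0]) (fun _ _ => 0)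

/-- `e ∧ w` for `e = (0,0,1)` and a horizontal vector `w = (w₁,w₂,0)`. -/
def eWedge (w : Plane) : Plane := !₂[- w 1, w 0]

/-- The physical constants: velocity diffusion, mass, vacuum permittivity and charge
(which may have either sign). -/
structure Constants where
  σ : ℝ
  m : ℝ
  ε₀ : ℝ
  q : ℝ
  σ_pos : 0 < σ
  m_pos : 0 < m
  ε₀_pos : 0 < ε₀
  q_ne : q ≠ 0

namespace Constants

variable (c : Constants)

/-- The cyclotron frequency `ω_c = q B_ext / m`. -/
def omegaC (B : Plane → ℝ) (x : Plane) : ℝ := c.q * B x / c.m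

/-- `k[n] = σ ∇n / n - (q/m) E`, with `g` in the place of `∇n`. -/
def kField (n : ℝ → Plane → ℝ) (g E : ℝ → Plane → Plane) (t : ℝ) (x : Plane) : Plane :=
  (c.σ / n t x) • g t x - (c.q / c.m) • E t x

/-- The flux `(n e / ω_c) ∧ k[n]`, written as `(e / ω_c) ∧ (σ ∇n - (q/m) n E)` so that it has its
intended meaning also where `n` vanishes; `g` stands for `∇n`. -/
def flux (B : Plane → ℝ) (n : ℝ → Plane → ℝ) (g E : ℝ → Plane → Plane) (t : ℝ) (x : Plane) :
    Plane :=
  (c.omegaC B x)⁻¹ • eWedge (c.σ • g t x - (c.q / c.m * n t x) • E t x)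

/-- `(n, E)`, with `E = (E₁,E₂,0)`, is a nonnegative regular solution on `[0,T] × ℝ²` of
`∂_t n + div[(n e / ω_c) ∧ (σ ∇n / n - (q/m) E)] = 0`, `ε₀ div E = q (n - D)`, `curl E = 0`,
`n(0) = n₀`. Both functions are the continuous representatives of their `W^{1,∞}` classes, and
`E` has finite energy, which fixes the solution of the div-curl system. -/
structure IsRegularSolution (T : ℝ) (B D n₀ : Plane → ℝ)
    (n : ℝ → Plane → ℝ) (E : ℝ → Plane → Plane) : Prop where
  nonneg : ∀ t ∈ Icc 0 T, ∀ x, 0 ≤ n t x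
  n_cont : ContinuousOn (Function.uncurry n) (Icc 0 T ×ˢ univ)
  E_cont : ContinuousOn (Function.uncurry E) (Icc 0 T ×ˢ univ)
  n_mem : MemSobolev ∞ (slab T) 1 (Function.uncurry n)
  E_mem : MemSobolev ∞ (slab T) 1 (Function.uncurry E)
  E_energy : MemTimeSobolev T 0 2 E
  transport : ∃ (r : ℝ → Plane → ℝ) (g : ℝ → Plane → Plane),
    HasWeakTimeDeriv T n r ∧ HasWeakSpaceGrad T n g ∧
      HasWeakSpaceDiv T (c.flux B n g E) (fun t x => - r t x)
  gauss : HasWeakSpaceDiv T (fun t x => c.ε₀ • E t x) (fun t x => c.q * (n t x - D x))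
  curl_free : WeakCurlFree T E
  initial : n 0 =ᵐ[volume] n₀

end Constants

end DriftLimit

end

open MeasureTheory Set Filter Topology
open scoped ENNReal NNReal ContDiff

set_option linter.unusedSectionVars false
set_option linter.unusedVariables false
set_option linter.unusedSimpArgs false
set_option linter.deprecated false

noncomputable section

namespace DriftLimit


/-! The equation only looks diffusive. Put `n = B w`. The flux equals `w B V + (σ m / q) rot ∇w`
with `V = a - B⁻¹ rot E` and `a = (σ m / q) B⁻² rot ∇B` (`Data.flux_eq`). A rotated gradient has no
divergence, `B a` is a multiple of `rot ∇ log B`, and `rot E` is solenoidal because `E` is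
curl-free. Hence `B V` is solenoidal and the continuity equation is the pure transport `∂ₜw + V · ∇w
= 0`. The flow `X` of `V` preserves the measure `B dx` (`IsFlow.measurePreserving`), and `n(t,x) =
B(x) w₀(X(0;t,x))`. Together with `E = c₀ (x/|x|²) * (n - D)` this is a nonlocal system of the type
of the planar vorticity equation, to be solved as a fixed point for `E`.

Global existence rests on a logarithm. Splitting the kernel at a length `δ` shows that the Lipschitz
constant of the field grows only like the logarithm of that of the density
(`IsDensity.norm_field_sub_le`). The latter is at most affine in the exponential of the time
integral of the Lipschitz constant of `V`, so the Lipschitz bound for the new field is affine in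
that integral (`Data.newField_lip`). A bound of the form `ampl * exp (rate * t)` is therefore
reproduced on the whole of `[0,T]` (`Data.admissible_newField`). Two fields are compared through the
displacement of trajectories (`field_displacement`), which makes the map contract in a sup norm with
exponential weight (`Data.newField_contraction`). Picard iteration then converges
(`Data.exists_fixed_field`).

Finite energy comes from neutrality and the first moment: subtracting the kernel centred at the
origin improves the decay of the far field to a square integrable one
(`IsDensity.lintegral_sq_field_le`). The bounds on `∂ₜn` in `L¹` and `∂ₜE` in `L²` use that
`∇(n₀/B)` is integrable.

For uniqueness, the components of any regular solution agree on the closed slab with Lipschitz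
functions. Its `n/B` is constant along the trajectories of its own field (`Data.transport_eq`), so
its density is Lagrangian. Its field differs from the kernel field by a bounded divergence-free and
curl-free field, constant by Liouville and zero by finite energy (`eq_of_solenoidal`,
`Data.eq_newField_of_energy`). It is thus a fixed point as well, and the contraction identifies the
two (`Data.eq_of_fixed`).

For the last assertion, second derivatives are measured by second differences, which pass to
pointwise limits. They are bounded uniformly along the iteration (`Data.exists_diff2_iter_le`),
hence for the flow. Then `log n = log B + log w₀ ∘ X(0;t,·)` has a space gradient that is Lipschitz
in space-time (`Data.exists_lipschitz_logGrad`), and `k[n]` is a combination of this gradient and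
`E`. -/

/-- The rotation by a right angle, `w ↦ e ∧ w`, as a continuous linear map. -/
def rot : Plane →L[ℝ] Plane :=
  LinearMap.toContinuousLinearMap
    { toFun := eWedge
      map_add' := fun x y => by ext i; fin_cases i <;> simp [eWedge]; ring
      map_smul' := fun c x => by ext i; fin_cases i <;> simp [eWedge] }

theorem rot_apply (w : Plane) : rot w = eWedge w := rfl

@[simp] theorem rot_zero_coord (w : Plane) : rot w 0 = - w 1 := by simp [rot_apply, eWedge]

@[simp] theorem rot_one_coord (w : Plane) : rot w 1 = w 0 := by simp [rot_apply, eWedge]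

@[simp] theorem norm_rot (w : Plane) : ‖rot w‖ = ‖w‖ := by
  simp only [EuclideanSpace.norm_eq, Fin.sum_univ_two, rot_zero_coord, rot_one_coord, norm_neg]
  rw [add_comm]

/-! ### The regularized Coulomb kernel and its integrals. -/

/-- The Cauchy type weight `(‖x‖² + δ²)⁻¹`. -/
def wt (δ : ℝ) (x : Plane) : ℝ := (‖x‖ ^ 2 + δ ^ 2)⁻¹

/-- The regularized gradient of the logarithm; `kern 0` is the singular kernel `x / ‖x‖²`. -/
def kern (δ : ℝ) (x : Plane) : Plane := wt δ x • x

theorem wt_nonneg (δ : ℝ) (x : Plane) : 0 ≤ wt δ x := by unfold wt; positivity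

theorem wt_pos {δ : ℝ} (hδ : 0 < δ) (x : Plane) : 0 < wt δ x := by unfold wt; positivity

theorem wt_le {δ : ℝ} (hδ : 0 < δ) (x : Plane) : wt δ x ≤ (δ ^ 2)⁻¹ := by
  unfold wt; gcongr; nlinarith [sq_nonneg ‖x‖]

theorem continuous_wt {δ : ℝ} (hδ : 0 < δ) : Continuous (wt δ) := by
  unfold wt
  exact Continuous.inv₀ (by fun_prop) (fun x => by positivity)

theorem measurable_wt (δ : ℝ) : Measurable (wt δ) := by unfold wt; fun_prop

theorem measurable_kern (δ : ℝ) : Measurable (kern δ) := by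
  unfold kern; exact (measurable_wt δ).smul measurable_id

theorem kern_zero_right (δ : ℝ) : kern δ 0 = 0 := by simp [kern]

theorem norm_kern (δ : ℝ) (x : Plane) : ‖kern δ x‖ = wt δ x * ‖x‖ := by
  rw [kern, norm_smul, Real.norm_of_nonneg (wt_nonneg δ x)]

theorem norm_kern_one_le (x : Plane) : ‖kern 1 x‖ ≤ 1 / 2 := by
  rw [norm_kern, wt, inv_mul_le_iff₀ (by positivity)]
  nlinarith [sq_nonneg (‖x‖ - 1)]

theorem norm_kern_le_zero (δ : ℝ) (x : Plane) : ‖kern δ x‖ ≤ ‖kern 0 x‖ := by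
  rw [norm_kern, norm_kern]
  rcases eq_or_ne x 0 with h | h
  · simp [h]
  · have : 0 < ‖x‖ := norm_pos_iff.2 h
    gcongr
    unfold wt
    exact inv_anti₀ (by positivity) (by nlinarith [sq_nonneg δ])

/-- For `δ = 0` this is the classical identity for the inversion `x ↦ x/|x|²`, with equality. The
regularization costs exactly the nonnegative defect `δ² (wt δ a - wt δ b)²`. -/
theorem norm_kern_sub_sq_le {δ : ℝ} (hδ : 0 < δ) (a b : Plane) :
    ‖kern δ a - kern δ b‖ ^ 2 ≤ ‖a - b‖ ^ 2 * (wt δ a * wt δ b) := by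
  have ha := wt_pos hδ a
  have hb := wt_pos hδ b
  have ha' : ‖a‖ ^ 2 * wt δ a = 1 - δ ^ 2 * wt δ a := by
    have : (‖a‖ ^ 2 + δ ^ 2) * wt δ a = 1 := mul_inv_cancel₀ (by positivity)
    linarith
  have hb' : ‖b‖ ^ 2 * wt δ b = 1 - δ ^ 2 * wt δ b := by
    have : (‖b‖ ^ 2 + δ ^ 2) * wt δ b = 1 := mul_inv_cancel₀ (by positivity)
    linarith
  rw [norm_sub_sq_real, norm_sub_sq_real]
  simp only [kern, norm_smul, inner_smul_left, inner_smul_right, Real.norm_of_nonneg ha.le,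
    Real.norm_of_nonneg hb.le, conj_trivial]
  have e1 : (wt δ a * ‖a‖) ^ 2 = wt δ a * (1 - δ ^ 2 * wt δ a) := by rw [← ha']; ring
  have e2 : (wt δ b * ‖b‖) ^ 2 = wt δ b * (1 - δ ^ 2 * wt δ b) := by rw [← hb']; ring
  have e3 : (‖a‖ ^ 2 - 2 * inner ℝ a b + ‖b‖ ^ 2) * (wt δ a * wt δ b)
      = wt δ b * (1 - δ ^ 2 * wt δ a) - 2 * (wt δ a * wt δ b) * inner ℝ a b
        + wt δ a * (1 - δ ^ 2 * wt δ b) := by rw [← ha', ← hb']; ring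
  rw [e1, e2, e3]
  nlinarith [mul_nonneg (sq_nonneg δ) (sq_nonneg (wt δ a - wt δ b))]

/-- The geometric mean of the two weights is replaced by the arithmetic one, so that each weight can
later be integrated on its own against a density. -/
theorem norm_kern_sub_le {δ : ℝ} (hδ : 0 < δ) (a b : Plane) :
    ‖kern δ a - kern δ b‖ ≤ ‖a - b‖ * ((wt δ a + wt δ b) / 2) := by
  have ha := wt_pos hδ a
  have hb := wt_pos hδ b
  refine abs_le_of_sq_le_sq' ?_ (by positivity) |>.2
  refine (norm_kern_sub_sq_le hδ a b).trans ?_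
  rw [mul_pow]
  gcongr
  nlinarith [sq_nonneg (wt δ a - wt δ b)]

theorem norm_kern_sub_le' {δ : ℝ} (hδ : 0 < δ) (a b : Plane) :
    ‖kern δ a - kern δ b‖ ≤ (δ ^ 2)⁻¹ * ‖a - b‖ := by
  refine (norm_kern_sub_le hδ a b).trans ?_
  rw [mul_comm]
  gcongr
  linarith [wt_le hδ a, wt_le hδ b]

/-- The difference behaves like `|x|⁻¹` at the origin and like `δ² |x|⁻³` at infinity, so it is
integrable on the plane, which the singular kernel itself is not. -/
theorem norm_kern_zero_sub (δ : ℝ) (a : Plane) (ha : a ≠ 0) :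
    ‖kern 0 a - kern δ a‖ = ‖a‖⁻¹ * (δ ^ 2 * wt δ a) := by
  have h : 0 < ‖a‖ := norm_pos_iff.2 ha
  have h2 : wt 0 a - wt δ a = (‖a‖ ^ 2)⁻¹ * (δ ^ 2 * wt δ a) := by
    unfold wt; field_simp; ring
  rw [kern, kern, ← sub_smul, norm_smul, h2, Real.norm_of_nonneg
    (mul_nonneg (by positivity) (mul_nonneg (by positivity) (wt_nonneg _ _)))]
  field_simp

/-- The size of `kern 0 - kern δ`. -/
def near (δ : ℝ) (x : Plane) : ℝ := ‖kern 0 x - kern δ x‖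

theorem near_nonneg (δ : ℝ) (x : Plane) : 0 ≤ near δ x := norm_nonneg _

theorem measurable_near (δ : ℝ) : Measurable (near δ) :=
  ((measurable_kern 0).sub (measurable_kern δ)).norm

theorem near_eq (δ : ℝ) : near δ = fun x => (fun r : ℝ => r⁻¹ * (δ ^ 2 * (r ^ 2 + δ ^ 2)⁻¹)) ‖x‖ := by
  ext x
  rcases eq_or_ne x 0 with h | h
  -- At the origin the right-hand side vanishes because `0⁻¹ = 0`.
  · simp [near, h, kern_zero_right]
  · exact norm_kern_zero_sub δ x h

theorem integrableOn_inv_sq_add {δ : ℝ} (hδ : 0 < δ) :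
    Integrable (fun r : ℝ => (r ^ 2 + δ ^ 2)⁻¹) := by
  have := (integrable_inv_one_add_sq.comp_div (R := δ) hδ.ne').const_mul ((δ ^ 2)⁻¹)
  refine this.congr (Eventually.of_forall fun r => ?_)
  simp only
  field_simp
  ring

theorem integral_inv_sq_add {δ : ℝ} (hδ : 0 < δ) :
    ∫ r : ℝ, (r ^ 2 + δ ^ 2)⁻¹ = Real.pi / δ := by
  have h : (fun r : ℝ => (r ^ 2 + δ ^ 2)⁻¹) = fun r => (δ ^ 2)⁻¹ * (1 + (r / δ) ^ 2)⁻¹ := by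
    ext r
    field_simp
    ring
  rw [h, integral_const_mul, Measure.integral_comp_div (fun r : ℝ => (1 + r ^ 2)⁻¹),
    integral_univ_inv_one_add_sq, abs_of_pos hδ, smul_eq_mul]
  field_simp

theorem finrank_plane : Module.finrank ℝ Plane = 2 := by simp

theorem volume_real_ball : (volume : Measure Plane).real (Metric.ball 0 1) = Real.pi := by
  rw [Measure.real, EuclideanSpace.volume_ball_fin_two]
  simp [Real.pi_pos.le]

theorem integrable_near {δ : ℝ} (hδ : 0 < δ) : Integrable (near δ) := by
  rw [near_eq, integrable_fun_norm_addHaar volume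
    (f := fun r : ℝ => r⁻¹ * (δ ^ 2 * (r ^ 2 + δ ^ 2)⁻¹)), finrank_plane]
  refine (((integrableOn_inv_sq_add hδ).const_mul (δ ^ 2)).integrableOn (s := Ioi 0)).congr_fun
    (fun r hr => ?_) measurableSet_Ioi
  have : (0:ℝ) < r := hr
  simp only [smul_eq_mul]
  field_simp
  norm_num

/-- In polar coordinates the Jacobian cancels the singularity and leaves an arctangent integral. The
half-line is enlarged to the whole line, which loses a factor two. The factor `δ` is what makes the
near part of a field small. -/
theorem integral_near_le {δ : ℝ} (hδ : 0 < δ) :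
    ∫ x, near δ x ≤ 2 * Real.pi ^ 2 * δ := by
  rw [near_eq, integral_fun_norm_addHaar volume
    (fun r : ℝ => r⁻¹ * (δ ^ 2 * (r ^ 2 + δ ^ 2)⁻¹)), finrank_plane, volume_real_ball]
  have : ∫ y in Ioi (0:ℝ), y ^ (2 - 1) • (y⁻¹ * (δ ^ 2 * (y ^ 2 + δ ^ 2)⁻¹))
      = ∫ y in Ioi (0:ℝ), δ ^ 2 * (y ^ 2 + δ ^ 2)⁻¹ := by
    refine setIntegral_congr_fun measurableSet_Ioi fun r hr => ?_
    have : (0:ℝ) < r := hr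
    simp only [smul_eq_mul]
    field_simp
    norm_num
  rw [this]
  have h2 : ∫ y in Ioi (0:ℝ), δ ^ 2 * (y ^ 2 + δ ^ 2)⁻¹ ≤ Real.pi * δ := by
    refine (setIntegral_le_integral ((integrableOn_inv_sq_add hδ).const_mul _)
      (Eventually.of_forall fun r => by simp only [Pi.zero_apply]; positivity)).trans ?_
    rw [integral_const_mul, integral_inv_sq_add hδ]
    apply le_of_eq; field_simp
  simp only [nsmul_eq_mul, smul_eq_mul]
  push_cast
  nlinarith [Real.pi_pos]

theorem integrableOn_wt_ball {δ : ℝ} (hδ : 0 < δ) : IntegrableOn (wt δ) (Metric.ball 0 1) :=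
  (continuous_wt hδ).locallyIntegrable.integrableOn_isCompact (isCompact_closedBall 0 1)
    |>.mono_set Metric.ball_subset_closedBall

/-- This integral is the origin of the logarithm in the Lipschitz estimate for the field. -/
theorem integral_wt_ball {δ : ℝ} (hδ : 0 < δ) :
    ∫ x in Metric.ball (0 : Plane) 1, wt δ x = Real.pi * Real.log (1 + (δ ^ 2)⁻¹) := by
  have h : ∀ x : Plane, (Metric.ball (0:Plane) 1).indicator (wt δ) x
      = (fun r : ℝ => (Iio (1:ℝ)).indicator (fun r => (r ^ 2 + δ ^ 2)⁻¹) r) ‖x‖ := by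
    intro x
    by_cases hx : ‖x‖ < 1 <;> simp [indicator, hx, wt]
  rw [← integral_indicator measurableSet_ball]
  simp_rw [h]
  rw [integral_fun_norm_addHaar, finrank_plane, volume_real_ball]
  have h2 : ∫ y in Ioi (0:ℝ), y ^ (2 - 1) • (Iio (1:ℝ)).indicator (fun r => (r ^ 2 + δ ^ 2)⁻¹) y
      = ∫ y in (0:ℝ)..1, y * (y ^ 2 + δ ^ 2)⁻¹ := by
    rw [intervalIntegral.integral_of_le zero_le_one, ← integral_Ico_eq_integral_Ioc,
      integral_Ico_eq_integral_Ioo, ← integral_indicator measurableSet_Ioi,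
      ← integral_indicator measurableSet_Ioo]
    congr 1
    ext r
    by_cases h0 : 0 < r <;> by_cases h1 : r < 1 <;> simp [indicator, h0, h1]
  rw [h2]
  have h3 : ∫ y in (0:ℝ)..1, y * (y ^ 2 + δ ^ 2)⁻¹
      = Real.log (1 ^ 2 + δ ^ 2) / 2 - Real.log (0 ^ 2 + δ ^ 2) / 2 := by
    refine intervalIntegral.integral_eq_sub_of_hasDerivAt
      (f := fun y => Real.log (y ^ 2 + δ ^ 2) / 2) (fun y _ => ?_) ?_
    · have hp : y ^ 2 + δ ^ 2 ≠ 0 := by positivity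
      have := (((hasDerivAt_pow 2 y).add_const (δ ^ 2)).log hp).div_const 2
      exact this.congr_deriv (by push_cast; field_simp)
    · refine Continuous.intervalIntegrable ?_ _ _
      exact continuous_id.mul (Continuous.inv₀ (by fun_prop) (fun x => by positivity))
  rw [h3]
  have h4 : Real.log (1 + (δ ^ 2)⁻¹) = Real.log (1 ^ 2 + δ ^ 2) - Real.log (0 ^ 2 + δ ^ 2) := by
    rw [← Real.log_div (by positivity) (by positivity)]
    congr 1
    field_simp
    ring
  rw [h4]
  simp only [nsmul_eq_mul, smul_eq_mul]
  push_cast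
  ring

theorem wt_le_one_of_notMem {δ : ℝ} {x : Plane} (hx : x ∉ Metric.ball (0 : Plane) 1) :
    wt δ x ≤ 1 := by
  have : 1 ≤ ‖x‖ := by simpa using hx
  unfold wt
  apply inv_le_one_of_one_le₀
  nlinarith [sq_nonneg δ]

/-- The function is half the divergence of `kern δ`. That its mass does not depend on `δ` makes
these divergences an approximate identity of mass `2π`. -/
theorem integral_wt_sq {δ : ℝ} (hδ : 0 < δ) :
    Integrable (fun x : Plane => δ ^ 2 * wt δ x ^ 2) ∧ ∫ x, δ ^ 2 * wt δ x ^ 2 = Real.pi := by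
  have hderiv : ∀ y ∈ Ici (0:ℝ), HasDerivAt (fun y => - δ ^ 2 * (y ^ 2 + δ ^ 2)⁻¹ / 2)
      (y * (δ ^ 2 * ((y ^ 2 + δ ^ 2)⁻¹) ^ 2)) y := by
    intro y _
    have hp : y ^ 2 + δ ^ 2 ≠ 0 := by positivity
    have := ((((hasDerivAt_pow 2 y).add_const (δ ^ 2)).inv hp).const_mul (- δ ^ 2)).div_const 2
    exact this.congr_deriv (by push_cast; field_simp)
  have hlim : Tendsto (fun y : ℝ => - δ ^ 2 * (y ^ 2 + δ ^ 2)⁻¹ / 2) atTop (𝓝 0) := by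
    have h1 : Tendsto (fun y : ℝ => y ^ 2 + δ ^ 2) atTop atTop :=
      tendsto_atTop_add_const_right _ _ (tendsto_pow_atTop two_ne_zero)
    simpa using (h1.inv_tendsto_atTop.const_mul (- δ ^ 2)).div_const 2
  have hi := integrableOn_Ioi_deriv_of_nonneg' hderiv
    (fun y hy => by have : (0:ℝ) < y := hy; positivity) hlim
  have hv := integral_Ioi_of_hasDerivAt_of_nonneg' hderiv
    (fun y hy => by have : (0:ℝ) < y := hy; positivity) hlim
  have hfun : (fun x : Plane => δ ^ 2 * wt δ x ^ 2)
      = fun x => (fun r : ℝ => δ ^ 2 * ((r ^ 2 + δ ^ 2)⁻¹) ^ 2) ‖x‖ := rfl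
  constructor
  · rw [hfun, integrable_fun_norm_addHaar volume
      (f := fun r : ℝ => δ ^ 2 * ((r ^ 2 + δ ^ 2)⁻¹) ^ 2), finrank_plane]
    simpa using hi
  · rw [hfun, integral_fun_norm_addHaar volume
      (fun r : ℝ => δ ^ 2 * ((r ^ 2 + δ ^ 2)⁻¹) ^ 2), finrank_plane, volume_real_ball]
    simp only [Nat.add_one_sub_one, pow_one, smul_eq_mul, nsmul_eq_mul]
    rw [hv]
    push_cast
    field_simp
    norm_num


/-! ### Integration by parts for Lipschitz functions. -/

section IntegrationByParts

variable {V : Type*} [NormedAddCommGroup V] [NormedSpace ℝ V] [FiniteDimensional ℝ V]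
  [MeasurableSpace V] [BorelSpace V] {μ : Measure V} [μ.IsAddHaarMeasure]

theorem ae_fderiv_eq_lineDeriv {f : V → ℝ} {C : ℝ≥0} (hf : LipschitzWith C f) (v : V) :
    (fun x => fderiv ℝ f x v) =ᵐ[μ] fun x => lineDeriv ℝ f x v := by
  filter_upwards [hf.ae_differentiableAt (μ := μ)] with x hx
  exact hx.lineDeriv_eq_fderiv.symm

/-- Integration by parts for Lipschitz functions, one of which has compact support. -/
theorem integral_fderiv_mul_eq_neg {f g : V → ℝ} {C D : ℝ≥0} (hf : LipschitzWith C f)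
    (hg : LipschitzWith D g) (h : HasCompactSupport g) (v : V) :
    ∫ x, fderiv ℝ f x v * g x ∂μ = - ∫ x, f x * fderiv ℝ g x v ∂μ := by
  have h1 := hf.integral_lineDeriv_mul_eq (μ := μ) hg h v
  have h2 : ∫ x, fderiv ℝ f x v * g x ∂μ = ∫ x, lineDeriv ℝ f x v * g x ∂μ :=
    integral_congr_ae (by
      filter_upwards [ae_fderiv_eq_lineDeriv (μ := μ) hf v] with x hx
      rw [hx])
  have h3 : ∫ x, f x * fderiv ℝ g x v ∂μ = - ∫ x, lineDeriv ℝ g x (-v) * f x ∂μ := by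
    rw [← integral_neg]
    refine integral_congr_ae ?_
    filter_upwards [ae_fderiv_eq_lineDeriv (μ := μ) hg v] with x hx
    rw [hx, lineDeriv_neg]
    ring
  rw [h2, h3, h1, neg_neg]

theorem integral_fderiv_mul_eq_neg' {f g : V → ℝ} {C D : ℝ≥0} (hf : LipschitzWith C f)
    (hg : LipschitzWith D g) (h : HasCompactSupport f) (v : V) :
    ∫ x, fderiv ℝ f x v * g x ∂μ = - ∫ x, f x * fderiv ℝ g x v ∂μ := by
  have := integral_fderiv_mul_eq_neg (μ := μ) hg hf h v
  simp_rw [mul_comm (f _), mul_comm _ (g _)]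
  rw [← neg_eq_iff_eq_neg, ← this]

end IntegrationByParts

theorem norm_fderiv_le_of_lipschitzWith {V F : Type*} [NormedAddCommGroup V]
    [NormedSpace ℝ V] [NormedAddCommGroup F]
    [NormedSpace ℝ F] {f : V → F} {C : ℝ≥0} (hf : LipschitzWith C f)
    (x v : V) : ‖fderiv ℝ f x v‖ ≤ C * ‖v‖ :=
  (ContinuousLinearMap.le_opNorm _ _).trans (by gcongr; exact norm_fderiv_le_of_lipschitz ℝ hf)

/-- The standard basis vectors of the plane. -/
abbrev basisVec (i : Fin 2) : Plane := EuclideanSpace.single i 1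

theorem plane_decomp (w : Plane) : w = w 0 • basisVec 0 + w 1 • basisVec 1 := by
  ext i; fin_cases i <;> simp

theorem norm_basisVec (i : Fin 2) : ‖basisVec i‖ = 1 := by simp

theorem abs_coord_le (w : Plane) (i : Fin 2) : |w i| ≤ ‖w‖ := by
  simpa using PiLp.norm_apply_le w i

theorem lipschitzWith_coord {V : Type*} [PseudoMetricSpace V] {G : V → Plane} {C : ℝ≥0}
    (hG : LipschitzWith C G) (i : Fin 2) : LipschitzWith C fun x => G x i := by
  refine LipschitzWith.of_dist_le_mul fun x y => ?_
  refine le_trans ?_ (hG.dist_le_mul x y)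
  rw [Real.dist_eq, dist_eq_norm]
  exact abs_coord_le (G x - G y) i

theorem fderiv_coord {V : Type*} [NormedAddCommGroup V] [NormedSpace ℝ V] {G : V → Plane} {x : V}
    (hG : DifferentiableAt ℝ G x) (i : Fin 2) (v : V) :
    fderiv ℝ (fun x => G x i) x v = fderiv ℝ G x v i := by
  have := ((EuclideanSpace.proj (𝕜 := ℝ) i).hasFDerivAt (x := G x)).comp x hG.hasFDerivAt
  exact congrArg (fun L => L v) this.fderiv

theorem fderiv_apply_plane (L : Plane →L[ℝ] ℝ) (w : Plane) :
    L w = w 0 * L (basisVec 0) + w 1 * L (basisVec 1) := by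
  conv_lhs => rw [plane_decomp w]
  simp

/-- The divergence of a vector field at the points of differentiability. -/
def divg (G : Plane → Plane) (x : Plane) : ℝ :=
  fderiv ℝ G x (basisVec 0) 0 + fderiv ℝ G x (basisVec 1) 1

theorem integrable_bounded_mul_of_compact {V : Type*} [NormedAddCommGroup V]
    [MeasurableSpace V] [BorelSpace V] {μ : Measure V} [IsFiniteMeasureOnCompacts μ]
    {f g : V → ℝ} {C : ℝ} (hf : AEStronglyMeasurable f μ) (hb : ∀ x, |f x| ≤ C)
    (hg : Continuous g) (h : HasCompactSupport g) : Integrable (fun x => f x * g x) μ :=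
  (hg.integrable_of_hasCompactSupport h).bdd_mul hf (Eventually.of_forall hb)

theorem integrable_fderiv_mul {V : Type*} [NormedAddCommGroup V] [NormedSpace ℝ V]
    [FiniteDimensional ℝ V] [MeasurableSpace V] [BorelSpace V] {μ : Measure V}
    [IsFiniteMeasureOnCompacts μ] {f g : V → ℝ} {C : ℝ≥0} (hf : LipschitzWith C f)
    (hg : Continuous g) (h : HasCompactSupport f) (v : V) :
    Integrable (fun x => fderiv ℝ f x v * g x) μ := by
  have hs : Function.support (fun x => fderiv ℝ f x v * g x) ⊆ tsupport f := by
    refine (Function.support_mul_subset_left _ _).trans ?_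
    intro x hx
    refine (tsupport_fderiv_subset ℝ (f := f)) (subset_tsupport _ ?_)
    intro h0
    simp [h0] at hx
  rw [← integrableOn_iff_integrable_of_support_subset hs]
  obtain ⟨M, hM⟩ := h.isCompact.exists_bound_of_continuousOn hg.continuousOn
  refine Measure.integrableOn_of_bounded (M := C * ‖v‖ * M) h.isCompact.measure_lt_top.ne
    ((measurable_fderiv_apply_const ℝ f v).mul hg.measurable).aestronglyMeasurable ?_
  filter_upwards [ae_restrict_mem h.isCompact.measurableSet] with x hx
  rw [norm_mul]
  exact mul_le_mul (norm_fderiv_le_of_lipschitzWith hf x v) (hM x hx) (norm_nonneg _)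
    (by positivity)

theorem integral_fderiv_apply_field {φ : Plane → ℝ} {G : Plane → Plane} {C D : ℝ≥0}
    (hφ : LipschitzWith C φ) (hc : HasCompactSupport φ) (hG : LipschitzWith D G) :
    ∫ x, fderiv ℝ φ x (G x) = - ∫ x, φ x * divg G x := by
  have hGi := fun i => lipschitzWith_coord hG i
  have e1 : ∀ x, fderiv ℝ φ x (G x)
      = fderiv ℝ φ x (basisVec 0) * G x 0 + fderiv ℝ φ x (basisVec 1) * G x 1 := fun x => by
    rw [fderiv_apply_plane]; ring
  simp_rw [e1]
  rw [integral_add (integrable_fderiv_mul hφ (hGi 0).continuous hc _)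
      (integrable_fderiv_mul hφ (hGi 1).continuous hc _),
    integral_fderiv_mul_eq_neg' hφ (hGi 0) hc, integral_fderiv_mul_eq_neg' hφ (hGi 1) hc,
    ← neg_add, neg_inj, ← integral_add]
  · refine integral_congr_ae ?_
    filter_upwards [hG.ae_differentiableAt] with x hx
    rw [fderiv_coord hx, fderiv_coord hx, divg]
    ring
  all_goals
    simp_rw [mul_comm (φ _)]
    refine integrable_bounded_mul_of_compact (C := D * 1)
      (measurable_fderiv_apply_const ℝ _ _).aestronglyMeasurable
      (fun x => ?_) hφ.continuous hc
    refine (norm_fderiv_le_of_lipschitzWith (hGi _) x (basisVec _)).trans_eq ?_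
    rw [norm_basisVec]

/-! ### Divergence and curl of the kernel. -/

theorem hasFDerivAt_wt {δ : ℝ} (hδ : 0 < δ) (x : Plane) :
    HasFDerivAt (wt δ) (-(2 * wt δ x ^ 2) • innerSL ℝ x) x := by
  have hne : ‖x‖ ^ 2 + δ ^ 2 ≠ 0 := by positivity
  have h1 : HasFDerivAt (fun x : Plane => ‖x‖ ^ 2 + δ ^ 2) (2 • innerSL ℝ x) x :=
    (hasStrictFDerivAt_norm_sq x).hasFDerivAt.add_const _
  have h2 := (hasDerivAt_inv hne).comp_hasFDerivAt x h1
  refine HasFDerivAt.congr_fderiv (f := wt δ) h2 ?_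
  ext v
  simp [wt]
  ring

theorem hasFDerivAt_kern {δ : ℝ} (hδ : 0 < δ) (x : Plane) :
    HasFDerivAt (kern δ) (wt δ x • ContinuousLinearMap.id ℝ Plane +
      (-(2 * wt δ x ^ 2) • innerSL ℝ x).smulRight x) x :=
  (hasFDerivAt_wt hδ x).smul (hasFDerivAt_id x)

theorem fderiv_kern_apply {δ : ℝ} (hδ : 0 < δ) (x v : Plane) :
    fderiv ℝ (kern δ) x v = wt δ x • v - (2 * inner ℝ (kern δ x) v) • kern δ x := by
  rw [(hasFDerivAt_kern hδ x).fderiv]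
  simp [kern, inner_smul_left, smul_smul, sub_eq_add_neg, ← neg_smul]
  ring_nf

theorem differentiable_kern {δ : ℝ} (hδ : 0 < δ) : Differentiable ℝ (kern δ) :=
  fun x => (hasFDerivAt_kern hδ x).differentiableAt

theorem wt_mul_norm_sq {δ : ℝ} (hδ : 0 < δ) (x : Plane) :
    wt δ x * (x 0 ^ 2 + x 1 ^ 2) = 1 - δ ^ 2 * wt δ x := by
  have : (‖x‖ ^ 2 + δ ^ 2) * wt δ x = 1 := mul_inv_cancel₀ (by positivity)
  rw [EuclideanSpace.norm_sq_eq, Fin.sum_univ_two] at this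
  simp only [Real.norm_eq_abs, sq_abs] at this
  linarith

theorem divg_kern {δ : ℝ} (hδ : 0 < δ) (x : Plane) : divg (kern δ) x = 2 * (δ ^ 2 * wt δ x ^ 2) := by
  rw [divg, fderiv_kern_apply hδ, fderiv_kern_apply hδ]
  simp [kern, inner_smul_left, PiLp.inner_apply]
  have := wt_mul_norm_sq hδ x
  linear_combination (-2 * wt δ x) * this

theorem divg_rot_kern {δ : ℝ} (hδ : 0 < δ) (x : Plane) : divg (fun x => rot (kern δ x)) x = 0 := by
  have h : fderiv ℝ (fun x => rot (kern δ x)) x = rot.comp (fderiv ℝ (kern δ) x) :=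
    (rot.hasFDerivAt.comp x (differentiable_kern hδ x).hasFDerivAt).fderiv
  rw [divg, h]
  simp only [ContinuousLinearMap.comp_apply, rot_zero_coord, rot_one_coord]
  rw [fderiv_kern_apply hδ, fderiv_kern_apply hδ]
  simp [kern, inner_smul_left, PiLp.inner_apply]
  ring

theorem divg_comp_sub (G : Plane → Plane) (y x : Plane) :
    divg (fun x => G (x - y)) x = divg G (x - y) := by
  simp [divg, fderiv_comp_sub]

theorem lipschitzWith_kern {δ : ℝ} (hδ : 0 < δ) :
    LipschitzWith (Real.toNNReal (δ ^ 2)⁻¹) (kern δ) :=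
  LipschitzWith.of_dist_le_mul fun a b => by
    rw [dist_eq_norm, dist_eq_norm, Real.coe_toNNReal _ (by positivity)]
    exact norm_kern_sub_le' hδ a b

theorem lipschitzWith_comp_sub {V F : Type*} [NormedAddCommGroup V] [PseudoMetricSpace F]
    {G : V → F} {C : ℝ≥0} (hG : LipschitzWith C G) (y : V) :
    LipschitzWith C fun x => G (x - y) :=
  LipschitzWith.of_dist_le_mul fun a b => by simpa using hG.dist_le_mul (a - y) (b - y)

theorem lipschitzWith_rot : LipschitzWith 1 (rot : Plane → Plane) :=
  LipschitzWith.of_dist_le_mul fun a b => by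
    rw [dist_eq_norm, dist_eq_norm, ← map_sub, norm_rot]; simp

/-- Integration by parts produces the divergence of the kernel. Rescaling by `δ` turns it into a
fixed profile tested against `φ (y + δ u)`, a form in which `δ → 0` is immediate. -/
theorem integral_fderiv_kern {δ : ℝ} (hδ : 0 < δ) {φ : Plane → ℝ} {C : ℝ≥0}
    (hφ : LipschitzWith C φ) (hc : HasCompactSupport φ) (y : Plane) :
    ∫ x, fderiv ℝ φ x (kern δ (x - y)) = - ∫ u, φ (y + δ • u) * (2 * wt 1 u ^ 2) := by
  rw [integral_fderiv_apply_field hφ hc (lipschitzWith_comp_sub (lipschitzWith_kern hδ) y)]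
  simp_rw [divg_comp_sub, divg_kern hδ]
  congr 1
  have h1 : ∫ x, φ x * (2 * (δ ^ 2 * wt δ (x - y) ^ 2))
      = ∫ x, φ (y + x) * (2 * (δ ^ 2 * wt δ x ^ 2)) := by
    rw [← integral_add_left_eq_self _ y]
    simp
  rw [h1]
  have h2 := Measure.integral_comp_smul (volume : Measure Plane)
    (fun x => φ (y + x) * (2 * (δ ^ 2 * wt δ x ^ 2))) δ
  rw [finrank_plane, abs_of_pos (by positivity)] at h2
  have h3 : ∫ x, φ (y + x) * (2 * (δ ^ 2 * wt δ x ^ 2)) =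
      δ ^ 2 * ∫ x, φ (y + δ • x) * (2 * (δ ^ 2 * wt δ (δ • x) ^ 2)) := by
    rw [h2, smul_eq_mul, mul_inv_cancel_left₀ (by positivity)]
  rw [h3, ← integral_const_mul]
  congr 1
  ext u
  have : wt δ (δ • u) = (δ ^ 2)⁻¹ * wt 1 u := by
    simp only [wt, norm_smul, Real.norm_of_nonneg hδ.le]
    field_simp
  rw [this]
  field_simp

theorem integral_fderiv_rot_kern {δ : ℝ} (hδ : 0 < δ) {φ : Plane → ℝ} {C : ℝ≥0}
    (hφ : LipschitzWith C φ) (hc : HasCompactSupport φ) (y : Plane) :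
    ∫ x, fderiv ℝ φ x (rot (kern δ (x - y))) = 0 := by
  have h := integral_fderiv_apply_field hφ hc
    (lipschitzWith_rot.comp (lipschitzWith_comp_sub (lipschitzWith_kern hδ) y))
  simp only [Function.comp_def] at h
  rw [h]
  have : ∀ x, divg (fun x => rot (kern δ (x - y))) x = 0 := fun x => by
    rw [divg_comp_sub (fun x => rot (kern δ x)) y x, divg_rot_kern hδ]
  simp [this]

/-- The right-hand side is locally integrable and free of `δ`. It dominates all regularized kernels
at once in the passage to the singular one. -/
theorem norm_kern_zero_le (x : Plane) : ‖kern 0 x‖ ≤ near 1 x + 1 / 2 := by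
  have h : kern 0 x = (kern 0 x - kern 1 x) + kern 1 x := by abel
  calc ‖kern 0 x‖ = ‖(kern 0 x - kern 1 x) + kern 1 x‖ := by rw [← h]
    _ ≤ near 1 x + ‖kern 1 x‖ := norm_add_le _ _
    _ ≤ _ := by gcongr; exact norm_kern_one_le x

/-- A majorant of `fderiv φ x (kern δ (x - y))`, uniform in `δ`. -/
theorem norm_fderiv_kern_le {φ : Plane → ℝ} {C : ℝ≥0} (hφ : LipschitzWith C φ) (L : Plane → Plane)
    (hL : ∀ w, ‖L w‖ = ‖w‖) (δ : ℝ) (x y : Plane) :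
    ‖fderiv ℝ φ x (L (kern δ (x - y)))‖
      ≤ (tsupport φ).indicator (fun x => C * (near 1 (x - y) + 1 / 2)) x := by
  by_cases hx : x ∈ tsupport φ
  · rw [indicator_of_mem hx]
    refine (norm_fderiv_le_of_lipschitzWith hφ _ _).trans ?_
    rw [hL]
    gcongr
    exact (norm_kern_le_zero _ _).trans (norm_kern_zero_le _)
  · rw [indicator_of_notMem hx]
    have : fderiv ℝ φ x = 0 := by
      by_contra h
      exact hx (tsupport_fderiv_subset ℝ (subset_tsupport _ h))
    simp [this]

theorem integrable_fderiv_kern_bound {φ : Plane → ℝ} (C : ℝ≥0) (hc : HasCompactSupport φ)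
    (y : Plane) :
    Integrable ((tsupport φ).indicator (fun x => C * (near 1 (x - y) + 1 / 2))) := by
  rw [integrable_indicator_iff hc.isCompact.measurableSet]
  refine Integrable.const_mul ?_ _
  refine Integrable.add ((integrable_near one_pos).comp_sub_right y).integrableOn ?_
  exact (integrable_const_iff.2 (Or.inr ⟨by simpa using hc.isCompact.measure_lt_top⟩))

theorem measurable_fderiv_field {φ : Plane → ℝ} {G : Plane → Plane} (hG : Measurable G) :
    Measurable fun x => fderiv ℝ φ x (G x) := by
  have e1 : (fun x => fderiv ℝ φ x (G x)) = fun x => G x 0 * fderiv ℝ φ x (basisVec 0)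
      + G x 1 * fderiv ℝ φ x (basisVec 1) := by
    ext x; rw [fderiv_apply_plane]
  rw [e1]
  have h : ∀ i : Fin 2, Measurable fun x => G x i := fun i =>
    (EuclideanSpace.proj (𝕜 := ℝ) i).continuous.measurable.comp hG
  exact ((h 0).mul (measurable_fderiv_apply_const ℝ φ _)).add
    ((h 1).mul (measurable_fderiv_apply_const ℝ φ _))

theorem continuousAt_kern_delta (x : Plane) :
    Tendsto (fun n : ℕ => kern (1 / ((n : ℝ) + 1)) x) atTop (𝓝 (kern 0 x)) := by
  rcases eq_or_ne x 0 with rfl | hx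
  · simp [kern_zero_right]
  · have h : 0 < ‖x‖ := norm_pos_iff.2 hx
    have h0 : Tendsto (fun n : ℕ => (1 : ℝ) / ((n : ℝ) + 1)) atTop (𝓝 0) :=
      tendsto_one_div_add_atTop_nhds_zero_nat
    refine Tendsto.smul_const ?_ x
    unfold wt
    refine Tendsto.inv₀ (tendsto_const_nhds.add (h0.pow 2)) (by positivity)

theorem tendsto_integral_fderiv_kern {φ : Plane → ℝ} {C : ℝ≥0} (hφ : LipschitzWith C φ)
    (hc : HasCompactSupport φ) (L : Plane →L[ℝ] Plane) (hL : ∀ w, ‖L w‖ = ‖w‖) (y : Plane) :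
    Tendsto (fun n : ℕ => ∫ x, fderiv ℝ φ x (L (kern (1 / ((n : ℝ) + 1)) (x - y)))) atTop
      (𝓝 (∫ x, fderiv ℝ φ x (L (kern 0 (x - y))))) := by
  refine tendsto_integral_of_dominated_convergence _
    (fun n => (measurable_fderiv_field (L.continuous.measurable.comp
      ((measurable_kern _).comp (measurable_id.sub_const y)))).aestronglyMeasurable)
    (integrable_fderiv_kern_bound C hc y)
    (fun n => Eventually.of_forall fun x => norm_fderiv_kern_le hφ L hL _ x y)
    (Eventually.of_forall fun x => ?_)
  exact ((fderiv ℝ φ x).continuous.tendsto _).comp ((L.continuous.tendsto _).comp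
    (continuousAt_kern_delta (x - y)))

/-- The kernel `kern 0` is curl-free in the sense of distributions. -/
theorem integral_fderiv_rot_kern_zero {φ : Plane → ℝ} {C : ℝ≥0}
    (hφ : LipschitzWith C φ) (hc : HasCompactSupport φ) (y : Plane) :
    ∫ x, fderiv ℝ φ x (rot (kern 0 (x - y))) = 0 := by
  refine tendsto_nhds_unique (tendsto_integral_fderiv_kern hφ hc rot norm_rot y) ?_
  simp_rw [fun n : ℕ => integral_fderiv_rot_kern (δ := 1 / ((n : ℝ) + 1)) (by positivity) hφ hc y]
  exact tendsto_const_nhds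

/-- The divergence of `kern 0` is `2π` times the Dirac mass. -/
theorem integral_fderiv_kern_zero {φ : Plane → ℝ} {C : ℝ≥0}
    (hφ : LipschitzWith C φ) (hc : HasCompactSupport φ) (y : Plane) :
    ∫ x, fderiv ℝ φ x (kern 0 (x - y)) = - (2 * Real.pi * φ y) := by
  refine tendsto_nhds_unique
    (tendsto_integral_fderiv_kern hφ hc (ContinuousLinearMap.id ℝ Plane) (fun _ => rfl) y) ?_
  simp only [ContinuousLinearMap.id_apply]
  simp_rw [fun n : ℕ => integral_fderiv_kern (δ := 1 / ((n : ℝ) + 1)) (by positivity) hφ hc y]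
  refine Tendsto.neg ?_
  obtain ⟨M, hM⟩ := hφ.continuous.bounded_above_of_compact_support hc
  have hw := integral_wt_sq one_pos
  simp only [one_pow, one_mul] at hw
  have hlim : 2 * Real.pi * φ y = ∫ u, φ y * (2 * wt 1 u ^ 2) := by
    rw [integral_const_mul, integral_const_mul, hw.2]; ring
  rw [hlim]
  refine tendsto_integral_of_dominated_convergence (fun u => M * (2 * wt 1 u ^ 2)) (fun n => ?_)
    ((hw.1.const_mul 2).const_mul M) (fun n => Eventually.of_forall fun u => ?_)
    (Eventually.of_forall fun u => ?_)
  · have := continuous_wt one_pos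
    have := hφ.continuous
    exact Continuous.aestronglyMeasurable (by fun_prop)
  · rw [norm_mul, Real.norm_of_nonneg (r := 2 * wt 1 u ^ 2) (by positivity)]
    gcongr
    exact hM _
  · have h0 : Tendsto (fun n : ℕ => (1 : ℝ) / ((n : ℝ) + 1)) atTop (𝓝 0) :=
      tendsto_one_div_add_atTop_nhds_zero_nat
    refine Tendsto.mul_const _ ?_
    have h1 : Tendsto (fun n : ℕ => y + ((1 : ℝ) / ((n : ℝ) + 1)) • u) atTop (𝓝 (y + (0:ℝ) • u)) :=
      tendsto_const_nhds.add (h0.smul_const u)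
    rw [zero_smul, add_zero] at h1
    exact (hφ.continuous.tendsto y).comp h1

/-! ### Second differences. -/

/-- The second difference of a function. -/
def diff2 {V F : Type*} [Add V] [AddCommGroup F] (f : V → F) (x h k : V) : F :=
  f (x + h + k) - f (x + h) - f (x + k) + f x

/-- The mean value inequality is applied to the increment `z ↦ f (z + h) - f z` between `x` and `x +
k`. -/
theorem norm_diff2_le_of_fderiv {V F : Type*} [NormedAddCommGroup V] [NormedSpace ℝ V]
    [NormedAddCommGroup F] [NormedSpace ℝ F] {f : V → F} (hf : Differentiable ℝ f) {C : ℝ}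
    (hC : ∀ x y, ‖fderiv ℝ f x - fderiv ℝ f y‖ ≤ C * ‖x - y‖) (x h k : V) :
    ‖diff2 f x h k‖ ≤ C * ‖h‖ * ‖k‖ := by
  have h1 : ∀ z, HasFDerivAt (fun z => f (z + h) - f z) (fderiv ℝ f (z + h) - fderiv ℝ f z) z :=
    fun z => ((hasFDerivAt_comp_add_right h).2 (hf (z + h)).hasFDerivAt).sub (hf z).hasFDerivAt
  have := Convex.norm_image_sub_le_of_norm_hasFDerivWithin_le (s := univ) (C := C * ‖h‖)
    (fun z _ => (h1 z).hasFDerivWithinAt) (fun z _ => by simpa using hC (z + h) z) convex_univ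
    (mem_univ x) (mem_univ (x + k))
  rw [add_sub_cancel_left] at this
  refine le_of_eq_of_le ?_ this
  rw [diff2, add_right_comm x k h]
  congr 1
  abel

/-- The derivative is a weight times the identity minus a quadratic expression in `kern 1`. The
variation of the weight and of each of the two quadratic factors contributes `‖x - y‖` once, because
`‖kern 1‖ ≤ 1/2`; the constant four leaves some slack. -/
theorem norm_fderiv_kern_one_sub_le (x y : Plane) :
    ‖fderiv ℝ (kern 1) x - fderiv ℝ (kern 1) y‖ ≤ 4 * ‖x - y‖ := by
  refine ContinuousLinearMap.opNorm_le_bound _ (by positivity) fun v => ?_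
  rw [_root_.sub_apply, fderiv_kern_apply one_pos, fderiv_kern_apply one_pos]
  have hk : ‖kern 1 x - kern 1 y‖ ≤ ‖x - y‖ := by simpa using norm_kern_sub_le' one_pos x y
  have hx := norm_kern_one_le x
  have hy := norm_kern_one_le y
  have hwt : |wt 1 x - wt 1 y| ≤ ‖x - y‖ := by
    have e : wt 1 x - wt 1 y = (wt 1 x * wt 1 y) * ((‖y‖ - ‖x‖) * (‖y‖ + ‖x‖)) := by
      unfold wt; field_simp; ring
    have e2 : wt 1 x * wt 1 y * (‖y‖ + ‖x‖) ≤ 1 := by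
      have hx1 := wt_le one_pos x
      have hy1 := wt_le one_pos y
      rw [norm_kern] at hx hy
      have := wt_nonneg 1 x
      have := wt_nonneg 1 y
      norm_num at hx1 hy1
      nlinarith [norm_nonneg x, norm_nonneg y]
    have e3 : 0 ≤ wt 1 x * wt 1 y * (‖y‖ + ‖x‖) :=
      mul_nonneg (mul_nonneg (wt_nonneg _ _) (wt_nonneg _ _)) (by positivity)
    rw [e, show wt 1 x * wt 1 y * ((‖y‖ - ‖x‖) * (‖y‖ + ‖x‖))
      = (wt 1 x * wt 1 y * (‖y‖ + ‖x‖)) * (‖y‖ - ‖x‖) by ring, abs_mul, abs_of_nonneg e3]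
    have e4 : |‖y‖ - ‖x‖| ≤ ‖x - y‖ := by
      rw [norm_sub_rev]; exact abs_norm_sub_norm_le y x
    nlinarith [abs_nonneg (‖y‖ - ‖x‖)]
  have e : (wt 1 x • v - (2 * inner ℝ (kern 1 x) v) • kern 1 x)
      - (wt 1 y • v - (2 * inner ℝ (kern 1 y) v) • kern 1 y)
      = (wt 1 x - wt 1 y) • v - ((2 * inner ℝ (kern 1 x - kern 1 y) v) • kern 1 x
        + (2 * inner ℝ (kern 1 y) v) • (kern 1 x - kern 1 y)) := by
    rw [inner_sub_left]; module
  rw [e]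
  refine (norm_sub_le _ _).trans ?_
  refine (add_le_add_right (norm_add_le _ _) _).trans ?_
  simp only [norm_smul, norm_mul, Real.norm_eq_abs, abs_two]
  have i1 := abs_real_inner_le_norm (kern 1 x - kern 1 y) v
  have i2 := abs_real_inner_le_norm (kern 1 y) v
  have b1 : |wt 1 x - wt 1 y| * ‖v‖ ≤ ‖x - y‖ * ‖v‖ := by gcongr
  have b2 : 2 * |inner ℝ (kern 1 x - kern 1 y) v| * ‖kern 1 x‖ ≤ 2 * (‖x - y‖ * ‖v‖) * (1 / 2) := by
    gcongr
    exact i1.trans (by gcongr)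
  have b3 : 2 * |inner ℝ (kern 1 y) v| * ‖kern 1 x - kern 1 y‖ ≤ 2 * (1 / 2 * ‖v‖) * ‖x - y‖ := by
    gcongr
    exact i2.trans (by gcongr)
  nlinarith [mul_nonneg (norm_nonneg (x - y)) (norm_nonneg v)]

theorem norm_diff2_kern_one_le (x h k : Plane) : ‖diff2 (kern 1) x h k‖ ≤ 4 * ‖h‖ * ‖k‖ :=
  norm_diff2_le_of_fderiv (differentiable_kern one_pos) norm_fderiv_kern_one_sub_le x h k


/-! ### The field generated by a density. -/

/-- The field `kern 0 * ρ` generated by the density `ρ`. -/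
def field (ρ : Plane → ℝ) (x : Plane) : Plane := ∫ y, ρ y • kern 0 (x - y)

/-- The field generated through the regularized kernel `kern δ`. -/
def fieldReg (δ : ℝ) (ρ : Plane → ℝ) (x : Plane) : Plane := ∫ y, ρ y • kern δ (x - y)

/-- The integral of `f` against the integrable kernel `kern 0 - kern δ`. -/
def nearInt (δ : ℝ) (f : Plane → ℝ) : Plane := ∫ z, f z • (kern 0 z - kern δ z)

/-- `2π²`, which bounds `∫ near δ / δ`. -/
abbrev cNear : ℝ := 2 * Real.pi ^ 2

theorem integrable_nearInt {δ : ℝ} (hδ : 0 < δ) {f : Plane → ℝ} (hf : AEStronglyMeasurable f)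
    {R : ℝ} (hR : ∀ x, |f x| ≤ R) : Integrable fun z => f z • (kern 0 z - kern δ z) := by
  have h1 : Integrable fun z => kern 0 z - kern δ z := by
    refine (integrable_norm_iff (f := fun z => kern 0 z - kern δ z)
      ((measurable_kern 0).sub (measurable_kern δ)).aestronglyMeasurable).1 (integrable_near hδ)
  exact h1.bdd_smul R hf (Eventually.of_forall hR)

theorem norm_nearInt_le {δ : ℝ} (hδ : 0 < δ) {f : Plane → ℝ} {R : ℝ} (hR : ∀ x, |f x| ≤ R) :
    ‖nearInt δ f‖ ≤ R * (cNear * δ) := by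
  have h0 : 0 ≤ R := (abs_nonneg _).trans (hR 0)
  refine (norm_integral_le_of_norm_le ((integrable_near hδ).const_mul R)
    (Eventually.of_forall fun z => ?_)).trans ?_
  · rw [norm_smul]
    exact mul_le_mul_of_nonneg_right (hR z) (norm_nonneg _)
  · rw [integral_const_mul]
    gcongr
    exact integral_near_le hδ

theorem nearInt_sub {δ : ℝ} (hδ : 0 < δ) {f g : Plane → ℝ} (hf : AEStronglyMeasurable f)
    {R : ℝ} (hR : ∀ x, |f x| ≤ R) (hg : AEStronglyMeasurable g)
    {R' : ℝ} (hR' : ∀ x, |g x| ≤ R') :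
    nearInt δ f - nearInt δ g = nearInt δ fun z => f z - g z := by
  rw [nearInt, nearInt, ← integral_sub (integrable_nearInt hδ hf hR) (integrable_nearInt hδ hg hR')]
  simp only [nearInt, ← sub_smul]

/-- A bounded integrable density. -/
structure IsDensity (R : ℝ) (ρ : Plane → ℝ) : Prop where
  integrable : Integrable ρ
  bound : ∀ x, |ρ x| ≤ R

namespace IsDensity

variable {R : ℝ} {ρ : Plane → ℝ}

theorem bound_nonneg (h : IsDensity R ρ) : 0 ≤ R := (abs_nonneg _).trans (h.bound 0)

theorem sub {R' : ℝ} {ρ' : Plane → ℝ} (h : IsDensity R ρ) (h' : IsDensity R' ρ') :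
    IsDensity (R + R') fun x => ρ x - ρ' x where
  integrable := h.integrable.sub h'.integrable
  bound x := (abs_sub _ _).trans (add_le_add (h.bound x) (h'.bound x))

theorem comp_sub_left (h : IsDensity R ρ) (x : Plane) : IsDensity R fun z => ρ (x - z) where
  integrable := h.integrable.comp_sub_left x
  bound _ := h.bound _

theorem integrable_reg (h : IsDensity R ρ) {δ : ℝ} (hδ : 0 < δ) (x : Plane) :
    Integrable fun y => ρ y • kern δ (x - y) := by
  have hk : AEStronglyMeasurable (fun y => kern δ (x - y)) (volume : Measure Plane) :=
    ((measurable_kern δ).comp (measurable_const.sub measurable_id)).aestronglyMeasurable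
  refine Integrable.smul_bdd h.integrable δ⁻¹ hk (Eventually.of_forall fun y => ?_)
  rw [norm_kern, wt, inv_mul_le_iff₀ (by positivity), ← div_eq_mul_inv, le_div_iff₀ hδ]
  nlinarith [sq_nonneg (‖x - y‖ - δ)]

theorem integrable_near (h : IsDensity R ρ) {δ : ℝ} (hδ : 0 < δ) (x : Plane) :
    Integrable fun y => ρ y • (kern 0 (x - y) - kern δ (x - y)) := by
  have := (integrable_nearInt hδ (h.comp_sub_left x).integrable.aestronglyMeasurable
    (h.comp_sub_left x).bound).comp_sub_left x
  simpa using this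

theorem integrable_kern (h : IsDensity R ρ) (x : Plane) :
    Integrable fun y => ρ y • kern 0 (x - y) := by
  refine ((h.integrable_near one_pos x).add (h.integrable_reg one_pos x)).congr
    (Eventually.of_forall fun y => ?_)
  simp [← smul_add]

/-- This splitting carries the field estimates. The near part has an integrable kernel, so
differences in `x` can be moved onto the density. The far part has a smooth kernel, so there they
stay on the kernel. -/
theorem field_eq (h : IsDensity R ρ) {δ : ℝ} (hδ : 0 < δ) (x : Plane) :
    field ρ x = nearInt δ (fun z => ρ (x - z)) + fieldReg δ ρ x := by
  have e : nearInt δ (fun z => ρ (x - z)) = ∫ y, ρ y • (kern 0 (x - y) - kern δ (x - y)) := by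
    rw [nearInt, ← integral_sub_left_eq_self _ _ x]
    simp
  rw [e, fieldReg, ← integral_add (h.integrable_near hδ x) (h.integrable_reg hδ x), field]
  simp [← smul_add]

theorem field_sub {R' : ℝ} {ρ' : Plane → ℝ} (h : IsDensity R ρ) (h' : IsDensity R' ρ') (x : Plane) :
    field ρ x - field ρ' x = field (fun y => ρ y - ρ' y) x := by
  rw [field, field, ← integral_sub (h.integrable_kern x) (h'.integrable_kern x)]
  simp only [field, ← sub_smul]

theorem norm_fieldReg_one_le (h : IsDensity R ρ) (x : Plane) :
    ‖fieldReg 1 ρ x‖ ≤ ∫ y, |ρ y| := by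
  refine norm_integral_le_of_norm_le h.integrable.norm (Eventually.of_forall fun y => ?_)
  rw [norm_smul]
  have := norm_kern_one_le (x - y)
  rw [← Real.norm_eq_abs]
  nlinarith [norm_nonneg (ρ y)]

theorem norm_field_le (h : IsDensity R ρ) (x : Plane) :
    ‖field ρ x‖ ≤ R * cNear + ∫ y, |ρ y| := by
  rw [h.field_eq one_pos]
  refine (norm_add_le _ _).trans (add_le_add ?_ (h.norm_fieldReg_one_le x))
  simpa using norm_nearInt_le one_pos (h.comp_sub_left x).bound

theorem integrable_wt (h : IsDensity R ρ) {δ : ℝ} (hδ : 0 < δ) (x : Plane) :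
    Integrable fun y => |ρ y| * wt δ (x - y) := by
  have hk : AEStronglyMeasurable (fun y => wt δ (x - y)) (volume : Measure Plane) :=
    ((measurable_wt δ).comp (measurable_const.sub measurable_id)).aestronglyMeasurable
  refine Integrable.mul_bdd (c := (δ ^ 2)⁻¹) h.integrable.norm hk (Eventually.of_forall fun y => ?_)
  rw [Real.norm_of_nonneg (wt_nonneg _ _)]
  exact wt_le hδ _

/-- Within the unit ball the density is bounded by its supremum and the weight integrates to a
logarithm. Outside, the weight is at most one and the `L¹` norm suffices. -/
theorem integral_wt_le (h : IsDensity R ρ) {δ : ℝ} (hδ : 0 < δ) (x : Plane) :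
    ∫ y, |ρ y| * wt δ (x - y) ≤ R * (Real.pi * Real.log (1 + (δ ^ 2)⁻¹)) + ∫ y, |ρ y| := by
  have e : ∫ y, |ρ y| * wt δ (x - y) = ∫ z, |ρ (x - z)| * wt δ z := by
    rw [← integral_sub_left_eq_self _ _ x]
    simp
  have e2 : ∫ y, |ρ y| = ∫ z, |ρ (x - z)| :=
    (integral_sub_left_eq_self (fun y => |ρ y|) volume x).symm
  have hi : Integrable fun z => R * (Metric.ball (0:Plane) 1).indicator (wt δ) z :=
    ((integrable_indicator_iff measurableSet_ball).2 (integrableOn_wt_ball hδ)).const_mul R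
  have hi2 := (h.comp_sub_left x).integrable.abs
  rw [e, e2, ← integral_wt_ball hδ, ← integral_const_mul, ← integral_indicator measurableSet_ball]
  have e3 : ∀ z : Plane, (Metric.ball (0:Plane) 1).indicator (fun z => R * wt δ z) z
      = R * (Metric.ball (0:Plane) 1).indicator (wt δ) z := fun z => by
    by_cases hz : z ∈ Metric.ball (0:Plane) 1 <;> simp [hz, indicator]
  simp_rw [e3]
  rw [← integral_add hi hi2]
  refine integral_mono_of_nonneg (Eventually.of_forall fun z => ?_) (hi.add hi2)
    (Eventually.of_forall fun z => ?_)
  · exact mul_nonneg (abs_nonneg _) (wt_nonneg _ _)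
  · have hb := h.bound (x - z)
    have hw := wt_nonneg δ z
    by_cases hz : z ∈ Metric.ball (0:Plane) 1
    · simp only [indicator_of_mem hz]
      nlinarith [abs_nonneg (ρ (x - z))]
    · simp only [indicator_of_notMem hz]
      nlinarith [abs_nonneg (ρ (x - z)), wt_le_one_of_notMem (δ := δ) hz]

theorem norm_fieldReg_sub_le (h : IsDensity R ρ) {δ : ℝ} (hδ : 0 < δ) (x x' : Plane) :
    ‖fieldReg δ ρ x - fieldReg δ ρ x'‖
      ≤ (R * (Real.pi * Real.log (1 + (δ ^ 2)⁻¹)) + ∫ y, |ρ y|) * ‖x - x'‖ := by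
  rw [fieldReg, fieldReg, ← integral_sub (h.integrable_reg hδ x) (h.integrable_reg hδ x')]
  have hi : Integrable fun y => ‖x - x'‖ / 2 * (|ρ y| * wt δ (x - y))
      + ‖x - x'‖ / 2 * (|ρ y| * wt δ (x' - y)) :=
    ((h.integrable_wt hδ x).const_mul _).add ((h.integrable_wt hδ x').const_mul _)
  refine (norm_integral_le_of_norm_le hi (Eventually.of_forall fun y => ?_)).trans ?_
  · rw [← smul_sub, norm_smul, Real.norm_eq_abs]
    have := norm_kern_sub_le hδ (x - y) (x' - y)
    rw [sub_sub_sub_cancel_right] at this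
    calc _ ≤ |ρ y| * (‖x - x'‖ * ((wt δ (x - y) + wt δ (x' - y)) / 2)) := by gcongr
      _ = _ := by ring
  · rw [integral_add ((h.integrable_wt hδ x).const_mul _) ((h.integrable_wt hδ x').const_mul _),
      integral_const_mul, integral_const_mul]
    have h1 := h.integral_wt_le hδ x
    have h2 := h.integral_wt_le hδ x'
    nlinarith [norm_nonneg (x - x')]

/-- The Lipschitz constant of the field depends only logarithmically on that of the density. -/
theorem norm_field_sub_le (h : IsDensity R ρ) {Λ : ℝ} (hΛ : 0 ≤ Λ)
    (hL : ∀ x y, |ρ x - ρ y| ≤ Λ * ‖x - y‖) (x x' : Plane) :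
    ‖field ρ x - field ρ x'‖
      ≤ (cNear + R * (Real.pi * (2 * Real.log (2 + Λ))) + ∫ y, |ρ y|) * ‖x - x'‖ := by
  -- This scale makes the near part contribute `Λ δ ≤ 1`, while the far part pays only `log (1 +
  -- δ⁻²) ≤ 2 log (2 + Λ)`.
  set δ : ℝ := (1 + Λ)⁻¹ with hδ_def
  have hδ : 0 < δ := by positivity
  have hR := h.bound_nonneg
  have hm := fun x => (h.comp_sub_left x).integrable.aestronglyMeasurable
  rw [h.field_eq hδ, h.field_eq hδ, add_sub_add_comm,
    nearInt_sub hδ (hm x) (h.comp_sub_left x).bound (hm x') (h.comp_sub_left x').bound]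
  have h1 : ‖nearInt δ fun z => ρ (x - z) - ρ (x' - z)‖ ≤ cNear * ‖x - x'‖ := by
    refine (norm_nearInt_le hδ (R := Λ * ‖x - x'‖) (fun z => ?_)).trans ?_
    · simpa using hL (x - z) (x' - z)
    · have : Λ * δ ≤ 1 := by
        rw [hδ_def, ← div_eq_mul_inv, div_le_one (by positivity)]; linarith
      nlinarith [mul_nonneg (norm_nonneg (x - x')) (show 0 ≤ cNear by positivity)]
  have h2 := h.norm_fieldReg_sub_le hδ x x'
  have h3 : Real.log (1 + (δ ^ 2)⁻¹) ≤ 2 * Real.log (2 + Λ) := by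
    rw [show 2 * Real.log (2 + Λ) = Real.log ((2 + Λ) ^ 2) by rw [Real.log_pow]; norm_num]
    refine Real.log_le_log (by positivity) ?_
    rw [hδ_def, inv_pow, inv_inv]
    nlinarith
  have h4 : (R * (Real.pi * Real.log (1 + (δ ^ 2)⁻¹)) + ∫ y, |ρ y|) * ‖x - x'‖
      ≤ (R * (Real.pi * (2 * Real.log (2 + Λ))) + ∫ y, |ρ y|) * ‖x - x'‖ := by
    have := Real.pi_pos
    gcongr
  refine (norm_add_le _ _).trans ?_
  linarith

/-- At scale `δ = 1` the second difference falls on the density in the near part and on the smooth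
kernel in the far part. No logarithm appears, because second differences of the density are assumed
bounded. -/
theorem norm_diff2_field_le (h : IsDensity R ρ) {M : ℝ}
    (hM : ∀ x h k, |diff2 ρ x h k| ≤ M * ‖h‖ * ‖k‖) (x u v : Plane) :
    ‖diff2 (field ρ) x u v‖ ≤ (M * cNear + 4 * ∫ y, |ρ y|) * ‖u‖ * ‖v‖ := by
  have hd := fun x => h.comp_sub_left x
  have hm := fun x => (hd x).integrable.aestronglyMeasurable
  have hm' : ∀ x x', AEStronglyMeasurable (fun z => ρ (x - z) - ρ (x' - z)) :=
    fun x x' => (hm x).sub (hm x')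
  have e : diff2 (field ρ) x u v = nearInt 1 (fun z => diff2 ρ (x - z) u v)
      + ∫ y, ρ y • diff2 (kern 1) (x - y) u v := by
    have e1 : nearInt 1 (fun z => ρ (x + u + v - z)) - nearInt 1 (fun z => ρ (x + u - z))
        - (nearInt 1 (fun z => ρ (x + v - z)) - nearInt 1 (fun z => ρ (x - z)))
        = nearInt 1 (fun z => diff2 ρ (x - z) u v) := by
      rw [nearInt_sub one_pos (hm _) (hd _).bound (hm _) (hd _).bound,
        nearInt_sub one_pos (hm _) (hd _).bound (hm _) (hd _).bound,
        nearInt_sub one_pos (hm' _ _) ((hd _).sub (hd _)).bound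
          (hm' _ _) ((hd _).sub (hd _)).bound]
      congr 1
      ext z
      rw [diff2, show x + u + v - z = x - z + u + v by abel, show x + u - z = x - z + u by abel,
        show x + v - z = x - z + v by abel]
      ring
    have hr := fun x => h.integrable_reg one_pos x
    have hr' : ∀ x x', Integrable fun y => ρ y • kern 1 (x - y) - ρ y • kern 1 (x' - y) :=
      fun x x' => (hr x).sub (hr x')
    have e2 : ∫ y, ρ y • diff2 (kern 1) (x - y) u v = fieldReg 1 ρ (x + u + v)
        - fieldReg 1 ρ (x + u) - (fieldReg 1 ρ (x + v) - fieldReg 1 ρ x) := by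
      simp only [fieldReg]
      rw [← integral_sub (hr _) (hr _), ← integral_sub (hr _) (hr _),
        ← integral_sub (hr' _ _) (hr' _ _)]
      congr 1
      ext1 y
      rw [diff2, show x + u + v - y = x - y + u + v by abel, show x + u - y = x - y + u by abel,
        show x + v - y = x - y + v by abel]
      module
    rw [← e1, e2, diff2, h.field_eq one_pos, h.field_eq one_pos, h.field_eq one_pos,
      h.field_eq one_pos]
    abel
  rw [e]
  refine (norm_add_le _ _).trans ?_
  have h1 := norm_nearInt_le one_pos (fun z => hM (x - z) u v)
  have h2 : ‖∫ y, ρ y • diff2 (kern 1) (x - y) u v‖ ≤ ∫ y, |ρ y| * (4 * ‖u‖ * ‖v‖) := by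
    refine norm_integral_le_of_norm_le (h.integrable.abs.mul_const _)
      (Eventually.of_forall fun y => ?_)
    rw [norm_smul, Real.norm_eq_abs]
    gcongr
    exact norm_diff2_kern_one_le _ _ _
  rw [integral_mul_const] at h2
  linarith

/-- Fubini's theorem for the pairing of the field with a gradient. -/
theorem integral_fderiv_field (h : IsDensity R ρ) {φ : Plane → ℝ} {C : ℝ≥0}
    (hφ : LipschitzWith C φ) (hc : HasCompactSupport φ) (L : Plane →L[ℝ] Plane)
    (hL : ∀ w, ‖L w‖ = ‖w‖) :
    ∫ x, fderiv ℝ φ x (L (field ρ x)) = ∫ y, ρ y * ∫ x, fderiv ℝ φ x (L (kern 0 (x - y))) := by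
  have hmeas : Measurable (Function.uncurry fun x y : Plane => fderiv ℝ φ x (L (kern 0 (x - y)))) := by
    have e1 : (Function.uncurry fun x y : Plane => fderiv ℝ φ x (L (kern 0 (x - y))))
        = fun z => L (kern 0 (z.1 - z.2)) 0 * fderiv ℝ φ z.1 (basisVec 0)
          + L (kern 0 (z.1 - z.2)) 1 * fderiv ℝ φ z.1 (basisVec 1) := by
      ext z
      simp only [Function.uncurry]
      rw [fderiv_apply_plane]
    rw [e1]
    have hk : ∀ i : Fin 2, Measurable fun z : Plane × Plane => L (kern 0 (z.1 - z.2)) i := fun i =>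
      (EuclideanSpace.proj (𝕜 := ℝ) i).continuous.measurable.comp
        (L.continuous.measurable.comp ((measurable_kern 0).comp (measurable_fst.sub measurable_snd)))
    exact ((hk 0).mul ((measurable_fderiv_apply_const ℝ φ _).comp measurable_fst)).add
      ((hk 1).mul ((measurable_fderiv_apply_const ℝ φ _).comp measurable_fst))
  have e1 : ∀ x, fderiv ℝ φ x (L (field ρ x)) = ∫ y, ρ y * fderiv ℝ φ x (L (kern 0 (x - y))) := by
    intro x
    have := ((fderiv ℝ φ x).comp L).integral_comp_comm (h.integrable_kern x)
    rw [field]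
    simp only [ContinuousLinearMap.comp_apply, map_smul, smul_eq_mul] at this
    exact this.symm
  simp_rw [e1, ← integral_const_mul]
  refine integral_integral_swap ?_
  set g : Plane → ℝ := (tsupport φ).indicator fun _ => (C : ℝ) with hg
  have hgi : Integrable g := by
    rw [hg, integrable_indicator_iff hc.isCompact.measurableSet]
    exact integrable_const_iff.2 (Or.inr ⟨by simpa using hc.isCompact.measure_lt_top⟩)
  -- the majorant `g x * |ρ y| * (near 1 (x - y) + 1/2)`
  have hmaj : Integrable (fun z : Plane × Plane => (g z.1 * R) * near 1 (z.1 - z.2)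
      + (1 / 2) * (g z.1 * |ρ z.2|)) (volume.prod volume) := by
    refine Integrable.add ?_ ((hgi.mul_prod h.integrable.abs).const_mul _)
    have h1 : Integrable (fun z : Plane × Plane => (g z.1 * R) * near 1 z.2) (volume.prod volume) :=
      (hgi.mul_const R).mul_prod (DriftLimit.integrable_near one_pos)
    have hmp := measurePreserving_sub_prod (volume : Measure Plane)
    rw [integrable_prod_iff]
    · constructor
      · refine Eventually.of_forall fun x => ?_
        exact ((DriftLimit.integrable_near one_pos).comp_sub_left x).const_mul (g x * R)
      · have : ∀ x, ∫ y, ‖(g x * R) * near 1 (x - y)‖ = ‖g x * R‖ * ∫ y, near 1 y := by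
          intro x
          simp_rw [norm_mul _ (near _ _), integral_const_mul, Real.norm_of_nonneg (near_nonneg _ _)]
          rw [integral_sub_left_eq_self (near 1)]
        simp_rw [this]
        exact (hgi.mul_const R).norm.mul_const _
    · exact (((hgi.mul_const R).aestronglyMeasurable).comp_fst).mul
        ((measurable_near 1).comp (measurable_fst.sub measurable_snd)).aestronglyMeasurable
  refine hmaj.mono' ((h.integrable.aestronglyMeasurable.comp_snd).mul hmeas.aestronglyMeasurable)
    (Eventually.of_forall fun z => ?_)
  simp only [Function.uncurry]
  have hb := norm_fderiv_kern_le hφ L hL 0 z.1 z.2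
  have hgn : 0 ≤ g z.1 := indicator_nonneg (fun _ _ => C.2) _
  have hb' : ‖fderiv ℝ φ z.1 (L (kern 0 (z.1 - z.2)))‖ ≤ g z.1 * (near 1 (z.1 - z.2) + 1 / 2) := by
    refine hb.trans (le_of_eq ?_)
    by_cases hz : z.1 ∈ tsupport φ <;> simp [hg, hz, indicator]
  rw [norm_mul, Real.norm_eq_abs]
  have hn := near_nonneg 1 (z.1 - z.2)
  calc _ ≤ |ρ z.2| * (g z.1 * (near 1 (z.1 - z.2) + 1 / 2)) := by gcongr
    _ = g z.1 * |ρ z.2| * near 1 (z.1 - z.2) + 1 / 2 * (g z.1 * |ρ z.2|) := by ring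
    _ ≤ _ := by gcongr; exact h.bound _

/-- The field is curl-free in the sense of distributions. -/
theorem integral_fderiv_rot_field (h : IsDensity R ρ) {φ : Plane → ℝ} {C : ℝ≥0}
    (hφ : LipschitzWith C φ) (hc : HasCompactSupport φ) :
    ∫ x, fderiv ℝ φ x (rot (field ρ x)) = 0 := by
  rw [h.integral_fderiv_field hφ hc rot norm_rot]
  simp [integral_fderiv_rot_kern_zero hφ hc]

/-- Gauss' law `div (field ρ) = 2πρ` in the sense of distributions. -/
theorem integral_fderiv_field_eq (h : IsDensity R ρ) {φ : Plane → ℝ} {C : ℝ≥0}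
    (hφ : LipschitzWith C φ) (hc : HasCompactSupport φ) :
    ∫ x, fderiv ℝ φ x (field ρ x) = - (2 * Real.pi * ∫ x, φ x * ρ x) := by
  have := h.integral_fderiv_field hφ hc (ContinuousLinearMap.id ℝ Plane) (fun _ => rfl)
  simp only [ContinuousLinearMap.id_apply] at this
  rw [this]
  simp_rw [integral_fderiv_kern_zero hφ hc]
  rw [← integral_const_mul, ← integral_neg]
  congr 1
  ext y
  ring

end IsDensity


/-! ### Square integrability of fields. -/

theorem sq_lintegral_mul_le {α : Type*} [MeasurableSpace α] {μ : Measure α} {P S : α → ℝ≥0∞}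
    (hP : Measurable P) (hS : Measurable S) :
    (∫⁻ y, P y * S y ∂μ) ^ 2 ≤ (∫⁻ y, P y ∂μ) * ∫⁻ y, P y * S y ^ 2 ∂μ := by
  -- A factor `√P` is put into each of the two functions, so that Hölder with exponents `2, 2` is
  -- the Cauchy–Schwarz inequality for the measure `P dμ`.
  have h := ENNReal.lintegral_mul_le_Lp_mul_Lq μ Real.HolderConjugate.two_two
    (f := fun y => P y ^ (1 / 2 : ℝ)) (g := fun y => P y ^ (1 / 2 : ℝ) * S y)
    (hP.pow_const _).aemeasurable ((hP.pow_const _).mul hS).aemeasurable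
  have e0 : ∀ y, P y ^ (1 / 2 : ℝ) * P y ^ (1 / 2 : ℝ) = P y := fun y => by
    rw [← ENNReal.rpow_add_of_nonneg _ _ (by norm_num) (by norm_num)]; norm_num
  have e1 : ∀ y, ((fun y => P y ^ (1 / 2 : ℝ)) * fun y => P y ^ (1 / 2 : ℝ) * S y) y = P y * S y :=
    fun y => by simp only [Pi.mul_apply]; rw [← mul_assoc, e0]
  have e2 : ∀ y, (P y ^ (1 / 2 : ℝ)) ^ (2 : ℝ) = P y := fun y => by
    rw [← ENNReal.rpow_mul]; norm_num
  have e3 : ∀ y, (P y ^ (1 / 2 : ℝ) * S y) ^ (2 : ℝ) = P y * S y ^ 2 := fun y => by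
    rw [ENNReal.mul_rpow_of_nonneg _ _ (by norm_num), e2]; norm_num
  simp_rw [e1, e2, e3] at h
  calc _ ≤ ((∫⁻ y, P y ∂μ) ^ (1 / 2 : ℝ) * (∫⁻ y, P y * S y ^ 2 ∂μ) ^ (1 / 2 : ℝ)) ^ 2 := by gcongr
    _ = _ := by
      rw [mul_pow, ← ENNReal.rpow_natCast, ← ENNReal.rpow_natCast, ← ENNReal.rpow_mul,
        ← ENNReal.rpow_mul]
      norm_num

/-- Minkowski's inequality in `L²`, for a family of functions bounded in `L²`. -/
theorem lintegral_sq_lintegral_le {P : Plane → ℝ≥0∞} {S : Plane → Plane → ℝ≥0∞}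
    (hP : Measurable P) (hS : Measurable (Function.uncurry S)) {W : ℝ≥0∞}
    (hW : ∀ y, ∫⁻ x, S x y ^ 2 ≤ W) :
    ∫⁻ x, (∫⁻ y, P y * S x y) ^ 2 ≤ (∫⁻ y, P y) ^ 2 * W := by
  calc ∫⁻ x, (∫⁻ y, P y * S x y) ^ 2
      ≤ ∫⁻ x, (∫⁻ y, P y) * ∫⁻ y, P y * S x y ^ 2 := by
        gcongr with x
        exact sq_lintegral_mul_le hP (hS.comp measurable_prodMk_left)
    _ = (∫⁻ y, P y) * ∫⁻ x, ∫⁻ y, P y * S x y ^ 2 := by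
        rw [lintegral_const_mul]
        exact Measurable.lintegral_prod_right' (f := fun z : Plane × Plane => P z.2 * S z.1 z.2 ^ 2)
          ((hP.comp measurable_snd).mul (hS.pow_const 2))
    _ = (∫⁻ y, P y) * ∫⁻ y, P y * ∫⁻ x, S x y ^ 2 := by
        rw [lintegral_lintegral_swap]
        · congr 2
          ext y
          rw [lintegral_const_mul]
          exact (hS.comp measurable_prodMk_right).pow_const 2
        · exact ((hP.comp measurable_snd).mul (hS.pow_const 2)).aemeasurable
    _ ≤ (∫⁻ y, P y) * ∫⁻ y, P y * W := by
        gcongr with y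
        exact hW y
    _ = _ := by rw [lintegral_mul_const _ hP]; ring

/-- `∫ (1 + ‖x‖²)⁻²`. -/
abbrev cWt : ℝ := Real.pi

theorem lintegral_wt_sq (a : Plane) :
    ∫⁻ x, ENNReal.ofReal (wt 1 (x - a) ^ 2) = ENNReal.ofReal cWt := by
  have hw := integral_wt_sq one_pos
  simp only [one_pow, one_mul] at hw
  rw [lintegral_sub_right_eq_self (fun x => ENNReal.ofReal (wt 1 x ^ 2)) a,
    ← ofReal_integral_eq_lintegral_ofReal hw.1 (Eventually.of_forall fun _ => by positivity), hw.2]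

/-- The far field of a displaced density is small in `L²`. -/
theorem lintegral_sq_far_le {m : Plane → ℝ} (hm : Measurable m) {a b : Plane → Plane}
    (ha : Measurable a) (hb : Measurable b) {d : Plane → ℝ} (hd : Measurable d)
    (hab : ∀ y, ‖a y - b y‖ ≤ d y) (hi : Integrable fun y => |m y| * d y) :
    ∫⁻ x, ‖∫ y, m y • (kern 1 (x - a y) - kern 1 (x - b y))‖ₑ ^ 2
      ≤ ENNReal.ofReal ((∫ y, |m y| * d y) ^ 2 * cWt) := by
  set P : Plane → ℝ≥0∞ := fun y => ENNReal.ofReal (|m y| * d y) with hP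
  set S : Plane → Plane → ℝ≥0∞ := fun x y =>
    ENNReal.ofReal ((wt 1 (x - a y) + wt 1 (x - b y)) / 2) with hS
  have hd0 : ∀ y, 0 ≤ d y := fun y => (norm_nonneg _).trans (hab y)
  have hPm : Measurable P := (hm.abs.mul hd).ennreal_ofReal
  have hSm : Measurable (Function.uncurry S) := by
    refine Measurable.ennreal_ofReal (Measurable.div_const (Measurable.add ?_ ?_) 2)
    · exact (measurable_wt 1).comp (measurable_fst.sub (ha.comp measurable_snd))
    · exact (measurable_wt 1).comp (measurable_fst.sub (hb.comp measurable_snd))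
  have h1 : ∀ x, ‖∫ y, m y • (kern 1 (x - a y) - kern 1 (x - b y))‖ₑ ≤ ∫⁻ y, P y * S x y := by
    intro x
    refine (enorm_integral_le_lintegral_enorm _).trans (lintegral_mono fun y => ?_)
    rw [hP, hS]
    simp only
    rw [← ENNReal.ofReal_mul (mul_nonneg (abs_nonneg _) (hd0 y)), ← ofReal_norm]
    refine ENNReal.ofReal_le_ofReal ?_
    rw [norm_smul, Real.norm_eq_abs]
    have h2 := norm_kern_sub_le one_pos (x - a y) (x - b y)
    rw [sub_sub_sub_cancel_left, norm_sub_rev (b y)] at h2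
    have h3 : 0 ≤ (wt 1 (x - a y) + wt 1 (x - b y)) / 2 := by
      have := wt_nonneg 1 (x - a y)
      have := wt_nonneg 1 (x - b y)
      positivity
    calc _ ≤ |m y| * (‖a y - b y‖ * ((wt 1 (x - a y) + wt 1 (x - b y)) / 2)) := by gcongr
      _ ≤ |m y| * (d y * ((wt 1 (x - a y) + wt 1 (x - b y)) / 2)) := by gcongr; exact hab y
      _ = _ := by ring
  have h2 : ∀ y, ∫⁻ x, S x y ^ 2 ≤ ENNReal.ofReal cWt := by
    intro y
    -- Convexity of the square separates the two centres. Each weight then has the same `L²` norm by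
    -- translation invariance.
    have h3 : ∀ x, S x y ^ 2 ≤ ENNReal.ofReal (1 / 2) * ENNReal.ofReal (wt 1 (x - a y) ^ 2)
        + ENNReal.ofReal (1 / 2) * ENNReal.ofReal (wt 1 (x - b y) ^ 2) := by
      intro x
      have p := wt_nonneg 1 (x - a y)
      have q := wt_nonneg 1 (x - b y)
      rw [hS]
      simp only
      rw [← ENNReal.ofReal_pow (by positivity), ← ENNReal.ofReal_mul (by norm_num),
        ← ENNReal.ofReal_mul (by norm_num), ← ENNReal.ofReal_add (by positivity) (by positivity)]
      refine ENNReal.ofReal_le_ofReal ?_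
      nlinarith [sq_nonneg (wt 1 (x - a y) - wt 1 (x - b y))]
    have hmw : ∀ c : Plane, Measurable fun x => ENNReal.ofReal (wt 1 (x - c) ^ 2) := fun c =>
      (((measurable_wt 1).comp (measurable_id.sub_const c)).pow_const 2).ennreal_ofReal
    refine (lintegral_mono h3).trans ?_
    rw [lintegral_add_left ((hmw _).const_mul _), lintegral_const_mul _ (hmw _),
      lintegral_const_mul _ (hmw _), lintegral_wt_sq, lintegral_wt_sq, ← add_mul,
      ← ENNReal.ofReal_add (by norm_num) (by norm_num)]
    norm_num
  calc _ ≤ ∫⁻ x, (∫⁻ y, P y * S x y) ^ 2 := by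
        gcongr with x
        exact h1 x
    _ ≤ (∫⁻ y, P y) ^ 2 * ENNReal.ofReal cWt := lintegral_sq_lintegral_le hPm hSm h2
    _ = _ := by
      rw [hP, ← ofReal_integral_eq_lintegral_ofReal hi
        (Eventually.of_forall fun y => mul_nonneg (abs_nonneg _) (hd0 y)),
        ← ENNReal.ofReal_pow (integral_nonneg fun y => mul_nonneg (abs_nonneg _) (hd0 y)),
        ← ENNReal.ofReal_mul (by positivity)]

/-- This is Young's inequality `L¹ * L² ⊆ L²`, with the squared `L²` norm of `ρ` bounded by the
supremum times the `L¹` norm. -/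
theorem IsDensity.lintegral_sq_near_le {R : ℝ} {ρ : Plane → ℝ} (h : IsDensity R ρ)
    (hm : Measurable ρ) :
    ∫⁻ x, ‖nearInt 1 (fun z => ρ (x - z))‖ₑ ^ 2
      ≤ ENNReal.ofReal (cNear ^ 2 * (R * ∫ y, |ρ y|)) := by
  set P : Plane → ℝ≥0∞ := fun z => ENNReal.ofReal (near 1 z) with hP
  set S : Plane → Plane → ℝ≥0∞ := fun x z => ENNReal.ofReal |ρ (x - z)| with hS
  have hR := h.bound_nonneg
  have hPm : Measurable P := (measurable_near 1).ennreal_ofReal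
  have hSm : Measurable (Function.uncurry S) :=
    (hm.comp (measurable_fst.sub measurable_snd)).abs.ennreal_ofReal
  have h1 : ∀ x, ‖nearInt 1 (fun z => ρ (x - z))‖ₑ ≤ ∫⁻ z, P z * S x z := by
    intro x
    refine (enorm_integral_le_lintegral_enorm _).trans (lintegral_mono fun z => ?_)
    rw [hP, hS]
    simp only
    rw [← ENNReal.ofReal_mul (near_nonneg _ _), ← ofReal_norm, norm_smul,
      Real.norm_eq_abs, mul_comm]
    rfl
  have h2 : ∀ z, ∫⁻ x, S x z ^ 2 ≤ ENNReal.ofReal (R * ∫ y, |ρ y|) := by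
    intro z
    have h3 : ∀ x, S x z ^ 2 ≤ ENNReal.ofReal (R * |ρ (x - z)|) := fun x => by
      rw [hS]
      simp only
      rw [← ENNReal.ofReal_pow (abs_nonneg _), pow_two]
      exact ENNReal.ofReal_le_ofReal (mul_le_mul_of_nonneg_right (h.bound _) (abs_nonneg _))
    refine (lintegral_mono h3).trans ?_
    rw [lintegral_sub_right_eq_self (fun x => ENNReal.ofReal (R * |ρ x|)) z,
      ← ofReal_integral_eq_lintegral_ofReal (h.integrable.abs.const_mul R)
      (Eventually.of_forall fun _ => by positivity), integral_const_mul]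
  calc _ ≤ ∫⁻ x, (∫⁻ z, P z * S x z) ^ 2 := by
        gcongr with x
        exact h1 x
    _ ≤ (∫⁻ z, P z) ^ 2 * ENNReal.ofReal (R * ∫ y, |ρ y|) := lintegral_sq_lintegral_le hPm hSm h2
    _ ≤ ENNReal.ofReal cNear ^ 2 * ENNReal.ofReal (R * ∫ y, |ρ y|) := by
      gcongr
      rw [hP, ← ofReal_integral_eq_lintegral_ofReal (DriftLimit.integrable_near one_pos)
        (Eventually.of_forall fun _ => near_nonneg _ _)]
      exact ENNReal.ofReal_le_ofReal (by simpa using integral_near_le one_pos)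
    _ = _ := by
      rw [← ENNReal.ofReal_pow (by positivity), ← ENNReal.ofReal_mul (by positivity)]

theorem lintegral_sq_add_le {f g : Plane → Plane} {A A' : ℝ} (hA : 0 ≤ A) (hA' : 0 ≤ A')
    (hfm : AEMeasurable f) (hf : ∫⁻ x, ‖f x‖ₑ ^ 2 ≤ ENNReal.ofReal A)
    (hg : ∫⁻ x, ‖g x‖ₑ ^ 2 ≤ ENNReal.ofReal A') :
    ∫⁻ x, ‖f x + g x‖ₑ ^ 2 ≤ ENNReal.ofReal (2 * A + 2 * A') := by
  have h1 : ∀ x, ‖f x + g x‖ₑ ^ 2 ≤ 2 * ‖f x‖ₑ ^ 2 + 2 * ‖g x‖ₑ ^ 2 := fun x => by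
    have key : ∀ p q r : ℝ, 0 ≤ p → 0 ≤ q → 0 ≤ r → r ≤ p + q →
        ENNReal.ofReal r ^ 2 ≤ 2 * ENNReal.ofReal p ^ 2 + 2 * ENNReal.ofReal q ^ 2 := by
      intro p q r hp hq hr h
      rw [← ENNReal.ofReal_pow hp, ← ENNReal.ofReal_pow hq, ← ENNReal.ofReal_pow hr,
        ← ENNReal.ofReal_ofNat 2, ← ENNReal.ofReal_mul (by norm_num),
        ← ENNReal.ofReal_mul (by norm_num), ← ENNReal.ofReal_add (by positivity) (by positivity)]
      refine ENNReal.ofReal_le_ofReal ?_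
      nlinarith [sq_nonneg (p - q)]
    simp only [← ofReal_norm]
    exact key _ _ _ (norm_nonneg _) (norm_nonneg _) (norm_nonneg _) (norm_add_le _ _)
  refine (lintegral_mono h1).trans ?_
  rw [lintegral_add_left' ((hfm.enorm.pow_const 2).const_mul _), lintegral_const_mul' _ _ (by simp),
    lintegral_const_mul' _ _ (by simp), ENNReal.ofReal_add (by positivity) (by positivity),
    ENNReal.ofReal_mul (by norm_num), ENNReal.ofReal_mul (by norm_num), ENNReal.ofReal_ofNat]
  gcongr

theorem IsDensity.continuous_fieldReg {R : ℝ} {ρ : Plane → ℝ} (h : IsDensity R ρ) :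
    Continuous (fieldReg 1 ρ) := by
  refine LipschitzWith.continuous (K := Real.toNNReal
    (R * (Real.pi * Real.log (1 + (1 ^ 2)⁻¹)) + ∫ y, |ρ y|)) (LipschitzWith.of_dist_le_mul fun x y => ?_)
  rw [dist_eq_norm, dist_eq_norm]
  exact (h.norm_fieldReg_sub_le one_pos x y).trans (by gcongr; exact Real.le_coe_toNNReal _)

/-- A neutral density with finite first moment generates a field of finite energy. -/
theorem IsDensity.lintegral_sq_field_le {R : ℝ} {ρ : Plane → ℝ} (h : IsDensity R ρ)
    (hm : Measurable ρ) (h0 : ∫ y, ρ y = 0) (h1 : Integrable fun y => |ρ y| * ‖y‖) :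
    ∫⁻ x, ‖field ρ x‖ₑ ^ 2 ≤ ENNReal.ofReal
      (2 * ((∫ y, |ρ y| * ‖y‖) ^ 2 * cWt) + 2 * (cNear ^ 2 * (R * ∫ y, |ρ y|))) := by
  have e : ∀ x, field ρ x = fieldReg 1 ρ x + nearInt 1 (fun z => ρ (x - z)) := fun x => by
    rw [h.field_eq one_pos, add_comm]
  -- Neutrality allows the kernel centred at the origin to be subtracted for free. The difference
  -- decays like `|x|⁻²`, which is square integrable at infinity, whereas `|x|⁻¹` is not; the price
  -- is the first moment of `ρ`.
  have e2 : ∀ x, fieldReg 1 ρ x = ∫ y, ρ y • (kern 1 (x - y) - kern 1 (x - 0)) := fun x => by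
    simp_rw [smul_sub]
    rw [integral_sub (h.integrable_reg one_pos x) (h.integrable.smul_const _), integral_smul_const,
      h0, zero_smul, sub_zero, fieldReg]
  simp_rw [e]
  have hR := h.bound_nonneg
  have hint : 0 ≤ ∫ y, |ρ y| := integral_nonneg fun y => abs_nonneg _
  refine lintegral_sq_add_le (by positivity) (by positivity) h.continuous_fieldReg.aemeasurable ?_
    (h.lintegral_sq_near_le hm)
  simp_rw [e2]
  exact lintegral_sq_far_le (a := fun y => y) (b := fun _ => 0) hm measurable_id measurable_const
    measurable_norm (fun y => by simp) h1

/-! ### Comparison of the fields of two transported densities. -/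

/-- `n` is the density transported from `n₀` by the map `X`. -/
structure IsPush (n₀ : Plane → ℝ) (X : Plane → Plane) (n : Plane → ℝ) : Prop where
  continuous : Continuous X
  integral_eq : ∀ f : Plane → Plane, Continuous f → (∃ C, ∀ x, ‖f x‖ ≤ C) →
    ∫ y, n y • f y = ∫ y, n₀ y • f (X y)

theorem continuous_kern_sub {δ : ℝ} (hδ : 0 < δ) (x : Plane) : Continuous fun y => kern δ (x - y) :=
  (differentiable_kern hδ).continuous.comp (by fun_prop)

section Displacement

variable {R R' : ℝ} {n₀ n₁ n₂ D : Plane → ℝ} {X₁ X₂ : Plane → Plane}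

/-- The background cancels. In the far part both densities are pulled back to the common labels `y`,
so only the displacement `X₁ y - X₂ y` matters. The near part keeps the pointwise difference of the
densities. -/
theorem field_displacement (h₀ : Integrable n₀) (h₁ : IsDensity R n₁) (h₂ : IsDensity R n₂)
    (hD : IsDensity R' D) (p₁ : IsPush n₀ X₁ n₁) (p₂ : IsPush n₀ X₂ n₂) (x : Plane) :
    field (fun y => n₁ y - D y) x - field (fun y => n₂ y - D y) x
      = (∫ y, n₀ y • (kern 1 (x - X₁ y) - kern 1 (x - X₂ y)))
        + nearInt 1 (fun z => n₁ (x - z) - n₂ (x - z)) := by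
  rw [(h₁.sub hD).field_sub (h₂.sub hD)]
  have e : (fun y => n₁ y - D y - (n₂ y - D y)) = fun y => n₁ y - n₂ y := by ext y; ring
  rw [e, (h₁.sub h₂).field_eq one_pos, add_comm]
  congr 1
  have hb : ∃ C, ∀ y, ‖kern 1 (x - y)‖ ≤ C := ⟨_, fun y => norm_kern_one_le _⟩
  have hi : ∀ {X : Plane → Plane}, Continuous X → Integrable fun y => n₀ y • kern 1 (x - X y) := by
    intro X hX
    exact Integrable.smul_bdd h₀ (1 / 2)
      ((continuous_kern_sub one_pos x).comp hX).aestronglyMeasurable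
      (Eventually.of_forall fun y => norm_kern_one_le _)
  simp_rw [smul_sub]
  rw [integral_sub (hi p₁.continuous) (hi p₂.continuous),
    ← p₁.integral_eq _ (continuous_kern_sub one_pos x) hb,
    ← p₂.integral_eq _ (continuous_kern_sub one_pos x) hb, fieldReg,
    ← integral_sub (h₁.integrable_reg one_pos x) (h₂.integrable_reg one_pos x)]
  simp_rw [sub_smul]

theorem norm_field_displacement_le (h₀ : Integrable n₀) (h₁ : IsDensity R n₁) (h₂ : IsDensity R n₂)
    (hD : IsDensity R' D) (p₁ : IsPush n₀ X₁ n₁) (p₂ : IsPush n₀ X₂ n₂) {a d : ℝ}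
    (ha : ∀ x, |n₁ x - n₂ x| ≤ a) (hd : ∀ y, ‖X₁ y - X₂ y‖ ≤ d) (x : Plane) :
    ‖field (fun y => n₁ y - D y) x - field (fun y => n₂ y - D y) x‖
      ≤ (∫ y, |n₀ y|) * d + a * cNear := by
  rw [field_displacement h₀ h₁ h₂ hD p₁ p₂]
  refine (norm_add_le _ _).trans (add_le_add ?_ ?_)
  · rw [← integral_mul_const]
    refine norm_integral_le_of_norm_le (h₀.abs.mul_const d) (Eventually.of_forall fun y => ?_)
    rw [norm_smul, Real.norm_eq_abs]
    gcongr
    have := norm_kern_sub_le' one_pos (x - X₁ y) (x - X₂ y)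
    rw [sub_sub_sub_cancel_left, norm_sub_rev (X₂ y)] at this
    norm_num at this
    exact this.trans (hd y)
  · simpa using norm_nearInt_le one_pos fun z => ha (x - z)

theorem lintegral_sq_field_displacement_le (h₀ : Integrable n₀) (h₀m : Measurable n₀)
    (h₁ : IsDensity R n₁) (h₂ : IsDensity R n₂) (hm₁ : Measurable n₁) (hm₂ : Measurable n₂)
    (hD : IsDensity R' D) (p₁ : IsPush n₀ X₁ n₁) (p₂ : IsPush n₀ X₂ n₂) {a d : ℝ}
    (ha : ∀ x, |n₁ x - n₂ x| ≤ a) (hd : ∀ y, ‖X₁ y - X₂ y‖ ≤ d) :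
    ∫⁻ x, ‖field (fun y => n₁ y - D y) x - field (fun y => n₂ y - D y) x‖ₑ ^ 2
      ≤ ENNReal.ofReal (2 * (((∫ y, |n₀ y|) * d) ^ 2 * cWt)
        + 2 * (cNear ^ 2 * (a * ∫ y, |n₁ y - n₂ y|))) := by
  simp_rw [field_displacement h₀ h₁ h₂ hD p₁ p₂]
  have hd' : IsDensity a fun y => n₁ y - n₂ y := ⟨h₁.integrable.sub h₂.integrable, ha⟩
  have hint : 0 ≤ ∫ y, |n₁ y - n₂ y| := integral_nonneg fun y => abs_nonneg _
  have ha0 := hd'.bound_nonneg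
  have hfar := lintegral_sq_far_le h₀m p₁.continuous.measurable p₂.continuous.measurable
    (d := fun _ => d) measurable_const hd (h₀.abs.mul_const d)
  rw [integral_mul_const] at hfar
  refine lintegral_sq_add_le (by positivity) (by positivity) ?_ hfar
    (hd'.lintegral_sq_near_le (hm₁.sub hm₂))
  have hk : Measurable (Function.uncurry fun x y : Plane =>
      n₀ y • (kern 1 (x - X₁ y) - kern 1 (x - X₂ y))) :=
    (h₀m.comp measurable_snd).smul
      (((measurable_kern 1).comp (measurable_fst.sub (p₁.continuous.measurable.comp measurable_snd))).sub
      ((measurable_kern 1).comp (measurable_fst.sub (p₂.continuous.measurable.comp measurable_snd))))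
  exact (hk.stronglyMeasurable.integral_prod_right (ν := volume)).measurable.aemeasurable

end Displacement


/-! ### Gronwall's inequality and flows of Lipschitz fields. -/

theorem hasDerivAt_reflect {G : Type*} [NormedAddCommGroup G] [NormedSpace ℝ G] {f : ℝ → G}
    {f' : G} {r : ℝ} (h : HasDerivAt f f' (-r)) : HasDerivAt (fun r => f (-r)) (-f') r :=
  (h.scomp r (hasDerivAt_neg r)).congr_deriv (by simp)

section Gronwall

variable {F : Type*} [NormedAddCommGroup F] [NormedSpace ℝ F]

theorem norm_le_of_norm_deriv_le_forward {u u' : ℝ → F} {Λ ℓ η e : ℝ → ℝ} {s t : ℝ} (hst : s ≤ t)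
    (hu : ∀ r ∈ Icc s t, HasDerivAt u (u' r) r) (hΛ : ∀ r, HasDerivAt Λ (ℓ r) r)
    (hη : ∀ r, HasDerivAt η (e r) r) (hℓ : ∀ r, 0 ≤ ℓ r) (he : ∀ r, 0 ≤ e r)
    (hb : ∀ r ∈ Icc s t, ‖u' r‖ ≤ ℓ r * ‖u r‖ + e r) :
    ‖u t‖ ≤ Real.exp (Λ t - Λ s) * (‖u s‖ + (η t - η s)) := by
  have hΛm : Monotone Λ := monotone_of_hasDerivAt_nonneg hΛ hℓ
  -- The slack `ε` makes the comparison function grow strictly faster than `‖u‖` at every point of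
  -- contact, as the comparison principle requires. It is removed by letting `ε → 0`. Primitives `Λ`
  -- and `η` take the place of integrals of the rates.
  have key : ∀ ε > 0, ‖u t‖ ≤ Real.exp (Λ t - Λ s) * (‖u s‖ + ε + (η t - η s) + ε * (t - s)) := by
    intro ε hε
    set b : ℝ → ℝ := fun r =>
      Real.exp (Λ r - Λ s) * (‖u s‖ + ε + (η r - η s) + ε * (r - s)) with hbdef
    have hbd : ∀ r, HasDerivAt b (Real.exp (Λ r - Λ s) * ℓ r *
        (‖u s‖ + ε + (η r - η s) + ε * (r - s)) + Real.exp (Λ r - Λ s) * (e r + ε)) r := by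
      intro r
      have h1 := ((hΛ r).sub_const (Λ s)).exp
      have h2 : HasDerivAt (fun r => ‖u s‖ + ε + (η r - η s) + ε * (r - s)) (e r + ε) r := by
        have h3 := (((hη r).sub_const (η s)).const_add (‖u s‖ + ε)).add
          (((hasDerivAt_id r).sub_const s).const_mul ε)
        exact h3.congr_deriv (by simp)
      exact h1.mul h2
    refine image_norm_le_of_norm_deriv_right_lt_deriv_boundary' (f := u) (f' := u') (a := s) (b := t)
      (fun r hr => (hu r hr).continuousAt.continuousWithinAt)
      (fun r hr => (hu r (Ico_subset_Icc_self hr)).hasDerivWithinAt) (B := b) ?_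
      (fun r _ => (hbd r).continuousAt.continuousWithinAt) (fun r _ => (hbd r).hasDerivWithinAt)
      (fun r hr hur => ?_) (right_mem_Icc.2 hst)
    · simp [hbdef, hε.le]
    · have h1 := hb r (Ico_subset_Icc_self hr)
      have hexp : 1 ≤ Real.exp (Λ r - Λ s) := Real.one_le_exp (by linarith [hΛm hr.1])
      rw [hur] at h1
      simp only [hbdef] at h1
      have h4 : e r < Real.exp (Λ r - Λ s) * (e r + ε) := by nlinarith [he r]
      have h5 : ℓ r * (Real.exp (Λ r - Λ s) * (‖u s‖ + ε + (η r - η s) + ε * (r - s)))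
        = Real.exp (Λ r - Λ s) * ℓ r * (‖u s‖ + ε + (η r - η s) + ε * (r - s)) := by ring
      linarith
  have h0 : Tendsto (fun ε : ℝ => Real.exp (Λ t - Λ s) *
      (‖u s‖ + ε + (η t - η s) + ε * (t - s))) (𝓝[>] 0)
      (𝓝 (Real.exp (Λ t - Λ s) * (‖u s‖ + 0 + (η t - η s) + 0 * (t - s)))) := by
    refine Tendsto.mono_left (Continuous.tendsto ?_ 0) nhdsWithin_le_nhds
    fun_prop
  have := ge_of_tendsto h0 (eventually_nhdsWithin_of_forall key)
  simpa using this

/-- A Gronwall inequality, in both time directions, with time dependent rates `ℓ = Λ'` and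
`e = η'`. -/
theorem norm_le_of_norm_deriv_le {u u' : ℝ → F} {Λ ℓ η e : ℝ → ℝ} {s t : ℝ}
    (hu : ∀ r ∈ uIcc s t, HasDerivAt u (u' r) r) (hΛ : ∀ r, HasDerivAt Λ (ℓ r) r)
    (hη : ∀ r, HasDerivAt η (e r) r) (hℓ : ∀ r, 0 ≤ ℓ r) (he : ∀ r, 0 ≤ e r)
    (hb : ∀ r ∈ uIcc s t, ‖u' r‖ ≤ ℓ r * ‖u r‖ + e r) :
    ‖u t‖ ≤ Real.exp |Λ t - Λ s| * (‖u s‖ + |η t - η s|) := by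
  have hΛm : Monotone Λ := monotone_of_hasDerivAt_nonneg hΛ hℓ
  have hηm : Monotone η := monotone_of_hasDerivAt_nonneg hη he
  rcases le_total s t with hst | hst
  · rw [uIcc_of_le hst] at hu hb
    rw [abs_of_nonneg (sub_nonneg.2 (hΛm hst)), abs_of_nonneg (sub_nonneg.2 (hηm hst))]
    exact norm_le_of_norm_deriv_le_forward hst hu hΛ hη hℓ he hb
  · rw [uIcc_of_ge hst] at hu hb
    rw [abs_of_nonpos (sub_nonpos.2 (hΛm hst)), abs_of_nonpos (sub_nonpos.2 (hηm hst))]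
    -- The backward case is the forward one after time reversal. The primitives change sign as well,
    -- so the rates remain nonnegative.
    have := norm_le_of_norm_deriv_le_forward (u := fun r => u (-r)) (u' := fun r => - u' (-r))
      (Λ := fun r => - Λ (-r)) (ℓ := fun r => ℓ (-r)) (η := fun r => - η (-r))
      (e := fun r => e (-r)) (s := -s) (t := -t) (neg_le_neg hst)
      (fun r hr => hasDerivAt_reflect (hu (-r) ⟨by linarith [hr.2], by linarith [hr.1]⟩))
      (fun r => (hasDerivAt_reflect (hΛ (-r))).neg.congr_deriv (neg_neg _))
      (fun r => (hasDerivAt_reflect (hη (-r))).neg.congr_deriv (neg_neg _))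
      (fun r => hℓ _) (fun r => he _)
      (fun r hr => by
        rw [norm_neg]; exact hb (-r) ⟨by linarith [hr.2], by linarith [hr.1]⟩)
    simpa [neg_add_eq_sub] using this

end Gronwall

/-- The projection of a time to `[0, T]`. -/
def clamp (T t : ℝ) : ℝ := max 0 (min t T)

theorem clamp_mem {T : ℝ} (hT : 0 ≤ T) (t : ℝ) : clamp T t ∈ Icc 0 T :=
  ⟨le_max_left _ _, max_le hT (min_le_right _ _)⟩

theorem clamp_of_mem {T t : ℝ} (ht : t ∈ Icc 0 T) : clamp T t = t := by
  rw [clamp, min_eq_left ht.2, max_eq_right ht.1]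

/-- Freezing the time outside `[0,T]` does not increase Lipschitz constants. Functions defined
through the flow thereby become Lipschitz on all of space-time, where Rademacher's theorem and
integration by parts apply. -/
theorem abs_clamp_sub_le (T t s : ℝ) : |clamp T t - clamp T s| ≤ |t - s| := by
  unfold clamp
  refine (abs_max_sub_max_le_max _ _ _ _).trans ?_
  refine max_le (by simp) ((abs_min_sub_min_le_max _ _ _ _).trans ?_)
  simp

/-- A bounded velocity field, Lipschitz in space. -/
structure IsVel (M L : ℝ) (F : ℝ → Plane → Plane) : Prop where
  continuous : Continuous (Function.uncurry F)
  bound : ∀ t x, ‖F t x‖ ≤ M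
  lip : ∀ t x y, ‖F t x - F t y‖ ≤ L * ‖x - y‖
  L_nonneg : 0 ≤ L

theorem IsVel.M_nonneg {M L : ℝ} {F : ℝ → Plane → Plane} (h : IsVel M L F) : 0 ≤ M :=
  (norm_nonneg _).trans (h.bound 0 0)

/-- `X t s x` is the position at time `t` of the trajectory of `F` which passes at time `s`
through `x`. -/
structure IsFlow (T : ℝ) (F : ℝ → Plane → Plane) (X : ℝ → ℝ → Plane → Plane) : Prop where
  self : ∀ s ∈ Icc 0 T, ∀ x, X s s x = x
  deriv : ∀ s ∈ Icc 0 T, ∀ t ∈ Icc 0 T, ∀ x, HasDerivAt (fun t => X t s x) (F t (X t s x)) t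

theorem exists_isFlow {M L : ℝ} {F : ℝ → Plane → Plane} (h : IsVel M L F) (T : ℝ) :
    ∃ X, IsFlow T F X := by
  have key : ∀ s x, ∃ α : ℝ → Plane, s ∈ Icc 0 T → (α s = x ∧
      ∀ t ∈ Icc 0 T, HasDerivAt α (F t (α t)) t) := by
    intro s x
    by_cases hs : s ∈ Icc 0 T
    swap
    · exact ⟨0, fun h => absurd h hs⟩
    -- The equation is solved on an interval longer by one at each end, so that the derivatives are
    -- two-sided on `[0,T]`. Elapsed times stay below `T + 2`, hence the radius `M (T + 2)`.
    have hs' : s ∈ Icc (-1) (T + 1) := ⟨by linarith [hs.1], by linarith [hs.2]⟩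
    have hM := h.M_nonneg
    have hT : 0 ≤ T := hs.1.trans hs.2
    have hPL : IsPicardLindelof F (⟨s, hs'⟩ : Icc (-1) (T + 1)) x
        (Real.toNNReal (M * (T + 2))) 0 (Real.toNNReal M) (Real.toNNReal L) := by
      refine ⟨fun t _ => (LipschitzWith.of_dist_le_mul fun a b => ?_).lipschitzOnWith,
        fun y _ => ?_, fun t _ y _ => ?_, ?_⟩
      · rw [dist_eq_norm, dist_eq_norm, Real.coe_toNNReal _ h.L_nonneg]
        exact h.lip t a b
      · exact (h.continuous.comp (by fun_prop : Continuous fun t : ℝ => (t, y))).continuousOn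
      · rw [Real.coe_toNNReal _ hM]
        exact h.bound t y
      · rw [Real.coe_toNNReal _ hM, Real.coe_toNNReal _ (by positivity)]
        simp only [NNReal.coe_zero, sub_zero]
        refine mul_le_mul_of_nonneg_left (max_le ?_ ?_) hM <;> linarith [hs.1, hs.2]
    obtain ⟨α, h0, h1⟩ := hPL.exists_eq_forall_mem_Icc_hasDerivWithinAt₀
    refine ⟨α, fun _ => ⟨h0, fun t ht => (h1 t ⟨by linarith [ht.1], by linarith [ht.2]⟩).hasDerivAt
      (Icc_mem_nhds (by linarith [ht.1]) (by linarith [ht.2]))⟩⟩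
  choose α hα using key
  exact ⟨fun t s x => α s x t, fun s hs x => (hα s x hs).1, fun s hs t ht x => (hα s x hs).2 t ht⟩

namespace IsFlow

variable {T M L : ℝ} {F : ℝ → Plane → Plane} {X : ℝ → ℝ → Plane → Plane}

theorem uIcc_subset {s t : ℝ} (hs : s ∈ Icc 0 T) (ht : t ∈ Icc 0 T) {r : ℝ} (hr : r ∈ uIcc s t) :
    r ∈ Icc 0 T := uIcc_subset_Icc hs ht hr

/-- Lipschitz bound for the flow with a time dependent rate. -/
theorem norm_sub_le (hX : IsFlow T F X) {Λ ℓ : ℝ → ℝ} (hΛ : ∀ r, HasDerivAt Λ (ℓ r) r)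
    (hℓ : ∀ r, 0 ≤ ℓ r) (hF : ∀ r ∈ Icc 0 T, ∀ x y, ‖F r x - F r y‖ ≤ ℓ r * ‖x - y‖)
    {s t : ℝ} (hs : s ∈ Icc 0 T) (ht : t ∈ Icc 0 T) (x y : Plane) :
    ‖X t s x - X t s y‖ ≤ Real.exp |Λ t - Λ s| * ‖x - y‖ := by
  have := norm_le_of_norm_deriv_le (u := fun r => X r s x - X r s y) (η := fun _ => 0)
    (e := fun _ => 0) (s := s) (t := t)
    (fun r hr => (hX.deriv s hs r (uIcc_subset hs ht hr) x).sub
      (hX.deriv s hs r (uIcc_subset hs ht hr) y)) hΛ (fun r => hasDerivAt_const r 0) hℓ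
    (fun _ => le_rfl) (fun r hr => by simpa using hF r (uIcc_subset hs ht hr) _ _)
  simpa [hX.self s hs] using this

theorem norm_sub_le_exp (hX : IsFlow T F X) (hF : IsVel M L F) {s t : ℝ} (hs : s ∈ Icc 0 T)
    (ht : t ∈ Icc 0 T) (x y : Plane) :
    ‖X t s x - X t s y‖ ≤ Real.exp (L * |t - s|) * ‖x - y‖ := by
  have := hX.norm_sub_le (Λ := fun r => L * r) (ℓ := fun _ => L)
    (fun r => by simpa using (hasDerivAt_id r).const_mul L) (fun _ => hF.L_nonneg)
    (fun r _ => hF.lip r) hs ht x y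
  rwa [← mul_sub, abs_mul, abs_of_nonneg hF.L_nonneg] at this

theorem abs_sub_le {s t : ℝ} (hs : s ∈ Icc 0 T) (ht : t ∈ Icc 0 T) : |t - s| ≤ T :=
  abs_sub_le_iff.2 ⟨by linarith [hs.1, ht.2], by linarith [ht.1, hs.2]⟩

theorem norm_sub_le_const (hX : IsFlow T F X) (hF : IsVel M L F) {s t : ℝ} (hs : s ∈ Icc 0 T)
    (ht : t ∈ Icc 0 T) (x y : Plane) :
    ‖X t s x - X t s y‖ ≤ Real.exp (L * T) * ‖x - y‖ := by
  refine (hX.norm_sub_le_exp hF hs ht x y).trans ?_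
  have := hF.L_nonneg
  gcongr
  exact abs_sub_le hs ht

/-- Gronwall is started at the time `r₀` of contact, which need be neither `s` nor `t`. This form
yields the group property and, later, the equality of flows of two fields that agree on `[0,T]`. -/
theorem eq_of_deriv (hX : IsFlow T F X) (hF : IsVel M L F) {α : ℝ → Plane} {s t r₀ : ℝ}
    (hs : s ∈ Icc 0 T) (ht : t ∈ Icc 0 T) (hr₀ : r₀ ∈ Icc 0 T) {x : Plane}
    (hα : ∀ r ∈ Icc 0 T, HasDerivAt α (F r (α r)) r) (h0 : α r₀ = X r₀ s x) :
    α t = X t s x := by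
  have := norm_le_of_norm_deriv_le (u := fun r => α r - X r s x) (Λ := fun r => L * r)
    (ℓ := fun _ => L) (η := fun _ => 0) (e := fun _ => 0) (s := r₀) (t := t)
    (fun r hr => (hα r (uIcc_subset hr₀ ht hr)).sub
      (hX.deriv s hs r (uIcc_subset hr₀ ht hr) x))
    (fun r => by simpa using (hasDerivAt_id r).const_mul L) (fun r => hasDerivAt_const r 0)
    (fun _ => hF.L_nonneg) (fun _ => le_rfl) (fun r hr => by simpa using hF.lip r _ _)
  simp only [h0, sub_self, norm_zero, abs_zero, add_zero, mul_zero] at this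
  exact sub_eq_zero.1 (norm_le_zero_iff.1 this)

theorem comp (hX : IsFlow T F X) (hF : IsVel M L F) {s r t : ℝ} (hs : s ∈ Icc 0 T)
    (hr : r ∈ Icc 0 T) (ht : t ∈ Icc 0 T) (x : Plane) : X t r (X r s x) = X t s x :=
  hX.eq_of_deriv hF hs ht hr (fun q hq => hX.deriv r hr q hq _) (hX.self r hr _)

theorem inv (hX : IsFlow T F X) (hF : IsVel M L F) {s t : ℝ} (hs : s ∈ Icc 0 T)
    (ht : t ∈ Icc 0 T) (x : Plane) : X s t (X t s x) = x := by
  rw [hX.comp hF hs ht hs, hX.self s hs]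

theorem norm_time_sub_le (hX : IsFlow T F X) (hF : IsVel M L F) {s t t' : ℝ} (hs : s ∈ Icc 0 T)
    (ht : t ∈ Icc 0 T) (ht' : t' ∈ Icc 0 T) (x : Plane) :
    ‖X t s x - X t' s x‖ ≤ M * |t - t'| := by
  have := Convex.norm_image_sub_le_of_norm_hasDerivWithin_le (s := Icc 0 T) (C := M)
    (fun r hr => (hX.deriv s hs r hr x).hasDerivWithinAt) (fun r _ => hF.bound r _)
    (convex_Icc 0 T) ht' ht
  simpa using this

theorem norm_sub_self_le (hX : IsFlow T F X) (hF : IsVel M L F) {s t : ℝ} (hs : s ∈ Icc 0 T)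
    (ht : t ∈ Icc 0 T) (x : Plane) : ‖X t s x - x‖ ≤ M * |t - s| := by
  simpa [hX.self s hs] using hX.norm_time_sub_le hF hs ht hs x

/-- By the group property a change of the initial time is a change of the initial point by at most
`M |s - s'|`, which the flow then amplifies. -/
theorem norm_start_sub_le (hX : IsFlow T F X) (hF : IsVel M L F) {s s' t : ℝ} (hs : s ∈ Icc 0 T)
    (hs' : s' ∈ Icc 0 T) (ht : t ∈ Icc 0 T) (x : Plane) :
    ‖X t s x - X t s' x‖ ≤ Real.exp (L * T) * M * |s - s'| := by
  rw [← hX.comp hF hs hs' ht]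
  refine (hX.norm_sub_le_const hF hs' ht _ _).trans ?_
  rw [mul_assoc, abs_sub_comm]
  gcongr
  exact hX.norm_sub_self_le hF hs hs' x

theorem continuous_space (hX : IsFlow T F X) (hF : IsVel M L F) {s t : ℝ} (hs : s ∈ Icc 0 T)
    (ht : t ∈ Icc 0 T) : Continuous (X t s) :=
  LipschitzWith.continuous (K := Real.toNNReal (Real.exp (L * T))) (LipschitzWith.of_dist_le_mul
    fun x y => by
      rw [dist_eq_norm, dist_eq_norm, Real.coe_toNNReal _ (Real.exp_pos _).le]
      exact hX.norm_sub_le_const hF hs ht x y)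

/-- Stability of the flow with respect to the velocity field. -/
theorem norm_sub_flow_le (hX : IsFlow T F X) (hF : IsVel M L F) {F' : ℝ → Plane → Plane}
    {X' : ℝ → ℝ → Plane → Plane} (hX' : IsFlow T F' X') {η e : ℝ → ℝ}
    (hη : ∀ r, HasDerivAt η (e r) r) (he : ∀ r, 0 ≤ e r)
    (hFF : ∀ r ∈ Icc 0 T, ∀ x, ‖F r x - F' r x‖ ≤ e r) {s t : ℝ} (hs : s ∈ Icc 0 T)
    (ht : t ∈ Icc 0 T) (x : Plane) :
    ‖X t s x - X' t s x‖ ≤ Real.exp (L * T) * |η t - η s| := by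
  have := norm_le_of_norm_deriv_le (u := fun r => X r s x - X' r s x) (Λ := fun r => L * r)
    (ℓ := fun _ => L) (s := s) (t := t)
    (fun r hr => (hX.deriv s hs r (uIcc_subset hs ht hr) x).sub
      (hX'.deriv s hs r (uIcc_subset hs ht hr) x))
    (fun r => by simpa using (hasDerivAt_id r).const_mul L) hη (fun _ => hF.L_nonneg) he
    (fun r hr => by
      have h1 := hF.lip r (X r s x) (X' r s x)
      have h2 := hFF r (uIcc_subset hs ht hr) (X' r s x)
      calc _ = ‖(F r (X r s x) - F r (X' r s x)) + (F r (X' r s x) - F' r (X' r s x))‖ := by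
            congr 1; abel
        _ ≤ _ := (norm_add_le _ _).trans (add_le_add h1 h2))
  simp only [hX.self s hs, hX'.self s hs, sub_self, norm_zero, zero_add] at this
  refine this.trans ?_
  gcongr
  rw [← mul_sub, abs_mul, abs_of_nonneg hF.L_nonneg]
  have := hF.L_nonneg
  gcongr
  exact abs_sub_le hs ht

/-- The gain is the factor `|t - s|` next to `‖x - y‖`. It controls the mixed space-time second
differences of the flow. -/
theorem norm_displacement_sub_le (hX : IsFlow T F X) (hF : IsVel M L F) {s t : ℝ}
    (hs : s ∈ Icc 0 T) (ht : t ∈ Icc 0 T) (x y : Plane) :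
    ‖(X t s x - x) - (X t s y - y)‖ ≤ L * Real.exp (L * T) * ‖x - y‖ * |t - s| := by
  have := Convex.norm_image_sub_le_of_norm_hasDerivWithin_le (s := Icc 0 T)
    (C := L * Real.exp (L * T) * ‖x - y‖) (f := fun r => X r s x - X r s y)
    (fun r hr => ((hX.deriv s hs r hr x).sub (hX.deriv s hs r hr y)).hasDerivWithinAt)
    (fun r hr => by
      refine (hF.lip r _ _).trans ?_
      rw [mul_assoc]
      exact mul_le_mul_of_nonneg_left (hX.norm_sub_le_const hF hs hr x y) hF.L_nonneg)
    (convex_Icc 0 T) hs ht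
  simp only [hX.self s hs] at this
  rw [sub_sub_sub_comm]
  exact this

end IsFlow

/-- The second difference at the vertices of a quadrilateral, for a function with second
differences controlled on parallelograms. -/
theorem norm_four_point_le {V F : Type*} [NormedAddCommGroup V] [NormedAddCommGroup F]
    {f : V → F} {m L : ℝ} (hd : ∀ x h k, ‖diff2 f x h k‖ ≤ m * ‖h‖ * ‖k‖)
    (hL : ∀ x y, ‖f x - f y‖ ≤ L * ‖x - y‖) (a b c d : V) :
    ‖f a - f b - f c + f d‖ ≤ m * ‖b - d‖ * ‖c - d‖ + L * ‖a - b - c + d‖ := by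
  -- The quadrilateral is compared with the parallelogram spanned at `d` by the sides towards `b`
  -- and `c`. Its fourth vertex `b + (c - d)` misses `a` by exactly `a - b - c + d`.
  have h1 := hd d (b - d) (c - d)
  have h2 := hL a (d + (b - d) + (c - d))
  have e1 : a - (d + (b - d) + (c - d)) = a - b - c + d := by abel
  rw [e1] at h2
  rw [diff2, add_sub_cancel, add_sub_cancel] at h1
  rw [add_sub_cancel] at h2
  calc _ = ‖(f (b + (c - d)) - f b - f c + f d) + (f a - f (b + (c - d)))‖ := by congr 1; abel
    _ ≤ _ := (norm_add_le _ _).trans (add_le_add h1 h2)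

namespace IsFlow

variable {T M L : ℝ} {F : ℝ → Plane → Plane} {X : ℝ → ℝ → Plane → Plane}

/-- Second differences of the flow. -/
theorem norm_diff2_le (hX : IsFlow T F X) (hF : IsVel M L F) {η m : ℝ → ℝ}
    (hη : ∀ r, HasDerivAt η (m r) r) (hm : ∀ r, 0 ≤ m r)
    (hd : ∀ r ∈ Icc 0 T, ∀ x h k, ‖diff2 (F r) x h k‖ ≤ m r * ‖h‖ * ‖k‖) {s t : ℝ}
    (hs : s ∈ Icc 0 T) (ht : t ∈ Icc 0 T) (x h k : Plane) :
    ‖diff2 (X t s) x h k‖ ≤ Real.exp (L * T) ^ 3 * |η t - η s| * ‖h‖ * ‖k‖ := by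
  -- The two transported sides of the parallelogram have lengths at most `exp (L T) ‖h‖` and `exp (L
  -- T) ‖k‖`, and `A` is their product. The third exponential factor comes from Gronwall.
  set A : ℝ := Real.exp (L * T) ^ 2 * (‖h‖ * ‖k‖) with hA
  have hA0 : 0 ≤ A := by positivity
  have := norm_le_of_norm_deriv_le (u := fun r => diff2 (X r s) x h k)
    (u' := fun r => F r (X r s (x + h + k)) - F r (X r s (x + h)) - F r (X r s (x + k))
      + F r (X r s x)) (Λ := fun r => L * r)
    (ℓ := fun _ => L) (η := fun r => A * η r) (e := fun r => A * m r) (s := s) (t := t)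
    (fun r hr => by
      have hd := fun y => hX.deriv s hs r (uIcc_subset hs ht hr) y
      exact (((hd _).sub (hd _)).sub (hd _)).add (hd _))
    (fun r => by simpa using (hasDerivAt_id r).const_mul L) (fun r => (hη r).const_mul A)
    (fun _ => hF.L_nonneg) (fun r => mul_nonneg hA0 (hm r))
    (fun r hr => by
      have hr' := uIcc_subset hs ht hr
      have h1 := norm_four_point_le (hd r hr') (hF.lip r) (X r s (x + h + k)) (X r s (x + h))
        (X r s (x + k)) (X r s x)
      have h2 := hX.norm_sub_le_const hF hs hr' (x + h) x
      have h3 := hX.norm_sub_le_const hF hs hr' (x + k) x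
      rw [add_sub_cancel_left] at h2 h3
      have h4 : m r * ‖X r s (x + h) - X r s x‖ * ‖X r s (x + k) - X r s x‖ ≤ A * m r := by
        calc _ ≤ m r * (Real.exp (L * T) * ‖h‖) * (Real.exp (L * T) * ‖k‖) := by
              have := hm r
              gcongr
          _ = _ := by rw [hA]; ring
      rw [diff2]
      linarith)
  have h0 : diff2 (X s s) x h k = 0 := by
    simp only [diff2, hX.self s hs]; abel
  simp only [h0, norm_zero, zero_add] at this
  rw [← mul_sub, ← mul_sub, abs_mul, abs_mul, abs_of_nonneg hF.L_nonneg, abs_of_nonneg hA0] at this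
  refine this.trans ?_
  have h5 : Real.exp (L * |t - s|) ≤ Real.exp (L * T) := by
    have := hF.L_nonneg
    gcongr
    exact abs_sub_le hs ht
  calc _ ≤ Real.exp (L * T) * (A * |η t - η s|) := by gcongr
    _ = _ := by rw [hA]; ring

end IsFlow


/-! ### Invariance of the weighted measure under the flow. -/

/-- `∫ fderiv φ (B F) = 0` for all Lipschitz test functions: the field `B F` is solenoidal. -/
def IsSolenoidal (G : Plane → Plane) : Prop :=
  ∀ (φ : Plane → ℝ) (C : ℝ≥0), LipschitzWith C φ → HasCompactSupport φ →
    ∫ x, fderiv ℝ φ x (G x) = 0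

instance instIsAddHaarMeasureSpaceTime : (volume : Measure (ℝ × Plane)).IsAddHaarMeasure :=
  Measure.prod.instIsAddHaarMeasure volume volume

theorem lineDeriv_time (g : ℝ × Plane → ℝ) (s : ℝ) (x : Plane) :
    lineDeriv ℝ g (s, x) ((1 : ℝ), (0 : Plane)) = deriv (fun r => g (r, x)) s := by
  have : (fun τ : ℝ => g ((s, x) + τ • ((1 : ℝ), (0 : Plane)))) = fun τ => g (s + τ, x) := by
    ext τ; simp
  rw [lineDeriv, this, deriv_comp_const_add (fun r => g (r, x)) s 0, add_zero]

theorem fderiv_space {F : Type*} [NormedAddCommGroup F] [NormedSpace ℝ F]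
    {g : ℝ × Plane → F} {z : ℝ × Plane} (hg : DifferentiableAt ℝ g z) (v : Plane) :
    fderiv ℝ (fun x => g (z.1, x)) z.2 v = fderiv ℝ g z ((0 : ℝ), v) := by
  have h := HasFDerivAt.comp z.2 (f := fun x => (z.1, x)) (g := g) hg.hasFDerivAt
    (hasFDerivAt_prodMk_right z.1 z.2)
  exact congrArg (fun A => A v) h.fderiv

theorem lipschitzWith_space {F : Type*} [PseudoMetricSpace F] {g : ℝ × Plane → F} {C : ℝ≥0}
    (hg : LipschitzWith C g) (s : ℝ) : LipschitzWith C fun x => g (s, x) :=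
  LipschitzWith.of_dist_le_mul fun x y => (hg.dist_le_mul (s, x) (s, y)).trans (by simp)

theorem lipschitzWith_time {F : Type*} [PseudoMetricSpace F] {g : ℝ × Plane → F} {C : ℝ≥0}
    (hg : LipschitzWith C g) (x : Plane) : LipschitzWith C fun s => g (s, x) :=
  LipschitzWith.of_dist_le_mul fun s t => (hg.dist_le_mul (s, x) (t, x)).trans (by simp)

theorem volume_restrict_slab (T : ℝ) : (volume : Measure (ℝ × Plane)).restrict (slab T)
    = ((volume : Measure ℝ).restrict (Ioo 0 T)).prod (volume : Measure Plane) := by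
  rw [slab, Measure.volume_eq_prod, ← Measure.prod_restrict, Measure.restrict_univ]

theorem measurableSet_slab (T : ℝ) : MeasurableSet (slab T) :=
  measurableSet_Ioo.prod MeasurableSet.univ

theorem isOpen_slab (T : ℝ) : IsOpen (slab T) := isOpen_Ioo.prod isOpen_univ

theorem integral_lineDeriv_time {g : ℝ × Plane → ℝ} {C : ℝ≥0} (hg : LipschitzWith C g)
    (a b : ℝ) (x : Plane) :
    ∫ s in a..b, lineDeriv ℝ g (s, x) ((1 : ℝ), (0 : Plane)) = g (b, x) - g (a, x) := by
  simp_rw [lineDeriv_time]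
  exact (LipschitzOnWith.absolutelyContinuousOnInterval
    (lipschitzWith_time hg x).lipschitzOnWith).integral_deriv_eq_sub

theorem norm_lineDeriv_le {g : ℝ × Plane → ℝ} {C : ℝ≥0} (hg : LipschitzWith C g)
    (z v : ℝ × Plane) : ‖lineDeriv ℝ g z v‖ ≤ C * ‖v‖ :=
  norm_lineDeriv_le_of_lipschitz ℝ hg

theorem hasCompactSupport_of_zero_outside {g : Plane → ℝ} {R : ℝ} (h : ∀ x, R < ‖x‖ → g x = 0) :
    HasCompactSupport g :=
  HasCompactSupport.intro (isCompact_closedBall 0 R) fun x hx => h x (by simpa using hx)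

/-- A quantity which is constant along the trajectories of `F` has a constant integral with
respect to the weight `B`, when `B F` is solenoidal. -/
theorem integral_weight_const {T : ℝ} {F : ℝ → Plane → Plane} {B : Plane → ℝ} {B₁ : ℝ}
    (hB : Continuous B) (hB₁ : ∀ x, |B x| ≤ B₁)
    (hdiv : ∀ s ∈ Ioo 0 T, IsSolenoidal fun x => B x • F s x)
    {g : ℝ × Plane → ℝ} {C : ℝ≥0} (hg : LipschitzWith C g) {R : ℝ}
    (hR : ∀ s x, R < ‖x‖ → g (s, x) = 0)
    (htr : ∀ᵐ z ∂(volume.restrict (slab T)), fderiv ℝ g z ((1 : ℝ), F z.1 z.2) = 0)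
    {t : ℝ} (ht : t ∈ Icc 0 T) : ∫ x, g (t, x) * B x = ∫ x, g (0, x) * B x := by
  have hsupp : ∀ s, HasCompactSupport fun x => g (s, x) := fun s =>
    hasCompactSupport_of_zero_outside (hR s)
  have hint : ∀ s, Integrable fun x => g (s, x) * B x := fun s =>
    ((lipschitzWith_space hg s).continuous.mul hB).integrable_of_hasCompactSupport
      (hsupp s).mul_right
  -- The line derivative is used instead of the full one: for each fixed `x` it is the derivative of
  -- a Lipschitz function of time, so the fundamental theorem of calculus holds for every `x`. It
  -- agrees with `fderiv` almost everywhere in space-time.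
  set q : ℝ × Plane → ℝ := fun z => lineDeriv ℝ g z ((1 : ℝ), (0 : Plane)) with hq
  have hqm : Measurable q := measurable_lineDeriv hg.continuous
  have hqb : ∀ z, ‖q z‖ ≤ C := fun z => by
    simpa using norm_lineDeriv_le hg z ((1 : ℝ), (0 : Plane))
  have hq0 : ∀ s x, R < ‖x‖ → q (s, x) = 0 := fun s x hx => by
    simp only [hq]
    rw [lineDeriv_time]
    simp [hR _ x hx]
  rw [← sub_eq_zero, ← integral_sub (hint t) (hint 0)]
  have e1 : ∀ x, g (t, x) * B x - g (0, x) * B x = ∫ s in Ioc 0 t, q (s, x) * B x := fun x => by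
    rw [integral_mul_const, ← intervalIntegral.integral_of_le ht.1, integral_lineDeriv_time hg]
    ring
  simp_rw [e1]
  have hswap : Integrable (Function.uncurry fun (x : Plane) (s : ℝ) => q (s, x) * B x)
      (volume.prod (volume.restrict (Ioc 0 t))) := by
    have hb : Integrable (fun z : Plane × ℝ =>
        (Metric.closedBall (0 : Plane) R).indicator (fun _ => (C : ℝ) * B₁) z.1 * 1)
        (volume.prod (volume.restrict (Ioc 0 t))) := by
      refine Integrable.mul_prod ?_ (integrable_const (1 : ℝ))
      rw [integrable_indicator_iff measurableSet_closedBall]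
      exact integrable_const_iff.2 (Or.inr ⟨by
        simpa using (isCompact_closedBall (0 : Plane) R).measure_lt_top (μ := volume)⟩)
    refine hb.mono' ((hqm.comp measurable_swap).mul
      (hB.measurable.comp measurable_fst)).aestronglyMeasurable (Eventually.of_forall fun z => ?_)
    simp only [Function.uncurry, mul_one]
    by_cases hz : z.1 ∈ Metric.closedBall (0 : Plane) R
    · rw [indicator_of_mem hz, norm_mul]
      exact mul_le_mul (hqb _) (hB₁ _) (norm_nonneg _) C.2
    · rw [hq0 _ _ (by simpa using hz)]
      simp [indicator_of_notMem hz]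
  rw [integral_integral_swap hswap]
  have hdiff : ∀ᵐ z ∂(volume.restrict (slab T)), DifferentiableAt ℝ g z :=
    ae_restrict_of_ae hg.ae_differentiableAt
  have hae := hdiff.and htr
  rw [volume_restrict_slab] at hae
  have hae2 : ∀ᵐ s ∂(volume.restrict (Ioc 0 t)), s ∈ Ioo 0 T ∧ ∀ᵐ x : Plane,
      DifferentiableAt ℝ g (s, x) ∧ fderiv ℝ g (s, x) ((1 : ℝ), F s x) = 0 := by
    have h1 : ∀ᵐ s ∂(volume.restrict (Ioo 0 T)), s ∈ Ioo 0 T ∧ ∀ᵐ x : Plane,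
        DifferentiableAt ℝ g (s, x) ∧ fderiv ℝ g (s, x) ((1 : ℝ), F s x) = 0 :=
      (ae_restrict_mem measurableSet_Ioo).and (Measure.ae_ae_of_ae_prod hae)
    rw [restrict_Ioo_eq_restrict_Ioc] at h1
    exact ae_restrict_of_ae_restrict_of_subset (Ioc_subset_Ioc_right ht.2) h1
  refine integral_eq_zero_of_ae ?_
  filter_upwards [hae2] with s hs
  -- Since `∂ₜg = - F · ∇g`, the space integral of `B ∂ₜg` is minus the pairing of `∇g` with the
  -- solenoidal field `B F`.
  rw [Pi.zero_apply, ← neg_zero, ← hdiv s hs.1 _ C (lipschitzWith_space hg s) (hsupp s), ← integral_neg]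
  refine integral_congr_ae ?_
  filter_upwards [hs.2] with x hx
  have e2 : q (s, x) = fderiv ℝ g (s, x) ((1 : ℝ), (0 : Plane)) := hx.1.lineDeriv_eq_fderiv
  have e3 := fderiv_space hx.1 (B x • F s x)
  simp only at e3
  rw [e2, e3]
  have e4 : ((1 : ℝ), F s x) = ((1 : ℝ), (0 : Plane)) + ((0 : ℝ), F s x) := by simp
  have e5 : ((0 : ℝ), B x • F s x) = B x • ((0 : ℝ), F s x) := by simp
  have h3 := hx.2
  rw [e4, map_add] at h3
  rw [e5, map_smul, smul_eq_mul]
  linear_combination (B x) * h3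

namespace IsFlow

variable {T M L : ℝ} {F : ℝ → Plane → Plane} {X : ℝ → ℝ → Plane → Plane}

theorem lipschitzWith_start (hX : IsFlow T F X) (hF : IsVel M L F) (hT : 0 ≤ T) {t : ℝ}
    (ht : t ∈ Icc 0 T) :
    LipschitzWith (Real.toNNReal (Real.exp (L * T) * (M + 1)))
      fun z : ℝ × Plane => X t (clamp T z.1) z.2 := by
  refine LipschitzWith.of_dist_le_mul fun z z' => ?_
  have hM := hF.M_nonneg
  rw [dist_eq_norm, dist_eq_norm, Real.coe_toNNReal _ (by positivity)]
  have h1 := hX.norm_start_sub_le hF (clamp_mem hT z.1) (clamp_mem hT z'.1) ht z.2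
  have h2 := hX.norm_sub_le_const hF (clamp_mem hT z'.1) ht z.2 z'.2
  have h3 : |clamp T z.1 - clamp T z'.1| ≤ ‖z - z'‖ :=
    (abs_clamp_sub_le T z.1 z'.1).trans (norm_fst_le (z - z'))
  have h4 : ‖z.2 - z'.2‖ ≤ ‖z - z'‖ := norm_snd_le (z - z')
  have h5 : ‖X t (clamp T z.1) z.2 - X t (clamp T z'.1) z'.2‖
      ≤ ‖X t (clamp T z.1) z.2 - X t (clamp T z'.1) z.2‖
        + ‖X t (clamp T z'.1) z.2 - X t (clamp T z'.1) z'.2‖ := norm_sub_le_norm_sub_add_norm_sub _ _ _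
  have he := Real.exp_pos (L * T)
  calc _ ≤ _ := h5
    _ ≤ Real.exp (L * T) * M * ‖z - z'‖ + Real.exp (L * T) * ‖z - z'‖ := by
        refine add_le_add (h1.trans (by gcongr)) (h2.trans (by gcongr))
    _ = _ := by ring

/-- A function of the final position is transported by the flow. -/
theorem ae_transport (hX : IsFlow T F X) (hF : IsVel M L F) (hT : 0 ≤ T) {t : ℝ}
    (ht : t ∈ Icc 0 T) {ψ : Plane → ℝ} {C : ℝ≥0} (hψ : LipschitzWith C ψ) :
    ∀ᵐ z ∂(volume.restrict (slab T)),
      fderiv ℝ (fun z : ℝ × Plane => ψ (X t (clamp T z.1) z.2)) z ((1 : ℝ), F z.1 z.2) = 0 := by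
  have hL := hψ.comp (hX.lipschitzWith_start hF hT ht)
  have hd : ∀ᵐ z ∂(volume.restrict (slab T)), DifferentiableAt ℝ
      (fun z : ℝ × Plane => ψ (X t (clamp T z.1) z.2)) z := ae_restrict_of_ae hL.ae_differentiableAt
  filter_upwards [hd, ae_restrict_mem (measurableSet_slab T)] with z hz hzT
  obtain ⟨s, x⟩ := z
  have hs : s ∈ Ioo 0 T := hzT.1
  have hs' := Ioo_subset_Icc_self hs
  have hc : HasDerivAt (fun r => ((r, X r s x) : ℝ × Plane)) ((1 : ℝ), F s (X s s x)) s :=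
    (hasDerivAt_id s).prodMk (hX.deriv s hs' s hs' x)
  rw [hX.self s hs'] at hc
  have hz' : HasFDerivAt (fun z : ℝ × Plane => ψ (X t (clamp T z.1) z.2))
      (fderiv ℝ (fun z : ℝ × Plane => ψ (X t (clamp T z.1) z.2)) (s, x)) (s, X s s x) := by
    rw [hX.self s hs']; exact hz.hasFDerivAt
  have h1 := hz'.comp_hasDerivAt s hc
  -- By the group property `X t r (X r s x)` does not depend on `r`. The chain rule at a point of
  -- differentiability turns this into the transport equation.
  have h2 : (fun r => ψ (X t (clamp T r) (X r s x))) =ᶠ[𝓝 s] fun _ => ψ (X t s x) := by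
    filter_upwards [Icc_mem_nhds hs.1 hs.2] with r hr
    rw [clamp_of_mem hr, hX.comp hF hs' hr ht]
  have h3 : HasDerivAt (fun r => ψ (X t (clamp T r) (X r s x))) 0 s :=
    (hasDerivAt_const s (ψ (X t s x))).congr_of_eventuallyEq h2
  exact h1.unique h3

end IsFlow

/-- The indicator of a bounded open set `U` is the increasing limit of the functions `min 1 (n
dist(·, Uᶜ))`. Lipschitz tests are the natural class because composition with the flow preserves no
more regularity. -/
theorem measure_ext_of_lipschitz {μ ν : Measure Plane} [IsFiniteMeasureOnCompacts μ]
    [IsFiniteMeasureOnCompacts ν]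
    (h : ∀ (φ : Plane → ℝ) (C : ℝ≥0), LipschitzWith C φ → HasCompactSupport φ →
      ∫ x, φ x ∂μ = ∫ x, φ x ∂ν) : μ = ν := by
  refine Measure.OuterRegular.ext_isOpen_isBounded fun U hU hUb => ?_
  have hne : (Uᶜ).Nonempty := by
    rw [nonempty_compl]
    rintro rfl
    exact NormedSpace.unbounded_univ ℝ Plane hUb
  have hfin : ∀ (m : Measure Plane) [IsFiniteMeasureOnCompacts m], m U ≠ ⊤ := fun m _ =>
    ((measure_mono subset_closure).trans_lt hUb.isCompact_closure.measure_lt_top).ne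
  set φ : ℕ → Plane → ℝ := fun n x => min 1 (n * Metric.infDist x Uᶜ) with hφ
  have hφL : ∀ n : ℕ, LipschitzWith n (φ n) := fun n => by
    refine (LipschitzWith.of_dist_le_mul fun x y => ?_ :
      LipschitzWith n fun x => (n : ℝ) * Metric.infDist x Uᶜ).const_min 1
    have := (Metric.lipschitz_infDist_pt Uᶜ).dist_le_mul x y
    rw [Real.dist_eq, ← mul_sub, abs_mul, ← Real.dist_eq]
    simp only [NNReal.coe_one, one_mul] at this
    simp only [NNReal.coe_natCast, Nat.abs_cast]
    gcongr
  have hφ0 : ∀ n, ∀ x ∉ U, φ n x = 0 := fun n x hx => by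
    have : Metric.infDist x Uᶜ = 0 := Metric.infDist_zero_of_mem hx
    simp [hφ, this]
  have hφc : ∀ n, HasCompactSupport (φ n) := fun n =>
    HasCompactSupport.intro hUb.isCompact_closure fun x hx =>
      hφ0 n x fun hxU => hx (subset_closure hxU)
  have hlim : ∀ (m : Measure Plane) [IsFiniteMeasureOnCompacts m],
      Tendsto (fun n => ∫ x, φ n x ∂m) atTop (𝓝 (m.real U)) := by
    intro m _
    rw [← integral_indicator_one hU.measurableSet]
    refine tendsto_integral_of_dominated_convergence (U.indicator 1)
      (fun n => (hφL n).continuous.aestronglyMeasurable)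
      ((integrable_indicator_iff hU.measurableSet).2 (integrable_const_iff.2
        (Or.inr ⟨by simpa using (hfin m).lt_top⟩)))
      (fun n => Eventually.of_forall fun x => ?_) (Eventually.of_forall fun x => ?_)
    · by_cases hx : x ∈ U
      · simp only [indicator_of_mem hx, Pi.one_apply, hφ]
        rw [Real.norm_of_nonneg (le_min zero_le_one
          (mul_nonneg n.cast_nonneg Metric.infDist_nonneg))]
        exact min_le_left _ _
      · rw [hφ0 n x hx, indicator_of_notMem hx, norm_zero]
    · by_cases hx : x ∈ U
      · rw [indicator_of_mem hx]
        have hpos : 0 < Metric.infDist x Uᶜ :=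
          (hU.isClosed_compl.notMem_iff_infDist_pos hne).1 (by simpa using hx)
        refine tendsto_const_nhds.congr' ?_
        obtain ⟨N, hN⟩ := exists_nat_ge (Metric.infDist x Uᶜ)⁻¹
        filter_upwards [eventually_ge_atTop N] with n hn
        simp only [hφ, Pi.one_apply]
        rw [min_eq_left]
        rw [← div_le_iff₀ hpos, one_div]
        exact hN.trans (by exact_mod_cast hn)
      · rw [indicator_of_notMem hx]
        simp_rw [hφ0 _ x hx]
        exact tendsto_const_nhds
  have hreal : μ.real U = ν.real U := by
    refine tendsto_nhds_unique (hlim μ) ?_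
    simp_rw [h _ _ (hφL _) (hφc _)]
    exact hlim ν
  exact (measureReal_eq_measureReal_iff (hfin μ) (hfin ν)).1 hreal

/-- The measure with density `B`. -/
def wMeasure (B : Plane → ℝ) : Measure Plane := volume.withDensity fun x => ENNReal.ofReal (B x)

theorem integral_wMeasure {F : Type*} [NormedAddCommGroup F] [NormedSpace ℝ F] {B : Plane → ℝ}
    (hB : Measurable B) (hB0 : ∀ x, 0 ≤ B x) (f : Plane → F) :
    ∫ x, f x ∂(wMeasure B) = ∫ x, B x • f x := by
  have := integral_withDensity_eq_integral_smul (μ := (volume : Measure Plane))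
    (f := fun x => Real.toNNReal (B x)) hB.real_toNNReal f
  simp only [NNReal.smul_def, Real.coe_toNNReal _ (hB0 _)] at this
  exact this

theorem integrable_wMeasure_iff {F : Type*} [NormedAddCommGroup F] [NormedSpace ℝ F]
    {B : Plane → ℝ} (hB : Measurable B) (hB0 : ∀ x, 0 ≤ B x) (f : Plane → F) :
    Integrable f (wMeasure B) ↔ Integrable fun x => B x • f x := by
  have := integrable_withDensity_iff_integrable_smul (μ := (volume : Measure Plane))
    (f := fun x => Real.toNNReal (B x)) hB.real_toNNReal (g := f)
  simp only [NNReal.smul_def, Real.coe_toNNReal _ (hB0 _)] at this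
  exact this

theorem isFiniteMeasureOnCompacts_wMeasure {B : Plane → ℝ} (hB : Continuous B) :
    IsFiniteMeasureOnCompacts (wMeasure B) := by
  refine ⟨fun K hK => ?_⟩
  obtain ⟨C, hC⟩ := hK.exists_bound_of_continuousOn hB.continuousOn
  rw [wMeasure, withDensity_apply _ hK.measurableSet]
  calc _ ≤ ∫⁻ _ in K, ENNReal.ofReal C := by
        refine setLIntegral_mono measurable_const fun x hx => ?_
        exact ENNReal.ofReal_le_ofReal ((le_abs_self _).trans (hC x hx))
    _ < ⊤ := by
        rw [setLIntegral_const]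
        exact ENNReal.mul_lt_top ENNReal.ofReal_lt_top hK.measure_lt_top

namespace IsFlow

variable {T M L : ℝ} {F : ℝ → Plane → Plane} {X : ℝ → ℝ → Plane → Plane}

/-- The homeomorphism given by the flow. -/
def homeo (hX : IsFlow T F X) (hF : IsVel M L F) {s t : ℝ} (hs : s ∈ Icc 0 T)
    (ht : t ∈ Icc 0 T) : Plane ≃ₜ Plane where
  toFun := X t s
  invFun := X s t
  left_inv := hX.inv hF hs ht
  right_inv := hX.inv hF ht hs
  continuous_toFun := hX.continuous_space hF hs ht
  continuous_invFun := hX.continuous_space hF ht hs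

/-- The function `φ (X t s x)` of `(s, x)` is transported and equals `φ` at `s = t` and `φ ∘ X t 0`
at `s = 0`. Finite speed keeps its support in the ball of radius `R + M T`, so its weighted integral
is constant in `s`. -/
theorem integral_comp_mul_weight (hX : IsFlow T F X) (hF : IsVel M L F) {B : Plane → ℝ} {B₁ : ℝ}
    (hB : Continuous B) (hB₁ : ∀ x, |B x| ≤ B₁)
    (hdiv : ∀ s ∈ Ioo 0 T, IsSolenoidal fun x => B x • F s x) {t : ℝ} (ht : t ∈ Icc 0 T)
    {φ : Plane → ℝ} {C : ℝ≥0} (hφ : LipschitzWith C φ) (hc : HasCompactSupport φ) :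
    ∫ x, φ (X t 0 x) * B x = ∫ x, φ x * B x := by
  have hT : 0 ≤ T := ht.1.trans ht.2
  have h0 : (0 : ℝ) ∈ Icc 0 T := left_mem_Icc.2 hT
  obtain ⟨R, hR⟩ := hc.isCompact.isBounded.subset_closedBall 0
  have := integral_weight_const hB hB₁ hdiv
    (hφ.comp (hX.lipschitzWith_start hF hT ht)) (R := R + M * T) (fun s x hx => ?_)
    (hX.ae_transport hF hT ht hφ) ht
  · simp only [Function.comp_def] at this
    rw [clamp_of_mem ht, clamp_of_mem h0] at this
    simp_rw [hX.self t ht] at this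
    exact this.symm
  · simp only [Function.comp_def]
    refine image_eq_zero_of_notMem_tsupport fun hmem => ?_
    have h1 : ‖X t (clamp T s) x‖ ≤ R := by simpa using hR hmem
    have h2 := hX.norm_sub_self_le hF (clamp_mem hT s) ht x
    have h3 := abs_sub_le (clamp_mem hT s) ht
    have h4 : ‖x‖ ≤ ‖X t (clamp T s) x‖ + ‖X t (clamp T s) x - x‖ := by
      have := norm_sub_norm_le x (X t (clamp T s) x)
      rw [norm_sub_rev] at this
      linarith
    nlinarith [hF.M_nonneg]

theorem measurePreserving (hX : IsFlow T F X) (hF : IsVel M L F) {B : Plane → ℝ} {B₁ : ℝ}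
    (hB : Continuous B) (hB0 : ∀ x, 0 ≤ B x) (hB₁ : ∀ x, |B x| ≤ B₁)
    (hdiv : ∀ s ∈ Ioo 0 T, IsSolenoidal fun x => B x • F s x) {t : ℝ} (ht : t ∈ Icc 0 T) :
    MeasurePreserving (X t 0) (wMeasure B) (wMeasure B) := by
  have h0 : (0 : ℝ) ∈ Icc 0 T := left_mem_Icc.2 (ht.1.trans ht.2)
  have hcont := hX.continuous_space hF h0 ht
  refine ⟨hcont.measurable, ?_⟩
  have := isFiniteMeasureOnCompacts_wMeasure hB
  have : IsFiniteMeasureOnCompacts (Measure.map (X t 0) (wMeasure B)) := by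
    refine ⟨fun K hK => ?_⟩
    rw [Measure.map_apply hcont.measurable hK.measurableSet]
    exact ((hX.homeo hF h0 ht).isCompact_preimage.2 hK).measure_lt_top
  refine measure_ext_of_lipschitz fun φ C hφ hc => ?_
  rw [integral_map hcont.aemeasurable hφ.continuous.aestronglyMeasurable,
    integral_wMeasure hB.measurable hB0, integral_wMeasure hB.measurable hB0]
  simp only [smul_eq_mul, mul_comm (B _)]
  exact hX.integral_comp_mul_weight hF hB hB₁ hdiv ht hφ hc

end IsFlow


/-! ### The transport problem and its Lagrangian densities. -/

theorem integrable_fderiv_field {φ : Plane → ℝ} {C : ℝ≥0} (hφ : LipschitzWith C φ)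
    (hc : HasCompactSupport φ) {G : Plane → Plane} (hG : Continuous G) :
    Integrable fun x => fderiv ℝ φ x (G x) := by
  have e1 : ∀ x, fderiv ℝ φ x (G x)
      = fderiv ℝ φ x (basisVec 0) * G x 0 + fderiv ℝ φ x (basisVec 1) * G x 1 := fun x => by
    rw [fderiv_apply_plane]; ring
  simp_rw [e1]
  have hi : ∀ i : Fin 2, Continuous fun x => G x i := fun i =>
    (EuclideanSpace.proj (𝕜 := ℝ) i).continuous.comp hG
  exact (integrable_fderiv_mul hφ (hi 0) hc _).add (integrable_fderiv_mul hφ (hi 1) hc _)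

theorem IsSolenoidal.add {G H : Plane → Plane} (hG : IsSolenoidal G) (hH : IsSolenoidal H)
    (hGc : Continuous G) (hHc : Continuous H) : IsSolenoidal fun x => G x + H x := by
  intro φ C hφ hc
  simp_rw [map_add]
  rw [integral_add (integrable_fderiv_field hφ hc hGc) (integrable_fderiv_field hφ hc hHc),
    hG φ C hφ hc, hH φ C hφ hc, add_zero]

theorem IsSolenoidal.smul {G : Plane → Plane} (hG : IsSolenoidal G) (c : ℝ) :
    IsSolenoidal fun x => c • G x := by
  intro φ C hφ hc
  simp_rw [map_smul]
  rw [integral_smul, hG φ C hφ hc, smul_zero]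

/-- The data of the transport problem: `B` is the weight, `a` the drift produced by the diffusion
term, `w` the initial value of `n / B`, `D` the background density, and `c₀ field` the solution
operator of the div-curl system. -/
structure Data where
  T : ℝ
  B : Plane → ℝ
  a : Plane → Plane
  w : Plane → ℝ
  D : Plane → ℝ
  c₀ : ℝ
  B₀ : ℝ
  B₁ : ℝ
  LB : ℝ
  A₀ : ℝ
  A₁ : ℝ
  W : ℝ
  Lw : ℝ
  RD : ℝ
  LD : ℝ
  T_pos : 0 < T
  B₀_pos : 0 < B₀
  B_ge : ∀ x, B₀ ≤ B x
  B_le : ∀ x, B x ≤ B₁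
  B_lip : ∀ x y, |B x - B y| ≤ LB * ‖x - y‖
  a_bound : ∀ x, ‖a x‖ ≤ A₀
  a_lip : ∀ x y, ‖a x - a y‖ ≤ A₁ * ‖x - y‖
  a_sol : IsSolenoidal fun x => B x • a x
  w_nonneg : ∀ x, 0 ≤ w x
  w_le : ∀ x, w x ≤ W
  w_lip : ∀ x y, |w x - w y| ≤ Lw * ‖x - y‖
  n_int : Integrable fun x => B x * w x
  n_mom : Integrable fun x => ‖x‖ * (B x * w x)
  D_bound : ∀ x, |D x| ≤ RD
  D_lip : ∀ x y, |D x - D y| ≤ LD * ‖x - y‖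
  D_int : Integrable D
  D_mom : Integrable fun x => ‖x‖ * D x
  neutral : ∫ x, B x * w x = ∫ x, D x

theorem lipschitz_of_norm_le {V F : Type*} [SeminormedAddCommGroup V] [SeminormedAddCommGroup F]
    {f : V → F} {C : ℝ}
    (h : ∀ x y, ‖f x - f y‖ ≤ C * ‖x - y‖) : LipschitzWith (Real.toNNReal C) f :=
  LipschitzWith.of_dist_le_mul fun x y => by
    rw [dist_eq_norm, dist_eq_norm]
    exact (h x y).trans (by gcongr; exact Real.le_coe_toNNReal C)

theorem nonneg_of_lip {V F : Type*} [NormedAddCommGroup V] [Nontrivial V]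
    [SeminormedAddCommGroup F] {f : V → F} {C : ℝ}
    (h : ∀ x y, ‖f x - f y‖ ≤ C * ‖x - y‖) : 0 ≤ C := by
  obtain ⟨x, hx⟩ := exists_ne (0 : V)
  have h1 := (norm_nonneg _).trans (h x 0)
  rw [sub_zero] at h1
  exact nonneg_of_mul_nonneg_left h1 (norm_pos_iff.2 hx)

/-- Fields with uniform bound `M` and Lipschitz constant `K`, curl-free. -/
structure IsField (T M K : ℝ) (E : ℝ → Plane → Plane) : Prop where
  continuous : Continuous (Function.uncurry E)
  bound : ∀ t x, ‖E t x‖ ≤ M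
  lip : ∀ t x y, ‖E t x - E t y‖ ≤ K * ‖x - y‖
  curl : ∀ t ∈ Ioo 0 T, IsSolenoidal fun x => rot (E t x)

namespace Data

variable (d : Data)

theorem B_pos (x : Plane) : 0 < d.B x := d.B₀_pos.trans_le (d.B_ge x)

theorem B_abs (x : Plane) : |d.B x| ≤ d.B₁ := by
  rw [abs_of_pos (d.B_pos x)]; exact d.B_le x

theorem LB_nonneg : 0 ≤ d.LB := nonneg_of_lip (f := d.B) d.B_lip

theorem A₁_nonneg : 0 ≤ d.A₁ := nonneg_of_lip d.a_lip

theorem Lw_nonneg : 0 ≤ d.Lw := nonneg_of_lip (f := d.w) d.w_lip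

theorem LD_nonneg : 0 ≤ d.LD := nonneg_of_lip (f := d.D) d.D_lip

theorem W_nonneg : 0 ≤ d.W := (d.w_nonneg 0).trans (d.w_le 0)

theorem RD_nonneg : 0 ≤ d.RD := (abs_nonneg _).trans (d.D_bound 0)

theorem B₁_pos : 0 < d.B₁ := (d.B_pos 0).trans_le (d.B_le 0)

theorem continuous_B : Continuous d.B := (lipschitz_of_norm_le (f := d.B) d.B_lip).continuous

theorem continuous_a : Continuous d.a := (lipschitz_of_norm_le d.a_lip).continuous

theorem continuous_w : Continuous d.w := (lipschitz_of_norm_le (f := d.w) d.w_lip).continuous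

theorem continuous_D : Continuous d.D := (lipschitz_of_norm_le (f := d.D) d.D_lip).continuous

theorem inv_B_le (x : Plane) : (d.B x)⁻¹ ≤ d.B₀⁻¹ := inv_anti₀ d.B₀_pos (d.B_ge x)

theorem inv_B_sub_le (x y : Plane) :
    |(d.B x)⁻¹ - (d.B y)⁻¹| ≤ d.LB * d.B₀⁻¹ ^ 2 * ‖x - y‖ := by
  have hx := d.B_pos x
  have hy := d.B_pos y
  have hB := d.B₀_pos
  have e : (d.B x)⁻¹ - (d.B y)⁻¹ = (d.B x)⁻¹ * (d.B y)⁻¹ * (d.B y - d.B x) := by field_simp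
  rw [e, abs_mul, abs_of_pos (by positivity), abs_sub_comm]
  calc _ ≤ d.B₀⁻¹ * d.B₀⁻¹ * (d.LB * ‖x - y‖) := by
        gcongr
        · exact d.B_ge x
        · exact d.B_ge y
        · exact d.B_lip x y
    _ = _ := by ring

/-- The velocity field `-(rot E)/B + a`. -/
def vel (E : ℝ → Plane → Plane) (t : ℝ) (x : Plane) : Plane :=
  d.a x - (d.B x)⁻¹ • rot (E t x)

/-- The initial density. -/
def n₀ (x : Plane) : ℝ := d.B x * d.w x

/-- The density transported by a map with inverse `Y`. -/
def dens (Y : Plane → Plane) (x : Plane) : ℝ := d.B x * d.w (Y x)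

/-- The charge density, up to a constant. -/
def rho (Y : Plane → Plane) (x : Plane) : ℝ := d.dens Y x - d.D x

/-- The total mass. -/
def mass : ℝ := ∫ x, d.n₀ x

/-- A bound for the `L¹` norm of `rho`. -/
def rho₁ : ℝ := d.mass + ∫ x, |d.D x|

/-- A bound for `rho`. -/
def rhoSup : ℝ := d.B₁ * d.W + d.RD

theorem n₀_nonneg (x : Plane) : 0 ≤ d.n₀ x := mul_nonneg (d.B_pos x).le (d.w_nonneg x)

theorem mass_nonneg : 0 ≤ d.mass := integral_nonneg d.n₀_nonneg

theorem integral_abs_n₀ : ∫ x, |d.n₀ x| = d.mass := by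
  simp_rw [abs_of_nonneg (d.n₀_nonneg _)]; rfl

theorem rho₁_nonneg : 0 ≤ d.rho₁ := add_nonneg d.mass_nonneg (integral_nonneg fun _ => abs_nonneg _)

theorem rhoSup_nonneg : 0 ≤ d.rhoSup :=
  add_nonneg (mul_nonneg d.B₁_pos.le d.W_nonneg) d.RD_nonneg

/-- Sup bound for the velocity. -/
def V₀ (M : ℝ) : ℝ := d.A₀ + d.B₀⁻¹ * M

/-- Lipschitz bound for the velocity. -/
def V₁ (M K : ℝ) : ℝ := d.A₁ + d.B₀⁻¹ * K + d.LB * d.B₀⁻¹ ^ 2 * M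

variable {d}

theorem vel_lip {M : ℝ} {E : ℝ → Plane → Plane} (hM : ∀ t x, ‖E t x‖ ≤ M) {k t : ℝ}
    (hk : ∀ x y, ‖E t x - E t y‖ ≤ k * ‖x - y‖) (x y : Plane) :
    ‖d.vel E t x - d.vel E t y‖ ≤ d.V₁ M k * ‖x - y‖ := by
  have e : d.vel E t x - d.vel E t y = (d.a x - d.a y) - ((d.B x)⁻¹ • rot (E t x - E t y)
      + ((d.B x)⁻¹ - (d.B y)⁻¹) • rot (E t y)) := by
    simp only [vel, map_sub]; module
  rw [e]
  refine (norm_sub_le _ _).trans ?_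
  have h1 : ‖(d.B x)⁻¹ • rot (E t x - E t y)‖ ≤ d.B₀⁻¹ * (k * ‖x - y‖) := by
    rw [norm_smul, norm_rot, Real.norm_of_nonneg (inv_pos.2 (d.B_pos x)).le]
    exact mul_le_mul (d.inv_B_le x) (hk x y) (norm_nonneg _) (inv_pos.2 d.B₀_pos).le
  have h2 : ‖((d.B x)⁻¹ - (d.B y)⁻¹) • rot (E t y)‖ ≤ d.LB * d.B₀⁻¹ ^ 2 * ‖x - y‖ * M := by
    rw [norm_smul, norm_rot, Real.norm_eq_abs]
    exact mul_le_mul (d.inv_B_sub_le x y) (hM t y) (norm_nonneg _)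
      (mul_nonneg (mul_nonneg d.LB_nonneg (by positivity)) (norm_nonneg _))
  have h3 := d.a_lip x y
  have h4 := norm_add_le ((d.B x)⁻¹ • rot (E t x - E t y)) (((d.B x)⁻¹ - (d.B y)⁻¹) • rot (E t y))
  have h5 : d.V₁ M k * ‖x - y‖ = d.A₁ * ‖x - y‖ + (d.B₀⁻¹ * (k * ‖x - y‖)
      + d.LB * d.B₀⁻¹ ^ 2 * ‖x - y‖ * M) := by rw [V₁]; ring
  linarith

theorem continuous_vel {E : ℝ → Plane → Plane} (hE : Continuous (Function.uncurry E)) :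
    Continuous (Function.uncurry (d.vel E)) := by
  have hinv : Continuous fun x => (d.B x)⁻¹ := d.continuous_B.inv₀ fun x => (d.B_pos x).ne'
  exact (d.continuous_a.comp continuous_snd).sub
    ((hinv.comp continuous_snd).smul (rot.continuous.comp hE))

theorem isVel {M K : ℝ} {E : ℝ → Plane → Plane} (h : IsField d.T M K E) :
    IsVel (d.V₀ M) (d.V₁ M K) (d.vel E) where
  continuous := continuous_vel h.continuous
  bound t x := by
    refine (norm_sub_le _ _).trans (add_le_add (d.a_bound x) ?_)
    rw [norm_smul, norm_rot, Real.norm_of_nonneg (inv_pos.2 (d.B_pos x)).le]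
    exact mul_le_mul (d.inv_B_le x) (h.bound t x) (norm_nonneg _) (inv_pos.2 d.B₀_pos).le
  lip t := vel_lip h.bound (h.lip t)
  L_nonneg := nonneg_of_lip (f := d.vel E 0) (vel_lip h.bound (h.lip 0))

/-- Multiplication by `B` cancels the factor `B⁻¹` in front of `rot E`, leaving a sum of two
solenoidal fields. -/
theorem solenoidal_vel {E : ℝ → Plane → Plane} (hE : Continuous (Function.uncurry E))
    (hs : ∀ t ∈ Ioo 0 d.T, IsSolenoidal fun x => rot (E t x)) :
    ∀ t ∈ Ioo 0 d.T, IsSolenoidal fun x => d.B x • d.vel E t x := by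
  intro t ht
  have e : (fun x => d.B x • d.vel E t x) = fun x => d.B x • d.a x + (-1 : ℝ) • rot (E t x) := by
    ext1 x
    rw [vel, smul_sub, smul_smul, mul_inv_cancel₀ (d.B_pos x).ne']
    module
  rw [e]
  have hE' : Continuous fun x => rot (E t x) :=
    rot.continuous.comp (hE.comp (by fun_prop : Continuous fun x : Plane => (t, x)))
  exact d.a_sol.add ((hs t ht).smul (-1)) (d.continuous_B.smul d.continuous_a)
    (hE'.const_smul (-1 : ℝ))

theorem solenoidal {M K : ℝ} {E : ℝ → Plane → Plane} (h : IsField d.T M K E) :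
    ∀ t ∈ Ioo 0 d.T, IsSolenoidal fun x => d.B x • d.vel E t x :=
  solenoidal_vel h.continuous h.curl

variable (d)

/-- `X` is the flow of the velocity field associated with `E`. -/
abbrev Flow (E : ℝ → Plane → Plane) (X : ℝ → ℝ → Plane → Plane) : Prop :=
  IsFlow d.T (d.vel E) X

variable {d}

section Lagrangian

variable {M K : ℝ} {E : ℝ → Plane → Plane} {X : ℝ → ℝ → Plane → Plane}

theorem zero_mem : (0 : ℝ) ∈ Icc 0 d.T := left_mem_Icc.2 d.T_pos.le

theorem preserving (h : IsField d.T M K E) (hX : d.Flow E X) {t : ℝ} (ht : t ∈ Icc 0 d.T) :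
    MeasurePreserving (X t 0) (wMeasure d.B) (wMeasure d.B) :=
  hX.measurePreserving (isVel h) d.continuous_B (fun x => (d.B_pos x).le) d.B_abs (solenoidal h) ht

theorem measurableEmbedding (h : IsField d.T M K E) (hX : d.Flow E X) {t : ℝ}
    (ht : t ∈ Icc 0 d.T) : MeasurableEmbedding (X t 0) :=
  (hX.homeo (isVel h) zero_mem ht).measurableEmbedding

/-- Change of variables along the flow. -/
theorem integral_comp (h : IsField d.T M K E) (hX : d.Flow E X) {t : ℝ} (ht : t ∈ Icc 0 d.T)
    {F : Type*} [NormedAddCommGroup F] [NormedSpace ℝ F] (g : Plane → F) :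
    ∫ y, d.B y • g (X t 0 y) = ∫ x, d.B x • g x := by
  have := (preserving h hX ht).integral_comp (measurableEmbedding h hX ht) g
  rwa [integral_wMeasure d.continuous_B.measurable (fun x => (d.B_pos x).le),
    integral_wMeasure d.continuous_B.measurable (fun x => (d.B_pos x).le)] at this

theorem integrable_comp_iff (h : IsField d.T M K E) (hX : d.Flow E X) {t : ℝ}
    (ht : t ∈ Icc 0 d.T) {F : Type*} [NormedAddCommGroup F] [NormedSpace ℝ F] (g : Plane → F) :
    (Integrable fun y => d.B y • g (X t 0 y)) ↔ Integrable fun x => d.B x • g x := by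
  have := (preserving h hX ht).integrable_comp_emb (measurableEmbedding h hX ht) (g := g)
  rwa [integrable_wMeasure_iff d.continuous_B.measurable (fun x => (d.B_pos x).le),
    integrable_wMeasure_iff d.continuous_B.measurable (fun x => (d.B_pos x).le)] at this

theorem integrable_dens_smul_iff (h : IsField d.T M K E) (hX : d.Flow E X) {t : ℝ}
    (ht : t ∈ Icc 0 d.T) {F : Type*} [NormedAddCommGroup F] [NormedSpace ℝ F] (f : Plane → F) :
    (Integrable fun x => d.dens (X 0 t) x • f x) ↔ Integrable fun y => d.n₀ y • f (X t 0 y) := by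
  have := integrable_comp_iff h hX ht fun x => d.w (X 0 t x) • f x
  simp only [hX.inv (isVel h) zero_mem ht, smul_smul] at this
  exact this.symm

/-- The measure `B dx` is invariant and the density is `B` times a function of the backward flow, so
the transported mass is the image of the initial one. No integrability of `f` is needed because the
flow map is a homeomorphism. -/
theorem integral_dens_smul (h : IsField d.T M K E) (hX : d.Flow E X) {t : ℝ}
    (ht : t ∈ Icc 0 d.T) {F : Type*} [NormedAddCommGroup F] [NormedSpace ℝ F] (f : Plane → F) :
    ∫ x, d.dens (X 0 t) x • f x = ∫ y, d.n₀ y • f (X t 0 y) := by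
  have := integral_comp h hX ht fun x => d.w (X 0 t x) • f x
  simp only [hX.inv (isVel h) zero_mem ht, smul_smul] at this
  exact this.symm

theorem isPush (h : IsField d.T M K E) (hX : d.Flow E X) {t : ℝ} (ht : t ∈ Icc 0 d.T) :
    IsPush d.n₀ (X t 0) (d.dens (X 0 t)) :=
  ⟨hX.continuous_space (isVel h) zero_mem ht, fun f _ _ => integral_dens_smul h hX ht f⟩

theorem dens_nonneg (Y : Plane → Plane) (x : Plane) : 0 ≤ d.dens Y x :=
  mul_nonneg (d.B_pos x).le (d.w_nonneg _)

theorem dens_le (Y : Plane → Plane) (x : Plane) : d.dens Y x ≤ d.B₁ * d.W :=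
  mul_le_mul (d.B_le x) (d.w_le _) (d.w_nonneg _) d.B₁_pos.le

theorem integrable_dens (h : IsField d.T M K E) (hX : d.Flow E X) {t : ℝ} (ht : t ∈ Icc 0 d.T) :
    Integrable (d.dens (X 0 t)) := by
  have := (integrable_dens_smul_iff h hX ht fun _ => (1 : ℝ)).2 (by simpa [n₀] using d.n_int)
  simpa using this

theorem integral_dens (h : IsField d.T M K E) (hX : d.Flow E X) {t : ℝ} (ht : t ∈ Icc 0 d.T) :
    ∫ x, d.dens (X 0 t) x = d.mass := by
  have := integral_dens_smul h hX ht fun _ => (1 : ℝ)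
  rw [mass]
  simpa using this

theorem isDensity_dens (h : IsField d.T M K E) (hX : d.Flow E X) {t : ℝ} (ht : t ∈ Icc 0 d.T) :
    IsDensity (d.B₁ * d.W) (d.dens (X 0 t)) :=
  ⟨integrable_dens h hX ht, fun x => by rw [abs_of_nonneg (dens_nonneg _ x)]; exact dens_le _ x⟩

theorem isDensity_D : IsDensity d.RD d.D := ⟨d.D_int, d.D_bound⟩

theorem isDensity_rho (h : IsField d.T M K E) (hX : d.Flow E X) {t : ℝ} (ht : t ∈ Icc 0 d.T) :
    IsDensity d.rhoSup (d.rho (X 0 t)) := (isDensity_dens h hX ht).sub isDensity_D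

theorem integral_rho (h : IsField d.T M K E) (hX : d.Flow E X) {t : ℝ} (ht : t ∈ Icc 0 d.T) :
    ∫ x, d.rho (X 0 t) x = 0 := by
  simp only [rho]
  rw [integral_sub (integrable_dens h hX ht) d.D_int, integral_dens h hX ht, mass, ← d.neutral]
  exact sub_self _

theorem integral_abs_rho_le (h : IsField d.T M K E) (hX : d.Flow E X) {t : ℝ}
    (ht : t ∈ Icc 0 d.T) : ∫ x, |d.rho (X 0 t) x| ≤ d.rho₁ := by
  rw [rho₁, ← integral_dens h hX ht, ← integral_add (integrable_dens h hX ht) d.D_int.abs]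
  refine integral_mono (isDensity_rho h hX ht).integrable.abs
    ((integrable_dens h hX ht).add d.D_int.abs) fun x => ?_
  have := abs_sub (d.dens (X 0 t) x) (d.D x)
  rwa [abs_of_nonneg (dens_nonneg _ x)] at this

/-- The first moment of the density stays bounded. -/
theorem integrable_moment (h : IsField d.T M K E) (hX : d.Flow E X) {t : ℝ} (ht : t ∈ Icc 0 d.T) :
    (Integrable fun x => ‖x‖ * d.dens (X 0 t) x) ∧
      ∫ x, ‖x‖ * d.dens (X 0 t) x ≤ (∫ x, ‖x‖ * d.n₀ x) + d.V₀ M * d.T * d.mass := by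
  have hb : ∀ y, ‖X t 0 y‖ ≤ ‖y‖ + d.V₀ M * d.T := fun y => by
    have h1 := hX.norm_sub_self_le (isVel h) zero_mem ht y
    have h2 : |t - 0| ≤ d.T := IsFlow.abs_sub_le zero_mem ht
    have h3 := norm_sub_norm_le (X t 0 y) y
    nlinarith [(isVel h).M_nonneg]
  have hmom : Integrable fun x => ‖x‖ * d.n₀ x := d.n_mom
  have hn : Integrable d.n₀ := d.n_int
  have hmaj : Integrable fun y => ‖y‖ * d.n₀ y + d.V₀ M * d.T * d.n₀ y :=
    hmom.add (hn.const_mul _)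
  have hle : ∀ y, d.n₀ y * ‖X t 0 y‖ ≤ ‖y‖ * d.n₀ y + d.V₀ M * d.T * d.n₀ y := fun y => by
    nlinarith [hb y, d.n₀_nonneg y]
  have hi : Integrable fun y => d.n₀ y * ‖X t 0 y‖ := by
    refine hmaj.mono' (d.n_int.aestronglyMeasurable.mul
      (hX.continuous_space (isVel h) zero_mem ht).norm.aestronglyMeasurable)
      (Eventually.of_forall fun y => ?_)
    rw [Real.norm_of_nonneg (mul_nonneg (d.n₀_nonneg y) (norm_nonneg _))]
    exact hle y
  have h1 := (integrable_dens_smul_iff h hX ht fun x => ‖x‖).2 hi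
  have h2 := integral_dens_smul h hX ht fun x => ‖x‖
  simp only [smul_eq_mul, mul_comm (d.dens _ _)] at h1 h2
  refine ⟨h1, ?_⟩
  rw [h2, mass, ← integral_const_mul, ← integral_add hmom (hn.const_mul _)]
  exact integral_mono hi hmaj hle

theorem dens_sub_le {Y Y' : Plane → Plane} (x : Plane) :
    |d.dens Y x - d.dens Y' x| ≤ d.B₁ * d.Lw * ‖Y x - Y' x‖ := by
  rw [dens, dens, ← mul_sub, abs_mul, mul_assoc]
  exact mul_le_mul (d.B_abs x) (d.w_lip _ _) (abs_nonneg _) d.B₁_pos.le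

theorem rho_lip {Y : Plane → Plane} {k : ℝ} (hY : ∀ x y, ‖Y x - Y y‖ ≤ k * ‖x - y‖) (x y : Plane) :
    |d.rho Y x - d.rho Y y| ≤ (d.LB * d.W + d.B₁ * d.Lw * k + d.LD) * ‖x - y‖ := by
  have e : d.rho Y x - d.rho Y y = (d.B x - d.B y) * d.w (Y x) + d.B y * (d.w (Y x) - d.w (Y y))
      - (d.D x - d.D y) := by rw [rho, rho, dens, dens]; ring
  rw [e]
  refine (abs_sub _ _).trans ?_
  have h1 : |(d.B x - d.B y) * d.w (Y x)| ≤ d.LB * ‖x - y‖ * d.W := by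
    rw [abs_mul, abs_of_nonneg (d.w_nonneg _)]
    exact mul_le_mul (d.B_lip x y) (d.w_le _) (d.w_nonneg _)
      (mul_nonneg d.LB_nonneg (norm_nonneg _))
  have h2 : |d.B y * (d.w (Y x) - d.w (Y y))| ≤ d.B₁ * (d.Lw * (k * ‖x - y‖)) := by
    rw [abs_mul]
    refine mul_le_mul (d.B_abs y) ((d.w_lip _ _).trans ?_) (abs_nonneg _) d.B₁_pos.le
    exact mul_le_mul_of_nonneg_left (hY x y) d.Lw_nonneg
  have h3 := d.D_lip x y
  have h4 := abs_add_le ((d.B x - d.B y) * d.w (Y x)) (d.B y * (d.w (Y x) - d.w (Y y)))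
  linarith

end Lagrangian

/-! ### Bounds for the field generated by a flow. -/

variable (d)

/-- The fields generated by the Lagrangian densities of the flow `X`. -/
def newField (X : ℝ → ℝ → Plane → Plane) (t : ℝ) (x : Plane) : Plane :=
  d.c₀ • field (d.rho (X 0 (clamp d.T t))) x

/-- Uniform bound for the fields. -/
def Mfield : ℝ := |d.c₀| * (d.rhoSup * cNear + d.rho₁)

/-- Sensitivity of the field with respect to the flow. -/
def Cfield : ℝ := |d.c₀| * (d.mass + d.B₁ * d.Lw * cNear)

/-- The two constants in the logarithmic Lipschitz bound for the field. -/
def Pfield : ℝ := |d.c₀| * (cNear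
  + d.rhoSup * (Real.pi * (2 * Real.log (2 + d.LB * d.W + d.B₁ * d.Lw + d.LD))) + d.rho₁)

/-- See `Pfield`. -/
def Qfield : ℝ := |d.c₀| * (d.rhoSup * (Real.pi * 2))

theorem Mfield_nonneg : 0 ≤ d.Mfield :=
  mul_nonneg (abs_nonneg _) (add_nonneg (mul_nonneg d.rhoSup_nonneg (by positivity)) d.rho₁_nonneg)

theorem Cfield_nonneg : 0 ≤ d.Cfield :=
  mul_nonneg (abs_nonneg _) (add_nonneg d.mass_nonneg
    (mul_nonneg (mul_nonneg d.B₁_pos.le d.Lw_nonneg) (by positivity)))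

theorem Qfield_nonneg : 0 ≤ d.Qfield :=
  mul_nonneg (abs_nonneg _) (mul_nonneg d.rhoSup_nonneg (by positivity))

theorem Pfield_nonneg : 0 ≤ d.Pfield := by
  refine mul_nonneg (abs_nonneg _) (add_nonneg (add_nonneg (by positivity) (mul_nonneg
    d.rhoSup_nonneg (mul_nonneg Real.pi_pos.le (mul_nonneg zero_le_two (Real.log_nonneg ?_)))))
    d.rho₁_nonneg)
  have h1 := mul_nonneg d.LB_nonneg d.W_nonneg
  have h2 := mul_nonneg d.B₁_pos.le d.Lw_nonneg
  linarith [d.LD_nonneg]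

variable {d} {M K : ℝ} {E : ℝ → Plane → Plane} {X : ℝ → ℝ → Plane → Plane}

theorem norm_newField_le (h : IsField d.T M K E) (hX : d.Flow E X) (t : ℝ) (x : Plane) :
    ‖d.newField X t x‖ ≤ d.Mfield := by
  have ht := clamp_mem d.T_pos.le t
  rw [newField, norm_smul, Mfield, Real.norm_eq_abs]
  gcongr
  refine ((isDensity_rho h hX ht).norm_field_le x).trans ?_
  gcongr
  exact integral_abs_rho_le h hX ht

/-- The density has a Lipschitz constant affine in `exp G`, and `log (α + β exp G) ≤ log (α + β) +
G` for `G ≥ 0`. The logarithm in the field estimate thus undoes the exponential growth along the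
flow and leaves a bound affine in `G`. -/
theorem newField_lip (h : IsField d.T M K E) (hX : d.Flow E X) {t G : ℝ} (hG : 0 ≤ G)
    (hY : ∀ x y, ‖X 0 (clamp d.T t) x - X 0 (clamp d.T t) y‖ ≤ Real.exp G * ‖x - y‖)
    (x y : Plane) :
    ‖d.newField X t x - d.newField X t y‖ ≤ (d.Pfield + d.Qfield * G) * ‖x - y‖ := by
  have ht := clamp_mem d.T_pos.le t
  have h1 := mul_nonneg d.LB_nonneg d.W_nonneg
  have h2 := mul_nonneg d.B₁_pos.le d.Lw_nonneg
  have h3 := d.LD_nonneg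
  have hexp : 1 ≤ Real.exp G := Real.one_le_exp hG
  have hb := (isDensity_rho h hX ht).norm_field_sub_le
    (Λ := d.LB * d.W + d.B₁ * d.Lw * Real.exp G + d.LD) (by positivity) (rho_lip hY) x y
  rw [newField, newField, ← smul_sub, norm_smul, Real.norm_eq_abs]
  have hlog : Real.log (2 + (d.LB * d.W + d.B₁ * d.Lw * Real.exp G + d.LD))
      ≤ Real.log (2 + d.LB * d.W + d.B₁ * d.Lw + d.LD) + G := by
    have e : Real.log (2 + d.LB * d.W + d.B₁ * d.Lw + d.LD) + G
        = Real.log ((2 + d.LB * d.W + d.B₁ * d.Lw + d.LD) * Real.exp G) := by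
      rw [Real.log_mul (by positivity) (Real.exp_pos G).ne', Real.log_exp]
    rw [e]
    refine Real.log_le_log (by positivity) ?_
    nlinarith
  have hb2 : cNear + d.rhoSup * (Real.pi * (2 * Real.log
      (2 + (d.LB * d.W + d.B₁ * d.Lw * Real.exp G + d.LD)))) + ∫ y, |d.rho (X 0 (clamp d.T t)) y|
      ≤ cNear + d.rhoSup * (Real.pi * (2 * (Real.log (2 + d.LB * d.W + d.B₁ * d.Lw + d.LD) + G)))
        + d.rho₁ := by
    have := d.rhoSup_nonneg
    have := Real.pi_pos
    gcongr
    exact integral_abs_rho_le h hX ht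
  calc _ ≤ |d.c₀| * ((cNear + d.rhoSup * (Real.pi * (2 *
        (Real.log (2 + d.LB * d.W + d.B₁ * d.Lw + d.LD) + G))) + d.rho₁) * ‖x - y‖) := by
        gcongr
        exact hb.trans (by gcongr)
    _ = _ := by rw [Pfield, Qfield]; ring

/-- Two flows and two times are compared at once. One flow at two times gives time regularity of the
field; two flows at one time give the contraction. -/
theorem newField_displacement (h : IsField d.T M K E) (hX : d.Flow E X) {M' K' : ℝ}
    {E' : ℝ → Plane → Plane} {X' : ℝ → ℝ → Plane → Plane} (h' : IsField d.T M' K' E')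
    (hX' : d.Flow E' X') {t s δ : ℝ}
    (h1 : ∀ y, ‖X (clamp d.T t) 0 y - X' (clamp d.T s) 0 y‖ ≤ δ)
    (h2 : ∀ y, ‖X 0 (clamp d.T t) y - X' 0 (clamp d.T s) y‖ ≤ δ) (x : Plane) :
    ‖d.newField X t x - d.newField X' s x‖ ≤ d.Cfield * δ := by
  have ht := clamp_mem d.T_pos.le t
  have hs := clamp_mem d.T_pos.le s
  have hb := norm_field_displacement_le (n₀ := d.n₀) d.n_int (isDensity_dens h hX ht)
    (isDensity_dens h' hX' hs) (isDensity_D (d := d)) (isPush h hX ht) (isPush h' hX' hs)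
    (a := d.B₁ * d.Lw * δ) (d := δ) (fun x => (dens_sub_le x).trans
      (mul_le_mul_of_nonneg_left (h2 x) (mul_nonneg d.B₁_pos.le d.Lw_nonneg))) h1 x
  rw [d.integral_abs_n₀] at hb
  rw [newField, newField, ← smul_sub, norm_smul, Real.norm_eq_abs]
  calc _ ≤ |d.c₀| * (d.mass * δ + d.B₁ * d.Lw * δ * cNear) := by
        gcongr
        exact hb
    _ = _ := by rw [Cfield]; ring

theorem newField_time (h : IsField d.T M K E) (hX : d.Flow E X) (t s : ℝ) (x : Plane) :
    ‖d.newField X t x - d.newField X s x‖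
      ≤ d.Cfield * (Real.exp (d.V₁ M K * d.T) * d.V₀ M) * |t - s| := by
  have ht := clamp_mem d.T_pos.le t
  have hs := clamp_mem d.T_pos.le s
  have hv := isVel h
  have hM := hv.M_nonneg
  have hexp : 1 ≤ Real.exp (d.V₁ M K * d.T) :=
    Real.one_le_exp (mul_nonneg hv.L_nonneg d.T_pos.le)
  rw [mul_assoc]
  have hcl := abs_clamp_sub_le d.T t s
  refine newField_displacement h hX h hX (fun y => ?_) (fun y => ?_) x
  · refine (hX.norm_time_sub_le hv zero_mem ht hs y).trans ?_
    calc _ ≤ d.V₀ M * |t - s| := by gcongr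
      _ ≤ _ := by rw [mul_assoc]; exact le_mul_of_one_le_left (by positivity) hexp
  · refine (hX.norm_start_sub_le hv ht hs zero_mem y).trans ?_
    gcongr

theorem newField_solenoidal (h : IsField d.T M K E) (hX : d.Flow E X) (t : ℝ) :
    IsSolenoidal fun x => rot (d.newField X t x) := by
  have ht := clamp_mem d.T_pos.le t
  simp only [newField, map_smul]
  refine IsSolenoidal.smul ?_ _
  intro φ C hφ hc
  exact (isDensity_rho h hX ht).integral_fderiv_rot_field hφ hc

theorem isField_newField (h : IsField d.T M K E) (hX : d.Flow E X) {K' : ℝ}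
    (hK' : ∀ t x y, ‖d.newField X t x - d.newField X t y‖ ≤ K' * ‖x - y‖) :
    IsField d.T d.Mfield K' (d.newField X) where
  continuous := by
    refine LipschitzWith.continuous (K := Real.toNNReal
      (d.Cfield * (Real.exp (d.V₁ M K * d.T) * d.V₀ M) + K')) (lipschitz_of_norm_le fun z z' => ?_)
    have h1 := newField_time h hX z.1 z'.1 z.2
    have h2 := hK' z'.1 z.2 z'.2
    have h3 : |z.1 - z'.1| ≤ ‖z - z'‖ := norm_fst_le (z - z')
    have h4 : ‖z.2 - z'.2‖ ≤ ‖z - z'‖ := norm_snd_le (z - z')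
    have h5 : 0 ≤ K' := nonneg_of_lip (f := d.newField X 0) (hK' 0)
    have h6 : 0 ≤ d.Cfield * (Real.exp (d.V₁ M K * d.T) * d.V₀ M) :=
      mul_nonneg d.Cfield_nonneg (mul_nonneg (Real.exp_pos _).le (isVel h).M_nonneg)
    calc _ ≤ _ := norm_sub_le_norm_sub_add_norm_sub _ (d.newField X z'.1 z.2) _
      _ ≤ _ := add_le_add h1 h2
      _ ≤ _ := by rw [add_mul]; gcongr
  bound := norm_newField_le h hX
  lip := hK'
  curl t _ := newField_solenoidal h hX t

/-- Contraction estimate in an exponentially weighted norm. -/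
theorem newField_contraction (h : IsField d.T M K E) (hX : d.Flow E X) {M' K' : ℝ}
    {E' : ℝ → Plane → Plane} {X' : ℝ → ℝ → Plane → Plane} (h' : IsField d.T M' K' E')
    (hX' : d.Flow E' X') {ε ν : ℝ} (hν : 0 < ν)
    (hE : ∀ t ∈ Icc 0 d.T, ∀ x, ‖E t x - E' t x‖ ≤ ε * Real.exp (ν * t)) {t : ℝ}
    (ht : t ∈ Icc 0 d.T) (x : Plane) :
    ‖d.newField X t x - d.newField X' t x‖
      ≤ d.Cfield * (Real.exp (d.V₁ M K * d.T) * d.B₀⁻¹) / ν * (ε * Real.exp (ν * t)) := by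
  have hε : 0 ≤ ε := by
    have := (norm_nonneg _).trans (hE 0 zero_mem 0)
    simpa using this
  have hB := inv_pos.2 d.B₀_pos
  -- A primitive of the bound for the difference of the velocities. Integrating the weight `exp (ν
  -- r)` produces the factor `1 / ν` responsible for the contraction.
  set η : ℝ → ℝ := fun r => d.B₀⁻¹ * (ε / ν * Real.exp (ν * r)) with hη
  have hηd : ∀ r, HasDerivAt η (d.B₀⁻¹ * (ε * Real.exp (ν * r))) r := by
    intro r
    have h1 := ((((hasDerivAt_id r).const_mul ν).exp).const_mul (ε / ν)).const_mul d.B₀⁻¹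
    exact h1.congr_deriv (by simp only [id]; field_simp)
  have hη0 : |η t - η 0| ≤ d.B₀⁻¹ * (ε / ν * Real.exp (ν * t)) := by
    have hm : Real.exp (ν * 0) ≤ Real.exp (ν * t) := by
      have := ht.1
      gcongr
    have hp := Real.exp_pos (ν * 0)
    have : 0 ≤ d.B₀⁻¹ * (ε / ν) := by positivity
    rw [abs_of_nonneg (by simp only [hη]; nlinarith)]
    simp only [hη]
    nlinarith
  have hFF : ∀ r ∈ Icc 0 d.T, ∀ x, ‖d.vel E r x - d.vel E' r x‖
      ≤ d.B₀⁻¹ * (ε * Real.exp (ν * r)) := by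
    intro r hr x
    have e : d.vel E r x - d.vel E' r x = -((d.B x)⁻¹ • rot (E r x - E' r x)) := by
      simp only [vel, map_sub]; module
    rw [e, norm_neg, norm_smul, norm_rot, Real.norm_of_nonneg (inv_pos.2 (d.B_pos x)).le]
    exact mul_le_mul (d.inv_B_le x) (hE r hr x) (norm_nonneg _) hB.le
  have hflow : ∀ p ∈ Icc 0 d.T, ∀ q ∈ Icc 0 d.T, ∀ y, ‖X q p y - X' q p y‖
      ≤ Real.exp (d.V₁ M K * d.T) * |η q - η p| := fun p hp q hq y =>
    hX.norm_sub_flow_le (isVel h) hX' hηd (fun r => by positivity) hFF hp hq y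
  have := newField_displacement h hX h' hX' (t := t) (s := t)
    (δ := Real.exp (d.V₁ M K * d.T) * (d.B₀⁻¹ * (ε / ν * Real.exp (ν * t))))
    (fun y => by
      rw [clamp_of_mem ht]
      exact (hflow 0 zero_mem t ht y).trans (by gcongr))
    (fun y => by
      rw [clamp_of_mem ht]
      refine (hflow t ht 0 zero_mem y).trans ?_
      rw [abs_sub_comm]
      gcongr) x
  refine this.trans (le_of_eq ?_)
  field_simp

end Data


/-! ### Calculus of second differences. -/

theorem norm_diff2_smul_le {V F : Type*} [NormedAddCommGroup V] [NormedAddCommGroup F]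
    [NormedSpace ℝ F] {f : V → ℝ} {g : V → F} {Mf Lf mf Mg Lg mg : ℝ} (hMf : ∀ x, |f x| ≤ Mf)
    (hLf : ∀ x y, |f x - f y| ≤ Lf * ‖x - y‖) (hmf : ∀ x h k, |diff2 f x h k| ≤ mf * ‖h‖ * ‖k‖)
    (hMg : ∀ x, ‖g x‖ ≤ Mg) (hLg : ∀ x y, ‖g x - g y‖ ≤ Lg * ‖x - y‖)
    (hmg : ∀ x h k, ‖diff2 g x h k‖ ≤ mg * ‖h‖ * ‖k‖) (x h k : V) :
    ‖diff2 (fun x => f x • g x) x h k‖ ≤ (mf * Mg + 2 * Lf * Lg + Mf * mg) * ‖h‖ * ‖k‖ := by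
  -- The discrete Leibniz rule. The factors are evaluated at different corners of the parallelogram,
  -- which does no harm because all bounds are uniform.
  have e : diff2 (fun x => f x • g x) x h k = diff2 f x h k • g (x + h + k)
      + (f (x + h) - f x) • (g (x + h + k) - g (x + h))
      + (f (x + k) - f x) • (g (x + h + k) - g (x + k)) + f x • diff2 g x h k := by
    simp only [diff2]; module
  rw [e]
  have h1 : ‖diff2 f x h k • g (x + h + k)‖ ≤ mf * ‖h‖ * ‖k‖ * Mg := by
    rw [norm_smul, Real.norm_eq_abs]
    exact mul_le_mul (hmf x h k) (hMg _) (norm_nonneg _) ((abs_nonneg _).trans (hmf x h k))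
  have h2 : ‖(f (x + h) - f x) • (g (x + h + k) - g (x + h))‖ ≤ Lf * ‖h‖ * (Lg * ‖k‖) := by
    have a1 := hLf (x + h) x
    have a2 := hLg (x + h + k) (x + h)
    rw [add_sub_cancel_left] at a1 a2
    rw [norm_smul, Real.norm_eq_abs]
    exact mul_le_mul a1 a2 (norm_nonneg _) ((abs_nonneg _).trans a1)
  have h3 : ‖(f (x + k) - f x) • (g (x + h + k) - g (x + k))‖ ≤ Lf * ‖k‖ * (Lg * ‖h‖) := by
    have a1 := hLf (x + k) x
    have a2 := hLg (x + h + k) (x + k)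
    rw [add_sub_cancel_left] at a1
    rw [show x + h + k - (x + k) = h by abel] at a2
    rw [norm_smul, Real.norm_eq_abs]
    exact mul_le_mul a1 a2 (norm_nonneg _) ((abs_nonneg _).trans a1)
  have h4 : ‖f x • diff2 g x h k‖ ≤ Mf * (mg * ‖h‖ * ‖k‖) := by
    rw [norm_smul, Real.norm_eq_abs]
    exact mul_le_mul (hMf x) (hmg x h k) (norm_nonneg _) ((abs_nonneg _).trans (hMf x))
  calc _ ≤ mf * ‖h‖ * ‖k‖ * Mg + Lf * ‖h‖ * (Lg * ‖k‖) + Lf * ‖k‖ * (Lg * ‖h‖)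
        + Mf * (mg * ‖h‖ * ‖k‖) :=
        (norm_add_le _ _).trans (add_le_add ((norm_add_le _ _).trans (add_le_add
          ((norm_add_le _ _).trans (add_le_add h1 h2)) h3)) h4)
    _ = _ := by ring

/-- The images of the four corners form a general quadrilateral whose defect from a parallelogram is
the second difference of `Y`. This is the discrete form of `f'' Y' Y' + f' Y''`. -/
theorem norm_diff2_comp_le {V F G : Type*} [NormedAddCommGroup V] [NormedAddCommGroup F]
    [NormedAddCommGroup G] {f : F → G} {Y : V → F} {m L k' mY : ℝ} (hm0 : 0 ≤ m) (hL0 : 0 ≤ L)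
    (hd : ∀ x h k, ‖diff2 f x h k‖ ≤ m * ‖h‖ * ‖k‖) (hL : ∀ x y, ‖f x - f y‖ ≤ L * ‖x - y‖)
    (hY : ∀ x y, ‖Y x - Y y‖ ≤ k' * ‖x - y‖) (hY2 : ∀ x h k, ‖diff2 Y x h k‖ ≤ mY * ‖h‖ * ‖k‖)
    (x h k : V) :
    ‖diff2 (fun x => f (Y x)) x h k‖ ≤ (m * k' ^ 2 + L * mY) * ‖h‖ * ‖k‖ := by
  have h1 := norm_four_point_le hd hL (Y (x + h + k)) (Y (x + h)) (Y (x + k)) (Y x)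
  have a1 := hY (x + h) x
  have a2 := hY (x + k) x
  rw [add_sub_cancel_left] at a1 a2
  calc _ ≤ _ := h1
    _ ≤ m * (k' * ‖h‖) * (k' * ‖k‖) + L * (mY * ‖h‖ * ‖k‖) := by
        have : 0 ≤ m * (k' * ‖h‖) := mul_nonneg hm0 ((norm_nonneg _).trans a1)
        refine add_le_add (mul_le_mul (mul_le_mul_of_nonneg_left a1 hm0) a2 (norm_nonneg _) this)
          (mul_le_mul_of_nonneg_left (hY2 x h k) hL0)
    _ = _ := by ring

theorem isSolenoidal_of_tendsto {G : ℕ → Plane → Plane} {H : Plane → Plane} {M : ℝ}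
    (hG : ∀ k, IsSolenoidal (G k)) (hc : ∀ k, Continuous (G k)) (hb : ∀ k x, ‖G k x‖ ≤ M)
    (hl : ∀ x, Tendsto (fun k => G k x) atTop (𝓝 (H x))) : IsSolenoidal H := by
  intro φ C hφ hcs
  have hlim : Tendsto (fun k => ∫ x, fderiv ℝ φ x (G k x)) atTop (𝓝 (∫ x, fderiv ℝ φ x (H x))) := by
    refine tendsto_integral_of_dominated_convergence ((tsupport φ).indicator fun _ => C * M)
      (fun k => (integrable_fderiv_field hφ hcs (hc k)).aestronglyMeasurable)
      ((integrableOn_const hcs.isCompact.measure_lt_top.ne).integrable_indicator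
          (isClosed_tsupport φ).measurableSet) (fun k => Eventually.of_forall fun x => ?_)
      (Eventually.of_forall fun x => ((fderiv ℝ φ x).continuous.tendsto _).comp (hl x))
    by_cases hx : x ∈ tsupport φ
    · rw [indicator_of_mem hx]
      exact (norm_fderiv_le_of_lipschitzWith hφ x _).trans (by gcongr; exact hb k x)
    · rw [indicator_of_notMem hx, fderiv_of_notMem_tsupport (𝕜 := ℝ) hx]
      simp
  refine tendsto_nhds_unique hlim ?_
  simp_rw [fun k => hG k φ C hφ hcs]
  exact tendsto_const_nhds

/-! ### Admissible fields and the Picard iteration. -/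

namespace Data

variable (d : Data)

/-- The constant part of the Lipschitz bound for the velocity. -/
def drift₁ : ℝ := d.A₁ + d.LB * d.B₀⁻¹ ^ 2 * d.Mfield

/-- Growth rate of the Lipschitz bound for the fields. -/
def rate : ℝ := 2 * d.Qfield * d.B₀⁻¹ + 1

/-- Initial value of the Lipschitz bound for the fields. -/
def ampl : ℝ := 2 * (d.Pfield + d.Qfield * (d.drift₁ * d.T))

/-- Lipschitz bound for the fields on `[0,T]`. -/
def Kfield : ℝ := d.ampl * Real.exp (d.rate * d.T)

theorem drift₁_nonneg : 0 ≤ d.drift₁ :=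
  add_nonneg d.A₁_nonneg (mul_nonneg (mul_nonneg d.LB_nonneg (by positivity)) d.Mfield_nonneg)

theorem rate_pos : 0 < d.rate :=
  add_pos_of_nonneg_of_pos (mul_nonneg (mul_nonneg zero_le_two d.Qfield_nonneg)
    (inv_pos.2 d.B₀_pos).le) one_pos

theorem ampl_nonneg : 0 ≤ d.ampl :=
  mul_nonneg zero_le_two (add_nonneg d.Pfield_nonneg (mul_nonneg d.Qfield_nonneg
    (mul_nonneg d.drift₁_nonneg d.T_pos.le)))

/-- The class of fields which is preserved by the iteration. -/
structure Admissible (E : ℝ → Plane → Plane) : Prop where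
  isField : IsField d.T d.Mfield d.Kfield E
  lip : ∀ t x y, ‖E t x - E t y‖ ≤ d.ampl * Real.exp (d.rate * clamp d.T t) * ‖x - y‖
  clamp : ∀ t, E t = E (clamp d.T t)

variable {d}

theorem ampl_exp_le (t : ℝ) : d.ampl * Real.exp (d.rate * clamp d.T t) ≤ d.Kfield :=
  mul_le_mul_of_nonneg_left (Real.exp_le_exp.2 (mul_le_mul_of_nonneg_left
    (clamp_mem d.T_pos.le t).2 d.rate_pos.le)) d.ampl_nonneg

theorem clamp_clamp (t : ℝ) : DriftLimit.clamp d.T (DriftLimit.clamp d.T t) = DriftLimit.clamp d.T t :=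
  clamp_of_mem (clamp_mem d.T_pos.le t)

theorem newField_clamp (X : ℝ → ℝ → Plane → Plane) (t : ℝ) :
    d.newField X t = d.newField X (clamp d.T t) := by
  ext1 x; rw [newField, newField, clamp_clamp]

/-- The integrated Lipschitz rate of the velocity is at most `Λ`, and the new field has Lipschitz
constant at most `Pfield + Qfield * Λ`. The choice of `rate` absorbs half of the exponential growth,
and the choice of `ampl` absorbs the constant and the drift in the other half, so the bound
reproduces itself without restriction on `T`. -/
theorem admissible_newField {E : ℝ → Plane → Plane} {X : ℝ → ℝ → Plane → Plane}
    (h : d.Admissible E) (hX : d.Flow E X) : d.Admissible (d.newField X) := by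
  have hA := d.ampl_nonneg
  have hB := inv_pos.2 d.B₀_pos
  have hr := d.rate_pos
  have hc := d.drift₁_nonneg
  have hlip : ∀ t x y, ‖d.newField X t x - d.newField X t y‖
      ≤ d.ampl * Real.exp (d.rate * DriftLimit.clamp d.T t) * ‖x - y‖ := by
    intro t x y
    have ht := clamp_mem d.T_pos.le t
    set τ := DriftLimit.clamp d.T t
    -- A primitive of the Lipschitz rate of the velocity, normalized so that `Λ 0 ≥ 0`; hence `|Λ 0
    -- - Λ τ| ≤ Λ τ`.
    set Λ : ℝ → ℝ := fun r => d.drift₁ * r + d.B₀⁻¹ * (d.ampl / d.rate * Real.exp (d.rate * r))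
      with hΛdef
    have hΛ : ∀ r, HasDerivAt Λ (d.drift₁ + d.B₀⁻¹ * (d.ampl * Real.exp (d.rate * r))) r := by
      intro r
      have h1 := (((((hasDerivAt_id r).const_mul d.rate).exp).const_mul
        (d.ampl / d.rate)).const_mul d.B₀⁻¹)
      have h2 := ((hasDerivAt_id r).const_mul d.drift₁).add h1
      exact h2.congr_deriv (by simp only [id]; field_simp)
    have hF : ∀ r ∈ Icc 0 d.T, ∀ x y, ‖d.vel E r x - d.vel E r y‖
        ≤ (d.drift₁ + d.B₀⁻¹ * (d.ampl * Real.exp (d.rate * r))) * ‖x - y‖ := by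
      intro r hr x y
      have hl := h.lip r
      rw [clamp_of_mem hr] at hl
      refine (vel_lip h.isField.bound hl x y).trans (le_of_eq ?_)
      rw [V₁, drift₁]; ring
    have hfl := hX.norm_sub_le hΛ (fun r => by positivity) hF ht zero_mem
    have hG0 : Λ 0 ≤ Λ τ := by
      simp only [hΛdef]
      have := ht.1
      gcongr
    have hΛ0 : 0 ≤ Λ 0 := by simp only [hΛdef]; positivity
    have hY : ∀ x y, ‖X 0 τ x - X 0 τ y‖ ≤ Real.exp (Λ τ) * ‖x - y‖ := fun x y => by
      refine (hfl x y).trans ?_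
      gcongr
      rw [abs_sub_comm, abs_of_nonneg (by linarith)]
      linarith
    refine (newField_lip h.isField hX (hΛ0.trans hG0) hY x y).trans ?_
    gcongr
    have hexp : 1 ≤ Real.exp (d.rate * τ) := Real.one_le_exp (mul_nonneg hr.le ht.1)
    have hQ := d.Qfield_nonneg
    have h1 : d.Pfield + d.Qfield * (d.drift₁ * τ) ≤ d.ampl / 2 := by
      have : d.drift₁ * τ ≤ d.drift₁ * d.T := mul_le_mul_of_nonneg_left ht.2 hc
      rw [ampl]
      nlinarith
    -- This inequality dictates the value of `rate`; its summand one only keeps it positive.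
    have h2 : d.Qfield * d.B₀⁻¹ / d.rate ≤ 1 / 2 := by
      rw [div_le_div_iff₀ hr two_pos, rate]; linarith
    calc d.Pfield + d.Qfield * Λ τ = (d.Pfield + d.Qfield * (d.drift₁ * τ))
          + d.Qfield * d.B₀⁻¹ / d.rate * (d.ampl * Real.exp (d.rate * τ)) := by
          simp only [hΛdef]; ring
      _ ≤ d.ampl / 2 * Real.exp (d.rate * τ) + 1 / 2 * (d.ampl * Real.exp (d.rate * τ)) := by
          refine add_le_add (h1.trans (le_mul_of_one_le_right (by positivity) hexp)) ?_
          exact mul_le_mul_of_nonneg_right h2 (by positivity)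
      _ = _ := by ring
  exact ⟨isField_newField h.isField hX fun t x y => (hlip t x y).trans
    (mul_le_mul_of_nonneg_right (ampl_exp_le t) (norm_nonneg _)), hlip, newField_clamp X⟩

theorem admissible_zero : d.Admissible fun _ _ => 0 where
  isField :=
    { continuous := continuous_const
      bound := fun _ _ => by simpa using d.Mfield_nonneg
      lip := fun _ x y => by
        rw [sub_zero, norm_zero]
        exact mul_nonneg (mul_nonneg d.ampl_nonneg (Real.exp_pos _).le) (norm_nonneg _)
      curl := fun _ _ φ C _ _ => by simp }
  lip _ x y := by
    simpa using mul_nonneg (mul_nonneg d.ampl_nonneg (Real.exp_pos _).le) (norm_nonneg _)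
  clamp _ := rfl

variable (d)

/-- A choice of the flow generated by a field. -/
def flowOf (E : ℝ → Plane → Plane) : ℝ → ℝ → Plane → Plane := Classical.epsilon (d.Flow E)

/-- Picard iteration. -/
def iter : ℕ → ℝ → Plane → Plane
  | 0 => fun _ _ => 0
  | k + 1 => d.newField (d.flowOf (iter k))

variable {d}

theorem flow_flowOf {M K : ℝ} {E : ℝ → Plane → Plane} (h : IsField d.T M K E) :
    d.Flow E (d.flowOf E) := Classical.epsilon_spec (exists_isFlow (isVel h) d.T)

theorem admissible_iter (k : ℕ) : d.Admissible (d.iter k) := by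
  induction k with
  | zero => exact admissible_zero
  | succ k ih => exact admissible_newField ih (flow_flowOf ih.isField)

/-- The weight which makes the fixed point map a contraction. -/
theorem exists_weight (K : ℝ) : ∃ ν, 0 < ν ∧
    d.Cfield * (Real.exp (d.V₁ d.Mfield K * d.T) * d.B₀⁻¹) / ν ≤ 1 / 2 := by
  have h0 : 0 ≤ d.Cfield * (Real.exp (d.V₁ d.Mfield K * d.T) * d.B₀⁻¹) :=
    mul_nonneg d.Cfield_nonneg (mul_nonneg (Real.exp_pos _).le (inv_pos.2 d.B₀_pos).le)
  -- The summand one keeps the weight positive when the constant vanishes.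
  refine ⟨2 * (d.Cfield * (Real.exp (d.V₁ d.Mfield K * d.T) * d.B₀⁻¹)) + 1, by positivity, ?_⟩
  rw [div_le_div_iff₀ (by positivity) two_pos]
  linarith

/-- Uniform bounds on second differences of the data. -/
structure IsSmooth (d : Data) (S : ℝ) : Prop where
  nonneg : 0 ≤ S
  B : ∀ x h k, |diff2 d.B x h k| ≤ S * ‖h‖ * ‖k‖
  invB : ∀ x h k, |diff2 (fun x => (d.B x)⁻¹) x h k| ≤ S * ‖h‖ * ‖k‖
  a : ∀ x h k, ‖diff2 d.a x h k‖ ≤ S * ‖h‖ * ‖k‖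
  w : ∀ x h k, |diff2 d.w x h k| ≤ S * ‖h‖ * ‖k‖
  D : ∀ x h k, |diff2 d.D x h k| ≤ S * ‖h‖ * ‖k‖

theorem norm_diff2_vel_le {S : ℝ} (hS : d.IsSmooth S) {M K : ℝ} {E : ℝ → Plane → Plane}
    (hE : IsField d.T M K E) {t m : ℝ} (hm : ∀ x h k, ‖diff2 (E t) x h k‖ ≤ m * ‖h‖ * ‖k‖)
    (x h k : Plane) :
    ‖diff2 (d.vel E t) x h k‖
      ≤ (S + S * M + 2 * (d.LB * d.B₀⁻¹ ^ 2) * K + d.B₀⁻¹ * m) * ‖h‖ * ‖k‖ := by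
  have hr := norm_diff2_smul_le (f := fun x => (d.B x)⁻¹) (g := fun x => rot (E t x))
    (fun x => by
      rw [abs_of_pos (inv_pos.2 (d.B_pos x))]; exact d.inv_B_le x) d.inv_B_sub_le hS.invB
    (fun x => by rw [norm_rot]; exact hE.bound t x)
    (fun x y => by rw [← map_sub, norm_rot]; exact hE.lip t x y)
    (fun x h k => by
      have : diff2 (fun x => rot (E t x)) x h k = rot (diff2 (E t) x h k) := by
        simp only [diff2, map_sub, map_add]
      rw [this, norm_rot]; exact hm x h k) x h k
  have e : diff2 (d.vel E t) x h k = diff2 d.a x h k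
      - diff2 (fun x => (d.B x)⁻¹ • rot (E t x)) x h k := by
    simp only [diff2, vel]; abel
  rw [e]
  refine (norm_sub_le _ _).trans ((add_le_add (hS.a x h k) hr).trans (le_of_eq ?_))
  ring

theorem abs_diff2_rho_le {S : ℝ} (hS : d.IsSmooth S) {Y : Plane → Plane} {κ mY : ℝ}
    (hY : ∀ x y, ‖Y x - Y y‖ ≤ κ * ‖x - y‖) (hY2 : ∀ x h k, ‖diff2 Y x h k‖ ≤ mY * ‖h‖ * ‖k‖)
    (x h k : Plane) :
    |diff2 (d.rho Y) x h k| ≤ (S * d.W + 2 * d.LB * (d.Lw * κ) + d.B₁ * (S * κ ^ 2 + d.Lw * mY) + S)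
      * ‖h‖ * ‖k‖ := by
  have hr := norm_diff2_smul_le (f := d.B) (g := fun x => d.w (Y x)) d.B_abs d.B_lip hS.B
    (fun x => by rw [Real.norm_of_nonneg (d.w_nonneg _)]; exact d.w_le _)
    (fun x y => (d.w_lip _ _).trans (by
      rw [mul_assoc]; exact mul_le_mul_of_nonneg_left (hY x y) d.Lw_nonneg))
    (norm_diff2_comp_le hS.nonneg d.Lw_nonneg hS.w d.w_lip hY hY2) x h k
  have e : diff2 (d.rho Y) x h k = diff2 (fun x => d.B x • d.w (Y x)) x h k - diff2 d.D x h k := by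
    simp only [diff2, rho, dens, smul_eq_mul]; abel
  rw [e]
  refine (abs_sub _ _).trans ((add_le_add hr (hS.D x h k)).trans (le_of_eq ?_))
  ring

/-- Second differences of the new field are controlled by those of the old one, with a factor
which is integrated in time. -/
theorem exists_diff2_newField_le {S : ℝ} (hS : d.IsSmooth S) (K : ℝ) : ∃ α β : ℝ, 0 ≤ α ∧ 0 ≤ β ∧
    ∀ E X, IsField d.T d.Mfield K E → d.Flow E X → ∀ m H : ℝ → ℝ, (∀ r, HasDerivAt H (m r) r) →
      (∀ r, 0 ≤ m r) → (∀ r ∈ Icc 0 d.T, ∀ x h k, ‖diff2 (E r) x h k‖ ≤ m r * ‖h‖ * ‖k‖) →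
      ∀ t ∈ Icc 0 d.T, ∀ x h k,
        ‖diff2 (d.newField X t) x h k‖ ≤ (α + β * (H t - H 0)) * ‖h‖ * ‖k‖ := by
  -- A field in the class is needed only to know that `K` is nonnegative. If there is none, the
  -- assertion is vacuous.
  by_cases hex : ∃ E : ℝ → Plane → Plane, IsField d.T d.Mfield K E
  swap
  · exact ⟨0, 0, le_rfl, le_rfl, fun E X h => (hex ⟨E, h⟩).elim⟩
  obtain ⟨E₀, hE₀⟩ := hex
  have hK0 : 0 ≤ K := nonneg_of_lip (hE₀.lip 0)
  set κ := Real.exp (d.V₁ d.Mfield K * d.T) with hκ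
  have hκ0 : 0 < κ := Real.exp_pos _
  have hS0 := hS.nonneg
  have hB := inv_pos.2 d.B₀_pos
  have hB₁ := d.B₁_pos
  have hM := d.Mfield_nonneg
  have hLB := d.LB_nonneg
  have hLw := d.Lw_nonneg
  have hW := d.W_nonneg
  have hT := d.T_pos
  have hρ := d.rho₁_nonneg
  -- The part of the second difference bound for the velocity that does not involve second
  -- differences of the field.
  set c₁ := S + S * d.Mfield + 2 * (d.LB * d.B₀⁻¹ ^ 2) * K with hc₁
  have hc₁0 : 0 ≤ c₁ := by positivity
  refine ⟨|d.c₀| * ((S * d.W + 2 * d.LB * (d.Lw * κ) + d.B₁ * (S * κ ^ 2 + d.Lw * (κ ^ 3 *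
      (c₁ * d.T))) + S) * cNear + 4 * d.rho₁),
    |d.c₀| * (d.B₁ * (d.Lw * (κ ^ 3 * d.B₀⁻¹)) * cNear), by positivity, by positivity, ?_⟩
  intro E X hE hX m H hH hm hEm t ht x h k
  have hmono : H 0 ≤ H t := by
    refine monotone_of_deriv_nonneg (fun r => (hH r).differentiableAt) (fun r => ?_) ht.1
    rw [(hH r).deriv]; exact hm r
  have hη : ∀ r, HasDerivAt (fun r => c₁ * r + d.B₀⁻¹ * H r) (c₁ + d.B₀⁻¹ * m r) r := fun r =>
    (((hasDerivAt_id r).const_mul c₁).add ((hH r).const_mul d.B₀⁻¹)).congr_deriv (by ring)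
  have hY2 : ∀ x h k, ‖diff2 (X 0 t) x h k‖
      ≤ κ ^ 3 * (c₁ * d.T + d.B₀⁻¹ * (H t - H 0)) * ‖h‖ * ‖k‖ := by
    intro x h k
    refine (hX.norm_diff2_le (isVel hE) hη (fun r => add_nonneg hc₁0 (mul_nonneg hB.le (hm r)))
      (fun r hr => norm_diff2_vel_le hS hE (hEm r hr)) ht zero_mem x h k).trans ?_
    gcongr
    rw [abs_sub_comm, abs_of_nonneg]
    · have := mul_le_mul_of_nonneg_left ht.2 hc₁0
      linarith
    · have := mul_le_mul_of_nonneg_left ht.1 hc₁0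
      have := mul_le_mul_of_nonneg_left hmono hB.le
      linarith
  have hY := hX.norm_sub_le_const (isVel hE) ht zero_mem
  have hb := (isDensity_rho hE hX ht).norm_diff2_field_le
    (abs_diff2_rho_le hS hY hY2) x h k
  have e : diff2 (d.newField X t) x h k = d.c₀ • diff2 (field (d.rho (X 0 t))) x h k := by
    simp only [diff2, newField, clamp_of_mem ht]; module
  rw [e, norm_smul, Real.norm_eq_abs]
  calc _ ≤ |d.c₀| * (((S * d.W + 2 * d.LB * (d.Lw * κ) + d.B₁ * (S * κ ^ 2 + d.Lw *
        (κ ^ 3 * (c₁ * d.T + d.B₀⁻¹ * (H t - H 0)))) + S) * cNear + 4 * d.rho₁) * ‖h‖ * ‖k‖) := by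
        gcongr
        refine hb.trans ?_
        gcongr
        exact integral_abs_rho_le hE hX ht
    _ = _ := by ring

/-- One step turns a bound `m` into `α + β ∫ m`. The function `2 α exp (ν t)` with `ν = 2 β + 1` is
a supersolution of this recursion, and the zero field satisfies it, so one bound serves all
iterates. -/
theorem exists_diff2_iter_le {S : ℝ} (hS : d.IsSmooth S) : ∃ m, 0 ≤ m ∧ ∀ n t x h k,
    ‖diff2 (d.iter n t) x h k‖ ≤ m * ‖h‖ * ‖k‖ := by
  obtain ⟨α, β, hα, hβ, hstep⟩ := exists_diff2_newField_le hS d.Kfield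
  set ν := 2 * β + 1 with hν
  have hν0 : 0 < ν := by positivity
  have key : ∀ n, ∀ t ∈ Icc 0 d.T, ∀ x h k,
      ‖diff2 (d.iter n t) x h k‖ ≤ 2 * α * Real.exp (ν * t) * ‖h‖ * ‖k‖ := by
    intro n
    induction n with
    | zero =>
      intro t _ x h k
      have : diff2 (d.iter 0 t) x h k = 0 := by simp [diff2, iter]
      rw [this, norm_zero]
      positivity
    | succ n ih =>
      intro t ht x h k
      have hH : ∀ r, HasDerivAt (fun r => 2 * α / ν * Real.exp (ν * r))
          (2 * α * Real.exp (ν * r)) r := fun r =>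
        ((((hasDerivAt_id r).const_mul ν).exp).const_mul (2 * α / ν)).congr_deriv
          (by simp only [id]; field_simp)
      have hn := admissible_iter (d := d) n
      refine (hstep _ _ hn.isField (flow_flowOf hn.isField) _ _ hH (fun r => by positivity) ih
        t ht x h k).trans ?_
      gcongr
      have hexp : 1 ≤ Real.exp (ν * t) := Real.one_le_exp (mul_nonneg hν0.le ht.1)
      have h2 : β / ν ≤ 1 / 2 := by
        rw [div_le_div_iff₀ hν0 two_pos, hν]; linarith
      calc α + β * (2 * α / ν * Real.exp (ν * t) - 2 * α / ν * Real.exp (ν * 0))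
          ≤ α + β * (2 * α / ν * Real.exp (ν * t)) := by
            gcongr
            have : 0 ≤ 2 * α / ν * Real.exp (ν * 0) := by positivity
            linarith
        _ = α + β / ν * (2 * α * Real.exp (ν * t)) := by ring
        _ ≤ α * Real.exp (ν * t) + 1 / 2 * (2 * α * Real.exp (ν * t)) :=
            add_le_add (le_mul_of_one_le_right hα hexp)
              (mul_le_mul_of_nonneg_right h2 (by positivity))
        _ = _ := by ring
  refine ⟨2 * α * Real.exp (ν * d.T), by positivity, fun n t x h k => ?_⟩
  have ht := clamp_mem d.T_pos.le t
  rw [(admissible_iter n).clamp t]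
  refine (key n _ ht x h k).trans ?_
  gcongr
  exact ht.2

/-- Existence of a self-consistent field and flow. -/
theorem exists_fixed_field (d : Data) : ∃ E X, d.Admissible E ∧ d.Flow E X ∧ E = d.newField X ∧
    ∀ S, d.IsSmooth S → ∃ m, 0 ≤ m ∧ ∀ t x h k, ‖diff2 (E t) x h k‖ ≤ m * ‖h‖ * ‖k‖ := by
  obtain ⟨ν, hν, hν2⟩ := exists_weight (d := d) d.Kfield
  have hM := d.Mfield_nonneg
  have hstep : ∀ k, ∀ t ∈ Icc 0 d.T, ∀ x, ‖d.iter k t x - d.iter (k + 1) t x‖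
      ≤ d.Mfield * (1 / 2) ^ k * Real.exp (ν * t) := by
    intro k
    induction k with
    | zero =>
      intro t ht x
      have h1 := (admissible_iter (d := d) 1).isField.bound t x
      have hexp : 1 ≤ Real.exp (ν * t) := Real.one_le_exp (mul_nonneg hν.le ht.1)
      have e : d.iter 0 t x = 0 := rfl
      rw [e, zero_sub, norm_neg, pow_zero, mul_one]
      exact h1.trans (le_mul_of_one_le_right hM hexp)
    | succ k ih =>
      intro t ht x
      have h1 := admissible_iter (d := d) k
      have h2 := admissible_iter (d := d) (k + 1)
      refine (newField_contraction h1.isField (flow_flowOf h1.isField) h2.isField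
        (flow_flowOf h2.isField) hν ih ht x).trans ?_
      calc _ ≤ 1 / 2 * (d.Mfield * (1 / 2) ^ k * Real.exp (ν * t)) := by gcongr
        _ = _ := by rw [pow_succ]; ring
  -- The weighted estimate is converted to a uniform one at the cost of the largest weight. The
  -- convergence remains geometric with ratio one half.
  set C := d.Mfield * Real.exp (ν * d.T) with hC
  have hall : ∀ t x k, dist (d.iter k t x) (d.iter (k + 1) t x) ≤ C * (1 / 2) ^ k := by
    intro t x k
    have ht := clamp_mem d.T_pos.le t
    rw [(admissible_iter k).clamp t, (admissible_iter (k + 1)).clamp t, dist_eq_norm]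
    refine (hstep k _ ht x).trans ?_
    rw [hC, mul_right_comm]
    gcongr
    exact ht.2
  have hlim : ∀ t x, ∃ e, Tendsto (fun k => d.iter k t x) atTop (𝓝 e) := fun t x =>
    cauchySeq_tendsto_of_complete (cauchySeq_of_le_geometric _ _ (by norm_num) (hall t x))
  choose E hE using hlim
  have hdist : ∀ k t x, ‖d.iter k t x - E t x‖ ≤ 2 * C * (1 / 2) ^ k := by
    intro k t x
    have := dist_le_of_le_geometric_of_tendsto _ _ (by norm_num) (hall t x) (hE t x) k
    rw [dist_eq_norm] at this
    refine this.trans (le_of_eq ?_)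
    ring
  have hlim0 : Tendsto (fun k : ℕ => 2 * C * (1 / 2 : ℝ) ^ k) atTop (𝓝 0) := by
    simpa using (tendsto_pow_atTop_nhds_zero_of_lt_one (by norm_num : (0 : ℝ) ≤ 1 / 2)
      (by norm_num)).const_mul (2 * C)
  have hunif : TendstoUniformly (fun k => Function.uncurry (d.iter k)) (Function.uncurry E)
      atTop := by
    rw [Metric.tendstoUniformly_iff]
    intro ε hε
    filter_upwards [hlim0.eventually (gt_mem_nhds hε)] with k hk z
    rw [dist_comm, dist_eq_norm]
    exact (hdist k z.1 z.2).trans_lt hk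
  have hlip : ∀ t x y, ‖E t x - E t y‖
      ≤ d.ampl * Real.exp (d.rate * DriftLimit.clamp d.T t) * ‖x - y‖ := fun t x y =>
    le_of_tendsto ((hE t x).sub (hE t y)).norm
      (Eventually.of_forall fun k => (admissible_iter k).lip t x y)
  have hadm : d.Admissible E := by
    refine ⟨⟨hunif.continuous (Frequently.of_forall fun k => (admissible_iter k).isField.continuous),
      fun t x => le_of_tendsto (hE t x).norm
        (Eventually.of_forall fun k => (admissible_iter k).isField.bound t x),
      fun t x y => (hlip t x y).trans (mul_le_mul_of_nonneg_right (ampl_exp_le t) (norm_nonneg _)),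
      fun t ht => ?_⟩, hlip, fun t => ?_⟩
    · refine isSolenoidal_of_tendsto (fun k => (admissible_iter k).isField.curl t ht) (fun k => ?_)
        (fun k x => ?_) (fun x => (rot.continuous.tendsto _).comp (hE t x)) (M := d.Mfield)
      · exact rot.continuous.comp ((admissible_iter k).isField.continuous.comp
          (by fun_prop : Continuous fun x : Plane => (t, x)))
      · rw [norm_rot]; exact (admissible_iter k).isField.bound t x
    · ext1 x
      refine tendsto_nhds_unique (hE t x) ?_
      have := hE (DriftLimit.clamp d.T t) x
      simpa only [← (admissible_iter _).clamp t] using this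
  have hX := flow_flowOf hadm.isField
  have hfix : ∀ t ∈ Icc 0 d.T, ∀ x, E t x = d.newField (d.flowOf E) t x := by
    intro t ht x
    refine tendsto_nhds_unique ((hE t x).comp (tendsto_add_atTop_nat 1)) ?_
    rw [tendsto_iff_norm_sub_tendsto_zero]
    -- The contraction estimate compares an iterate directly with the limit, so no separate
    -- continuity of the map from fields to flows is needed.
    have hb : ∀ k, ‖d.iter (k + 1) t x - d.newField (d.flowOf E) t x‖
        ≤ 1 / 2 * (2 * C * (1 / 2) ^ k * Real.exp (ν * t)) := by
      intro k
      have h1 := admissible_iter (d := d) k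
      have hC0 : 0 ≤ C := by positivity
      refine (newField_contraction h1.isField (flow_flowOf h1.isField) hadm.isField hX hν
        (ε := 2 * C * (1 / 2) ^ k) (fun s hs y => (hdist k s y).trans
          (le_mul_of_one_le_right (by positivity)
            (Real.one_le_exp (mul_nonneg hν.le hs.1)))) ht x).trans ?_
      gcongr
    refine squeeze_zero (fun _ => norm_nonneg _) hb ?_
    have := (hlim0.mul_const (Real.exp (ν * t))).const_mul (1 / 2)
    rwa [zero_mul, mul_zero] at this
  refine ⟨E, d.flowOf E, hadm, hX, ?_, fun S hS => ?_⟩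
  · ext1 t
    rw [hadm.clamp t, newField_clamp]
    ext1 x
    exact hfix _ (clamp_mem d.T_pos.le t) x
  · obtain ⟨m, hm, hb⟩ := exists_diff2_iter_le hS
    refine ⟨m, hm, fun t x h k => ?_⟩
    have : Tendsto (fun n => diff2 (d.iter n t) x h k) atTop (𝓝 (diff2 (E t) x h k)) :=
      (((hE t _).sub (hE t _)).sub (hE t _)).add (hE t _)
    exact le_of_tendsto this.norm (Eventually.of_forall fun n => hb n t x h k)

/-- Self-consistent fields are unique. -/
theorem eq_of_fixed {K K' : ℝ} {E E' : ℝ → Plane → Plane} {X X' : ℝ → ℝ → Plane → Plane}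
    (h : IsField d.T d.Mfield K E) (hX : d.Flow E X) (hfix : E = d.newField X) {M' : ℝ}
    (h' : IsField d.T M' K' E') (hX' : d.Flow E' X')
    (hfix' : ∀ t ∈ Icc 0 d.T, ∀ x, E' t x = d.newField X' t x) {t : ℝ} (ht : t ∈ Icc 0 d.T)
    (x : Plane) : E' t x = E t x := by
  obtain ⟨ν, hν, hν2⟩ := exists_weight (d := d) K
  have hM := d.Mfield_nonneg
  have hM' : 0 ≤ M' := (norm_nonneg _).trans (h'.bound 0 0)
  -- Starting from the trivial bound `Mfield + M'`, each application of the contraction halves the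
  -- weighted distance.
  have key : ∀ k : ℕ, ∀ t ∈ Icc 0 d.T, ∀ x, ‖E t x - E' t x‖
      ≤ (d.Mfield + M') * (1 / 2) ^ k * Real.exp (ν * t) := by
    intro k
    induction k with
    | zero =>
      intro t ht x
      have hexp : 1 ≤ Real.exp (ν * t) := Real.one_le_exp (mul_nonneg hν.le ht.1)
      rw [pow_zero, mul_one]
      exact ((norm_sub_le _ _).trans (add_le_add (h.bound t x) (h'.bound t x))).trans
        (le_mul_of_one_le_right (by positivity) hexp)
    | succ k ih =>
      intro t ht x
      have h1 := newField_contraction h hX h' hX' hν ih ht x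
      rw [← hfix, ← hfix' t ht x] at h1
      refine h1.trans ?_
      calc _ ≤ 1 / 2 * ((d.Mfield + M') * (1 / 2) ^ k * Real.exp (ν * t)) := by gcongr
        _ = _ := by rw [pow_succ]; ring
  have hlim : Tendsto (fun k : ℕ => (d.Mfield + M') * (1 / 2 : ℝ) ^ k * Real.exp (ν * t)) atTop
      (𝓝 0) := by
    simpa using ((tendsto_pow_atTop_nhds_zero_of_lt_one (by norm_num : (0 : ℝ) ≤ 1 / 2)
      (by norm_num)).const_mul (d.Mfield + M')).mul_const (Real.exp (ν * t))
  have := ge_of_tendsto' hlim fun k => key k t ht x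
  rw [norm_le_zero_iff, sub_eq_zero] at this
  exact this.symm

end Data

/-! ### Weak derivatives of Lipschitz functions. -/

section Weak

variable {V : Type*} [NormedAddCommGroup V] [NormedSpace ℝ V] [FiniteDimensional ℝ V]
  [MeasureSpace V] [BorelSpace V] [(volume : Measure V).IsAddHaarMeasure]
  {F : Type*} [NormedAddCommGroup F] [NormedSpace ℝ F]

theorem IsTestFunction.exists_lipschitzWith {Ω : Set V} {φ : V → ℝ} (h : IsTestFunction Ω φ) :
    ∃ C, LipschitzWith C φ :=
  h.1.lipschitzWith_of_hasCompactSupport h.2.1 (by simp)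

theorem IsTestFunction.setIntegral_fderiv {Ω : Set V} {φ : V → ℝ} (h : IsTestFunction Ω φ)
    (u : V → F) (v : V → V) : ∫ z in Ω, fderiv ℝ φ z (v z) • u z = ∫ z, fderiv ℝ φ z (v z) • u z :=
  setIntegral_eq_integral_of_forall_compl_eq_zero fun z hz => by
    rw [fderiv_of_notMem_tsupport (𝕜 := ℝ) fun hz' => hz (h.2.2 hz')]; simp

theorem IsTestFunction.setIntegral {Ω : Set V} {φ : V → ℝ} (h : IsTestFunction Ω φ)
    (u : V → F) : ∫ z in Ω, φ z • u z = ∫ z, φ z • u z :=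
  setIntegral_eq_integral_of_forall_compl_eq_zero fun z hz => by
    rw [image_eq_zero_of_notMem_tsupport fun hz' => hz (h.2.2 hz'), zero_smul]

theorem IsTestFunction.integrable_smul {Ω : Set V} {φ : V → ℝ} (h : IsTestFunction Ω φ)
    (hΩ : IsOpen Ω) {u : V → F} (hu : LocallyIntegrableOn u Ω) : Integrable fun z => φ z • u z := by
  have h1 : IntegrableOn u (tsupport φ) :=
    hu.integrableOn_compact_subset h.2.2 h.2.1
  have h2 : IntegrableOn (fun z => φ z • u z) (tsupport φ) :=
    h1.continuousOn_smul h.1.continuous.continuousOn h.2.1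
  exact (integrableOn_iff_integrable_of_support_subset fun z hz => by
    by_contra hz'
    exact hz (by simp [image_eq_zero_of_notMem_tsupport hz'])).1 h2

theorem IsTestFunction.integrable_fderiv_smul {Ω : Set V} {φ : V → ℝ} (h : IsTestFunction Ω φ)
    (hΩ : IsOpen Ω) {u : V → F} (hu : LocallyIntegrableOn u Ω) (v : V) :
    Integrable fun z => fderiv ℝ φ z v • u z := by
  have h1 : IntegrableOn u (tsupport φ) :=
    hu.integrableOn_compact_subset h.2.2 h.2.1
  have h2 : IntegrableOn (fun z => fderiv ℝ φ z v • u z) (tsupport φ) :=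
    h1.continuousOn_smul ((h.1.continuous_fderiv (by simp)).clm_apply continuous_const).continuousOn
      h.2.1
  exact (integrableOn_iff_integrable_of_support_subset fun z hz => by
    by_contra hz'
    exact hz (by simp [fderiv_of_notMem_tsupport (𝕜 := ℝ) hz'])).1 h2

theorem HasWeakDeriv.integral_eq {Ω : Set V} {v : V} {u g : V → F} (h : HasWeakDeriv Ω v u g)
    {φ : V → ℝ} (hφ : IsTestFunction Ω φ) :
    ∫ z, fderiv ℝ φ z v • u z = - ∫ z, φ z • g z := by
  have := h.2.2 φ hφ
  rwa [hφ.setIntegral_fderiv u fun _ => v, hφ.setIntegral] at this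

/-- Weak derivatives are unique. -/
theorem HasWeakDeriv.ae_eq [CompleteSpace F] {Ω : Set V} (hΩ : IsOpen Ω) {v : V} {u u' g g' : V → F}
    (h : HasWeakDeriv Ω v u g) (h' : HasWeakDeriv Ω v u' g')
    (hu : ∀ᵐ z ∂(volume.restrict Ω), u z = u' z) : ∀ᵐ z ∂(volume.restrict Ω), g z = g' z := by
  have h0 := hΩ.ae_eq_zero_of_integral_contDiff_smul_eq_zero (h.2.1.sub h'.2.1)
    fun φ h1 h2 h3 => by
      have hφ : IsTestFunction Ω φ := ⟨h1, h2, h3⟩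
      have e1 := h.2.2 φ hφ
      have e2 := h'.2.2 φ hφ
      have e3 : ∫ z in Ω, fderiv ℝ φ z v • u z = ∫ z in Ω, fderiv ℝ φ z v • u' z :=
        integral_congr_ae (hu.mono fun z hz => by simp only [hz])
      rw [e3, e2, neg_inj, hφ.setIntegral, hφ.setIntegral] at e1
      simp only [Pi.sub_apply, smul_sub]
      rw [integral_sub (hφ.integrable_smul hΩ h.2.1) (hφ.integrable_smul hΩ h'.2.1), e1, sub_self]
  rw [ae_restrict_iff' hΩ.measurableSet]
  filter_upwards [h0] with z hz hzΩ
  exact sub_eq_zero.1 (hz hzΩ)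

theorem memLp_top_fderiv [FiniteDimensional ℝ F] {u : V → F} {C : ℝ≥0} (hu : LipschitzWith C u)
    (v : V) : MemLp (fun z => fderiv ℝ u z v) ⊤ := by
  borelize F
  have : CompleteSpace F := FiniteDimensional.complete ℝ F
  exact memLp_top_of_bound (measurable_fderiv_apply_const ℝ u v).aestronglyMeasurable (C * ‖v‖)
    (Eventually.of_forall fun z => norm_fderiv_le_of_lipschitzWith hu z v)

/-- The a.e. derivative of a Lipschitz function is its weak derivative. -/
theorem hasWeakDeriv_of_lipschitzWith [FiniteDimensional ℝ F] {u : V → F} {C : ℝ≥0}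
    (hu : LipschitzWith C u) {Ω : Set V} (hΩ : IsOpen Ω) (v : V) :
    HasWeakDeriv Ω v u fun z => fderiv ℝ u z v := by
  have : CompleteSpace F := FiniteDimensional.complete ℝ F
  have hl1 : LocallyIntegrableOn u Ω := hu.continuous.locallyIntegrable.locallyIntegrableOn _
  have hl2 : LocallyIntegrableOn (fun z => fderiv ℝ u z v) Ω :=
    ((memLp_top_fderiv hu v).locallyIntegrable le_top).locallyIntegrableOn _
  refine ⟨hl1, hl2, fun φ hφ => ?_⟩
  rw [hφ.setIntegral_fderiv u fun _ => v, hφ.setIntegral]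
  obtain ⟨D, hD⟩ := hφ.exists_lipschitzWith
  -- A vector identity is checked on continuous functionals, which reduces it to scalar integration
  -- by parts.
  rw [SeparatingDual.eq_iff_forall_dual_eq (R := ℝ)]
  intro ℓ
  rw [map_neg, ← ℓ.integral_comp_comm (hφ.integrable_fderiv_smul hΩ hl1 v),
    ← ℓ.integral_comp_comm (hφ.integrable_smul hΩ hl2)]
  simp_rw [map_smul, smul_eq_mul]
  have := integral_fderiv_mul_eq_neg' (μ := volume) hD (ℓ.lipschitz.comp hu) hφ.2.1 v
  simp only [Function.comp_def] at this
  rw [this, neg_inj]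
  refine integral_congr_ae ?_
  filter_upwards [hu.ae_differentiableAt (μ := volume)] with z hz
  have h := (ℓ.hasFDerivAt.comp z hz.hasFDerivAt).fderiv
  simp only [Function.comp_def] at h
  rw [h]
  rfl

theorem memSobolev_one_of_lipschitzWith [FiniteDimensional ℝ F] {u : V → F} {C : ℝ≥0}
    (hu : LipschitzWith C u) {M : ℝ} (hM : ∀ z, ‖u z‖ ≤ M) {Ω : Set V} (hΩ : IsOpen Ω) :
    MemSobolev ⊤ Ω 1 u :=
  ⟨memLp_top_of_bound hu.continuous.aestronglyMeasurable M (Eventually.of_forall hM), fun v =>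
    ⟨_, hasWeakDeriv_of_lipschitzWith hu hΩ v, (memLp_top_fderiv hu v).restrict Ω⟩⟩

end Weak

/-! ### Mollification and Lipschitz representatives. -/

section Mollify

variable {V : Type*} [NormedAddCommGroup V] [NormedSpace ℝ V] [FiniteDimensional ℝ V]
  [MeasureSpace V] [BorelSpace V] [(volume : Measure V).IsAddHaarMeasure]

/-- A shrinking sequence of bump functions. -/
def bump (k : ℕ) : ContDiffBump (0 : V) where
  rIn := 1 / ((k : ℝ) + 1)
  rOut := 2 * (1 / ((k : ℝ) + 1))
  rIn_pos := by positivity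
  rIn_lt_rOut := by
    have : (0 : ℝ) < 1 / ((k : ℝ) + 1) := by positivity
    linarith

/-- The normalized bump functions. -/
def moll (k : ℕ) : V → ℝ := (bump k).normed volume

/-- Mollification. -/
def mollify (k : ℕ) (u : V → ℝ) (x : V) : ℝ := ∫ y, moll k (x - y) * u y

theorem mollify_eq (k : ℕ) (u : V → ℝ) (x : V) : mollify k u x
    = (convolution (moll k) u (ContinuousLinearMap.lsmul ℝ ℝ) volume) x := by
  rw [convolution_def, mollify, ← integral_sub_left_eq_self (fun y => moll k (x - y) * u y) _ x]
  simp

theorem tendsto_bump_rOut : Tendsto (fun k => (bump k : ContDiffBump (0 : V)).rOut) atTop (𝓝 0) := by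
  have := (tendsto_one_div_add_atTop_nhds_zero_nat (𝕜 := ℝ)).const_mul 2
  rwa [mul_zero] at this

theorem contDiff_moll (k : ℕ) : ContDiff ℝ ∞ (moll k : V → ℝ) := (bump k).contDiff_normed

theorem hasCompactSupport_moll (k : ℕ) : HasCompactSupport (moll k : V → ℝ) :=
  (bump k).hasCompactSupport_normed

theorem moll_nonneg (k : ℕ) (x : V) : 0 ≤ moll k x := (bump k).nonneg_normed x

theorem integral_moll (k : ℕ) : ∫ x : V, moll k x = 1 := (bump k).integral_normed

theorem integrable_moll (k : ℕ) : Integrable (moll k : V → ℝ) :=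
  (contDiff_moll k).continuous.integrable_of_hasCompactSupport (hasCompactSupport_moll k)

theorem tendsto_mollify_ae {u : V → ℝ} (hu : LocallyIntegrable u) :
    ∀ᵐ x, Tendsto (fun k => mollify k u x) atTop (𝓝 (u x)) := by
  have := ContDiffBump.ae_convolution_tendsto_right_of_locallyIntegrable (μ := volume)
    (φ := fun k => (bump k : ContDiffBump (0 : V))) (K := 2)
    tendsto_bump_rOut (Eventually.of_forall fun k => le_rfl) hu
  simpa only [mollify_eq, moll] using this

theorem tendsto_mollify {u : V → ℝ} (hu : Continuous u) (x : V) :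
    Tendsto (fun k => mollify k u x) atTop (𝓝 (u x)) := by
  have := ContDiffBump.convolution_tendsto_right_of_continuous (μ := volume)
    (φ := fun k => (bump k : ContDiffBump (0 : V))) tendsto_bump_rOut hu x
  simpa only [mollify_eq, moll] using this

theorem contDiff_mollify (k : ℕ) {u : V → ℝ} (hu : LocallyIntegrable u) :
    ContDiff ℝ ∞ (mollify k u) := by
  rw [show mollify k u = _ from funext fun x => mollify_eq k u x]
  exact (hasCompactSupport_moll k).contDiff_convolution_left _ (contDiff_moll k) hu

theorem hasCompactSupport_comp_sub_left {f : V → ℝ} (hf : HasCompactSupport f) (x : V) :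
    HasCompactSupport fun y => f (x - y) :=
  hf.comp_homeomorph (Homeomorph.subLeft x)

theorem fderiv_comp_sub_left {f : V → ℝ} (hf : Differentiable ℝ f) (x y v : V) :
    fderiv ℝ (fun y => f (x - y)) y v = - fderiv ℝ f (x - y) v := by
  have h := (hf (x - y)).hasFDerivAt.comp y ((hasFDerivAt_id y).const_sub x)
  have := h.fderiv
  simp only [Function.comp_def, id] at this
  rw [this]
  simp

theorem isTestFunction_moll (k : ℕ) (x : V) {Ω : Set V}
    (hΩ : Metric.closedBall x (2 * (1 / ((k : ℝ) + 1))) ⊆ Ω) :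
    IsTestFunction Ω fun y => moll k (x - y) := by
  refine ⟨(contDiff_moll k).comp (contDiff_const.sub contDiff_id),
    hasCompactSupport_comp_sub_left (hasCompactSupport_moll k) x, ?_⟩
  refine (closure_minimal (fun y hy => ?_) Metric.isClosed_closedBall).trans hΩ
  have h1 : x - y ∈ tsupport (moll k : V → ℝ) := subset_closure hy
  rw [moll, ContDiffBump.tsupport_normed_eq, mem_closedBall_zero_iff] at h1
  rw [Metric.mem_closedBall, dist_comm, dist_eq_norm]
  exact h1

theorem fderiv_mollify (k : ℕ) {u : V → ℝ} (hu : LocallyIntegrable u) (x v : V) :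
    fderiv ℝ (mollify k u) x v = ∫ y, fderiv ℝ (moll k) (x - y) v * u y := by
  have h1 : ContDiff ℝ 1 (moll k : V → ℝ) := (contDiff_moll k).of_le (by simp)
  have e : mollify k u = convolution u (moll k) (ContinuousLinearMap.mul ℝ ℝ) volume := by
    ext1 x
    rw [convolution_def, mollify]
    simp [mul_comm]
  have h := (hasCompactSupport_moll k).hasFDerivAt_convolution_right
    (ContinuousLinearMap.mul ℝ ℝ) hu h1 x
  rw [e, h.fderiv, convolution_precompR_apply _ hu ((hasCompactSupport_moll k).fderiv ℝ)
    (h1.continuous_fderiv one_ne_zero), convolution_def]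
  simp [mul_comm]

/-- The derivative of a mollified function is the mollified weak derivative. -/
theorem fderiv_mollify_of_weak (k : ℕ) {Ω : Set V} {u g : V → ℝ}
    (hu : LocallyIntegrable (Ω.indicator u)) {v : V} (h : HasWeakDeriv Ω v u g) {x : V}
    (hx : Metric.closedBall x (2 * (1 / ((k : ℝ) + 1))) ⊆ Ω) :
    fderiv ℝ (mollify k (Ω.indicator u)) x v = ∫ y, moll k (x - y) * g y := by
  have ht := isTestFunction_moll k x hx
  have h1 := h.integral_eq ht
  rw [fderiv_mollify k hu]
  simp_rw [fderiv_comp_sub_left ((contDiff_moll k).differentiable (by simp)), smul_eq_mul,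
    neg_mul] at h1
  rw [integral_neg, neg_inj] at h1
  rw [← h1]
  refine integral_congr_ae (Eventually.of_forall fun y => ?_)
  by_cases hy : y ∈ Ω
  · simp only [indicator_of_mem hy]
  -- Outside `Ω` the indicator makes the right-hand integrand vanish, so the derivative of the
  -- mollifier has to vanish there too. It does, since its support lies in `Ω`.
  · have hy' := fun hy' => hy (ht.2.2 hy')
    have := fderiv_of_notMem_tsupport (𝕜 := ℝ) hy'
    have e := fderiv_comp_sub_left ((contDiff_moll k).differentiable (by simp)) x y v
    rw [this] at e
    simp only [ContinuousLinearMap.zero_apply, zero_eq_neg] at e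
    simp only [e, zero_mul]

theorem integrable_moll_sub (k : ℕ) (x : V) : Integrable fun y : V => moll k (x - y) :=
  (integrable_moll k).comp_sub_left x

theorem integral_moll_sub (k : ℕ) (x : V) : ∫ y : V, moll k (x - y) = 1 := by
  rw [integral_sub_left_eq_self (fun y : V => moll k y) _ x, integral_moll]

theorem abs_integral_moll_mul_le (k : ℕ) {Ω : Set V} {g : V → ℝ} {C : ℝ} {x : V}
    (hC : ∀ᵐ y ∂(volume.restrict Ω), |g y| ≤ C) (hΩ : MeasurableSet Ω)
    (hx : Metric.closedBall x (2 * (1 / ((k : ℝ) + 1))) ⊆ Ω) :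
    |∫ y, moll k (x - y) * g y| ≤ C := by
  have ht := isTestFunction_moll k x hx
  calc |∫ y, moll k (x - y) * g y| ≤ ∫ y, moll k (x - y) * C := by
        rw [← Real.norm_eq_abs]
        refine norm_integral_le_of_norm_le ((integrable_moll_sub k x).mul_const C) ?_
        filter_upwards [(ae_restrict_iff' hΩ).1 hC] with y hy
        rw [norm_mul, Real.norm_of_nonneg (moll_nonneg k _), Real.norm_eq_abs]
        by_cases hyΩ : y ∈ Ω
        · exact mul_le_mul_of_nonneg_left (hy hyΩ) (moll_nonneg k _)
        · have : moll k (x - y) = 0 := image_eq_zero_of_notMem_tsupport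
            (f := fun y => moll k (x - y)) fun hy' => hyΩ (ht.2.2 hy')
          simp [this]
    _ = C := by rw [integral_mul_const, integral_moll_sub, one_mul]

theorem ae_abs_le_of_memLp_top {Ω : Set V} {g : V → ℝ} (hg : MemLp g ⊤ (volume.restrict Ω)) :
    ∃ C : ℝ, ∀ᵐ y ∂(volume.restrict Ω), |g y| ≤ C := by
  refine ⟨(eLpNormEssSup g (volume.restrict Ω)).toReal, ?_⟩
  have hfin : eLpNormEssSup g (volume.restrict Ω) ≠ ⊤ := by
    have := hg.2.ne
    rwa [eLpNorm_exponent_top] at this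
  filter_upwards [enorm_ae_le_eLpNormEssSup g (volume.restrict Ω)] with y hy
  rw [← Real.norm_eq_abs, ← toReal_enorm]
  exact ENNReal.toReal_mono hfin hy

theorem exists_closedBall_subset {Ω K : Set V} (hΩ : IsOpen Ω) (hK : IsCompact K) (h : K ⊆ Ω) :
    ∀ᶠ k : ℕ in atTop, ∀ x ∈ K, Metric.closedBall x (2 * (1 / ((k : ℝ) + 1))) ⊆ Ω := by
  obtain ⟨δ, hδ, hsub⟩ := hK.exists_cthickening_subset_open hΩ h
  have : Tendsto (fun k : ℕ => 2 * (1 / ((k : ℝ) + 1))) atTop (𝓝 0) := by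
    simpa using (tendsto_one_div_add_atTop_nhds_zero_nat (𝕜 := ℝ)).const_mul 2
  filter_upwards [this.eventually (gt_mem_nhds hδ)] with k hk x hx
  exact (Metric.closedBall_subset_cthickening hx _).trans
    ((Metric.cthickening_mono hk.le K).trans hsub)

/-- A function with bounded weak derivatives on a convex open set has a Lipschitz
representative. -/
theorem exists_lipschitz_rep {Ω : Set V} (hΩ : IsOpen Ω) (hconv : Convex ℝ Ω) {u : V → ℝ}
    (hu : LocallyIntegrable (Ω.indicator u))
    (h : ∀ v, ∃ g, HasWeakDeriv Ω v u g ∧ MemLp g ⊤ (volume.restrict Ω)) :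
    ∃ (w : V → ℝ) (C : ℝ≥0), LipschitzWith C w ∧ ∀ᵐ z ∂(volume.restrict Ω), u z = w z := by
  choose g hg hgb using h
  -- The bounds on weak derivatives are given direction by direction. Uniform boundedness turns them
  -- into one operator norm bound, valid for all scales and all centres whose mollification ball
  -- lies in `Ω`.
  obtain ⟨C, hC⟩ := banach_steinhaus (𝕜 := ℝ) (𝕜₂ := ℝ) (E := V) (F := ℝ)
    (ι := {p : ℕ × V // Metric.closedBall p.2 (2 * (1 / ((p.1 : ℝ) + 1))) ⊆ Ω})
    (g := fun p => fderiv ℝ (mollify p.1.1 (Ω.indicator u)) p.1.2) (fun v => by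
      obtain ⟨C, hC⟩ := ae_abs_le_of_memLp_top (hgb v)
      refine ⟨C, fun p => ?_⟩
      rw [fderiv_mollify_of_weak _ hu (hg v) p.2]
      exact abs_integral_moll_mul_le _ hC hΩ.measurableSet p.2)
  -- These are the points where the mollifications recover `u`, almost all of `Ω`. The function is
  -- Lipschitz on this set and extends from it.
  set S := {x ∈ Ω | Tendsto (fun k => mollify k (Ω.indicator u) x) atTop
    (𝓝 (Ω.indicator u x))} with hS
  have hlip : LipschitzOnWith (Real.toNNReal C) (Ω.indicator u) S := by
    refine LipschitzOnWith.of_dist_le_mul fun x hx y hy => ?_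
    have hseg : segment ℝ x y ⊆ Ω := hconv.segment_subset hx.1 hy.1
    have hcpt : IsCompact (segment ℝ x y) := by
      rw [segment_eq_image]
      exact isCompact_Icc.image (by fun_prop)
    refine le_of_tendsto (hx.2.dist hy.2) ?_
    -- The segment lies in `Ω` by convexity and is compact, so at small scales the mollification
    -- balls around all its points lie in `Ω`.
    filter_upwards [exists_closedBall_subset hΩ hcpt hseg] with k hk
    rw [dist_eq_norm, dist_eq_norm, norm_sub_rev x y, norm_sub_rev (mollify _ _ _)]
    refine (convex_segment x y).norm_image_sub_le_of_norm_fderiv_le (𝕜 := ℝ)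
      (fun z _ => (contDiff_mollify k hu).differentiable (by simp) z) (fun z hz => ?_)
      (left_mem_segment ℝ x y) (right_mem_segment ℝ x y)
    exact (hC ⟨(k, z), hk z hz⟩).trans (Real.le_coe_toNNReal C)
  obtain ⟨w, hw, hwS⟩ := hlip.extend_real
  refine ⟨w, _, hw, ?_⟩
  filter_upwards [ae_restrict_of_ae (tendsto_mollify_ae hu), ae_restrict_mem hΩ.measurableSet]
    with z hz hzΩ
  rw [← hwS ⟨hzΩ, hz⟩, indicator_of_mem hzΩ]

theorem memLp_indicator_locallyIntegrable {Ω : Set V} (hΩ : MeasurableSet Ω) {u : V → ℝ}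
    (hu : MemLp u ⊤ (volume.restrict Ω)) : LocallyIntegrable (Ω.indicator u) :=
  ((memLp_indicator_iff_restrict hΩ).2 hu).locallyIntegrable le_top

/-- Bounded second weak derivatives give bounded second differences. -/
theorem abs_diff2_le_of_weak {u : V → ℝ} (hu : Continuous u)
    (h : ∀ v, ∃ g, HasWeakDeriv univ v u g ∧ ∃ C : ℝ≥0, LipschitzWith C g) :
    ∃ C : ℝ, ∀ x h k, |diff2 u x h k| ≤ C * ‖h‖ * ‖k‖ := by
  choose g hg Cg hgC using h
  have hloc : LocallyIntegrable ((univ : Set V).indicator u) := by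
    rw [indicator_univ]; exact hu.locallyIntegrable
  have hder : ∀ (k : ℕ) (x v : V), fderiv ℝ (mollify k u) x v = ∫ y, moll k y * g v (x - y) := by
    intro k x v
    have := fderiv_mollify_of_weak k hloc (hg v) (subset_univ (Metric.closedBall x _))
    rw [indicator_univ] at this
    rw [this, ← integral_sub_left_eq_self (fun y => moll k (x - y) * g v y) _ x]
    simp
  have hint : ∀ (k : ℕ) (x v : V), Integrable fun y => moll k y * g v (x - y) := fun k x v =>
    ((contDiff_moll k).continuous.mul ((hgC v).continuous.comp
      (continuous_const.sub continuous_id))).integrable_of_hasCompactSupport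
      ((hasCompactSupport_moll k).mul_right)
  -- Here uniform boundedness is applied to difference quotients of the derivatives, which gives a
  -- Lipschitz bound for the derivatives of the mollified functions, uniform in the scale.
  obtain ⟨C, hC⟩ := banach_steinhaus (𝕜 := ℝ) (𝕜₂ := ℝ) (E := V) (F := ℝ) (ι := ℕ × V × V)
    (g := fun p => ‖p.2.1 - p.2.2‖⁻¹ • (fderiv ℝ (mollify p.1 u) p.2.1
      - fderiv ℝ (mollify p.1 u) p.2.2)) (fun v => by
      refine ⟨Cg v, fun p => ?_⟩
      have hb : |fderiv ℝ (mollify p.1 u) p.2.1 v - fderiv ℝ (mollify p.1 u) p.2.2 v|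
          ≤ Cg v * ‖p.2.1 - p.2.2‖ := by
        rw [hder, hder, ← integral_sub (hint _ _ _) (hint _ _ _)]
        calc _ ≤ ∫ y, moll p.1 y * (Cg v * ‖p.2.1 - p.2.2‖) := by
              rw [← Real.norm_eq_abs]
              refine norm_integral_le_of_norm_le ((integrable_moll p.1).mul_const _)
                (Eventually.of_forall fun y => ?_)
              rw [← mul_sub, norm_mul, Real.norm_of_nonneg (moll_nonneg _ _)]
              refine mul_le_mul_of_nonneg_left ?_ (moll_nonneg _ _)
              have := (hgC v).dist_le_mul (p.2.1 - y) (p.2.2 - y)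
              rwa [dist_eq_norm, dist_eq_norm, sub_sub_sub_cancel_right] at this
          _ = _ := by rw [integral_mul_const, integral_moll, one_mul]
      rw [ContinuousLinearMap.smul_apply, ContinuousLinearMap.sub_apply, norm_smul, norm_inv,
        norm_norm, Real.norm_eq_abs]
      rcases eq_or_ne p.2.1 p.2.2 with h0 | h0
      · simp [h0]
      · rw [inv_mul_le_iff₀ (norm_pos_iff.2 (sub_ne_zero.2 h0)), mul_comm]
        exact hb)
  refine ⟨C, fun x h k => ?_⟩
  have hlim : Tendsto (fun n => diff2 (mollify n u) x h k) atTop (𝓝 (diff2 u x h k)) :=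
    (((tendsto_mollify hu _).sub (tendsto_mollify hu _)).sub (tendsto_mollify hu _)).add
      (tendsto_mollify hu _)
  refine le_of_tendsto hlim.abs (Eventually.of_forall fun n => ?_)
  refine norm_diff2_le_of_fderiv ((contDiff_mollify n hu.locallyIntegrable).differentiable (by simp))
    (fun y z => ?_) x h k
  have := hC (n, y, z)
  rw [norm_smul, norm_inv, norm_norm] at this
  rcases eq_or_ne y z with h0 | h0
  · simp [h0]
  · rwa [inv_mul_le_iff₀ (norm_pos_iff.2 (sub_ne_zero.2 h0)), mul_comm] at this

end Mollify

/-! ### Weak identities on the space-time slab. -/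

theorem eq_on_of_ae_eq {V F : Type*} [TopologicalSpace V] [MeasureSpace V] [OpensMeasurableSpace V]
    [(volume : Measure V).IsOpenPosMeasure] [TopologicalSpace F] [T2Space F] {Ω : Set V}
    (hΩ : IsOpen Ω) {S : Set V} (hS : Ω ⊆ S) (hS' : S ⊆ closure Ω) {u w : V → F}
    (hu : ContinuousOn u S) (hw : ContinuousOn w S)
    (h : ∀ᵐ z ∂(volume.restrict Ω), u z = w z) : EqOn u w S :=
  (Measure.eqOn_open_of_ae_eq h hΩ (hu.mono hS) (hw.mono hS)).of_subset_closure hu hw hS hS'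

theorem closure_slab {T : ℝ} (hT : 0 < T) : closure (slab T) = Icc 0 T ×ˢ univ := by
  rw [slab, closure_prod_eq, closure_Ioo hT.ne, closure_univ]

/-- The gradient of a function on the plane. -/
def grad (f : Plane → ℝ) (x : Plane) : Plane := WithLp.toLp 2 fun i => fderiv ℝ f x (basisVec i)

/-- The gradient in the space variables. -/
def spaceGrad (u : ℝ × Plane → ℝ) (z : ℝ × Plane) : Plane :=
  WithLp.toLp 2 fun i => fderiv ℝ u z ((0 : ℝ), basisVec i)

theorem fderiv_space_apply (u : ℝ × Plane → ℝ) (z : ℝ × Plane) (w : Plane) :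
    fderiv ℝ u z ((0 : ℝ), w) = w 0 * fderiv ℝ u z ((0 : ℝ), basisVec 0)
      + w 1 * fderiv ℝ u z ((0 : ℝ), basisVec 1) :=
  fderiv_apply_plane ((fderiv ℝ u z).comp (ContinuousLinearMap.inr ℝ ℝ Plane)) w

section General

variable {V : Type*} [NormedAddCommGroup V] [NormedSpace ℝ V] [FiniteDimensional ℝ V]
  [MeasurableSpace V] [BorelSpace V] {μ : Measure V} [μ.IsAddHaarMeasure]

/-- Both sides are minus the integral of `w` against the same second derivative of the smooth `φ`,
which is symmetric. Only one derivative of `w` is involved. -/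
theorem integral_fderiv_mul_fderiv_swap {φ w : V → ℝ} (hφ : ContDiff ℝ ∞ φ)
    (hc : HasCompactSupport φ) {C : ℝ≥0} (hw : LipschitzWith C w) (p q : V) :
    ∫ z, fderiv ℝ φ z p * fderiv ℝ w z q ∂μ = ∫ z, fderiv ℝ φ z q * fderiv ℝ w z p ∂μ := by
  have hd : ∀ p : V, ContDiff ℝ ∞ fun z => fderiv ℝ φ z p := fun p =>
    (hφ.fderiv_right (m := ∞) (by simp)).clm_apply contDiff_const
  have hcs : ∀ p : V, HasCompactSupport fun z => fderiv ℝ φ z p := fun p =>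
    hc.fderiv_apply (𝕜 := ℝ) p
  have key : ∀ p q : V, ∫ z, fderiv ℝ φ z p * fderiv ℝ w z q ∂μ
      = - ∫ z, fderiv ℝ (fderiv ℝ φ) z q p * w z ∂μ := by
    intro p q
    obtain ⟨D, hD⟩ := (hd p).lipschitzWith_of_hasCompactSupport (hcs p) (by simp)
    have := integral_fderiv_mul_eq_neg' (μ := μ) hD hw (hcs p) q
    have e : ∀ z, fderiv ℝ (fun z => fderiv ℝ φ z p) z q = fderiv ℝ (fderiv ℝ φ) z q p := fun z => by
      rw [fderiv_clm_apply ((hφ.fderiv_right (m := ∞) (by simp)).differentiable (by simp) z)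
        (differentiableAt_const p)]
      simp
    simp_rw [e] at this
    rw [this, neg_neg]
  rw [key, key]
  refine congrArg _ (integral_congr_ae (Eventually.of_forall fun z => ?_))
  have : IsSymmSndFDerivAt ℝ φ z := hφ.contDiffAt.isSymmSndFDerivAt (by simp; exact WithTop.coe_le_coe.2 (le_top : (2 : ℕ∞) ≤ ⊤))
  simp only [this.eq p q]

end General

theorem abs_mul_sub_mul_le {V : Type*} [NormedAddCommGroup V] {f g : V → ℝ} {Mf Lf Mg Lg : ℝ}
    (hMf : ∀ x, |f x| ≤ Mf) (hLf : ∀ x y, |f x - f y| ≤ Lf * ‖x - y‖)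
    (hMg : ∀ x, |g x| ≤ Mg) (hLg : ∀ x y, |g x - g y| ≤ Lg * ‖x - y‖) (x y : V) :
    |f x * g x - f y * g y| ≤ (Lf * Mg + Mf * Lg) * ‖x - y‖ := by
  have e : f x * g x - f y * g y = (f x - f y) * g x + f y * (g x - g y) := by ring
  rw [e]
  refine (abs_add_le _ _).trans ?_
  rw [abs_mul, abs_mul, add_mul]
  refine add_le_add ?_ ?_
  · refine (mul_le_mul (hLf x y) (hMg x) (abs_nonneg _)
      ((abs_nonneg _).trans (hLf x y))).trans (le_of_eq (by ring))
  · refine (mul_le_mul (hMf y) (hLg x y) (abs_nonneg _)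
      ((abs_nonneg _).trans (hMf y))).trans (le_of_eq (by ring))

theorem abs_sub_le_of_lipschitzWith {V : Type*} [SeminormedAddCommGroup V] {f : V → ℝ} {C : ℝ≥0}
    (h : LipschitzWith C f) (x y : V) : |f x - f y| ≤ C * ‖x - y‖ := by
  have := h.dist_le_mul x y
  rwa [Real.dist_eq, dist_eq_norm] at this

theorem LipschitzWith.mul_bounded {V : Type*} [NormedAddCommGroup V] {f g : V → ℝ} {Mf Mg : ℝ}
    {C D : ℝ≥0} (hf : LipschitzWith C f) (hg : LipschitzWith D g) (hMf : ∀ x, |f x| ≤ Mf)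
    (hMg : ∀ x, |g x| ≤ Mg) : ∃ K, LipschitzWith K fun x => f x * g x :=
  ⟨_, lipschitz_of_norm_le (f := fun x => f x * g x) (abs_mul_sub_mul_le hMf
    (abs_sub_le_of_lipschitzWith hf) hMg (abs_sub_le_of_lipschitzWith hg))⟩

theorem setIntegral_slab {F : Type*} [NormedAddCommGroup F] [NormedSpace ℝ F] {T : ℝ}
    {f : ℝ × Plane → F} (hf : IntegrableOn f (slab T)) :
    ∫ z in slab T, f z = ∫ t in Ioo 0 T, ∫ x, f (t, x) := by
  rw [IntegrableOn, volume_restrict_slab] at hf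
  rw [volume_restrict_slab, integral_prod _ hf]

theorem ae_ae_slab {T : ℝ} {p : ℝ × Plane → Prop} (h : ∀ᵐ z ∂(volume.restrict (slab T)), p z) :
    ∀ᵐ t ∂(volume.restrict (Ioo 0 T)), ∀ᵐ x : Plane, p (t, x) := by
  rw [volume_restrict_slab] at h
  exact Measure.ae_ae_of_ae_prod h

theorem hasCompactSupport_slice {ψ : ℝ × Plane → ℝ} (hc : HasCompactSupport ψ) (t : ℝ) :
    HasCompactSupport fun x => ψ (t, x) := by
  obtain ⟨R, hR⟩ := hc.isCompact.isBounded.subset_closedBall 0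
  refine HasCompactSupport.of_support_subset_isCompact (isCompact_closedBall (0 : Plane) R)
    fun x hx => ?_
  have := hR (subset_tsupport ψ (hx : (t, x) ∈ Function.support ψ))
  rw [mem_closedBall_zero_iff] at this ⊢
  exact (norm_snd_le (t, x)).trans this

theorem integrable_fderiv_space {ψ : ℝ × Plane → ℝ} {C : ℝ≥0} (hψ : LipschitzWith C ψ)
    (hc : HasCompactSupport ψ) {G : ℝ × Plane → Plane} (hG : Continuous G) :
    Integrable fun z => fderiv ℝ ψ z ((0 : ℝ), G z) := by
  simp only [fderiv_space_apply ψ _ (G _)]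
  have hi : ∀ i : Fin 2, Continuous fun z => G z i := fun i =>
    (EuclideanSpace.proj (𝕜 := ℝ) i).continuous.comp hG
  refine Integrable.add ?_ ?_
  · exact (integrable_fderiv_mul hψ (hi 0) hc _).congr
      (Eventually.of_forall fun z => mul_comm _ _)
  · exact (integrable_fderiv_mul hψ (hi 1) hc _).congr
      (Eventually.of_forall fun z => mul_comm _ _)

/-- Integration over the slab of the derivative along a field, by slices. -/
theorem setIntegral_slab_fderiv {T : ℝ} {ψ : ℝ × Plane → ℝ} {C : ℝ≥0} (hψ : LipschitzWith C ψ)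
    (hc : HasCompactSupport ψ) {G : ℝ × Plane → Plane} (hG : Continuous G) :
    ∫ z in slab T, fderiv ℝ ψ z ((0 : ℝ), G z)
      = ∫ t in Ioo 0 T, ∫ x, fderiv ℝ (fun x => ψ (t, x)) x (G (t, x)) := by
  rw [setIntegral_slab (integrable_fderiv_space hψ hc hG).integrableOn]
  have hd : ∀ᵐ z ∂(volume.restrict (slab T)), DifferentiableAt ℝ ψ z :=
    ae_restrict_of_ae (hψ.ae_differentiableAt (μ := volume))
  refine integral_congr_ae ?_
  filter_upwards [ae_ae_slab hd] with t ht
  refine integral_congr_ae ?_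
  filter_upwards [ht] with x hx
  exact (fderiv_space hx (G (t, x))).symm

theorem setIntegral_slab_solenoidal {T : ℝ} {ψ : ℝ × Plane → ℝ} {C : ℝ≥0} (hψ : LipschitzWith C ψ)
    (hc : HasCompactSupport ψ) {G : ℝ × Plane → Plane} (hG : Continuous G)
    (hs : ∀ t ∈ Ioo 0 T, IsSolenoidal fun x => G (t, x)) :
    ∫ z in slab T, fderiv ℝ ψ z ((0 : ℝ), G z) = 0 := by
  rw [setIntegral_slab_fderiv hψ hc hG, setIntegral_congr_fun measurableSet_Ioo fun t ht =>
    hs t ht _ C (lipschitzWith_space hψ t) (hasCompactSupport_slice hc t)]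
  simp

theorem exists_abs_le_of_hasCompactSupport {V : Type*} [TopologicalSpace V] {φ : V → ℝ}
    (hφ : Continuous φ) (hc : HasCompactSupport φ) : ∃ M, ∀ z, |φ z| ≤ M := by
  obtain ⟨M, hM⟩ := hc.exists_bound_of_continuous hφ
  exact ⟨M, hM⟩

/-- The product `φ u` is again a Lipschitz test function, so the solenoidal field pairs to zero with
its gradient; the Leibniz rule splits the result. -/
theorem setIntegral_slab_mul_fderiv {T : ℝ} {φ u : ℝ × Plane → ℝ} {C D : ℝ≥0}
    (hφ : LipschitzWith C φ) (hc : HasCompactSupport φ) (hu : LipschitzWith D u) {M : ℝ}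
    (hM : ∀ z, |u z| ≤ M) {G : ℝ × Plane → Plane} (hG : Continuous G)
    (hs : ∀ t ∈ Ioo 0 T, IsSolenoidal fun x => G (t, x)) :
    ∫ z in slab T, u z * fderiv ℝ φ z ((0 : ℝ), G z)
      = - ∫ z in slab T, φ z * fderiv ℝ u z ((0 : ℝ), G z) := by
  obtain ⟨Mφ, hMφ⟩ := exists_abs_le_of_hasCompactSupport hφ.continuous hc
  obtain ⟨K, hK⟩ := LipschitzWith.mul_bounded hφ hu hMφ hM
  have h0 := setIntegral_slab_solenoidal hK (hc.mul_right (f' := u)) hG hs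
  have e : (fun z => fderiv ℝ (fun z => φ z * u z) z ((0 : ℝ), G z)) =ᵐ[volume]
      fun z => u z * fderiv ℝ φ z ((0 : ℝ), G z) + φ z * fderiv ℝ u z ((0 : ℝ), G z) := by
    filter_upwards [hφ.ae_differentiableAt (μ := volume), hu.ae_differentiableAt (μ := volume)]
      with z h1 h2
    rw [fderiv_fun_mul h1 h2]
    simp [add_comm]
  have i1 : Integrable fun z => u z * fderiv ℝ φ z ((0 : ℝ), G z) :=
    (integrable_fderiv_space hφ hc hG).bdd_mul hu.continuous.aestronglyMeasurable
      (Eventually.of_forall hM)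
  have i2 : Integrable fun z => φ z * fderiv ℝ u z ((0 : ℝ), G z) := by
    refine ((integrable_fderiv_space hK (hc.mul_right (f' := u)) hG).sub i1).congr ?_
    filter_upwards [e] with z hz
    simp only [Pi.sub_apply, hz]
    ring
  rw [integral_congr_ae (ae_restrict_of_ae e), integral_add i1.integrableOn i2.integrableOn] at h0
  linarith

/-- The gradient of `w` is merely bounded and measurable, so its divergence exists only weakly. The
symmetry of second derivatives is transferred to the smooth `φ`. -/
theorem setIntegral_slab_rot_grad {T : ℝ} {φ w : ℝ × Plane → ℝ} (hφ : IsTestFunction (slab T) φ)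
    {D : ℝ≥0} (hw : LipschitzWith D w) :
    ∫ z in slab T, fderiv ℝ φ z ((0 : ℝ), rot (spaceGrad w z)) = 0 := by
  have h0 := hφ.setIntegral_fderiv (fun _ => (1 : ℝ)) fun z => ((0 : ℝ), rot (spaceGrad w z))
  simp only [smul_eq_mul, mul_one] at h0
  rw [h0]
  have hp : ∀ p q : ℝ × Plane, Integrable fun z => fderiv ℝ φ z p * fderiv ℝ w z q := by
    intro p q
    have hd : Continuous fun z => fderiv ℝ φ z p :=
      (hφ.1.continuous_fderiv (by simp)).clm_apply continuous_const
    refine (integrable_bounded_mul_of_compact (measurable_fderiv_apply_const ℝ w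
      q).aestronglyMeasurable (norm_fderiv_le_of_lipschitzWith hw · q) hd
      (hφ.2.1.fderiv_apply (𝕜 := ℝ) p)).congr (Eventually.of_forall fun z => mul_comm _ _)
  have e : ∀ z, fderiv ℝ φ z ((0 : ℝ), rot (spaceGrad w z))
      = fderiv ℝ φ z ((0 : ℝ), basisVec 1) * fderiv ℝ w z ((0 : ℝ), basisVec 0)
        - fderiv ℝ φ z ((0 : ℝ), basisVec 0) * fderiv ℝ w z ((0 : ℝ), basisVec 1) := fun z => by
    rw [fderiv_space_apply, rot_zero_coord, rot_one_coord, spaceGrad]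
    simp only []
    ring
  simp_rw [e]
  rw [integral_sub (hp _ _) (hp _ _),
    integral_fderiv_mul_fderiv_swap hφ.1 hφ.2.1 hw ((0 : ℝ), basisVec 1) ((0 : ℝ), basisVec 0),
    sub_self]

/-! ### The flux of the physical system. -/

/-- The data are those of the physical system. -/
structure Compat (c : Constants) (d : Data) : Prop where
  B_diff : Differentiable ℝ d.B
  a_eq : ∀ x, d.a x = (c.σ * c.m / c.q * (d.B x)⁻¹ ^ 2) • rot (grad d.B x)
  c₀_eq : d.c₀ = c.q / (2 * Real.pi * c.ε₀)

namespace Data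

variable {c : Constants} {d : Data}

theorem fderiv_B_mul (hc : Compat c d) {w : ℝ × Plane → ℝ} {z : ℝ × Plane}
    (hw : DifferentiableAt ℝ w z) (v : ℝ × Plane) :
    fderiv ℝ (fun z => d.B z.2 * w z) z v
      = d.B z.2 * fderiv ℝ w z v + w z * fderiv ℝ d.B z.2 v.2 := by
  have hB := (hc.B_diff z.2).hasFDerivAt.comp z hasFDerivAt_snd
  have := (hB.mul hw.hasFDerivAt).fderiv
  simp only [Function.comp_def] at this
  erw [this]
  simp

/-- Differentiating `n = B w` splits the diffusive flux. The `w ∇B` part joins the electric drift to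
form `w B V`, and the `B ∇w` part loses its factor `B` against the cyclotron frequency. The
remaining term `rot ∇w` is divergence-free. -/
theorem flux_eq (hc : Compat c d) {w : ℝ × Plane → ℝ} {g E : ℝ → Plane → Plane} {z : ℝ × Plane}
    (hw : DifferentiableAt ℝ w z)
    (hg : ∀ i, g z.1 z.2 i = fderiv ℝ (fun z => d.B z.2 * w z) z ((0 : ℝ), basisVec i)) :
    c.flux d.B (fun t x => d.B x * w (t, x)) g E z.1 z.2
      = w z • (d.B z.2 • d.vel E z.1 z.2) + (c.σ * c.m / c.q) • rot (spaceGrad w z) := by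
  have hB := (d.B_pos z.2).ne'
  have hm := c.m_pos.ne'
  have hq := c.q_ne
  have e : g z.1 z.2 = w z • grad d.B z.2 + d.B z.2 • spaceGrad w z := by
    ext i
    rw [hg i, fderiv_B_mul hc hw]
    simp [grad, spaceGrad]
    ring
  rw [Constants.flux, ← rot_apply, e, vel, hc.a_eq, Constants.omegaC]
  simp only [map_sub, map_smul, map_add, smul_sub, smul_add, smul_smul]
  match_scalars <;> field_simp

/-- The weak form of the flux term. -/
theorem setIntegral_flux (hc : Compat c d) {w : ℝ × Plane → ℝ} {C : ℝ≥0} (hw : LipschitzWith C w)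
    {M : ℝ} (hM : ∀ z, |w z| ≤ M) {E : ℝ → Plane → Plane} (hE : Continuous (Function.uncurry E))
    (hs : ∀ t ∈ Ioo 0 d.T, IsSolenoidal fun x => rot (E t x)) {g : ℝ → Plane → Plane}
    (hg : ∀ i, ∀ᵐ z ∂(volume.restrict (slab d.T)),
      g z.1 z.2 i = fderiv ℝ (fun z => d.B z.2 * w z) z ((0 : ℝ), basisVec i))
    {φ : ℝ × Plane → ℝ} (hφ : IsTestFunction (slab d.T) φ) :
    ∫ z in slab d.T, fderiv ℝ φ z ((0 : ℝ), c.flux d.B (fun t x => d.B x * w (t, x)) g E z.1 z.2)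
      = - ∫ z in slab d.T, φ z * (d.B z.2 * fderiv ℝ w z ((0 : ℝ), d.vel E z.1 z.2)) := by
  obtain ⟨D, hD⟩ := hφ.exists_lipschitzWith
  have hvel : Continuous fun z : ℝ × Plane => d.B z.2 • d.vel E z.1 z.2 :=
    (d.continuous_B.comp continuous_snd).smul (continuous_vel hE)
  have hsol := solenoidal_vel hE hs
  have e1 : ∀ᵐ z ∂(volume.restrict (slab d.T)),
      fderiv ℝ φ z ((0 : ℝ), c.flux d.B (fun t x => d.B x * w (t, x)) g E z.1 z.2)
        = w z * fderiv ℝ φ z ((0 : ℝ), d.B z.2 • d.vel E z.1 z.2)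
          + c.σ * c.m / c.q * fderiv ℝ φ z ((0 : ℝ), rot (spaceGrad w z)) := by
    filter_upwards [ae_restrict_of_ae (hw.ae_differentiableAt (μ := volume)), ae_all_iff.2 hg]
      with z hz hgz
    rw [flux_eq hc hz hgz, show ((0 : ℝ), w z • (d.B z.2 • d.vel E z.1 z.2)
      + (c.σ * c.m / c.q) • rot (spaceGrad w z)) = w z • ((0 : ℝ), d.B z.2 • d.vel E z.1 z.2)
      + (c.σ * c.m / c.q) • ((0 : ℝ), rot (spaceGrad w z)) by simp, map_add, map_smul, map_smul]
    rfl
  have i1 : Integrable fun z => w z * fderiv ℝ φ z ((0 : ℝ), d.B z.2 • d.vel E z.1 z.2) :=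
    (integrable_fderiv_space hD hφ.2.1 hvel).bdd_mul hw.continuous.aestronglyMeasurable
      (Eventually.of_forall hM)
  have i2 : Integrable fun z => fderiv ℝ φ z ((0 : ℝ), rot (spaceGrad w z)) := by
    simp only [fderiv_space_apply φ _ (rot _)]
    have hi : ∀ i : Fin 2, ∀ p : ℝ × Plane, Integrable fun z => fderiv ℝ w z p * fderiv ℝ φ z
        ((0 : ℝ), basisVec i) := fun i p =>
      integrable_bounded_mul_of_compact (measurable_fderiv_apply_const ℝ w p).aestronglyMeasurable
        (norm_fderiv_le_of_lipschitzWith hw · p)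
        ((hφ.1.continuous_fderiv (by simp)).clm_apply continuous_const)
        (hφ.2.1.fderiv_apply (𝕜 := ℝ) _)
    simp_rw [rot_zero_coord, rot_one_coord, neg_mul]
    exact (hi 0 _).neg.add (hi 1 _)
  rw [integral_congr_ae e1, integral_add i1.integrableOn (i2.const_mul _).integrableOn,
    integral_const_mul, setIntegral_slab_rot_grad hφ hw, mul_zero, add_zero,
    setIntegral_slab_mul_fderiv hD hφ.2.1 hw hM hvel hsol]
  refine congrArg _ (integral_congr_ae (Eventually.of_forall fun z => ?_))
  simp only []
  rw [show ((0 : ℝ), d.B z.2 • d.vel E z.1 z.2) = d.B z.2 • ((0 : ℝ), d.vel E z.1 z.2) by simp,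
    map_smul]
  rfl

end Data

/-! ### Curves with values in Lebesgue spaces. -/

theorem measurable_of_dist {α X : Type*} [MeasurableSpace α] [PseudoMetricSpace X]
    [SecondCountableTopology X] [MeasurableSpace X] [BorelSpace X] {N : α → X}
    (h : ∀ g, Measurable fun t => dist (N t) g) : Measurable N := by
  refine measurable_of_isOpen fun U hU => ?_
  have hball : ∀ x : U, ∃ ε > 0, Metric.ball (x : X) ε ⊆ U := fun x =>
    Metric.isOpen_iff.1 hU x x.2
  choose ε hε hsub using hball
  obtain ⟨S, -, hSc, hS⟩ := TopologicalSpace.isOpen_biUnion_countable (univ : Set U)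
    (fun x => Metric.ball (x : X) (ε x)) fun _ _ => Metric.isOpen_ball
  have hU' : U = ⋃ x ∈ S, Metric.ball (x : X) (ε x) := by
    rw [hS]
    refine subset_antisymm (fun y hy => ?_) (iUnion₂_subset fun x _ => hsub x)
    exact mem_iUnion₂.2 ⟨⟨y, hy⟩, mem_univ _, Metric.mem_ball_self (hε _)⟩
  rw [hU', preimage_iUnion₂]
  exact MeasurableSet.biUnion hSc fun x _ => measurableSet_lt (h x) measurable_const

section TimeSobolev

variable {F : Type*} [NormedAddCommGroup F] [MeasurableSpace F] [BorelSpace F]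
  [SecondCountableTopology F] {p : ℝ≥0∞} [hp1 : Fact (1 ≤ p)] [hp : Fact (p ≠ ⊤)]

open Classical in
/-- A function of time and space as a curve in `L^p`. -/
def lpCurve (p : ℝ≥0∞) (f : ℝ → Plane → F) (t : ℝ) : Lp F p (volume : Measure Plane) :=
  if h : MemLp (f t) p then h.toLp (f t) else 0

theorem coe_lpCurve {f : ℝ → Plane → F} {t : ℝ} (h : MemLp (f t) p) :
    lpCurve p f t =ᵐ[volume] f t := by
  rw [lpCurve, dif_pos h]
  exact h.coeFn_toLp

theorem measurable_eLpNorm_slice {f : ℝ → Plane → F} (hf : Measurable (Function.uncurry f)) :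
    Measurable fun t => eLpNorm (f t) p := by
  have h0 : p ≠ 0 := (zero_lt_one.trans_le hp1.out).ne'
  simp_rw [eLpNorm_eq_lintegral_rpow_enorm_toReal h0 hp.out]
  exact (Measurable.lintegral_prod_right' (hf.enorm.pow_const _)).pow_const _

theorem dist_lpCurve {f : ℝ → Plane → F} {t : ℝ} (h : MemLp (f t) p)
    (g : Lp F p (volume : Measure Plane)) :
    dist (lpCurve p f t) g = (eLpNorm (fun x => f t x - g x) p).toReal := by
  rw [Lp.dist_def]
  refine congrArg _ (eLpNorm_congr_ae ?_)
  filter_upwards [coe_lpCurve h] with x hx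
  rw [Pi.sub_apply, hx]

theorem measurable_dist_lpCurve {f : ℝ → Plane → F} (hf : Measurable (Function.uncurry f))
    (g : Lp F p (volume : Measure Plane)) : Measurable fun t => dist (lpCurve p f t) g := by
  have hg : Measurable (g : Plane → F) := (Lp.stronglyMeasurable g).measurable
  have hs : Measurable fun t => eLpNorm (f t) p := measurable_eLpNorm_slice hf
  have hS : MeasurableSet {t | eLpNorm (f t) p < ⊤} :=
    hs measurableSet_Iio
  have hm : Measurable fun t => (eLpNorm (fun x => f t x - g x) p).toReal :=
    (measurable_eLpNorm_slice (f := fun t x => f t x - g x)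
      (hf.sub (hg.comp measurable_snd))).ennreal_toReal
  have e : ∀ t, dist (lpCurve p f t) g = if eLpNorm (f t) p < ⊤ then
      (eLpNorm (fun x => f t x - g x) p).toReal
      else dist (0 : Lp F p (volume : Measure Plane)) g := by
    intro t
    by_cases ht : eLpNorm (f t) p < ⊤
    · rw [if_pos ht, dist_lpCurve ⟨(hf.comp measurable_prodMk_left).aestronglyMeasurable, ht⟩]
    · rw [if_neg ht, lpCurve, dif_neg fun h => ht h.2]
  simp_rw [e]
  exact Measurable.ite hS hm measurable_const

/-- For finite `p` the space is separable, so measurability can be tested on balls, that is, on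
distances to fixed elements. These are scalar functions of time to which Tonelli's theorem applies.
-/
theorem measurable_lpCurve {f : ℝ → Plane → F} (hf : Measurable (Function.uncurry f)) :
    StronglyMeasurable (lpCurve p f) := by
  let _ : MeasurableSpace (Lp F p (volume : Measure Plane)) := borel _
  have _ : BorelSpace (Lp F p (volume : Measure Plane)) := ⟨rfl⟩
  have : SecondCountableTopology (Lp F p (volume : Measure Plane)) := Lp.SecondCountableTopology
  exact (measurable_of_dist (measurable_dist_lpCurve hf)).stronglyMeasurable

theorem memLp_lpCurve {T C : ℝ} {f : ℝ → Plane → F} (hf : Measurable (Function.uncurry f))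
    (hC : ∀ᵐ t ∂(volume.restrict (Ioo 0 T)), eLpNorm (f t) p ≤ ENNReal.ofReal C) :
    (∀ᵐ t ∂(volume.restrict (Ioo 0 T)), lpCurve p f t =ᵐ[volume] f t) ∧
      MemLp (lpCurve p f) ⊤ (volume.restrict (Ioo 0 T)) := by
  have hslice : ∀ t, Measurable (f t) := fun t => hf.comp measurable_prodMk_left
  have hm : ∀ᵐ t ∂(volume.restrict (Ioo 0 T)), MemLp (f t) p := by
    filter_upwards [hC] with t ht
    exact ⟨(hslice t).aestronglyMeasurable, ht.trans_lt ENNReal.ofReal_lt_top⟩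
  refine ⟨hm.mono fun t ht => coe_lpCurve ht, memLp_top_of_bound
    (measurable_lpCurve hf).aestronglyMeasurable (max C 0) ?_⟩
  filter_upwards [hC, hm] with t ht hmt
  rw [lpCurve, dif_pos hmt, Lp.norm_toLp]
  refine ENNReal.toReal_le_of_le_ofReal (le_max_right _ _) (ht.trans ?_)
  exact ENNReal.ofReal_le_ofReal (le_max_left _ _)

theorem memTimeSobolev_zero [NormedSpace ℝ F] {T C : ℝ} {f : ℝ → Plane → F}
    (hf : Measurable (Function.uncurry f))
    (hC : ∀ᵐ t ∂(volume.restrict (Ioo 0 T)), eLpNorm (f t) p ≤ ENNReal.ofReal C) :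
    MemTimeSobolev T 0 p f :=
  ⟨lpCurve p f, memLp_lpCurve hf hC⟩

end TimeSobolev

/-- Integration over a set is thereby a continuous functional on `L¹` and commutes with Bochner
integrals in time. -/
theorem integral_coe_L1 {A : Set Plane} (f : Lp ℝ 1 (volume : Measure Plane)) :
    ((L1.integralCLM (μ := (volume : Measure Plane).restrict A) (E := ℝ)).comp
      (LpToLpRestrictCLM Plane ℝ ℝ volume 1 A)) f = ∫ x in A, f x := by
  rw [ContinuousLinearMap.comp_apply, ← L1.integral_eq, L1.integral_eq_integral]
  exact integral_congr_ae (LpToLpRestrictCLM_coeFn ℝ A f)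

theorem fderiv_time {F : Type*} [NormedAddCommGroup F] [NormedSpace ℝ F]
    {g : ℝ × Plane → F} {z : ℝ × Plane} (hg : DifferentiableAt ℝ g z) (v : ℝ) :
    fderiv ℝ (fun s => g (s, z.2)) z.1 v = fderiv ℝ g z (v, (0 : Plane)) := by
  have h : HasFDerivAt g (fderiv ℝ g z) ((z.1, z.2) : ℝ × Plane) := hg.hasFDerivAt
  have := HasFDerivAt.comp (g := g) (f := fun s => (s, z.2)) z.1 h
    (hasFDerivAt_prodMk_left (𝕜 := ℝ) z.1 z.2)
  have e := this.fderiv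
  simp only [Function.comp_def] at e
  rw [e]
  simp

/-- An identity in `L¹` may be checked by integrating over sets of finite measure. After Fubini it
reduces, for each fixed `x`, to integration by parts in time for a scalar Lipschitz function. -/
theorem memTimeSobolev_one_one {T M C C' : ℝ} {n : ℝ × Plane → ℝ} {K : ℝ≥0} (hn : LipschitzWith K n)
    (hM : ∀ z, |n z| ≤ M) (hC : ∀ t ∈ Ioo 0 T, eLpNorm (fun x => n (t, x)) 1 ≤ ENNReal.ofReal C)
    (hC' : ∀ᵐ t ∂(volume.restrict (Ioo 0 T)),
      eLpNorm (fun x => fderiv ℝ n (t, x) ((1 : ℝ), (0 : Plane))) 1 ≤ ENNReal.ofReal C') :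
    MemTimeSobolev T 1 1 fun t x => n (t, x) := by
  have : Fact ((1 : ℝ≥0∞) ≠ ⊤) := ⟨ENNReal.one_ne_top⟩
  have hn' : Measurable (Function.uncurry fun t x => n (t, x)) := hn.continuous.measurable
  have hr' : Measurable (Function.uncurry fun t x => fderiv ℝ n (t, x) ((1 : ℝ), (0 : Plane))) :=
    measurable_fderiv_apply_const ℝ n _
  obtain ⟨hN, hNb⟩ := memLp_lpCurve (p := 1) hn' ((ae_restrict_iff' measurableSet_Ioo).2
    (Eventually.of_forall hC))
  obtain ⟨hR, hRb⟩ := memLp_lpCurve (p := 1) hr' hC'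
  set N := lpCurve 1 fun t x => n (t, x)
  set R := lpCurve 1 fun t x => fderiv ℝ n (t, x) ((1 : ℝ), (0 : Plane))
  have hNi : IntegrableOn N (Ioo 0 T) := hNb.integrable le_top
  have hRi : IntegrableOn R (Ioo 0 T) := hRb.integrable le_top
  refine ⟨N, hN, hNb, fun v => ⟨fun t => v • R t, ⟨hNi.locallyIntegrableOn,
    IntegrableOn.locallyIntegrableOn (hRi.smul v), fun φ hφ => ?_⟩, hRb.const_smul v⟩⟩
  have hφ' : Continuous fun t => fderiv ℝ φ t v :=
    (hφ.1.continuous_fderiv (by simp)).clm_apply continuous_const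
  obtain ⟨b, hb⟩ := exists_abs_le_of_hasCompactSupport hφ.1.continuous hφ.2.1
  obtain ⟨b', hb'⟩ := exists_abs_le_of_hasCompactSupport hφ' (hφ.2.1.fderiv_apply (𝕜 := ℝ) v)
  have i1 : IntegrableOn (fun t => fderiv ℝ φ t v • N t) (Ioo 0 T) :=
    Integrable.bdd_smul hNi b' hφ'.aestronglyMeasurable (Eventually.of_forall hb')
  have i2 : IntegrableOn (fun t => φ t • v • R t) (Ioo 0 T) :=
    Integrable.bdd_smul (hRi.smul v) b hφ.1.continuous.aestronglyMeasurable
      (Eventually.of_forall hb)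
  have hset : ∀ f : Lp ℝ 1 (volume : Measure Plane), ∀ A : Set Plane, IntegrableOn (f : Plane → ℝ) A :=
    fun f A => (L1.integrable_coeFn f).integrableOn
  refine Lp.ext (Lp.ae_eq_of_forall_setIntegral_eq _ _ one_ne_zero ENNReal.one_ne_top
    (fun A _ _ => hset _ A) (fun A _ _ => hset _ A) fun A hA hAfin => ?_)
  rw [← integral_coe_L1, ← integral_coe_L1, map_neg, ← ContinuousLinearMap.integral_comp_comm _ i1,
    ← ContinuousLinearMap.integral_comp_comm _ i2]
  simp_rw [map_smul, integral_coe_L1]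
  have : IsFiniteMeasure ((volume : Measure Plane).restrict A) := ⟨by simpa using hAfin⟩
  have hd : ∀ᵐ z ∂((volume : Measure ℝ).restrict (Ioo 0 T)).prod
      ((volume : Measure Plane).restrict A), DifferentiableAt ℝ n z := by
    rw [Measure.prod_restrict, ← Measure.volume_eq_prod]
    exact ae_restrict_of_ae (hn.ae_differentiableAt (μ := volume))
  have e1 : ∫ t in Ioo 0 T, fderiv ℝ φ t v • ∫ x in A, N t x
      = ∫ t in Ioo 0 T, ∫ x in A, fderiv ℝ φ t v * n (t, x) := by
    refine integral_congr_ae ?_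
    filter_upwards [hN] with t ht
    rw [integral_const_mul, smul_eq_mul, integral_congr_ae (ae_restrict_of_ae ht)]
  have e2 : ∫ t in Ioo 0 T, φ t • v • ∫ x in A, R t x
      = ∫ t in Ioo 0 T, ∫ x in A, φ t * fderiv ℝ (fun s => n (s, x)) t v := by
    refine integral_congr_ae ?_
    filter_upwards [hR, Measure.ae_ae_of_ae_prod hd] with t ht hdt
    rw [integral_congr_ae (ae_restrict_of_ae ht), integral_const_mul, smul_eq_mul, smul_eq_mul,
      ← integral_const_mul v]
    refine congrArg _ (integral_congr_ae ?_)
    filter_upwards [hdt] with x hx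
    rw [fderiv_time hx v, show ((v, (0 : Plane)) : ℝ × Plane) = v • ((1 : ℝ), (0 : Plane)) by simp,
      map_smul, smul_eq_mul]
  have j1 : Integrable (Function.uncurry fun t x => fderiv ℝ φ t v * n (t, x))
      (((volume : Measure ℝ).restrict (Ioo 0 T)).prod ((volume : Measure Plane).restrict A)) := by
    refine Integrable.of_bound (C := b' * M) ((hφ'.comp continuous_fst).mul
      hn.continuous).aestronglyMeasurable (Eventually.of_forall fun z => ?_)
    simp only [Function.uncurry, norm_mul]
    exact mul_le_mul (hb' _) (hM _) (norm_nonneg _) ((abs_nonneg _).trans (hb' 0))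
  have j2 : Integrable (Function.uncurry fun t x => φ t * fderiv ℝ (fun s => n (s, x)) t v)
      (((volume : Measure ℝ).restrict (Ioo 0 T)).prod ((volume : Measure Plane).restrict A)) := by
    refine Integrable.of_bound (C := b * (K * ‖v‖)) (((hφ.1.continuous.comp
      continuous_fst).aestronglyMeasurable.mul (measurable_fderiv_apply_const ℝ n
      (v, (0 : Plane))).aestronglyMeasurable).congr (hd.mono fun z hz => ?_))
      (Eventually.of_forall fun z => ?_)
    · simp only [Function.uncurry, Pi.mul_apply, Function.comp_apply]
      rw [fderiv_time hz v]
    · simp only [Function.uncurry, norm_mul]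
      exact mul_le_mul (hb _) (norm_fderiv_le_of_lipschitzWith (lipschitzWith_time hn z.2) _ v)
        (norm_nonneg _) ((abs_nonneg _).trans (hb 0))
  rw [e1, e2, integral_integral_swap j1, integral_integral_swap j2, ← integral_neg]
  refine integral_congr_ae (Eventually.of_forall fun x => ?_)
  exact (hasWeakDeriv_of_lipschitzWith (lipschitzWith_time hn x) isOpen_Ioo v).2.2 φ hφ

theorem eLpNorm_two_le {f : Plane → Plane} {C : ℝ} (hC : 0 ≤ C)
    (h : ∫⁻ x, ‖f x‖ₑ ^ 2 ≤ ENNReal.ofReal C) : eLpNorm f 2 ≤ ENNReal.ofReal (√C) := by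
  rw [eLpNorm_eq_lintegral_rpow_enorm_toReal two_ne_zero ENNReal.ofNat_ne_top]
  simp only [ENNReal.toReal_ofNat, ENNReal.rpow_ofNat]
  rw [Real.sqrt_eq_rpow, ← ENNReal.ofReal_rpow_of_nonneg hC (by norm_num)]
  exact ENNReal.rpow_le_rpow h (by norm_num)

theorem eLpNorm_one_le_of_integral {f : Plane → ℝ} (hf : Integrable f) {C : ℝ}
    (h : ∫ x, |f x| ≤ C) : eLpNorm f 1 ≤ ENNReal.ofReal C := by
  rw [eLpNorm_one_eq_lintegral_enorm, ← ofReal_integral_norm_eq_lintegral_enorm hf]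
  exact ENNReal.ofReal_le_ofReal h

theorem lintegral_sq_smul_le {f : Plane → Plane} {C : ℝ} (a : ℝ)
    (h : ∫⁻ x, ‖f x‖ₑ ^ 2 ≤ ENNReal.ofReal C) :
    ∫⁻ x, ‖a • f x‖ₑ ^ 2 ≤ ENNReal.ofReal (a ^ 2 * C) := by
  have e : ∀ x, ‖a • f x‖ₑ ^ 2 = ENNReal.ofReal (a ^ 2) * ‖f x‖ₑ ^ 2 := fun x => by
    rw [enorm_smul, mul_pow, ← sq_abs, ENNReal.ofReal_pow (abs_nonneg a), Real.enorm_eq_ofReal_abs]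
  simp_rw [e]
  rw [lintegral_const_mul' _ _ ENNReal.ofReal_ne_top, ENNReal.ofReal_mul (sq_nonneg a)]
  gcongr

/-! ### Regularity of the Lagrangian density and of its field. -/

namespace Data

variable {c : Constants} {d : Data} {K : ℝ} {E : ℝ → Plane → Plane} {X : ℝ → ℝ → Plane → Plane}

variable (d) in
/-- The transported quantity `n / B` on space-time. -/
def wLag (X : ℝ → ℝ → Plane → Plane) (z : ℝ × Plane) : ℝ := d.w (X 0 (clamp d.T z.1) z.2)

variable (d) in
/-- The density on space-time. -/
def nLag (X : ℝ → ℝ → Plane → Plane) (z : ℝ × Plane) : ℝ := d.B z.2 * d.wLag X z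

theorem nLag_eq (t : ℝ) : (fun x => d.nLag X (t, x)) = d.dens (X 0 (clamp d.T t)) := rfl

theorem abs_wLag_le (z : ℝ × Plane) : |d.wLag X z| ≤ d.W := by
  rw [wLag, abs_of_nonneg (d.w_nonneg _)]
  exact d.w_le _

theorem nLag_nonneg (z : ℝ × Plane) : 0 ≤ d.nLag X z := mul_nonneg (d.B_pos _).le (d.w_nonneg _)

theorem abs_nLag_le (z : ℝ × Plane) : |d.nLag X z| ≤ d.B₁ * d.W := by
  rw [abs_of_nonneg (nLag_nonneg z)]
  exact dens_le _ z.2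

theorem lipschitzWith_w : LipschitzWith (Real.toNNReal d.Lw) d.w :=
  lipschitz_of_norm_le (f := d.w) d.w_lip

theorem lipschitzWith_B_snd : LipschitzWith (Real.toNNReal d.LB) fun z : ℝ × Plane => d.B z.2 := by
  have := (lipschitz_of_norm_le (f := d.B) d.B_lip).comp (LipschitzWith.prod_snd (α := ℝ))
  rwa [mul_one] at this

section Flow

variable {M : ℝ} (h : IsField d.T M K E) (hX : d.Flow E X)
include h hX

theorem lipschitzWith_back : ∃ C, LipschitzWith C fun z : ℝ × Plane => X 0 (clamp d.T z.1) z.2 :=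
  ⟨_, hX.lipschitzWith_start (isVel h) d.T_pos.le zero_mem⟩

theorem lipschitzWith_wLag : ∃ C, LipschitzWith C (d.wLag X) := by
  obtain ⟨C, hC⟩ := lipschitzWith_back h hX
  exact ⟨_, lipschitzWith_w.comp hC⟩

theorem lipschitzWith_nLag : ∃ C, LipschitzWith C (d.nLag X) := by
  obtain ⟨C, hC⟩ := lipschitzWith_wLag h hX
  exact LipschitzWith.mul_bounded lipschitzWith_B_snd hC (fun z => d.B_abs z.2) abs_wLag_le

theorem ae_transport_wLag : ∀ᵐ z ∂(volume.restrict (slab d.T)),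
    fderiv ℝ (d.wLag X) z ((1 : ℝ), d.vel E z.1 z.2) = 0 :=
  hX.ae_transport (isVel h) d.T_pos.le zero_mem lipschitzWith_w

theorem lipschitzWith_newField {K' : ℝ} (h' : IsField d.T M K' (d.newField X)) :
    ∃ C, LipschitzWith C (Function.uncurry (d.newField X)) := by
  refine ⟨Real.toNNReal (d.Cfield * (Real.exp (d.V₁ M K * d.T) * d.V₀ M) + K'),
    lipschitz_of_norm_le fun z z' => ?_⟩
  have h1 := newField_time h hX z.1 z'.1 z.2
  have h2 := h'.lip z'.1 z.2 z'.2
  have h3 : |z.1 - z'.1| ≤ ‖z - z'‖ := norm_fst_le (z - z')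
  have h4 : ‖z.2 - z'.2‖ ≤ ‖z - z'‖ := norm_snd_le (z - z')
  have h5 : 0 ≤ K' := nonneg_of_lip (f := d.newField X 0) (h'.lip 0)
  have h6 : 0 ≤ d.Cfield * (Real.exp (d.V₁ M K * d.T) * d.V₀ M) :=
    mul_nonneg d.Cfield_nonneg (mul_nonneg (Real.exp_pos _).le (isVel h).M_nonneg)
  calc _ ≤ _ := norm_sub_le_norm_sub_add_norm_sub _ (d.newField X z'.1 z.2) _
    _ ≤ _ := add_le_add h1 h2
    _ ≤ _ := by rw [add_mul]; gcongr

/-- The backward flow preserves null sets. -/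
theorem ae_comp_back {p : Plane → Prop} (hp : ∀ᵐ y, p y) {t : ℝ} (ht : t ∈ Icc 0 d.T) :
    ∀ᵐ x, p (X 0 t x) := by
  set e := (hX.homeo (isVel h) zero_mem ht).toMeasurableEquiv
  have h1 : MeasurePreserving e (wMeasure d.B) (wMeasure d.B) := preserving h hX ht
  have h2 : MeasurePreserving (X 0 t) (wMeasure d.B) (wMeasure d.B) := h1.symm e
  have h3 : ∀ᵐ y ∂(wMeasure d.B), p y := (withDensity_absolutelyContinuous _ _).ae_le hp
  have h4 := h2.quasiMeasurePreserving.ae h3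
  refine (withDensity_absolutelyContinuous' (μ := (volume : Measure Plane))
    (f := fun x => ENNReal.ofReal (d.B x)) ?_ ?_).ae_le h4
  · exact (ENNReal.measurable_ofReal.comp d.continuous_B.measurable).aemeasurable
  · exact Eventually.of_forall fun x => (ENNReal.ofReal_pos.2 (d.B_pos x)).ne'

/-- The time derivative of the density is bounded in `L¹`. -/
theorem exists_eLpNorm_fderiv_nLag_le (hc : Compat c d)
    (hw : Integrable fun x => ‖fderiv ℝ d.w x‖) :
    ∃ C, 0 ≤ C ∧ ∀ᵐ t ∂(volume.restrict (Ioo 0 d.T)),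
      eLpNorm (fun x => fderiv ℝ (d.nLag X) (t, x) ((1 : ℝ), (0 : Plane))) 1
        ≤ ENNReal.ofReal C := by
  obtain ⟨L, hL⟩ := lipschitzWith_back h hX
  obtain ⟨C, hC⟩ := lipschitzWith_wLag h hX
  have hBw : Integrable fun y => d.B y • ‖fderiv ℝ d.w y‖ :=
    hw.bdd_smul d.B₁ d.continuous_B.aestronglyMeasurable (Eventually.of_forall d.B_abs)
  refine ⟨L * ∫ y, d.B y • ‖fderiv ℝ d.w y‖, mul_nonneg L.2 (integral_nonneg fun y =>
    smul_nonneg (d.B_pos y).le (norm_nonneg _)), ?_⟩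
  have hd : ∀ᵐ z ∂(volume.restrict (slab d.T)), DifferentiableAt ℝ (d.wLag X) z ∧
      DifferentiableAt ℝ (fun z : ℝ × Plane => X 0 (clamp d.T z.1) z.2) z :=
    ae_restrict_of_ae ((hC.ae_differentiableAt (μ := volume)).and
      (hL.ae_differentiableAt (μ := volume)))
  filter_upwards [ae_ae_slab hd, ae_restrict_mem measurableSet_Ioo] with t ht htm
  have htI := Ioo_subset_Icc_self htm
  have hi : Integrable fun x => d.B x • ‖fderiv ℝ d.w (X 0 t x)‖ := by
    refine (integrable_comp_iff h hX htI fun x => ‖fderiv ℝ d.w (X 0 t x)‖).1 ?_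
    simpa only [hX.inv (isVel h) zero_mem htI] using hBw
  have he : ∫ x, d.B x • ‖fderiv ℝ d.w (X 0 t x)‖ = ∫ y, d.B y • ‖fderiv ℝ d.w y‖ := by
    have := integral_comp h hX htI fun x => ‖fderiv ℝ d.w (X 0 t x)‖
    simpa only [hX.inv (isVel h) zero_mem htI] using this.symm
  have hb : ∀ᵐ x, ‖fderiv ℝ (d.nLag X) (t, x) ((1 : ℝ), (0 : Plane))‖
      ≤ ‖L * d.B x • ‖fderiv ℝ d.w (X 0 t x)‖‖ := by
    -- The chain rule needs `w` to be differentiable at `X 0 t x`. This holds for almost every `x`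
    -- because the backward flow pulls null sets back to null sets.
    filter_upwards [ht, ae_comp_back h hX (lipschitzWith_w.ae_differentiableAt (μ := volume)) htI]
      with x hx hwx
    have hYx : (fun z : ℝ × Plane => X 0 (clamp d.T z.1) z.2) (t, x) = X 0 t x := by
      simp only [clamp_of_mem htI]
    have e1 : fderiv ℝ (d.wLag X) (t, x) ((1 : ℝ), (0 : Plane)) = fderiv ℝ d.w (X 0 t x)
        (fderiv ℝ (fun z : ℝ × Plane => X 0 (clamp d.T z.1) z.2) (t, x) ((1 : ℝ), (0 : Plane))) := by
      have h1 : HasFDerivAt d.w (fderiv ℝ d.w (X 0 t x))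
        ((fun z : ℝ × Plane => X 0 (clamp d.T z.1) z.2) (t, x)) := by
        rw [hYx]; exact hwx.hasFDerivAt
      have := (h1.comp (t, x) hx.2.hasFDerivAt).fderiv
      simp only [Function.comp_def] at this
      unfold wLag
      rw [this]
      rfl
    have e2 : fderiv ℝ (d.nLag X) (t, x) ((1 : ℝ), (0 : Plane))
        = d.B x * fderiv ℝ (d.wLag X) (t, x) ((1 : ℝ), (0 : Plane)) := by
      have := fderiv_B_mul hc hx.1 ((1 : ℝ), (0 : Plane))
      rw [map_zero, mul_zero, add_zero] at this
      exact this
    rw [e2, e1, norm_mul, Real.norm_of_nonneg (d.B_pos x).le, norm_mul, norm_smul, norm_norm,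
      Real.norm_of_nonneg (d.B_pos x).le, Real.norm_of_nonneg L.coe_nonneg]
    have h3 := (fderiv ℝ d.w (X 0 t x)).le_opNorm (fderiv ℝ (fun z : ℝ × Plane =>
      X 0 (clamp d.T z.1) z.2) (t, x) ((1 : ℝ), (0 : Plane)))
    have h4 := norm_fderiv_le_of_lipschitzWith hL (t, x) ((1 : ℝ), (0 : Plane))
    have h5 : ‖((1 : ℝ), (0 : Plane))‖ = 1 := by simp [Prod.norm_def]
    rw [h5, mul_one] at h4
    calc _ ≤ d.B x * (‖fderiv ℝ d.w (X 0 t x)‖ * L) :=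
          mul_le_mul_of_nonneg_left (h3.trans (mul_le_mul_of_nonneg_left h4 (norm_nonneg _)))
            (d.B_pos x).le
      _ = _ := by ring
  refine (eLpNorm_mono_ae hb).trans (eLpNorm_one_le_of_integral (hi.const_mul _) (le_of_eq ?_))
  rw [← he, ← integral_const_mul]
  refine integral_congr_ae (Eventually.of_forall fun x => abs_of_nonneg ?_)
  exact mul_nonneg L.2 (smul_nonneg (d.B_pos x).le (norm_nonneg _))

end Flow

end Data

namespace Data

variable {c : Constants} {d : Data} {K M : ℝ} {E : ℝ → Plane → Plane} {X : ℝ → ℝ → Plane → Plane}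

theorem continuous_dens {Y : Plane → Plane} (hY : Continuous Y) : Continuous (d.dens Y) :=
  d.continuous_B.mul (d.continuous_w.comp hY)

/-- The density is Lipschitz in time with values in `L¹`. -/
theorem exists_integral_dens_sub_le (hc : Compat c d) (h : IsField d.T M K E) (hX : d.Flow E X)
    (hw : Integrable fun x => ‖fderiv ℝ d.w x‖) :
    ∃ C, 0 ≤ C ∧ ∀ t ∈ Icc 0 d.T, ∀ s ∈ Icc 0 d.T,
      ∫ x, |d.dens (X 0 t) x - d.dens (X 0 s) x| ≤ C * |t - s| := by
  obtain ⟨C, hC, hb⟩ := exists_eLpNorm_fderiv_nLag_le h hX hc hw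
  obtain ⟨L, hL⟩ := lipschitzWith_nLag h hX
  refine ⟨C, hC, ?_⟩
  have key : ∀ t ∈ Icc 0 d.T, ∀ s ∈ Icc 0 d.T, s ≤ t →
      ∫ x, |d.dens (X 0 t) x - d.dens (X 0 s) x| ≤ C * |t - s| := by
    intro t ht s hs hst
    set D : ℝ × Plane → ℝ := fun z => lineDeriv ℝ (d.nLag X) z ((1 : ℝ), (0 : Plane)) with hD
    have hDm : Measurable D := measurable_lineDeriv hL.continuous
    have hDb : ∀ᵐ r ∂(volume.restrict (Ioc s t)), ∫⁻ x, ‖D (r, x)‖ₑ ≤ ENNReal.ofReal C := by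
      have h1 : ∀ᵐ r ∂(volume.restrict (Ioo 0 d.T)), ∫⁻ x, ‖D (r, x)‖ₑ ≤ ENNReal.ofReal C := by
        filter_upwards [hb, ae_ae_slab (ae_restrict_of_ae (ae_fderiv_eq_lineDeriv (μ := volume) hL
          ((1 : ℝ), (0 : Plane))))] with r hr hr'
        rw [eLpNorm_one_eq_lintegral_enorm] at hr
        refine le_trans (le_of_eq (lintegral_congr_ae ?_)) hr
        filter_upwards [hr'] with x hx
        rw [hx]
      rw [Measure.restrict_congr_set Ioo_ae_eq_Ioc] at h1
      exact ae_restrict_of_ae_restrict_of_subset (Ioc_subset_Ioc hs.1 ht.2) h1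
    -- The fundamental theorem in time holds for every `x`. Tonelli then transfers the `L¹` bound on
    -- the time derivative to increments.
    have hle : ∀ x, ‖d.dens (X 0 t) x - d.dens (X 0 s) x‖ₑ ≤ ∫⁻ r in Ioc s t, ‖D (r, x)‖ₑ := by
      intro x
      have := integral_lineDeriv_time hL s t x
      rw [intervalIntegral.integral_of_le hst] at this
      have e : d.dens (X 0 t) x - d.dens (X 0 s) x = d.nLag X (t, x) - d.nLag X (s, x) := by
        simp only [nLag, wLag, dens, clamp_of_mem ht, clamp_of_mem hs]
      rw [e, ← this]
      exact enorm_integral_le_lintegral_enorm _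
    have hfin : ∫⁻ x, ‖d.dens (X 0 t) x - d.dens (X 0 s) x‖ₑ ≤ ENNReal.ofReal (C * |t - s|) := by
      calc _ ≤ ∫⁻ x, ∫⁻ r in Ioc s t, ‖D (r, x)‖ₑ := lintegral_mono hle
        _ = ∫⁻ r in Ioc s t, ∫⁻ x, ‖D (r, x)‖ₑ := by
            rw [lintegral_lintegral_swap]
            exact (hDm.comp measurable_swap).enorm.aemeasurable
        _ ≤ ∫⁻ r in Ioc s t, ENNReal.ofReal C := lintegral_mono_ae hDb
        _ = _ := by
            rw [setLIntegral_const, Real.volume_Ioc, ← ENNReal.ofReal_mul hC,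
              abs_of_nonneg (sub_nonneg.2 hst)]
    have hi : Integrable fun x => d.dens (X 0 t) x - d.dens (X 0 s) x :=
      (integrable_dens h hX ht).sub (integrable_dens h hX hs)
    rw [← ofReal_integral_norm_eq_lintegral_enorm hi] at hfin
    exact (ENNReal.ofReal_le_ofReal_iff (by positivity)).1 hfin
  intro t ht s hs
  rcases le_total s t with hst | hst
  · exact key t ht s hs hst
  · have := key s hs t ht hst
    simp_rw [abs_sub_comm t s, abs_sub_comm (d.dens (X 0 t) _)]
    exact this

/-- The trajectories move by `O(|t - s|)`, which squared bounds the far part. The near part is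
bounded by the supremum times the `L¹` norm of the density increment, each `O(|t - s|)`. The second
of these is the reason for requiring `∇w` to be integrable. -/
theorem exists_lintegral_sq_newField_sub_le (hc : Compat c d) (h : IsField d.T M K E)
    (hX : d.Flow E X) (hw : Integrable fun x => ‖fderiv ℝ d.w x‖) :
    ∃ C, 0 ≤ C ∧ ∀ t s, ∫⁻ x, ‖d.newField X t x - d.newField X s x‖ₑ ^ 2
      ≤ ENNReal.ofReal (C * (t - s) ^ 2) := by
  obtain ⟨C, hC, hb⟩ := exists_integral_dens_sub_le hc h hX hw
  have hM := (isVel h).M_nonneg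
  have hLw := d.Lw_nonneg
  have hB₁ := d.B₁_pos
  set κ := Real.exp (d.V₁ M K * d.T) with hκ
  have hκ1 : 1 ≤ κ := Real.one_le_exp (mul_nonneg (isVel h).L_nonneg d.T_pos.le)
  refine ⟨d.c₀ ^ 2 * (2 * ((d.mass * (κ * d.V₀ M)) ^ 2 * cWt)
    + 2 * (cNear ^ 2 * (d.B₁ * d.Lw * (κ * d.V₀ M) * C))), by positivity, fun t s => ?_⟩
  have ht := clamp_mem d.T_pos.le t
  have hs := clamp_mem d.T_pos.le s
  have hcl := abs_clamp_sub_le d.T t s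
  set τ := clamp d.T t
  set ς := clamp d.T s
  have hfor : ∀ y, ‖X τ 0 y - X ς 0 y‖ ≤ κ * d.V₀ M * |τ - ς| := fun y => by
    refine (hX.norm_time_sub_le (isVel h) zero_mem ht hs y).trans ?_
    rw [mul_assoc]
    exact le_mul_of_one_le_left (by positivity) hκ1
  have hback : ∀ y, ‖X 0 τ y - X 0 ς y‖ ≤ κ * d.V₀ M * |τ - ς| :=
    hX.norm_start_sub_le (isVel h) ht hs zero_mem
  have hcY : ∀ r ∈ Icc 0 d.T, Continuous (X 0 r) := fun r hr =>
    hX.continuous_space (isVel h) hr zero_mem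
  have main := lintegral_sq_field_displacement_le (n₀ := d.n₀) d.n_int
    (d.continuous_B.mul d.continuous_w).measurable (isDensity_dens h hX ht)
    (isDensity_dens h hX hs) (continuous_dens (hcY τ ht)).measurable
    (continuous_dens (hcY ς hs)).measurable (isDensity_D (d := d)) (isPush h hX ht) (isPush h hX hs)
    (a := d.B₁ * d.Lw * (κ * d.V₀ M * |τ - ς|)) (fun x => (dens_sub_le x).trans
      (mul_le_mul_of_nonneg_left (hback x) (by positivity))) hfor
  have e : ∀ x, d.newField X t x - d.newField X s x
      = d.c₀ • (field (fun y => d.dens (X 0 τ) y - d.D y) x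
        - field (fun y => d.dens (X 0 ς) y - d.D y) x) := fun x => by
    rw [smul_sub]; rfl
  simp_rw [e]
  refine (lintegral_sq_smul_le d.c₀ main).trans (ENNReal.ofReal_le_ofReal ?_)
  rw [d.integral_abs_n₀]
  have h1 := hb τ ht ς hs
  have h2 : |τ - ς| ^ 2 ≤ (t - s) ^ 2 := by
    rw [← sq_abs (t - s)]; gcongr
  have h3 := d.mass_nonneg
  calc _ ≤ d.c₀ ^ 2 * (2 * ((d.mass * (κ * d.V₀ M * |τ - ς|)) ^ 2 * cWt) + 2 * (cNear ^ 2 *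
        (d.B₁ * d.Lw * (κ * d.V₀ M * |τ - ς|) * (C * |τ - ς|)))) := by gcongr
    _ = d.c₀ ^ 2 * (2 * ((d.mass * (κ * d.V₀ M)) ^ 2 * cWt)
      + 2 * (cNear ^ 2 * (d.B₁ * d.Lw * (κ * d.V₀ M) * C))) * |τ - ς| ^ 2 := by ring
    _ ≤ _ := by gcongr

/-- A family of fields which is Lipschitz in time with values in `L²` has its time derivative
in `L^∞(L²)`. -/
theorem lintegral_sq_fderiv_le {T C : ℝ} {G : ℝ × Plane → Plane} {L : ℝ≥0} (hG : LipschitzWith L G)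
    (hC : ∀ t s, ∫⁻ x, ‖G (t, x) - G (s, x)‖ₑ ^ 2 ≤ ENNReal.ofReal (C * (t - s) ^ 2)) :
    ∀ᵐ t ∂(volume.restrict (Ioo 0 T)),
      ∫⁻ x, ‖fderiv ℝ G (t, x) ((1 : ℝ), (0 : Plane))‖ₑ ^ 2 ≤ ENNReal.ofReal C := by
  filter_upwards [ae_ae_slab (ae_restrict_of_ae (hG.ae_differentiableAt (μ := volume)))] with t ht
  set η : ℕ → ℝ := fun k => 1 / ((k : ℝ) + 1) with hη
  have hη0 : ∀ k, 0 < η k := fun k => by positivity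
  have hlim : ∀ᵐ x, Tendsto (fun k => ‖(η k)⁻¹ • (G (t + η k, x) - G (t, x))‖ₑ ^ 2) atTop
      (𝓝 (‖fderiv ℝ G (t, x) ((1 : ℝ), (0 : Plane))‖ₑ ^ 2)) := by
    filter_upwards [ht] with x hx
    have h1 : HasFDerivAt (fun s => G (s, x)) (fderiv ℝ (fun s => G (s, x)) t) t :=
      DifferentiableAt.hasFDerivAt
        (DifferentiableAt.comp (g := G) t hx (hasFDerivAt_prodMk_left (𝕜 := ℝ) t x).differentiableAt)
    have h2 := h1.hasDerivAt
    rw [fderiv_time hx 1] at h2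
    have h3 : Tendsto η atTop (𝓝[≠] 0) := by
      refine tendsto_nhdsWithin_iff.2 ⟨tendsto_one_div_add_atTop_nhds_zero_nat,
        Eventually.of_forall fun k => (hη0 k).ne'⟩
    have h4 := (hasDerivAt_iff_tendsto_slope_zero.1 h2).comp h3
    exact (ENNReal.continuous_pow 2).continuousAt.tendsto.comp
      ((continuous_enorm.tendsto _).comp h4)
  have hbound : ∀ k, ∫⁻ x, ‖(η k)⁻¹ • (G (t + η k, x) - G (t, x))‖ₑ ^ 2 ≤ ENNReal.ofReal C := by
    intro k
    refine (lintegral_sq_smul_le _ (hC (t + η k) t)).trans (le_of_eq (congrArg _ ?_))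
    have := (hη0 k).ne'
    field_simp
    ring
  have hmeas : ∀ k, Measurable fun x => ‖(η k)⁻¹ • (G (t + η k, x) - G (t, x))‖ₑ ^ 2 := by
    intro k
    have h1 : ∀ s, Continuous fun x => G (s, x) := fun s => (lipschitzWith_space hG s).continuous
    have h2 : Continuous fun x => (η k)⁻¹ • (G (t + η k, x) - G (t, x)) :=
      ((h1 (t + η k)).sub (h1 t)).const_smul (η k)⁻¹
    exact ((ENNReal.continuous_pow 2).comp (continuous_enorm.comp h2)).measurable
  -- The derivative is a limit of difference quotients whose `L²` norms are uniformly bounded, so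
  -- Fatou's lemma applies.
  rw [lintegral_congr_ae (hlim.mono fun x hx => hx.liminf_eq.symm)]
  refine (lintegral_liminf_le hmeas).trans ?_
  refine (liminf_le_liminf (Eventually.of_forall hbound)).trans ?_
  rw [liminf_const]

/-- Uniform bound for the field energy. -/
theorem exists_lintegral_sq_newField_le (h : IsField d.T M K E) (hX : d.Flow E X) :
    ∃ C, 0 ≤ C ∧ ∀ t, ∫⁻ x, ‖d.newField X t x‖ₑ ^ 2 ≤ ENNReal.ofReal C := by
  have hM := (isVel h).M_nonneg
  set m := (∫ x, ‖x‖ * d.n₀ x) + d.V₀ M * d.T * d.mass + ∫ x, |‖x‖ * d.D x| with hm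
  have hρ := d.rho₁_nonneg
  have hρ' := d.rhoSup_nonneg
  refine ⟨d.c₀ ^ 2 * (2 * (m ^ 2 * cWt) + 2 * (cNear ^ 2 * (d.rhoSup * d.rho₁))), by positivity,
    fun t => ?_⟩
  have ht := clamp_mem d.T_pos.le t
  set τ := clamp d.T t
  obtain ⟨i1, i2⟩ := integrable_moment h hX ht
  have hle : ∀ y, |d.rho (X 0 τ) y| * ‖y‖ ≤ ‖y‖ * d.dens (X 0 τ) y + |‖y‖ * d.D y| := fun y => by
    have h1 := abs_sub (d.dens (X 0 τ) y) (d.D y)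
    rw [abs_of_nonneg (dens_nonneg _ y)] at h1
    rw [abs_mul, abs_norm, rho]
    nlinarith [norm_nonneg y]
  have hmeas : Measurable (d.rho (X 0 τ)) :=
    ((continuous_dens (hX.continuous_space (isVel h) ht zero_mem)).sub d.continuous_D).measurable
  have i3 : Integrable fun y => |d.rho (X 0 τ) y| * ‖y‖ := by
    refine (i1.add d.D_mom.abs).mono' (hmeas.abs.mul measurable_norm).aestronglyMeasurable
      (Eventually.of_forall fun y => ?_)
    rw [Real.norm_of_nonneg (by positivity)]
    exact hle y
  have h3 : ∫ y, |d.rho (X 0 τ) y| * ‖y‖ ≤ m := by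
    refine (integral_mono i3 (i1.add d.D_mom.abs) hle).trans ?_
    rw [integral_add' i1 d.D_mom.abs]
    linarith
  have h0 : 0 ≤ ∫ y, |d.rho (X 0 τ) y| * ‖y‖ := integral_nonneg fun y => by positivity
  refine (lintegral_sq_smul_le d.c₀ ((isDensity_rho h hX ht).lintegral_sq_field_le hmeas
    (integral_rho h hX ht) i3)).trans (ENNReal.ofReal_le_ofReal ?_)
  have h4 := integral_abs_rho_le h hX ht
  gcongr

end Data

/-! ### The Lagrangian pair solves the system. -/

theorem locallyIntegrableOn_of_memLp_top {V F : Type*} [NormedAddCommGroup V] [MeasureSpace V]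
    [OpensMeasurableSpace V] [IsLocallyFiniteMeasure (volume : Measure V)] [NormedAddCommGroup F]
    {Ω : Set V} {f : V → F} (hf : MemLp f ⊤ (volume.restrict Ω)) : LocallyIntegrableOn f Ω :=
  locallyIntegrableOn_of_locallyIntegrable_restrict (hf.locallyIntegrable le_top)

theorem ae_slab_of_ae {T : ℝ} {p : Plane → Prop} (h : ∀ᵐ x, p x) :
    ∀ᵐ z ∂(volume.restrict (slab T)), p z.2 := by
  rw [volume_restrict_slab]
  exact Measure.quasiMeasurePreserving_snd.ae h

theorem measurable_toPlane {α : Type*} [MeasurableSpace α] {f : Fin 2 → α → ℝ}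
    (hf : ∀ i, Measurable (f i)) : Measurable fun a => (WithLp.toLp 2 fun i => f i a : Plane) :=
  (WithLp.measurable_toLp 2 (Fin 2 → ℝ)).comp (measurable_pi_lambda _ hf)

theorem norm_le_add_abs (w : Plane) : ‖w‖ ≤ |w 0| + |w 1| := by
  conv_lhs => rw [plane_decomp w]
  refine (norm_add_le _ _).trans ?_
  rw [norm_smul, norm_smul, norm_basisVec, norm_basisVec, mul_one, mul_one, Real.norm_eq_abs,
    Real.norm_eq_abs]

theorem measurable_spaceGrad (u : ℝ × Plane → ℝ) : Measurable (spaceGrad u) :=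
  measurable_toPlane fun i => measurable_fderiv_apply_const ℝ u ((0 : ℝ), basisVec i)

theorem norm_zero_basisVec (i : Fin 2) : ‖((0 : ℝ), basisVec i)‖ = 1 := by
  simp [Prod.norm_def]

theorem norm_spaceGrad_le {u : ℝ × Plane → ℝ} {C : ℝ≥0} (hu : LipschitzWith C u) (z : ℝ × Plane) :
    ‖spaceGrad u z‖ ≤ 2 * C := by
  have h := fun i => norm_fderiv_le_of_lipschitzWith hu z ((0 : ℝ), basisVec i)
  simp only [norm_zero_basisVec, mul_one] at h
  refine (norm_le_add_abs _).trans ?_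
  have h0 := h 0
  have h1 := h 1
  rw [Real.norm_eq_abs] at h0 h1
  simp only [spaceGrad]
  linarith

namespace Data

variable {c : Constants} {d : Data} {K : ℝ} {E : ℝ → Plane → Plane} {X : ℝ → ℝ → Plane → Plane}

/-- On each time slice this is Gauss' law for the kernel, and `c₀ = q / (2π ε₀)` is the
normalization that cancels the mass `2π`. The given background is replaced by its Lipschitz
representative, which changes no integral. -/
theorem weak_gauss (hc : Compat c d) (h : IsField d.T d.Mfield K E) (hX : d.Flow E X)
    (hfix : E = d.newField X) {D : Plane → ℝ} (hD : D =ᵐ[volume] d.D) :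
    HasWeakSpaceDiv d.T (fun t x => c.ε₀ • E t x) fun t x => c.q * (d.nLag X (t, x) - D x) := by
  obtain ⟨Cn, hCn⟩ := lipschitzWith_nLag h hX
  have hDz : ∀ᵐ z ∂(volume.restrict (slab d.T)), D z.2 = d.D z.2 := ae_slab_of_ae hD
  have hcont : Continuous fun z : ℝ × Plane => c.q * (d.nLag X z - d.D z.2) :=
    continuous_const.mul (hCn.continuous.sub (d.continuous_D.comp continuous_snd))
  have hE : Continuous fun z : ℝ × Plane => c.ε₀ • E z.1 z.2 := h.continuous.const_smul c.ε₀
  have hm : MemLp (fun z : ℝ × Plane => c.q * (d.nLag X z - d.D z.2)) ⊤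
      (volume.restrict (slab d.T)) := by
    refine memLp_top_of_bound hcont.aestronglyMeasurable (|c.q| * (d.B₁ * d.W + d.RD))
      (Eventually.of_forall fun z => ?_)
    rw [norm_mul, Real.norm_eq_abs, Real.norm_eq_abs]
    gcongr
    exact (abs_sub _ _).trans (add_le_add (abs_nLag_le z) (d.D_bound _))
  refine ⟨hE.locallyIntegrable.locallyIntegrableOn _, locallyIntegrableOn_of_memLp_top
    (hm.ae_eq (hDz.mono fun z hz => by simp only [Function.uncurry, hz])), fun φ hφ => ?_⟩
  obtain ⟨L, hL⟩ := hφ.exists_lipschitzWith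
  have e1 : ∫ z in slab d.T, φ z * (c.q * (d.nLag X (z.1, z.2) - D z.2))
      = ∫ z in slab d.T, φ z * (c.q * (d.nLag X z - d.D z.2)) :=
    integral_congr_ae (hDz.mono fun z hz => by simp only [hz])
  have hi : Integrable fun z : ℝ × Plane => φ z * (c.q * (d.nLag X z - d.D z.2)) :=
    (hφ.1.continuous.mul hcont).integrable_of_hasCompactSupport hφ.2.1.mul_right
  rw [e1, setIntegral_slab_fderiv hL hφ.2.1 hE, setIntegral_slab hi.integrableOn, ← integral_neg]
  refine setIntegral_congr_fun measurableSet_Ioo fun t ht => ?_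
  have hcl := clamp_mem d.T_pos.le t
  have hf := (isDensity_rho h hX hcl).integral_fderiv_field_eq (lipschitzWith_space hL t)
    (hasCompactSupport_slice hφ.2.1 t)
  have e2 : ∀ x, fderiv ℝ (fun x => φ (t, x)) x (c.ε₀ • E t x) = c.ε₀ * d.c₀ *
      fderiv ℝ (fun x => φ (t, x)) x (field (d.rho (X 0 (clamp d.T t))) x) := fun x => by
    rw [hfix, newField, smul_smul, map_smul, smul_eq_mul]
  simp only [e2]
  rw [integral_const_mul, hf, hc.c₀_eq, mul_neg, neg_inj, ← integral_const_mul,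
    ← integral_const_mul]
  refine integral_congr_ae (Eventually.of_forall fun x => ?_)
  have hε := c.ε₀_pos.ne'
  have hπ := Real.pi_ne_zero
  simp only [rho, nLag, wLag, dens]
  field_simp

theorem weak_curlFree {F : ℝ → Plane → Plane} {T : ℝ} (hF : Continuous (Function.uncurry F))
    (hs : ∀ t ∈ Ioo 0 T, IsSolenoidal fun x => rot (F t x)) : WeakCurlFree T F := by
  have e : ∀ t x, (!₂[F t x 1, - F t x 0] : Plane) = (-1 : ℝ) • rot (F t x) := fun t x => by
    ext i
    fin_cases i <;> simp
  have hG : Continuous fun z : ℝ × Plane => (-1 : ℝ) • rot (F z.1 z.2) :=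
    (rot.continuous.comp hF).const_smul (-1 : ℝ)
  refine ⟨?_, (continuous_const (y := (0 : ℝ))).locallyIntegrable.locallyIntegrableOn _,
    fun φ hφ => ?_⟩
  · simp only [e]
    exact hG.locallyIntegrable.locallyIntegrableOn _
  · obtain ⟨L, hL⟩ := hφ.exists_lipschitzWith
    simp only [e, mul_zero, integral_zero, neg_zero]
    exact setIntegral_slab_solenoidal hL hφ.2.1 hG fun t ht => (hs t ht).smul (-1)

theorem locallyIntegrableOn_flux {n : ℝ → Plane → ℝ} {g : ℝ → Plane → Plane} {Mn Mg M : ℝ}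
    (hB : Continuous d.B) (hn : Continuous (Function.uncurry n)) (hnb : ∀ t x, |n t x| ≤ Mn)
    (hg : Measurable (Function.uncurry g)) (hgb : ∀ t x, ‖g t x‖ ≤ Mg)
    (hE : Continuous (Function.uncurry E)) (hEb : ∀ t x, ‖E t x‖ ≤ M) :
    LocallyIntegrableOn (Function.uncurry (c.flux d.B n g E)) (slab d.T) := by
  have hω : Continuous fun x => (c.omegaC d.B x)⁻¹ :=
    ((continuous_const.mul hB).div_const _).inv₀ fun x =>
      div_ne_zero (mul_ne_zero c.q_ne (d.B_pos x).ne') c.m_pos.ne'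
  have h1 : Measurable fun z : ℝ × Plane => rot (c.σ • g z.1 z.2 - (c.q / c.m * n z.1 z.2) • E z.1 z.2) :=
    rot.continuous.measurable.comp ((hg.const_smul c.σ).sub
      ((continuous_const.mul hn).smul hE).measurable)
  have h2 : Measurable (Function.uncurry (c.flux d.B n g E)) :=
    (hω.comp continuous_snd).measurable.smul h1
  have hMn : 0 ≤ Mn := (abs_nonneg _).trans (hnb 0 0)
  refine locallyIntegrableOn_of_memLp_top (memLp_top_of_bound h2.aestronglyMeasurable
    (|c.m| / |c.q| * d.B₀⁻¹ * (|c.σ| * Mg + |c.q / c.m| * Mn * M)) (Eventually.of_forall fun z => ?_))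
  have e : (c.omegaC d.B z.2)⁻¹ = c.m / c.q * (d.B z.2)⁻¹ := by
    rw [Constants.omegaC, inv_div, div_mul_eq_div_div]
    rfl
  rw [Function.uncurry, Constants.flux, e, ← rot_apply, norm_smul, norm_rot, norm_mul,
    Real.norm_of_nonneg (inv_pos.2 (d.B_pos _)).le, Real.norm_eq_abs, abs_div]
  have h3 : ‖c.σ • g z.1 z.2 - (c.q / c.m * n z.1 z.2) • E z.1 z.2‖
      ≤ |c.σ| * Mg + |c.q / c.m| * Mn * M := by
    refine (norm_sub_le _ _).trans (add_le_add ?_ ?_)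
    · rw [norm_smul]
      exact mul_le_mul_of_nonneg_left (hgb _ _) (norm_nonneg _)
    · rw [norm_smul, norm_mul]
      exact mul_le_mul (mul_le_mul_of_nonneg_left (hnb _ _) (norm_nonneg _)) (hEb _ _)
        (norm_nonneg _) (mul_nonneg (abs_nonneg _) hMn)
  exact mul_le_mul (mul_le_mul_of_nonneg_left (d.inv_B_le _) (by positivity)) h3 (norm_nonneg _)
    (mul_nonneg (by positivity) (inv_pos.2 d.B₀_pos).le)

section Assemble

variable (hc : Compat c d) (h : IsField d.T d.Mfield K E) (hX : d.Flow E X)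
  (hfix : E = d.newField X)
include h hX hfix

theorem lipschitzWith_field : ∃ C, LipschitzWith C (Function.uncurry E) := by
  have := lipschitzWith_newField h hX (hfix ▸ h)
  rwa [← hfix] at this

theorem memTimeSobolev_field : MemTimeSobolev d.T 0 2 E := by
  have : Fact ((2 : ℝ≥0∞) ≠ ⊤) := ⟨ENNReal.ofNat_ne_top⟩
  obtain ⟨C, hC, hb⟩ := exists_lintegral_sq_newField_le h hX
  rw [← hfix] at hb
  exact memTimeSobolev_zero h.continuous.measurable
    (Eventually.of_forall fun t => eLpNorm_two_le hC (hb t))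

include hc in
theorem isRegularSolution {D n₀ : Plane → ℝ} (hD : D =ᵐ[volume] d.D) (hn₀ : n₀ =ᵐ[volume] d.n₀) :
    c.IsRegularSolution d.T d.B D n₀ (fun t x => d.nLag X (t, x)) E := by
  obtain ⟨Cn, hCn⟩ := lipschitzWith_nLag h hX
  obtain ⟨Cw, hCw⟩ := lipschitzWith_wLag h hX
  obtain ⟨CE, hCE⟩ := lipschitzWith_field h hX hfix
  exact
    { nonneg := fun t _ x => nLag_nonneg _
      n_cont := hCn.continuous.continuousOn
      E_cont := h.continuous.continuousOn
      n_mem := memSobolev_one_of_lipschitzWith (u := d.nLag X) hCn abs_nLag_le (isOpen_slab _)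
      E_mem := memSobolev_one_of_lipschitzWith hCE (fun z => h.bound z.1 z.2) (isOpen_slab _)
      E_energy := memTimeSobolev_field h hX hfix
      transport := by
        refine ⟨fun t x => fderiv ℝ (d.nLag X) (t, x) ((1 : ℝ), (0 : Plane)),
          fun t x => spaceGrad (d.nLag X) (t, x),
          hasWeakDeriv_of_lipschitzWith (u := d.nLag X) hCn (isOpen_slab _) _,
          fun i => hasWeakDeriv_of_lipschitzWith (u := d.nLag X) hCn (isOpen_slab _) _,
          locallyIntegrableOn_flux d.continuous_B hCn.continuous (fun t x => abs_nLag_le (t, x))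
            (measurable_spaceGrad _) (fun t x => norm_spaceGrad_le hCn (t, x)) h.continuous h.bound,
          locallyIntegrableOn_of_memLp_top ((memLp_top_fderiv hCn _).restrict _).neg,
          fun φ hφ => ?_⟩
        have := setIntegral_flux hc hCw abs_wLag_le h.continuous h.curl
          (g := fun t x => spaceGrad (d.nLag X) (t, x)) (fun i => Eventually.of_forall fun z => rfl) hφ
        refine this.trans (congrArg _ (integral_congr_ae ?_))
        -- The weak flux has become `B V · ∇w`. By the transport equation it equals `-B ∂ₜw = -∂ₜn`,
        -- since `B` does not depend on time.
        filter_upwards [ae_transport_wLag h hX, ae_restrict_of_ae (hCw.ae_differentiableAt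
          (μ := volume))] with z hz hdz
        have e1 := fderiv_B_mul hc hdz ((1 : ℝ), (0 : Plane))
        rw [map_zero, mul_zero, add_zero] at e1
        have e2 : fderiv ℝ (d.nLag X) (z.1, z.2) ((1 : ℝ), (0 : Plane))
          = d.B z.2 * fderiv ℝ (d.wLag X) z ((1 : ℝ), (0 : Plane)) := e1
        rw [show (((1 : ℝ), d.vel E z.1 z.2) : ℝ × Plane) = ((1 : ℝ), (0 : Plane))
          + ((0 : ℝ), d.vel E z.1 z.2) by simp, map_add] at hz
        simp only [e2]
        linear_combination (φ z * d.B z.2) * hz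
      gauss := weak_gauss hc h hX hfix hD
      curl_free := weak_curlFree h.continuous h.curl
      initial := by
        filter_upwards [hn₀] with x hx
        rw [hx, nLag, wLag, clamp_of_mem zero_mem, hX.self 0 zero_mem]
        rfl }

theorem memTimeSobolev_moment : MemTimeSobolev d.T 0 1 fun t x => ‖x‖ * d.nLag X (t, x) := by
  have : Fact ((1 : ℝ≥0∞) ≠ ⊤) := ⟨ENNReal.one_ne_top⟩
  obtain ⟨Cn, hCn⟩ := lipschitzWith_nLag h hX
  refine memTimeSobolev_zero (C := (∫ x, ‖x‖ * d.n₀ x) + d.V₀ d.Mfield * d.T * d.mass)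
    (measurable_snd.norm.mul hCn.continuous.measurable) (Eventually.of_forall fun t => ?_)
  obtain ⟨i1, i2⟩ := integrable_moment h hX (clamp_mem d.T_pos.le t)
  refine eLpNorm_one_le_of_integral i1 ?_
  have e : ∫ x, |‖x‖ * d.nLag X (t, x)| = ∫ x, ‖x‖ * d.dens (X 0 (clamp d.T t)) x :=
    integral_congr_ae (Eventually.of_forall fun x =>
      abs_of_nonneg (mul_nonneg (norm_nonneg x) (nLag_nonneg (t, x))))
  exact e.le.trans i2

include hc in
theorem memTimeSobolev_density (hw : Integrable fun x => ‖fderiv ℝ d.w x‖) :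
    MemTimeSobolev d.T 1 1 fun t x => d.nLag X (t, x) := by
  obtain ⟨Cn, hCn⟩ := lipschitzWith_nLag h hX
  obtain ⟨C, -, hb⟩ := exists_eLpNorm_fderiv_nLag_le h hX hc hw
  refine memTimeSobolev_one_one (C := d.mass) hCn abs_nLag_le (fun t ht => ?_) hb
  have hcl := clamp_mem d.T_pos.le t
  refine eLpNorm_one_le_of_integral (integrable_dens h hX hcl) ?_
  have e : ∫ x, |d.nLag X (t, x)| = ∫ x, d.dens (X 0 (clamp d.T t)) x :=
    integral_congr_ae (Eventually.of_forall fun x => abs_of_nonneg (nLag_nonneg (t, x)))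
  exact (e.trans (integral_dens h hX hcl)).le

include hc in
theorem exists_time_derivative (hw : Integrable fun x => ‖fderiv ℝ d.w x‖) :
    ∃ E_t : ℝ → Plane → Plane, HasWeakTimeDeriv d.T E E_t ∧ MemTimeSobolev d.T 0 2 E_t := by
  have : Fact ((2 : ℝ≥0∞) ≠ ⊤) := ⟨ENNReal.ofNat_ne_top⟩
  obtain ⟨CE, hCE⟩ := lipschitzWith_field h hX hfix
  obtain ⟨C, hC, hb⟩ := exists_lintegral_sq_newField_sub_le hc h hX hw
  rw [← hfix] at hb
  refine ⟨fun t x => fderiv ℝ (Function.uncurry E) (t, x) ((1 : ℝ), (0 : Plane)),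
    hasWeakDeriv_of_lipschitzWith hCE (isOpen_slab _) _,
    memTimeSobolev_zero (C := √C) (measurable_fderiv_apply_const ℝ (Function.uncurry E) _) ?_⟩
  filter_upwards [lintegral_sq_fderiv_le (G := Function.uncurry E) hCE hb] with t ht
  exact eLpNorm_two_le hC ht

end Assemble

end Data

/-! ### Uniqueness. -/

theorem lipschitzWith_clamp (T : ℝ) :
    LipschitzWith 1 fun z : ℝ × Plane => ((clamp T z.1, z.2) : ℝ × Plane) :=
  LipschitzWith.mk_one fun z z' => max_le_max (abs_clamp_sub_le T z.1 z'.1) le_rfl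

/-- A function of class `W^{1,∞}` on the slab which is continuous on its closure agrees there with
a bounded Lipschitz function on the whole space. -/
theorem exists_slab_rep {T : ℝ} (hT : 0 < T) {u : ℝ × Plane → ℝ}
    (hc : ContinuousOn u (Icc 0 T ×ˢ univ)) (hu : MemLp u ⊤ (volume.restrict (slab T)))
    (h : ∀ v, ∃ g, HasWeakDeriv (slab T) v u g ∧ MemLp g ⊤ (volume.restrict (slab T))) :
    ∃ (w : ℝ × Plane → ℝ) (C : ℝ≥0) (M : ℝ), LipschitzWith C w ∧ (∀ z, |w z| ≤ M) ∧
      EqOn u w (Icc 0 T ×ˢ univ) := by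
  have hsub : slab T ⊆ Icc 0 T ×ˢ univ := prod_mono Ioo_subset_Icc_self subset_rfl
  obtain ⟨w, C, hw, huw⟩ := exists_lipschitz_rep (isOpen_slab T)
    ((convex_Ioo 0 T).prod convex_univ)
    (memLp_indicator_locallyIntegrable (measurableSet_slab T) hu) h
  have heq := eq_on_of_ae_eq (isOpen_slab T) hsub (closure_slab hT).ge hc hw.continuous.continuousOn
    huw
  obtain ⟨M, hM⟩ := ae_abs_le_of_memLp_top hu
  -- The essential bound is written as the equality `max |w| M = M` of continuous functions, so that
  -- it passes from almost every point to every point of the closed slab.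
  have hb : EqOn (fun z => max |w z| M) (fun _ => M) (Icc 0 T ×ˢ univ) :=
    eq_on_of_ae_eq (isOpen_slab T) hsub (closure_slab hT).ge
      (hw.continuous.abs.max continuous_const).continuousOn continuousOn_const (by
        filter_upwards [hM, huw] with z h1 h2
        exact max_eq_right (h2 ▸ h1))
  refine ⟨fun z => w (clamp T z.1, z.2), _, M, hw.comp (lipschitzWith_clamp T), fun z => ?_,
    fun z hz => ?_⟩
  · exact max_eq_right_iff.1 (hb (x := (clamp T z.1, z.2)) ⟨clamp_mem hT.le _, mem_univ _⟩)
  · show u z = w (clamp T z.1, z.2)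
    rw [heq hz, clamp_of_mem hz.1]

theorem HasWeakDeriv.coord {Ω : Set (ℝ × Plane)} (hΩ : IsOpen Ω) {v : ℝ × Plane}
    {u g : ℝ × Plane → Plane} (h : HasWeakDeriv Ω v u g) (i : Fin 2) :
    HasWeakDeriv Ω v (fun z => u z i) fun z => g z i := by
  have hl : ∀ {f : ℝ × Plane → Plane}, LocallyIntegrableOn f Ω →
      LocallyIntegrableOn (fun z => f z i) Ω := fun hf z hz => by
    obtain ⟨s, hs, hi⟩ := hf z hz
    exact ⟨s, hs, (EuclideanSpace.proj (𝕜 := ℝ) i).integrable_comp hi⟩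
  refine ⟨hl h.1, hl h.2.1, fun φ hφ => ?_⟩
  have := congrArg (fun w : Plane => w i) (h.integral_eq hφ)
  rw [hφ.setIntegral_fderiv (fun z => u z i) fun _ => v, hφ.setIntegral]
  have e1 := (EuclideanSpace.proj (𝕜 := ℝ) i).integral_comp_comm
    (hφ.integrable_fderiv_smul hΩ h.1 v)
  have e2 := (EuclideanSpace.proj (𝕜 := ℝ) i).integral_comp_comm (hφ.integrable_smul hΩ h.2.1)
  exact e1.trans (this.trans (congrArg Neg.neg e2.symm))

theorem exists_slab_rep_field {T : ℝ} (hT : 0 < T) {u : ℝ × Plane → Plane}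
    (hc : ContinuousOn u (Icc 0 T ×ˢ univ)) (hu : MemSobolev ⊤ (slab T) 1 u) :
    ∃ (w : ℝ × Plane → Plane) (C : ℝ≥0) (M : ℝ), LipschitzWith C w ∧ (∀ z, ‖w z‖ ≤ M) ∧
      EqOn u w (Icc 0 T ×ˢ univ) := by
  have key : ∀ i : Fin 2, ∃ (w : ℝ × Plane → ℝ) (C : ℝ≥0) (M : ℝ), LipschitzWith C w ∧
      (∀ z, |w z| ≤ M) ∧ EqOn (fun z => u z i) w (Icc 0 T ×ˢ univ) := fun i =>
    exists_slab_rep hT ((EuclideanSpace.proj (𝕜 := ℝ) i).continuous.comp_continuousOn hc)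
      ((EuclideanSpace.proj (𝕜 := ℝ) i).comp_memLp' hu.1) fun v => by
        obtain ⟨g, hg, hg'⟩ := hu.2 v
        exact ⟨_, hg.coord (isOpen_slab T) i, (EuclideanSpace.proj (𝕜 := ℝ) i).comp_memLp' hg'⟩
  choose w C M hw hM he using key
  refine ⟨fun z => WithLp.toLp 2 fun i => w i z, _, M 0 + M 1, lipschitz_of_norm_le (C := C 0 + C 1)
    fun z z' => ?_, fun z => ?_, fun z hz => ?_⟩
  · refine (norm_le_add_abs _).trans ?_
    rw [add_mul]
    exact add_le_add (abs_sub_le_of_lipschitzWith (hw 0) z z')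
      (abs_sub_le_of_lipschitzWith (hw 1) z z')
  · exact (norm_le_add_abs _).trans (add_le_add (hM 0 z) (hM 1 z))
  · ext i
    exact he i hz

/-- A weak divergence equation on the slab with continuous data holds at each time. -/
theorem integral_fderiv_slice_eq {T : ℝ} {G : ℝ × Plane → Plane} {ρ : ℝ × Plane → ℝ}
    (hG : Continuous G) (hρ : Continuous ρ)
    (h : ∀ φ, IsTestFunction (slab T) φ →
      ∫ z in slab T, fderiv ℝ φ z ((0 : ℝ), G z) = - ∫ z in slab T, φ z * ρ z)
    {t : ℝ} (ht : t ∈ Ioo 0 T) {χ : Plane → ℝ} (hχ : ContDiff ℝ ∞ χ) (hc : HasCompactSupport χ) :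
    ∫ x, fderiv ℝ χ x (G (t, x)) = - ∫ x, χ x * ρ (t, x) := by
  have hA1 : Continuous fun t => ∫ x, fderiv ℝ χ x (G (t, x)) := by
    have hf : Continuous (Function.uncurry fun (t : ℝ) x => fderiv ℝ χ x (G (t, x))) :=
      ((hχ.continuous_fderiv (by simp)).comp continuous_snd).clm_apply hG
    refine (continuous_parametric_integral_of_continuous (μ := volume) hf hc).congr fun t => ?_
    exact setIntegral_eq_integral_of_forall_compl_eq_zero fun z hz => by
      rw [fderiv_of_notMem_tsupport (𝕜 := ℝ) hz]; simp
  have hA2 : Continuous fun t => ∫ x, χ x * ρ (t, x) := by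
    have hf : Continuous (Function.uncurry fun (t : ℝ) x => χ x * ρ (t, x)) :=
      (hχ.continuous.comp continuous_snd).mul hρ
    refine (continuous_parametric_integral_of_continuous (μ := volume) hf hc).congr fun t => ?_
    exact setIntegral_eq_integral_of_forall_compl_eq_zero fun z hz => by
      rw [image_eq_zero_of_notMem_tsupport hz, zero_mul]
  -- Testing with products `θ(t) χ(x)` shows that this continuous function of time vanishes almost
  -- everywhere on `(0,T)`, hence at every time there.
  set A : ℝ → ℝ := fun t => (∫ x, fderiv ℝ χ x (G (t, x))) + ∫ x, χ x * ρ (t, x) with hA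
  have h0 := isOpen_Ioo.ae_eq_zero_of_integral_contDiff_smul_eq_zero (U := Ioo 0 T) (f := A)
    (μ := volume) ((hA1.add hA2).locallyIntegrable.locallyIntegrableOn _) fun θ h1 h2 h3 => by
      have hts : tsupport (fun z : ℝ × Plane => θ z.1 * χ z.2) ⊆ tsupport θ ×ˢ tsupport χ :=
        closure_minimal (fun z hz => ⟨subset_tsupport _ (left_ne_zero_of_mul hz),
          subset_tsupport _ (right_ne_zero_of_mul hz)⟩)
          ((isClosed_tsupport _).prod (isClosed_tsupport _))
      have hφ : IsTestFunction (slab T) fun z : ℝ × Plane => θ z.1 * χ z.2 :=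
        ⟨(h1.comp contDiff_fst).mul (hχ.comp contDiff_snd),
          (h2.isCompact.prod hc.isCompact).of_isClosed_subset (isClosed_tsupport _) hts,
          hts.trans (prod_mono h3 (subset_univ _))⟩
      obtain ⟨L, hL⟩ := hφ.exists_lipschitzWith
      have e := h _ hφ
      have hi : Integrable fun z : ℝ × Plane => θ z.1 * χ z.2 * ρ z :=
        (hφ.1.continuous.mul hρ).integrable_of_hasCompactSupport hφ.2.1.mul_right
      rw [setIntegral_slab_fderiv hL hφ.2.1 hG, setIntegral_slab hi.integrableOn] at e
      have hd : ∀ t x, fderiv ℝ (fun x => θ t * χ x) x (G (t, x))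
          = θ t * fderiv ℝ χ x (G (t, x)) := fun t x => by
        rw [fderiv_const_mul (hχ.differentiable (by simp) x)]
        rfl
      simp only [hd, mul_assoc, integral_const_mul] at e
      have hi' : ∀ {f : ℝ → ℝ}, Continuous f → Integrable fun t => θ t * f t := fun hf =>
        (h1.continuous.mul hf).integrable_of_hasCompactSupport h2.mul_right
      have hsupp : ∀ f : ℝ → ℝ, ∫ t in Ioo 0 T, θ t * f t = ∫ t, θ t * f t := fun f =>
        setIntegral_eq_integral_of_forall_compl_eq_zero fun z hz => by
          rw [image_eq_zero_of_notMem_tsupport fun hz' => hz (h3 hz'), zero_mul]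
      rw [hsupp, hsupp] at e
      simp only [hA, smul_eq_mul, mul_add]
      rw [integral_add (hi' hA1) (hi' hA2), e, neg_add_cancel]
  have := eq_on_of_ae_eq isOpen_Ioo subset_rfl subset_closure (hA1.add hA2).continuousOn
    (continuousOn_const (c := (0 : ℝ))) ((ae_restrict_iff' measurableSet_Ioo).2 h0) ht
  exact eq_neg_of_add_eq_zero_left this

/-- For a Lipschitz field, smooth tests already force the pointwise divergence to vanish almost
everywhere. Integration by parts then covers all Lipschitz tests. -/
theorem isSolenoidal_of_smooth {G : Plane → Plane} {C : ℝ≥0} (hG : LipschitzWith C G)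
    (h : ∀ χ : Plane → ℝ, ContDiff ℝ ∞ χ → HasCompactSupport χ → ∫ x, fderiv ℝ χ x (G x) = 0) :
    IsSolenoidal G := by
  have hl : LocallyIntegrable (divg G) :=
    (((EuclideanSpace.proj (𝕜 := ℝ) (0 : Fin 2)).comp_memLp' (memLp_top_fderiv hG (basisVec 0))).add
      ((EuclideanSpace.proj (𝕜 := ℝ) (1 : Fin 2)).comp_memLp'
        (memLp_top_fderiv hG (basisVec 1)))).locallyIntegrable le_top
  have h0 := ae_eq_zero_of_integral_contDiff_smul_eq_zero hl fun χ h1 h2 => by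
    obtain ⟨L, hL⟩ := h1.lipschitzWith_of_hasCompactSupport h2 (by simp)
    have := integral_fderiv_apply_field hL h2 hG
    rw [h χ h1 h2, zero_eq_neg] at this
    exact this
  intro φ D hφ hc
  rw [integral_fderiv_apply_field hφ hc hG, neg_eq_zero]
  exact integral_eq_zero_of_ae (h0.mono fun x hx => by simp [hx])

/-- Liouville's theorem for bounded fields without divergence and curl. -/
theorem eq_of_solenoidal {H : Plane → Plane} {M : ℝ} (hH : Continuous H) (hM : ∀ x, ‖H x‖ ≤ M)
    (hd : ∀ χ : Plane → ℝ, ContDiff ℝ ∞ χ → HasCompactSupport χ → ∫ x, fderiv ℝ χ x (H x) = 0)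
    (hr : ∀ χ : Plane → ℝ, ContDiff ℝ ∞ χ → HasCompactSupport χ →
      ∫ x, fderiv ℝ χ x (rot (H x)) = 0) (x y : Plane) : H x = H y := by
  have hc : ∀ i : Fin 2, Continuous fun x => H x i := fun i =>
    (EuclideanSpace.proj (𝕜 := ℝ) i).continuous.comp hH
  set u : ℕ → Fin 2 → Plane → ℝ := fun k i => mollify k fun x => H x i with hu
  have hsm : ∀ k i, ContDiff ℝ ∞ (u k i) := fun k i => contDiff_mollify k (hc i).locallyIntegrable
  have hint : ∀ k (x v : Plane) i, Integrable fun y => fderiv ℝ (moll k) (x - y) v * H y i :=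
    fun k x v i => ((((contDiff_moll k).continuous_fderiv (by simp)).comp
      (continuous_const.sub continuous_id)).clm_apply continuous_const).mul (hc i)
      |>.integrable_of_hasCompactSupport ((hasCompactSupport_comp_sub_left
        ((hasCompactSupport_moll k).fderiv_apply (𝕜 := ℝ) v) x).mul_right)
  have hfd : ∀ k x v i, fderiv ℝ (u k i) x v = ∫ y, fderiv ℝ (moll k) (x - y) v * H y i :=
    fun k x v i => fderiv_mollify k (hc i).locallyIntegrable x v
  have hχ : ∀ k (x : Plane), ContDiff ℝ ∞ (fun y : Plane => moll k (x - y)) ∧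
      HasCompactSupport fun y : Plane => moll k (x - y) := fun k x =>
    ⟨(contDiff_moll k).comp (contDiff_const.sub contDiff_id),
      hasCompactSupport_comp_sub_left (hasCompactSupport_moll k) x⟩
  have hfs : ∀ k (x y v : Plane), fderiv ℝ (fun y => moll k (x - y)) y v
      = - fderiv ℝ (moll k) (x - y) v := fun k x y v =>
    fderiv_comp_sub_left ((contDiff_moll k).differentiable (by simp)) x y v
  -- Testing with translates of the mollifier turns the weak divergence equation into a classical
  -- one for the mollified components; `hcurl` does the same for the curl.
  have hdiv : ∀ k x, fderiv ℝ (u k 0) x (basisVec 0) = - fderiv ℝ (u k 1) x (basisVec 1) := by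
    intro k x
    have := hd _ (hχ k x).1 (hχ k x).2
    have e : ∀ y, fderiv ℝ (fun y => moll k (x - y)) y (H y)
        = -(fderiv ℝ (moll k) (x - y) (basisVec 0) * H y 0
          + fderiv ℝ (moll k) (x - y) (basisVec 1) * H y 1) := fun y => by
      rw [hfs, fderiv_apply_plane _ (H y)]
      ring
    simp only [e] at this
    rw [integral_neg, integral_add (hint k x _ 0) (hint k x _ 1), ← hfd, ← hfd] at this
    linarith
  have hcurl : ∀ k x, fderiv ℝ (u k 0) x (basisVec 1) = fderiv ℝ (u k 1) x (basisVec 0) := by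
    intro k x
    have := hr _ (hχ k x).1 (hχ k x).2
    have e : ∀ y, fderiv ℝ (fun y => moll k (x - y)) y (rot (H y))
        = fderiv ℝ (moll k) (x - y) (basisVec 0) * H y 1
          - fderiv ℝ (moll k) (x - y) (basisVec 1) * H y 0 := fun y => by
      rw [hfs, fderiv_apply_plane _ (rot (H y)), rot_zero_coord, rot_one_coord]
      ring
    simp only [e] at this
    rw [integral_sub (hint k x _ 1) (hint k x _ 0), ← hfd, ← hfd] at this
    linarith
  have hbd : ∀ k i x, |u k i x| ≤ M := fun k i x =>
    abs_integral_moll_mul_le k (Ω := univ) (Eventually.of_forall fun y =>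
      (abs_coord_le (H y) i).trans (hM y)) MeasurableSet.univ (subset_univ _)
  have hconst : ∀ k i, u k i x = u k i y := by
    intro k
    set p : ℂ →L[ℝ] Plane := Complex.reCLM.smulRight (basisVec 0) + Complex.imCLM.smulRight (basisVec 1)
      with hp
    have hp1 : p 1 = basisVec 0 := by simp [hp]
    have hpI : p Complex.I = basisVec 1 := by simp [hp]
    -- With the second component conjugated, vanishing divergence and curl are the Cauchy–Riemann
    -- equations. The function is bounded and entire, hence constant.
    set f : ℂ → ℂ := fun z => (u k 0 (p z) : ℂ) - Complex.I * (u k 1 (p z) : ℂ) with hf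
    have hder : ∀ z, HasFDerivAt f ((Complex.ofRealCLM.comp ((fderiv ℝ (u k 0) (p z)).comp p))
        - Complex.I • (Complex.ofRealCLM.comp ((fderiv ℝ (u k 1) (p z)).comp p))) z := fun z => by
      have h := fun i => Complex.ofRealCLM.hasFDerivAt.comp z
        (((hsm k i).differentiable (by simp) (p z)).hasFDerivAt.comp z p.hasFDerivAt)
      exact (h 0).sub ((h 1).const_smul Complex.I)
    have hfC : Differentiable ℂ f := fun z => by
      refine differentiableAt_complex_iff_differentiableAt_real.2
        ⟨(hder z).differentiableAt, ?_⟩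
      rw [(hder z).fderiv]
      simp only [ContinuousLinearMap.sub_apply, ContinuousLinearMap.comp_apply,
        ContinuousLinearMap.smul_apply, hp1, hpI, Complex.ofRealCLM_apply, hdiv, hcurl, smul_eq_mul]
      push_cast
      linear_combination ((fderiv ℝ (u k 1) (p z) (basisVec 0) : ℝ) : ℂ) * Complex.I_mul_I
    have hfb : Bornology.IsBounded (range f) := by
      refine isBounded_iff_forall_norm_le.2 ⟨M + M, ?_⟩
      rintro _ ⟨z, rfl⟩
      refine (_root_.norm_sub_le _ _).trans (add_le_add ?_ ?_)
      · rw [Complex.norm_real]; exact hbd k 0 _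
      · rw [norm_mul, Complex.norm_I, one_mul, Complex.norm_real]; exact hbd k 1 _
    have hsurj : ∀ w : Plane, p ⟨w 0, w 1⟩ = w := fun w => (plane_decomp w).symm
    have h := hfC.apply_eq_apply_of_bounded hfb ⟨x 0, x 1⟩ ⟨y 0, y 1⟩
    simp only [hf, hsurj] at h
    intro i
    have hre := congrArg Complex.re h
    have him := congrArg Complex.im h
    simp at hre him
    fin_cases i
    · exact hre
    · exact him
  ext i
  have h1 := tendsto_mollify (hc i) x
  have h2 := tendsto_mollify (hc i) y
  have e : ∀ k, mollify k (fun x => H x i) x = mollify k (fun x => H x i) y := fun k => hconst k i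
  simp only [e] at h1
  exact tendsto_nhds_unique h1 h2

namespace Data

variable {c : Constants} {d : Data}

theorem exists_isField_newField {M K : ℝ} {E : ℝ → Plane → Plane} {X : ℝ → ℝ → Plane → Plane}
    (h : IsField d.T M K E) (hX : d.Flow E X) : ∃ K', IsField d.T d.Mfield K' (d.newField X) :=
  ⟨_, isField_newField h hX fun _ x y => newField_lip h hX
    (mul_nonneg (isVel h).L_nonneg d.T_pos.le)
    (hX.norm_sub_le_const (isVel h) (clamp_mem d.T_pos.le _) zero_mem) x y⟩

/-- Solutions of the transport equation are constant along the trajectories. -/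
theorem transport_eq {M K : ℝ} {E : ℝ → Plane → Plane} {X : ℝ → ℝ → Plane → Plane}
    (h : IsField d.T M K E) (hX : d.Flow E X) {w : ℝ × Plane → ℝ} {C : ℝ≥0} (hw : LipschitzWith C w)
    {W : ℝ} (hW : ∀ z, |w z| ≤ W)
    (htr : ∀ᵐ z ∂(volume.restrict (slab d.T)), fderiv ℝ w z ((1 : ℝ), d.vel E z.1 z.2) = 0)
    {t : ℝ} (ht : t ∈ Icc 0 d.T) (y : Plane) : w (t, X t 0 y) = w (0, y) := by
  have hv := isVel h
  have hcw : ∀ s, Continuous fun x => w (s, x) := fun s => (lipschitzWith_space hw s).continuous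
  have hXc : Continuous (X t 0) := hX.continuous_space hv zero_mem ht
  -- The function `w` need not be differentiable along a given trajectory, which is a null set, so
  -- the claim is proved in integrated form. For a test `φ` on labels, `w(s,x) φ(X 0 s x)` is
  -- transported, and its weighted integrals at times `t` and `0` agree. A change of variables gives
  -- `∫ φ f = 0`, and continuity gives the claim at every `y`.
  set f : Plane → ℝ := fun y => d.B y * (w (t, X t 0 y) - w (0, y)) with hf
  have hfc : Continuous f := d.continuous_B.mul (((hcw t).comp hXc).sub (hcw 0))
  have h0 := ae_eq_zero_of_integral_contDiff_smul_eq_zero (f := f) (μ := volume)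
    hfc.locallyIntegrable fun φ h1 h2 => by
      obtain ⟨L, hL⟩ := h1.lipschitzWith_of_hasCompactSupport h2 (by simp)
      obtain ⟨P, hP⟩ := exists_abs_le_of_hasCompactSupport h1.continuous h2
      obtain ⟨C', hC'⟩ := lipschitzWith_back h hX
      have hψ := hL.comp hC'
      obtain ⟨D, hD⟩ := LipschitzWith.mul_bounded hw hψ hW fun z => hP _
      obtain ⟨R, hR⟩ := h2.isCompact.isBounded.subset_closedBall 0
      have key := integral_weight_const (T := d.T) (F := d.vel E) d.continuous_B d.B_abs
        (solenoidal h) hD (R := R + d.V₀ M * d.T) (fun s x hx => by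
          have hs := clamp_mem d.T_pos.le s
          have e1 := hX.norm_sub_self_le hv hs zero_mem x
          have e2 : |0 - clamp d.T s| ≤ d.T := IsFlow.abs_sub_le hs zero_mem
          have e3 := norm_sub_norm_le x (x - X 0 (clamp d.T s) x)
          rw [sub_sub_cancel, norm_sub_rev] at e3
          have e4 := mul_le_mul_of_nonneg_left e2 hv.M_nonneg
          have e5 : φ (X 0 (clamp d.T s) x) = 0 := image_eq_zero_of_notMem_tsupport fun hm => by
            have := mem_closedBall_zero_iff.1 (hR hm)
            linarith
          simp only [Function.comp_def, e5, mul_zero]) (by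
          have hd : ∀ᵐ z ∂(volume.restrict (slab d.T)), DifferentiableAt ℝ w z ∧
              DifferentiableAt ℝ (fun z : ℝ × Plane => φ (X 0 (clamp d.T z.1) z.2)) z :=
            ae_restrict_of_ae ((hw.ae_differentiableAt (μ := volume)).and
              (hψ.ae_differentiableAt (μ := volume)))
          filter_upwards [htr, hX.ae_transport hv d.T_pos.le zero_mem hL, hd] with z z1 z2 z3
          have := (z3.1.hasFDerivAt.mul z3.2.hasFDerivAt).fderiv
          simp only [Function.comp_def]
          erw [this]
          simp [z1, z2]) ht
      simp only [Function.comp_def, clamp_of_mem ht, clamp_of_mem zero_mem, hX.self 0 zero_mem]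
        at key
      have hch := integral_comp h hX ht fun x => w (t, x) * φ (X 0 t x)
      simp only [hX.inv hv zero_mem ht, smul_eq_mul] at hch
      have hi : ∀ {g : Plane → ℝ}, Continuous g → Integrable fun y => φ y * (d.B y * g y) :=
        fun hg => (h1.continuous.mul (d.continuous_B.mul hg)).integrable_of_hasCompactSupport
          h2.mul_right
      have e : ∀ y, φ y • f y = φ y * (d.B y * w (t, X t 0 y)) - φ y * (d.B y * w (0, y)) :=
        fun y => by simp only [hf, smul_eq_mul]; ring
      simp only [e]
      rw [integral_sub (hi (g := fun y => w (t, X t 0 y)) ((hcw t).comp hXc)) (hi (hcw 0)),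
        sub_eq_zero]
      calc _ = ∫ y, d.B y * (w (t, X t 0 y) * φ y) := by congr 1; ext y; ring
        _ = ∫ x, w (t, x) * φ (X 0 t x) * d.B x := by rw [hch]; congr 1; ext y; ring
        _ = _ := by rw [key]; congr 1; ext y; ring
  have h1 := congrFun ((Continuous.ae_eq_iff_eq volume hfc continuous_const).1 h0) y
  exact sub_eq_zero.1 ((mul_eq_zero.1 h1).resolve_left (d.B_pos y).ne')

/-- The weak continuity equation is the transport equation for `w = n / B`. -/
theorem ae_transport_of_weak (hc : Compat c d) {M K : ℝ} {E E' : ℝ → Plane → Plane}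
    {n : ℝ → Plane → ℝ} (h : IsField d.T M K E) {w : ℝ × Plane → ℝ} {C : ℝ≥0} (hw : LipschitzWith C w)
    {W : ℝ} (hW : ∀ z, |w z| ≤ W) (hn : ∀ z ∈ slab d.T, n z.1 z.2 = d.B z.2 * w z)
    (hE : ∀ z ∈ slab d.T, E' z.1 z.2 = E z.1 z.2)
    (hs : ∃ (r : ℝ → Plane → ℝ) (g : ℝ → Plane → Plane),
      HasWeakTimeDeriv d.T n r ∧ HasWeakSpaceGrad d.T n g ∧
        HasWeakSpaceDiv d.T (c.flux d.B n g E') fun t x => - r t x) :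
    ∀ᵐ z ∂(volume.restrict (slab d.T)), fderiv ℝ w z ((1 : ℝ), d.vel E z.1 z.2) = 0 := by
  obtain ⟨r, g, hr, hg, hdiv⟩ := hs
  obtain ⟨L, hL⟩ := LipschitzWith.mul_bounded lipschitzWith_B_snd hw (fun z => d.B_abs z.2) hW
  have hna : ∀ᵐ z ∂(volume.restrict (slab d.T)), Function.uncurry n z = d.B z.2 * w z :=
    (ae_restrict_mem (measurableSet_slab d.T)).mono hn
  -- The derivatives `r` and `g` in the definition of a solution are arbitrary weak derivatives.
  -- Uniqueness identifies them with the almost everywhere derivatives of the Lipschitz function `B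
  -- w`.
  have hr' := HasWeakDeriv.ae_eq (isOpen_slab d.T) hr
    (hasWeakDeriv_of_lipschitzWith hL (isOpen_slab d.T) _) hna
  have hg' := fun i => HasWeakDeriv.ae_eq (isOpen_slab d.T) (hg i)
    (hasWeakDeriv_of_lipschitzWith hL (isOpen_slab d.T) _) hna
  set P : ℝ × Plane → ℝ := fun z => d.B z.2 * fderiv ℝ w z ((0 : ℝ), d.vel E z.1 z.2) with hP
  have hvc := (isVel h).continuous
  have hvi : ∀ i : Fin 2, Measurable fun z : ℝ × Plane => d.vel E z.1 z.2 i := fun i =>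
    ((EuclideanSpace.proj (𝕜 := ℝ) i).continuous.comp hvc).measurable
  have hPm : Measurable P := by
    simp only [hP, fderiv_space_apply w _ (d.vel E _ _)]
    exact (d.continuous_B.comp continuous_snd).measurable.mul
      (((hvi 0).mul (measurable_fderiv_apply_const ℝ w _)).add
        ((hvi 1).mul (measurable_fderiv_apply_const ℝ w _)))
  have hPl : LocallyIntegrableOn P (slab d.T) := by
    refine locallyIntegrableOn_of_memLp_top (memLp_top_of_bound hPm.aestronglyMeasurable
      (d.B₁ * (C * d.V₀ M)) (Eventually.of_forall fun z => ?_))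
    rw [hP, norm_mul]
    refine mul_le_mul (d.B_abs _) ((norm_fderiv_le_of_lipschitzWith hw z _).trans ?_) (norm_nonneg _)
      d.B₁_pos.le
    have : ‖((0 : ℝ), d.vel E z.1 z.2)‖ = ‖d.vel E z.1 z.2‖ := by simp [Prod.norm_def]
    rw [this]
    exact mul_le_mul_of_nonneg_left ((isVel h).bound _ _) C.2
  have h0 := (isOpen_slab d.T).ae_eq_zero_of_integral_contDiff_smul_eq_zero
    (f := fun z => P z + Function.uncurry r z) (μ := volume) (hPl.add hr.2.1) fun φ h1 h2 h3 => by
      have hφ : IsTestFunction (slab d.T) φ := ⟨h1, h2, h3⟩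
      have e1 := setIntegral_flux hc hw hW h.continuous h.curl hg' hφ
      have e2 := hdiv.2.2 φ hφ
      have e3 : ∫ z in slab d.T, fderiv ℝ φ z ((0 : ℝ), c.flux d.B n g E' z.1 z.2)
          = ∫ z in slab d.T, fderiv ℝ φ z ((0 : ℝ),
            c.flux d.B (fun t x => d.B x * w (t, x)) g E z.1 z.2) :=
        setIntegral_congr_fun (measurableSet_slab d.T) fun z hz => by
          simp only [Constants.flux, hn z hz, hE z hz]
      rw [e3, e1, neg_inj] at e2
      have e4 := hφ.setIntegral P
      have e5 := hφ.setIntegral (Function.uncurry r)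
      simp only [smul_add]
      rw [integral_add (hφ.integrable_smul (isOpen_slab _) hPl)
        (hφ.integrable_smul (isOpen_slab _) hr.2.1), ← e4, ← e5]
      simp only [mul_neg, integral_neg] at e2
      exact add_eq_zero_iff_eq_neg.2 e2
  filter_upwards [(ae_restrict_iff' (measurableSet_slab d.T)).2 h0, hr',
    ae_restrict_of_ae (hw.ae_differentiableAt (μ := volume))] with z z1 z2 z3
  have e1 := fderiv_B_mul hc z3 ((1 : ℝ), (0 : Plane))
  rw [map_zero, mul_zero, add_zero] at e1
  rw [z2, e1, hP, ← mul_add, ← map_add] at z1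
  have := (mul_eq_zero.1 z1).resolve_left (d.B_pos _).ne'
  simpa using this

/-- A field of finite energy with the right divergence and curl is the one given by the kernel. -/
theorem eq_newField_of_energy (hc : Compat c d) {M K : ℝ} {E E' : ℝ → Plane → Plane}
    {X : ℝ → ℝ → Plane → Plane} (h : IsField d.T M K E) (hX : d.Flow E X)
    (hE : ∀ t ∈ Icc 0 d.T, ∀ x, E' t x = E t x) (hL2 : MemTimeSobolev d.T 0 2 E')
    (hdiv : ∀ t ∈ Ioo 0 d.T, ∀ χ : Plane → ℝ, ContDiff ℝ ∞ χ → HasCompactSupport χ →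
      ∫ x, fderiv ℝ χ x (c.ε₀ • E t x) = - ∫ x, χ x * (c.q * d.rho (X 0 t) x))
    {t : ℝ} (ht : t ∈ Icc 0 d.T) (x : Plane) : E t x = d.newField X t x := by
  obtain ⟨K', h'⟩ := exists_isField_newField h hX
  obtain ⟨C, hC, hb⟩ := exists_lintegral_sq_newField_le h hX
  obtain ⟨N, hN, -⟩ := hL2
  have hcs : ∀ {F : ℝ → Plane → Plane}, Continuous (Function.uncurry F) → ∀ t, Continuous (F t) :=
    fun hF t => hF.comp (by fun_prop : Continuous fun x : Plane => (t, x))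
  have key : ∀ᵐ t ∂(volume.restrict (Ioo 0 d.T)), E t x = d.newField X t x := by
    filter_upwards [hN, ae_restrict_mem measurableSet_Ioo] with t hNt ht
    have htI := Ioo_subset_Icc_self ht
    have hE1 := hcs h.continuous t
    have hE2 := hcs h'.continuous t
    have hH : Continuous fun x => E t x + (-1 : ℝ) • d.newField X t x :=
      hE1.add (hE2.const_smul (-1 : ℝ))
    have hconst : ∀ y, E t y + (-1 : ℝ) • d.newField X t y
        = E t x + (-1 : ℝ) • d.newField X t x := by
      intro y
      refine eq_of_solenoidal (M := M + d.Mfield) hH (fun y => ?_) (fun χ h1 h2 => ?_)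
        (fun χ h1 h2 => ?_) y x
      · refine (norm_add_le _ _).trans (add_le_add (h.bound t y) ?_)
        rw [norm_smul]
        simpa using h'.bound t y
      · obtain ⟨L, hL⟩ := h1.lipschitzWith_of_hasCompactSupport h2 (by simp)
        have e1 := hdiv t ht χ h1 h2
        have e2 := (isDensity_rho h hX htI).integral_fderiv_field_eq hL h2
        have e3 : ∀ y, fderiv ℝ χ y (d.newField X t y)
            = d.c₀ * fderiv ℝ χ y (field (d.rho (X 0 t)) y) := fun y => by
          rw [newField, clamp_of_mem htI, map_smul, smul_eq_mul]
        simp only [map_smul, smul_eq_mul, integral_const_mul, mul_left_comm _ c.q] at e1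
        simp only [map_add, map_smul, smul_eq_mul]
        rw [integral_add (integrable_fderiv_field hL h2 hE1)
          ((integrable_fderiv_field hL h2 hE2).const_mul _), integral_const_mul]
        simp only [e3]
        rw [integral_const_mul, e2, hc.c₀_eq]
        have hε := c.ε₀_pos.ne'
        have hπ := Real.pi_ne_zero
        field_simp
        linear_combination e1
      · obtain ⟨L, hL⟩ := h1.lipschitzWith_of_hasCompactSupport h2 (by simp)
        have := ((h.curl t ht).add ((h'.curl t ht).smul (-1)) (rot.continuous.comp hE1)
          ((rot.continuous.comp hE2).const_smul (-1 : ℝ))) χ L hL h2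
        simpa only [map_add, map_smul] using this
    have hm1 : MemLp (E t) 2 := by
      refine (memLp_congr_ae ?_).1 (Lp.memLp (N t))
      filter_upwards [hNt] with y hy
      rw [hy, hE t htI]
    have hm2 : MemLp (d.newField X t) 2 :=
      ⟨hE2.aestronglyMeasurable, (eLpNorm_two_le hC (hb t)).trans_lt ENNReal.ofReal_lt_top⟩
    have hm := hm1.add (hm2.const_smul (-1 : ℝ))
    -- The constant difference of the two fields is square integrable on a plane of infinite
    -- measure, so it is zero.
    have hm' : MemLp (fun _ : Plane => E t x + (-1 : ℝ) • d.newField X t x) 2 :=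
      (memLp_congr_ae (Eventually.of_forall hconst)).1 hm
    rw [memLp_const_iff two_ne_zero ENNReal.ofNat_ne_top,
      measure_univ_of_isAddLeftInvariant] at hm'
    have := hm'.resolve_right (lt_irrefl _)
    rwa [neg_one_smul, ← sub_eq_add_neg, sub_eq_zero] at this
  have hct : ∀ {F : ℝ → Plane → Plane}, Continuous (Function.uncurry F) →
      Continuous fun t => F t x :=
    fun hF => hF.comp (by fun_prop : Continuous fun t : ℝ => (t, x))
  -- Finite energy is available only for almost every time. Both sides are continuous in time, which
  -- covers the closed interval.
  exact eq_on_of_ae_eq isOpen_Ioo Ioo_subset_Icc_self (closure_Ioo d.T_pos.ne).ge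
    (hct h.continuous).continuousOn (hct h'.continuous).continuousOn key ht

/-- The competing pair is replaced by Lipschitz functions on space-time, so that its field generates
a flow of its own. Its density is Lagrangian for that flow, and its field is the kernel field of
that density. It is therefore a fixed point of the same map, and the contraction leaves only one. -/
theorem eq_of_isRegularSolution (hc : Compat c d) {K : ℝ} {E : ℝ → Plane → Plane}
    {X : ℝ → ℝ → Plane → Plane} (h : IsField d.T d.Mfield K E) (hX : d.Flow E X)
    (hfix : E = d.newField X) {D n₀ : Plane → ℝ} (hD : D =ᵐ[volume] d.D)
    (hn₀ : n₀ =ᵐ[volume] d.n₀) {n' : ℝ → Plane → ℝ} {E' : ℝ → Plane → Plane}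
    (hs : c.IsRegularSolution d.T d.B D n₀ n' E') {t : ℝ} (ht : t ∈ Icc 0 d.T) (x : Plane) :
    n' t x = d.nLag X (t, x) ∧ E' t x = E t x := by
  obtain ⟨ν, Cν, Mν, hν, hνb, hνe⟩ := exists_slab_rep d.T_pos hs.n_cont hs.n_mem.1 hs.n_mem.2
  obtain ⟨e, Ce, Me, he, heb, hee⟩ := exists_slab_rep_field d.T_pos hs.E_cont hs.E_mem
  set F : ℝ → Plane → Plane := fun t x => e (t, x) with hFdef
  have hEF : ∀ t ∈ Icc 0 d.T, ∀ x, E' t x = F t x := fun t ht x => hee (x := (t, x)) ⟨ht, mem_univ x⟩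
  have hnν : ∀ t ∈ Icc 0 d.T, ∀ x, n' t x = ν (t, x) := fun t ht x =>
    hνe (x := (t, x)) ⟨ht, mem_univ x⟩
  have hrot : ∀ z ∈ slab d.T, (!₂[E' z.1 z.2 1, - E' z.1 z.2 0] : Plane) = (-1 : ℝ) • rot (e z) :=
    fun z hz => by
      rw [hEF _ (Ioo_subset_Icc_self hz.1)]
      ext i
      fin_cases i <;> simp [hFdef]
  have hF : IsField d.T Me Ce F :=
    { continuous := he.continuous
      bound := fun t x => heb _
      lip := fun t x y => by
        have := (lipschitzWith_space he t).dist_le_mul x y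
        rwa [dist_eq_norm, dist_eq_norm] at this
      curl := fun t ht => by
        refine isSolenoidal_of_smooth (rot.lipschitz.comp (lipschitzWith_space he t))
          fun χ h1 h2 => ?_
        have := integral_fderiv_slice_eq (G := fun z => (-1 : ℝ) • rot (e z)) (ρ := fun _ => 0)
          ((rot.continuous.comp he.continuous).const_smul (-1 : ℝ)) continuous_const
          (fun φ hφ => by
            have := hs.curl_free.2.2 φ hφ
            rw [← this]
            exact setIntegral_congr_fun (measurableSet_slab d.T) fun z hz => by
              simp only [hrot z hz]) ht h1 h2
        simpa [integral_neg] using this }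
  obtain ⟨X', hX'⟩ := exists_isFlow (isVel hF) d.T
  have hBinv : LipschitzWith (Real.toNNReal (d.LB * d.B₀⁻¹ ^ 2)) fun z : ℝ × Plane => (d.B z.2)⁻¹ := by
    have := (lipschitz_of_norm_le (f := fun x => (d.B x)⁻¹) d.inv_B_sub_le).comp
      (LipschitzWith.prod_snd (α := ℝ))
    rwa [mul_one] at this
  have hBb : ∀ z : ℝ × Plane, |(d.B z.2)⁻¹| ≤ d.B₀⁻¹ := fun z => by
    rw [abs_of_pos (inv_pos.2 (d.B_pos _))]
    exact d.inv_B_le _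
  obtain ⟨Cw, hw⟩ := LipschitzWith.mul_bounded hν hBinv hνb hBb
  have hW : ∀ z, |ν z * (d.B z.2)⁻¹| ≤ Mν * d.B₀⁻¹ := fun z => by
    rw [abs_mul]
    exact mul_le_mul (hνb z) (hBb z) (abs_nonneg _) ((abs_nonneg _).trans (hνb z))
  have hBν : ∀ z : ℝ × Plane, d.B z.2 * (ν z * (d.B z.2)⁻¹) = ν z := fun z => by
    have := (d.B_pos z.2).ne'
    field_simp
  have htr := ae_transport_of_weak hc hF hw hW (fun z hz => by
    rw [hnν _ (Ioo_subset_Icc_self hz.1), hBν]) (fun z hz => hEF _ (Ioo_subset_Icc_self hz.1) _)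
    hs.transport
  have hinit : ∀ y, ν (0, y) = d.n₀ y := by
    have h1 : (fun y => ν (0, y)) =ᵐ[volume] d.n₀ := by
      filter_upwards [hs.initial, hn₀] with y h1 h2
      rw [← hnν 0 zero_mem, h1, h2]
    exact congrFun ((Continuous.ae_eq_iff_eq volume (lipschitzWith_space hν 0).continuous
      (d.continuous_B.mul d.continuous_w)).1 h1)
  have hdens : ∀ t ∈ Icc 0 d.T, ∀ x, ν (t, x) = d.dens (X' 0 t) x := fun t ht x => by
    have h1 := transport_eq hF hX' hw hW htr ht (X' 0 t x)
    rw [hX'.inv (isVel hF) ht zero_mem, hinit, Data.n₀, mul_comm (d.B _),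
      mul_inv_cancel_right₀ (d.B_pos _).ne'] at h1
    rw [dens, ← h1]
    exact (hBν (t, x)).symm
  have hfix' : ∀ t ∈ Icc 0 d.T, ∀ x, F t x = d.newField X' t x := fun t ht x =>
    eq_newField_of_energy hc hF hX' hEF hs.E_energy (fun t ht χ h1 h2 => by
      have hDz : ∀ᵐ z ∂(volume.restrict (slab d.T)), D z.2 = d.D z.2 := ae_slab_of_ae hD
      have := integral_fderiv_slice_eq (G := fun z => c.ε₀ • e z)
        (ρ := fun z => c.q * (ν z - d.D z.2)) (he.continuous.const_smul c.ε₀)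
        (continuous_const.mul (hν.continuous.sub (d.continuous_D.comp continuous_snd)))
        (fun φ hφ => by
          have h3 := hs.gauss.2.2 φ hφ
          have h4 : ∫ z in slab d.T, φ z * (c.q * (n' z.1 z.2 - D z.2))
              = ∫ z in slab d.T, φ z * (c.q * (ν z - d.D z.2)) := by
            refine integral_congr_ae ?_
            filter_upwards [hDz, ae_restrict_mem (measurableSet_slab d.T)] with z z1 z2
            simp only [z1, hnν _ (Ioo_subset_Icc_self z2.1)]
          rw [← h4, ← h3]
          exact setIntegral_congr_fun (measurableSet_slab d.T) fun z hz => by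
            simp only [hEF _ (Ioo_subset_Icc_self hz.1), hFdef]) ht h1 h2
      simp only [hdens t (Ioo_subset_Icc_self ht)] at this
      exact this) ht x
  have hE : ∀ t ∈ Icc 0 d.T, ∀ x, F t x = E t x := fun t ht x =>
    eq_of_fixed h hX hfix hF hX' hfix' ht x
  refine ⟨?_, (hEF t ht x).trans (hE t ht x)⟩
  -- The two velocity fields agree on `[0,T]`, so their trajectories through `x` at time `t`
  -- coincide.
  have hflow : X' 0 t x = X 0 t x :=
    hX.eq_of_deriv (isVel h) (α := fun r => X' r t x) (r₀ := t) ht zero_mem ht (fun r hr => by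
      have := hX'.deriv t ht r hr x
      rwa [vel, hE r hr] at this) (by rw [hX'.self t ht, hX.self t ht])
  rw [hnν t ht, hdens t ht, nLag, wLag, clamp_of_mem ht, dens, hflow]

end Data

/-! ### The gradient of the logarithm of the density. -/

theorem HasWeakDeriv.congr_ae {V F : Type*} [NormedAddCommGroup V] [NormedSpace ℝ V]
    [MeasureSpace V] [OpensMeasurableSpace V] [NormedAddCommGroup F] [NormedSpace ℝ F] {Ω : Set V}
    (hΩ : IsOpen Ω) {v : V} {u u' g g' : V → F} (h : HasWeakDeriv Ω v u g)
    (hu : ∀ᵐ z ∂(volume.restrict Ω), u z = u' z) (hg : ∀ᵐ z ∂(volume.restrict Ω), g z = g' z) :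
    HasWeakDeriv Ω v u' g' := by
  have hl : ∀ {f f' : V → F}, LocallyIntegrableOn f Ω → (∀ᵐ z ∂(volume.restrict Ω), f z = f' z) →
      LocallyIntegrableOn f' Ω := fun hf he x hx => by
    obtain ⟨s, hs, hi⟩ := hf x hx
    refine ⟨s ∩ Ω, inter_mem hs self_mem_nhdsWithin, ?_⟩
    refine (hi.mono_set inter_subset_left).congr_fun_ae ?_
    exact ae_mono (Measure.restrict_mono inter_subset_right le_rfl) he
  refine ⟨hl h.1 hu, hl h.2.1 hg, fun φ hφ => ?_⟩
  have e1 : ∫ z in Ω, fderiv ℝ φ z v • u z = ∫ z in Ω, fderiv ℝ φ z v • u' z :=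
    integral_congr_ae (hu.mono fun z hz => by simp only [hz])
  have e2 : ∫ z in Ω, φ z • g z = ∫ z in Ω, φ z • g' z :=
    integral_congr_ae (hg.mono fun z hz => by simp only [hz])
  rw [← e1, ← e2]
  exact h.2.2 φ hφ

/-- If mixed second differences are controlled, the directional derivative has a Lipschitz
version. -/
theorem exists_lipschitz_fderiv {V : Type*} [NormedAddCommGroup V] [NormedSpace ℝ V]
    [FiniteDimensional ℝ V] [MeasureSpace V] [BorelSpace V]
    [(volume : Measure V).IsAddHaarMeasure] {u : V → ℝ} {C : ℝ≥0} (hu : LipschitzWith C u) {v : V}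
    {m : ℝ} (hm : ∀ z a (s : ℝ), |diff2 u z a (s • v)| ≤ m * ‖a‖ * |s|) :
    ∃ (G : V → ℝ) (K : ℝ≥0), LipschitzWith K G ∧ (∀ z, |G z| ≤ C * ‖v‖) ∧
      ∀ᵐ z, fderiv ℝ u z v = G z := by
  set S := {z | DifferentiableAt ℝ u z} with hS
  have hlim : ∀ z ∈ S, Tendsto (fun s : ℝ => s⁻¹ • (u (z + s • v) - u z)) (𝓝[≠] 0)
      (𝓝 (fderiv ℝ u z v)) := fun z hz => by
    have := (hz.hasFDerivAt.hasLineDerivAt v).tendsto_slope_zero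
    simpa using this
  -- The difference of two directional difference quotients is a second difference divided by `s`,
  -- so the bound survives the limit `s → 0` at points of differentiability.
  have hlip : LipschitzOnWith (Real.toNNReal m) (fun z => fderiv ℝ u z v) S := by
    refine LipschitzOnWith.of_dist_le_mul fun x hx y hy => ?_
    rw [dist_eq_norm, dist_eq_norm]
    refine le_of_tendsto ((hlim x hx).sub (hlim y hy)).norm ?_
    filter_upwards [self_mem_nhdsWithin] with s hs
    have h1 := hm y (x - y) s
    rw [diff2, add_sub_cancel] at h1
    have e : s⁻¹ • (u (x + s • v) - u x) - s⁻¹ • (u (y + s • v) - u y)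
        = s⁻¹ * (u (x + s • v) - u x - u (y + s • v) + u y) := by
      simp only [smul_eq_mul]; ring
    rw [e, norm_mul, norm_inv, Real.norm_eq_abs, Real.norm_eq_abs,
      inv_mul_le_iff₀ (abs_pos.2 hs)]
    calc _ ≤ _ := h1
      _ ≤ _ := by
        rw [mul_comm |s|]
        exact mul_le_mul_of_nonneg_right (mul_le_mul_of_nonneg_right (Real.le_coe_toNNReal m)
          (norm_nonneg _)) (abs_nonneg _)
  obtain ⟨G, hG, hGS⟩ := hlip.extend_real
  have hae : ∀ᵐ z, fderiv ℝ u z v = G z :=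
    (hu.ae_differentiableAt (μ := volume)).mono fun z hz => hGS hz
  refine ⟨G, _, hG, fun z => ?_, hae⟩
  have : (fun z => max |G z| (C * ‖v‖)) =ᵐ[volume] fun _ => (C * ‖v‖ : ℝ) := hae.mono fun z hz =>
    max_eq_right (hz ▸ norm_fderiv_le_of_lipschitzWith hu z v)
  exact max_eq_right_iff.1 (congrFun ((Continuous.ae_eq_iff_eq volume
    (hG.continuous.abs.max continuous_const) continuous_const).1 this) z)

/-- Mixed second differences of the backward flow in space and space-time. -/
theorem IsFlow.exists_mixed_diff2_le {T M L m : ℝ} {F : ℝ → Plane → Plane}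
    {X : ℝ → ℝ → Plane → Plane} (hX : IsFlow T F X) (hF : IsVel M L F) (hT : 0 ≤ T) (hm : 0 ≤ m)
    (hd : ∀ r ∈ Icc 0 T, ∀ x h k, ‖diff2 (F r) x h k‖ ≤ m * ‖h‖ * ‖k‖) :
    ∃ C, 0 ≤ C ∧ ∀ (z a : ℝ × Plane) (k : Plane),
      ‖diff2 (fun z : ℝ × Plane => X 0 (clamp T z.1) z.2) z a ((0 : ℝ), k)‖ ≤ C * ‖a‖ * ‖k‖ := by
  have h0 : (0 : ℝ) ∈ Icc 0 T := left_mem_Icc.2 hT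
  have hM := hF.M_nonneg
  have hL := hF.L_nonneg
  set A := Real.exp (L * T) ^ 3 * (m * T) with hA
  have hA0 : 0 ≤ A := by positivity
  have hd2 : ∀ s ∈ Icc 0 T, ∀ x h k, ‖diff2 (X 0 s) x h k‖ ≤ A * ‖h‖ * ‖k‖ := fun s hs x h k => by
    refine (hX.norm_diff2_le hF (η := fun r => m * r) (m := fun _ => m)
      (fun r => by simpa using (hasDerivAt_id r).const_mul m) (fun _ => hm) hd hs h0 x h k).trans ?_
    rw [← mul_sub, abs_mul, abs_of_nonneg hm, hA]
    gcongr
    exact IsFlow.abs_sub_le hs h0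
  refine ⟨A + (A * M + Real.exp (L * T) * (L * Real.exp (L * T))), by positivity, fun z a k => ?_⟩
  set s := clamp T z.1 with hs
  set s' := clamp T (z.1 + a.1) with hs'
  have hsm : s ∈ Icc 0 T := clamp_mem hT _
  have hsm' : s' ∈ Icc 0 T := clamp_mem hT _
  have hss : |s' - s| ≤ ‖a‖ := by
    refine (abs_clamp_sub_le T _ _).trans ?_
    rw [add_sub_cancel_left]
    exact norm_fst_le a
  -- The increment `a` is split into its space part, taken at time `s'`, and its time part. The
  -- group property writes the latter as a four-point difference of the single map `X 0 s`, with two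
  -- of the points displaced by `X s s'`.
  have e : diff2 (fun z : ℝ × Plane => X 0 (clamp T z.1) z.2) z a ((0 : ℝ), k)
      = diff2 (X 0 s') z.2 a.2 k + (X 0 s (X s s' (z.2 + k)) - X 0 s (X s s' z.2) - X 0 s (z.2 + k)
        + X 0 s z.2) := by
    rw [hX.comp hF hsm' hsm h0, hX.comp hF hsm' hsm h0]
    simp only [diff2, Prod.fst_add, Prod.snd_add, add_zero, ← hs, ← hs']
    abel
  rw [e]
  have h1 := hd2 s' hsm' z.2 a.2 k
  have h2 := norm_four_point_le (hd2 s hsm) (hX.norm_sub_le_const hF hsm h0)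
    (X s s' (z.2 + k)) (X s s' z.2) (z.2 + k) z.2
  have h3 := hX.norm_sub_self_le hF hsm' hsm z.2
  have h4 := hX.norm_displacement_sub_le hF hsm' hsm (z.2 + k) z.2
  rw [abs_sub_comm] at h3 h4
  rw [add_sub_cancel_left] at h2 h4
  have h5 : X s s' (z.2 + k) - X s s' z.2 - (z.2 + k) + z.2
      = X s s' (z.2 + k) - (z.2 + k) - (X s s' z.2 - z.2) := by abel
  rw [h5] at h2
  calc _ ≤ A * ‖a.2‖ * ‖k‖ + (A * (M * ‖a‖) * ‖k‖
        + Real.exp (L * T) * (L * Real.exp (L * T) * ‖k‖ * ‖a‖)) := by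
        refine (norm_add_le _ _).trans (add_le_add h1 (h2.trans ?_))
        gcongr
        · exact h3.trans (mul_le_mul_of_nonneg_left hss hM)
        · exact h4.trans (mul_le_mul_of_nonneg_left hss (by positivity))
    _ ≤ A * ‖a‖ * ‖k‖ + (A * (M * ‖a‖) * ‖k‖
        + Real.exp (L * T) * (L * Real.exp (L * T) * ‖k‖ * ‖a‖)) := by
        gcongr
        exact norm_snd_le a
    _ = _ := by ring

namespace Data

variable {c : Constants} {d : Data} {K : ℝ} {E : ℝ → Plane → Plane} {X : ℝ → ℝ → Plane → Plane}

/-- The gradient of the logarithm of the density is Lipschitz in space-time. -/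
theorem exists_lipschitz_logGrad {M : ℝ} (h : IsField d.T M K E) (hX : d.Flow E X) {S m : ℝ}
    (hS : d.IsSmooth S) (hm : 0 ≤ m) (hE : ∀ t x h k, ‖diff2 (E t) x h k‖ ≤ m * ‖h‖ * ‖k‖)
    {b ℓ : Plane → ℝ} {Cb Cℓ : ℝ≥0} {mb mℓ : ℝ} (hB : ∀ x, d.B x = Real.exp (b x))
    (hw : ∀ x, d.w x = Real.exp (ℓ x)) (hb : LipschitzWith Cb b) (hℓ : LipschitzWith Cℓ ℓ)
    (hb2 : ∀ x h k, |diff2 b x h k| ≤ mb * ‖h‖ * ‖k‖)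
    (hℓ2 : ∀ x h k, |diff2 ℓ x h k| ≤ mℓ * ‖h‖ * ‖k‖) :
    ∃ (G : ℝ × Plane → Plane) (C : ℝ≥0) (R : ℝ), LipschitzWith C G ∧ (∀ z, ‖G z‖ ≤ R) ∧
      ∀ᵐ z, ∀ i, fderiv ℝ (d.nLag X) z ((0 : ℝ), basisVec i) = d.nLag X z * G z i := by
  obtain ⟨L, hL⟩ := lipschitzWith_back h hX
  have hM0 := h.bound 0 0
  have hM : 0 ≤ M := (norm_nonneg _).trans hM0
  have hK : 0 ≤ K := nonneg_of_lip (f := E 0) (h.lip 0)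
  have hS0 := hS.nonneg
  have hLB := d.LB_nonneg
  have hB0 := d.B₀_pos
  obtain ⟨D, hD, hY⟩ := hX.exists_mixed_diff2_le (isVel h) d.T_pos.le
    (m := S + S * M + 2 * (d.LB * d.B₀⁻¹ ^ 2) * K + d.B₀⁻¹ * m) (by positivity)
    (fun r _ => norm_diff2_vel_le hS h (hE r))
  have hmb : 0 ≤ mb := by
    have := (abs_nonneg _).trans (hb2 0 (basisVec 0) (basisVec 0))
    simpa [norm_basisVec] using this
  have hmℓ : 0 ≤ mℓ := by
    have := (abs_nonneg _).trans (hℓ2 0 (basisVec 0) (basisVec 0))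
    simpa [norm_basisVec] using this
  -- This is the logarithm of the density. Only increments with one purely spatial direction are
  -- controlled, which is enough for its space gradient to be Lipschitz in space and time.
  set u : ℝ × Plane → ℝ := fun z => b z.2 + ℓ (X 0 (clamp d.T z.1) z.2) with hu
  have hnu : d.nLag X = fun z => Real.exp (u z) := by
    ext1 z
    rw [hu, Real.exp_add, ← hB, ← hw]
    rfl
  have huL : LipschitzWith (Cb * 1 + Cℓ * L) u := (hb.comp LipschitzWith.prod_snd).add (hℓ.comp hL)
  have hu2 : ∀ (i : Fin 2) z a (s : ℝ), |diff2 u z a (s • ((0 : ℝ), basisVec i))|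
      ≤ (mb + (mℓ * L * L + Cℓ * D)) * ‖a‖ * |s| := by
    intro i z a s
    have es : s • ((0 : ℝ), basisVec i) = ((0 : ℝ), s • basisVec i) := by simp
    have ns : ‖s • basisVec i‖ = |s| := by rw [norm_smul, norm_basisVec, mul_one, Real.norm_eq_abs]
    rw [es]
    have h1 := hb2 z.2 a.2 (s • basisVec i)
    have h2 := norm_four_point_le (f := ℓ) hℓ2 (abs_sub_le_of_lipschitzWith hℓ)
      (X 0 (clamp d.T (z + a + ((0 : ℝ), s • basisVec i)).1) (z + a + ((0 : ℝ), s • basisVec i)).2)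
      (X 0 (clamp d.T (z + a).1) (z + a).2)
      (X 0 (clamp d.T (z + ((0 : ℝ), s • basisVec i)).1) (z + ((0 : ℝ), s • basisVec i)).2)
      (X 0 (clamp d.T z.1) z.2)
    have h3 := hL.dist_le_mul (z + a) z
    have h4 := hL.dist_le_mul (z + ((0 : ℝ), s • basisVec i)) z
    have h5 := hY z a (s • basisVec i)
    rw [dist_eq_norm, dist_eq_norm, add_sub_cancel_left] at h3 h4
    have n4 : ‖((0 : ℝ), s • basisVec i)‖ = |s| := by
      rw [← ns]; simp [Prod.norm_def]
    rw [n4] at h4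
    rw [ns] at h1 h5
    rw [diff2] at h5
    have e : diff2 u z a ((0 : ℝ), s • basisVec i) = diff2 b z.2 a.2 (s • basisVec i)
        + (ℓ (X 0 (clamp d.T (z + a + ((0 : ℝ), s • basisVec i)).1)
            (z + a + ((0 : ℝ), s • basisVec i)).2)
          - ℓ (X 0 (clamp d.T (z + a).1) (z + a).2)
          - ℓ (X 0 (clamp d.T (z + ((0 : ℝ), s • basisVec i)).1) (z + ((0 : ℝ), s • basisVec i)).2)
          + ℓ (X 0 (clamp d.T z.1) z.2)) := by
      simp only [hu, diff2, Prod.snd_add]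
      ring
    rw [e]
    calc _ ≤ mb * ‖a‖ * |s| + (mℓ * (L * ‖a‖) * (L * |s|) + Cℓ * (D * ‖a‖ * |s|)) := by
          refine (abs_add_le _ _).trans (add_le_add (h1.trans ?_) (h2.trans ?_))
          · gcongr
            exact norm_snd_le a
          · gcongr
      _ = _ := by ring
  choose G KG hG hGb hGe using fun i => exists_lipschitz_fderiv huL (hu2 i)
  refine ⟨fun z => WithLp.toLp 2 fun i => G i z, _, _, lipschitz_of_norm_le (C := KG 0 + KG 1)
    fun z z' => ?_, fun z => (norm_le_add_abs _).trans (add_le_add (hGb 0 z) (hGb 1 z)), ?_⟩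
  · refine (norm_le_add_abs _).trans ?_
    rw [add_mul]
    exact add_le_add (abs_sub_le_of_lipschitzWith (hG 0) z z')
      (abs_sub_le_of_lipschitzWith (hG 1) z z')
  · filter_upwards [huL.ae_differentiableAt (μ := volume), ae_all_iff.2 hGe] with z z1 z2 i
    rw [hnu, fderiv_exp z1, ContinuousLinearMap.smul_apply, z2 i, smul_eq_mul]

/-- The density has no positive lower bound, so the quotient `∇n / n` cannot be estimated factor by
factor. Choosing the representative `n G` of the gradient makes the division exact and leaves `σ G -
(q/m) E`. -/
theorem exists_kField_memSobolev (h : IsField d.T d.Mfield K E) (hX : d.Flow E X)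
    (hfix : E = d.newField X) {G : ℝ × Plane → Plane} {C : ℝ≥0} {R : ℝ} (hG : LipschitzWith C G)
    (hR : ∀ z, ‖G z‖ ≤ R) (hpos : ∀ z, 0 < d.nLag X z)
    (he : ∀ᵐ z, ∀ i, fderiv ℝ (d.nLag X) z ((0 : ℝ), basisVec i) = d.nLag X z * G z i) :
    ∃ g : ℝ → Plane → Plane, HasWeakSpaceGrad d.T (fun t x => d.nLag X (t, x)) g ∧
      MemSobolev ⊤ (slab d.T) 1
        (Function.uncurry (c.kField (fun t x => d.nLag X (t, x)) g E)) := by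
  obtain ⟨Cn, hCn⟩ := lipschitzWith_nLag h hX
  obtain ⟨CE, hCE⟩ := lipschitzWith_field h hX hfix
  refine ⟨fun t x => d.nLag X (t, x) • G (t, x), fun i => ?_, ?_⟩
  · refine (hasWeakDeriv_of_lipschitzWith (u := d.nLag X) hCn (isOpen_slab d.T)
      ((0 : ℝ), basisVec i)).congr_ae (isOpen_slab d.T) (Eventually.of_forall fun z => rfl) ?_
    filter_upwards [ae_restrict_of_ae he] with z hz
    rw [hz i]
    rfl
  · have e : Function.uncurry (c.kField (fun t x => d.nLag X (t, x))
        (fun t x => d.nLag X (t, x) • G (t, x)) E)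
        = fun z => c.σ • G z - (c.q / c.m) • Function.uncurry E z := by
      ext1 z
      rw [Function.uncurry, Constants.kField, smul_smul, div_mul_cancel₀ _ (hpos _).ne']
      rfl
    rw [e]
    have hL : LipschitzWith (Real.toNNReal (|c.σ| * C + |c.q / c.m| * CE))
        fun z => c.σ • G z - (c.q / c.m) • Function.uncurry E z :=
      lipschitz_of_norm_le fun z z' => by
        have h1 := hG.dist_le_mul z z'
        have h2 := hCE.dist_le_mul z z'
        rw [dist_eq_norm, dist_eq_norm] at h1 h2
        rw [sub_sub_sub_comm, ← smul_sub, ← smul_sub, add_mul, mul_assoc, mul_assoc]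
        refine (norm_sub_le _ _).trans (add_le_add ?_ ?_)
        · rw [norm_smul]; exact mul_le_mul_of_nonneg_left h1 (norm_nonneg _)
        · rw [norm_smul]; exact mul_le_mul_of_nonneg_left h2 (norm_nonneg _)
    refine memSobolev_one_of_lipschitzWith hL (M := |c.σ| * R + |c.q / c.m| * d.Mfield)
      (fun z => (norm_sub_le _ _).trans (add_le_add ?_ ?_)) (isOpen_slab d.T)
    · rw [norm_smul]; exact mul_le_mul_of_nonneg_left (hR z) (norm_nonneg _)
    · rw [norm_smul]; exact mul_le_mul_of_nonneg_left (h.bound _ _) (norm_nonneg _)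

end Data

/-! ### From the physical hypotheses to the transport data. -/

/-- Bounded functions with bounded continuous derivatives up to the order `k`. -/
def DerivBounded : ℕ → (Plane → ℝ) → Prop
  | 0, f => Continuous f ∧ ∃ C, ∀ x, |f x| ≤ C
  | k + 1, f => Differentiable ℝ f ∧ (∃ C, ∀ x, |f x| ≤ C) ∧
      ∀ v, DerivBounded k fun x => fderiv ℝ f x v

theorem IsCkBounded.derivBounded {k : ℕ} {f : Plane → ℝ} (h : IsCkBounded k f) :
    DerivBounded k f := by
  induction k generalizing f with
  | zero =>
    obtain ⟨C, hC⟩ := h.2 0 le_rfl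
    refine ⟨h.1.continuous, C, fun x => ?_⟩
    have := hC x
    rwa [norm_iteratedFDeriv_zero] at this
  | succ k ih =>
    obtain ⟨C, hC⟩ := h.2 0 (Nat.zero_le _)
    refine ⟨h.1.differentiable (by simp), ⟨C, fun x => ?_⟩, fun v => ih ⟨?_, fun j hj => ?_⟩⟩
    · have := hC x
      rwa [norm_iteratedFDeriv_zero] at this
    · exact (h.1.fderiv_right (m := k) (by norm_cast)).clm_apply contDiff_const
    · obtain ⟨C, hC⟩ := h.2 (j + 1) (by omega)
      refine ⟨‖v‖ * C, fun x => ?_⟩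
      have h1 : ContDiff ℝ j (fderiv ℝ f) :=
        h.1.fderiv_right (m := j) (by exact_mod_cast Nat.add_le_add_right hj 1)
      refine (norm_iteratedFDeriv_clm_apply_const h1.contDiffAt le_rfl).trans ?_
      rw [norm_iteratedFDeriv_fderiv]
      exact mul_le_mul_of_nonneg_left (hC x) (norm_nonneg _)

namespace DerivBounded

variable {k : ℕ} {f g : Plane → ℝ}

theorem bound (h : DerivBounded k f) : ∃ C, ∀ x, |f x| ≤ C := by
  cases k with
  | zero => exact h.2
  | succ k => exact h.2.1

theorem continuous (h : DerivBounded k f) : Continuous f := by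
  cases k with
  | zero => exact h.1
  | succ k => exact h.1.continuous

theorem of_succ (h : DerivBounded (k + 1) f) : DerivBounded k f := by
  induction k generalizing f with
  | zero => exact ⟨h.continuous, h.bound⟩
  | succ k ih => exact ⟨h.1, h.2.1, fun v => ih (h.2.2 v)⟩

theorem const (a : ℝ) : DerivBounded k fun _ => a := by
  induction k generalizing a with
  | zero => exact ⟨continuous_const, |a|, fun _ => le_rfl⟩
  | succ k ih =>
    refine ⟨differentiable_const a, ⟨|a|, fun _ => le_rfl⟩, fun v => ?_⟩
    simpa using ih 0

theorem bound_add (hf : DerivBounded k f) (hg : DerivBounded k g) : ∃ C, ∀ x, |f x + g x| ≤ C := by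
  obtain ⟨C, hC⟩ := hf.bound
  obtain ⟨D, hD⟩ := hg.bound
  exact ⟨C + D, fun x => (abs_add_le _ _).trans (add_le_add (hC x) (hD x))⟩

theorem bound_mul (hf : DerivBounded k f) (hg : DerivBounded k g) : ∃ C, ∀ x, |f x * g x| ≤ C := by
  obtain ⟨C, hC⟩ := hf.bound
  obtain ⟨D, hD⟩ := hg.bound
  exact ⟨C * D, fun x => by
    rw [abs_mul]
    exact mul_le_mul (hC x) (hD x) (abs_nonneg _) ((abs_nonneg _).trans (hC x))⟩

theorem add (hf : DerivBounded k f) (hg : DerivBounded k g) : DerivBounded k fun x => f x + g x := by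
  induction k generalizing f g with
  | zero => exact ⟨hf.1.add hg.1, hf.bound_add hg⟩
  | succ k ih =>
    refine ⟨hf.1.add hg.1, hf.bound_add hg, fun v => ?_⟩
    have e : (fun x => fderiv ℝ (fun x => f x + g x) x v)
        = fun x => fderiv ℝ f x v + fderiv ℝ g x v := by
      ext1 x
      rw [fderiv_fun_add (hf.1 x) (hg.1 x)]
      rfl
    rw [e]
    exact ih (hf.2.2 v) (hg.2.2 v)

theorem mul (hf : DerivBounded k f) (hg : DerivBounded k g) : DerivBounded k fun x => f x * g x := by
  induction k generalizing f g with
  | zero => exact ⟨hf.1.mul hg.1, hf.bound_mul hg⟩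
  | succ k ih =>
    refine ⟨hf.1.mul hg.1, hf.bound_mul hg, fun v => ?_⟩
    have e : (fun x => fderiv ℝ (fun x => f x * g x) x v)
        = fun x => f x * fderiv ℝ g x v + g x * fderiv ℝ f x v := by
      ext1 x
      rw [fderiv_fun_mul (hf.1 x) (hg.1 x)]
      rfl
    rw [e]
    exact (ih hf.of_succ (hg.2.2 v)).add (ih hg.of_succ (hf.2.2 v))

theorem inv {b : ℝ} (hb : 0 < b) (hf : DerivBounded k f) (h : ∀ x, b ≤ f x) :
    DerivBounded k fun x => (f x)⁻¹ := by
  have hpos : ∀ x, 0 < f x := fun x => hb.trans_le (h x)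
  have hbd : ∃ C, ∀ x, |(f x)⁻¹| ≤ C := ⟨b⁻¹, fun x => by
    rw [abs_of_pos (inv_pos.2 (hpos x))]
    exact inv_anti₀ hb (h x)⟩
  induction k with
  | zero => exact ⟨hf.1.inv₀ fun x => (hpos x).ne', hbd⟩
  | succ k ih =>
    refine ⟨fun x => (hf.1 x).inv (hpos x).ne', hbd, fun v => ?_⟩
    have e : (fun x => fderiv ℝ (fun x => (f x)⁻¹) x v)
        = fun x => (-1) * ((f x)⁻¹ * (f x)⁻¹) * fderiv ℝ f x v := by
      ext1 x
      have := ((hasDerivAt_inv (hpos x).ne').comp_hasFDerivAt x (hf.1 x).hasFDerivAt).fderiv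
      simp only [Function.comp_def] at this
      rw [this, ContinuousLinearMap.smul_apply, smul_eq_mul]
      ring
    rw [e]
    exact ((const (-1)).mul ((ih hf.of_succ).mul (ih hf.of_succ))).mul (hf.2.2 v)

theorem fderiv_log {b : ℝ} (hb : 0 < b) (hf : Differentiable ℝ f) (h : ∀ x, b ≤ f x) (x v : Plane) :
    fderiv ℝ (fun x => Real.log (f x)) x v = (f x)⁻¹ * fderiv ℝ f x v := by
  rw [fderiv.log (hf x) (hb.trans_le (h x)).ne']
  rfl

/-- The logarithm itself appears only at order zero, where the two-sided bounds on `f` control it.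
Its derivatives are products of `f⁻¹` and derivatives of `f`. -/
theorem log {b : ℝ} (hb : 0 < b) (hf : DerivBounded (k + 1) f) (h : ∀ x, b ≤ f x) :
    DerivBounded (k + 1) fun x => Real.log (f x) := by
  have hpos : ∀ x, 0 < f x := fun x => hb.trans_le (h x)
  obtain ⟨C, hC⟩ := hf.bound
  refine ⟨fun x => (hf.1 x).log (hpos x).ne', ⟨|Real.log b| + |Real.log C|, fun x => ?_⟩, fun v => ?_⟩
  · have h1 := Real.log_le_log hb (h x)
    have h2 := Real.log_le_log (hpos x) ((le_abs_self _).trans (hC x))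
    exact abs_le.2 ⟨by linarith [neg_abs_le (Real.log b), abs_nonneg (Real.log C)],
      by linarith [le_abs_self (Real.log C), abs_nonneg (Real.log b)]⟩
  · simp only [fderiv_log hb hf.1 h]
    exact (inv hb hf.of_succ h).mul (hf.2.2 v)

theorem exists_lipschitzWith (h : DerivBounded 1 f) : ∃ C, LipschitzWith C f := by
  choose C hC using fun i : Fin 2 => (h.2.2 (basisVec i)).2
  refine ⟨Real.toNNReal (C 0 + C 1), lipschitzWith_of_nnnorm_fderiv_le h.1 fun x => ?_⟩
  have h0 : 0 ≤ C 0 + C 1 := add_nonneg ((abs_nonneg _).trans (hC 0 x)) ((abs_nonneg _).trans (hC 1 x))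
  rw [← NNReal.coe_le_coe, coe_nnnorm, Real.coe_toNNReal _ h0]
  refine ContinuousLinearMap.opNorm_le_bound _ h0 fun v => ?_
  rw [fderiv_apply_plane, add_mul]
  refine (_root_.norm_add_le _ _).trans (add_le_add ?_ ?_)
  all_goals
    rw [norm_mul, mul_comm, Real.norm_eq_abs, Real.norm_eq_abs]
    exact mul_le_mul (hC _ x) (abs_coord_le v _) (abs_nonneg _) ((abs_nonneg _).trans (hC _ x))

theorem abs_diff2_le (h : DerivBounded 2 f) :
    ∃ m, ∀ x p q, |diff2 f x p q| ≤ m * ‖p‖ * ‖q‖ := by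
  obtain ⟨C, hC⟩ := h.of_succ.exists_lipschitzWith
  exact abs_diff2_le_of_weak h.continuous fun v => ⟨_, hasWeakDeriv_of_lipschitzWith hC isOpen_univ v,
    (h.2.2 v).exists_lipschitzWith⟩

/-- Rotated gradients are solenoidal. -/
theorem isSolenoidal_rot_grad (h : DerivBounded 2 f) : IsSolenoidal fun x => rot (grad f x) := by
  obtain ⟨C, hC⟩ := h.of_succ.exists_lipschitzWith
  choose L hL using fun i : Fin 2 => (h.2.2 (basisVec i)).exists_lipschitzWith
  have hg : LipschitzWith (Real.toNNReal (L 0 + L 1)) (grad f) := lipschitz_of_norm_le fun x y => by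
    refine (norm_le_add_abs _).trans ?_
    rw [add_mul]
    exact add_le_add (abs_sub_le_of_lipschitzWith (hL 0) x y)
      (abs_sub_le_of_lipschitzWith (hL 1) x y)
  refine isSolenoidal_of_smooth (rot.lipschitz.comp hg) fun χ h1 h2 => ?_
  obtain ⟨D, hD⟩ := h1.lipschitzWith_of_hasCompactSupport h2 (by simp)
  have e : ∀ x, fderiv ℝ χ x (rot (grad f x))
      = fderiv ℝ χ x (basisVec 1) * fderiv ℝ f x (basisVec 0)
        - fderiv ℝ χ x (basisVec 0) * fderiv ℝ f x (basisVec 1) := fun x => by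
    rw [fderiv_apply_plane _ (rot _), rot_zero_coord, rot_one_coord, grad]
    simp only []
    ring
  simp only [e]
  rw [integral_sub (integrable_fderiv_mul hD (h.2.2 _).continuous h2 _)
    (integrable_fderiv_mul hD (h.2.2 _).continuous h2 _),
    integral_fderiv_mul_fderiv_swap h1 h2 hC (basisVec 1) (basisVec 0), sub_self]

end DerivBounded

/-- Bounds for a planar field from bounds for its components. -/
theorem field_bounds {G : Plane → Plane} (h : ∀ i : Fin 2, DerivBounded 1 fun x => G x i) :
    (∃ A, ∀ x, ‖G x‖ ≤ A) ∧ ∃ A, ∀ x y, ‖G x - G y‖ ≤ A * ‖x - y‖ := by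
  choose A hA using fun i => (h i).bound
  choose L hL using fun i => (h i).exists_lipschitzWith
  refine ⟨⟨A 0 + A 1, fun x => (norm_le_add_abs _).trans (add_le_add (hA 0 x) (hA 1 x))⟩,
    L 0 + L 1, fun x y => (norm_le_add_abs _).trans ?_⟩
  rw [add_mul]
  exact add_le_add (abs_sub_le_of_lipschitzWith (hL 0) x y)
    (abs_sub_le_of_lipschitzWith (hL 1) x y)

theorem field_diff2_le {G : Plane → Plane} (h : ∀ i : Fin 2, DerivBounded 2 fun x => G x i) :
    ∃ m, ∀ x p q, ‖diff2 G x p q‖ ≤ m * ‖p‖ * ‖q‖ := by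
  choose m hm using fun i => (h i).abs_diff2_le
  refine ⟨m 0 + m 1, fun x p q => (norm_le_add_abs _).trans ?_⟩
  rw [add_mul, add_mul]
  exact add_le_add (hm 0 x p q) (hm 1 x p q)

theorem derivBounded_drift {k : ℕ} {B : Plane → ℝ} {b : ℝ} (hb : 0 < b)
    (hB : DerivBounded (k + 1) B) (h : ∀ x, b ≤ B x) (κ : ℝ) (i : Fin 2) :
    DerivBounded k fun x => ((κ * (B x)⁻¹ ^ 2) • rot (grad B x)) i := by
  have hi := hB.of_succ.inv hb h
  have h2 : DerivBounded k fun x => κ * (B x)⁻¹ ^ 2 := by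
    simpa only [sq] using (DerivBounded.const κ).mul (hi.mul hi)
  fin_cases i
  · have := (h2.mul ((DerivBounded.const (-1)).mul (hB.2.2 (basisVec 1))))
    refine (congrArg (DerivBounded k) (funext fun x => ?_)).mp this
    simp [grad]
  · have := h2.mul (hB.2.2 (basisVec 0))
    refine (congrArg (DerivBounded k) (funext fun x => ?_)).mp this
    simp [grad]

theorem exists_lipschitz_rep_univ {u : Plane → ℝ} (hu : LocallyIntegrable u)
    (h : ∀ v, ∃ g, HasWeakDeriv univ v u g ∧ MemLp g ⊤ (volume.restrict univ)) :
    ∃ (w : Plane → ℝ) (C : ℝ≥0), LipschitzWith C w ∧ u =ᵐ[volume] w := by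
  obtain ⟨w, C, hw, huw⟩ := exists_lipschitz_rep isOpen_univ convex_univ
    (by rwa [indicator_univ]) h
  exact ⟨w, C, hw, by rwa [Measure.restrict_univ] at huw⟩

theorem exists_bounded_lipschitz_rep {u : Plane → ℝ} (h : MemSobolev ⊤ univ 1 u) :
    ∃ (w : Plane → ℝ) (C : ℝ≥0) (M : ℝ), LipschitzWith C w ∧ (∀ x, |w x| ≤ M) ∧
      u =ᵐ[volume] w := by
  have hm : MemLp u ⊤ := by simpa using h.1
  obtain ⟨w, C, hw, huw⟩ := exists_lipschitz_rep_univ (hm.locallyIntegrable le_top) h.2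
  obtain ⟨M, hM⟩ := ae_abs_le_of_memLp_top h.1
  rw [Measure.restrict_univ] at hM
  refine ⟨w, C, M, hw, fun x => ?_, huw⟩
  have : (fun z => max |w z| M) =ᵐ[volume] fun _ => M := by
    filter_upwards [hM, huw] with z h1 h2
    exact max_eq_right (h2 ▸ h1)
  exact max_eq_right_iff.1 (congrFun ((Continuous.ae_eq_iff_eq volume
    (hw.continuous.abs.max continuous_const) continuous_const).1 this) x)

theorem abs_diff2_le_of_memSobolev {u w : Plane → ℝ} (hw : Continuous w) (huw : u =ᵐ[volume] w)
    (h : ∀ v, ∃ g, HasWeakDeriv univ v u g ∧ MemSobolev ⊤ univ 1 g) :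
    ∃ m, ∀ x p q, |diff2 w x p q| ≤ m * ‖p‖ * ‖q‖ :=
  abs_diff2_le_of_weak hw fun v => by
    obtain ⟨g, hg, hg'⟩ := h v
    obtain ⟨g', C, -, hC, -, he⟩ := exists_bounded_lipschitz_rep hg'
    exact ⟨g', hg.congr_ae isOpen_univ (ae_restrict_of_ae huw) (ae_restrict_of_ae he), C, hC⟩

theorem integrable_norm_fderiv_of_memSobolev {u w : Plane → ℝ} {C : ℝ≥0} (hw : LipschitzWith C w)
    (huw : u =ᵐ[volume] w) (h : MemSobolev 1 univ 1 u) :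
    ∀ v, Integrable fun x => fderiv ℝ w x v := fun v => by
  obtain ⟨g, hg, hg'⟩ := h.2 v
  have := HasWeakDeriv.ae_eq isOpen_univ hg (hasWeakDeriv_of_lipschitzWith hw isOpen_univ v)
    (ae_restrict_of_ae huw)
  rw [Measure.restrict_univ] at this
  have hi : Integrable g := by
    have : MemLp g 1 (volume.restrict univ) := hg'
    rwa [Measure.restrict_univ, memLp_one_iff_integrable] at this
  exact hi.congr this

namespace Data

variable {c : Constants}

/-- The data of the transport problem which belong to the physical data. -/
theorem exists_compat (c : Constants) {T : ℝ} (hT : 0 < T) {B D n₀ : Plane → ℝ} {B₀ : ℝ}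
    (hB : DerivBounded 2 B) (hB₀ : 0 < B₀) (hge : ∀ x, B₀ ≤ B x)
    (hD_mom : Integrable fun x => ‖x‖ * D x) (hD : Integrable D) (hD_reg : MemSobolev ⊤ univ 1 D)
    (hn₀ : ∀ᵐ x, 0 ≤ n₀ x) (hn₀_mom : Integrable fun x => ‖x‖ * n₀ x)
    (hn₀_reg : MemSobolev 1 univ 1 n₀) (hn₀_reg' : MemSobolev ⊤ univ 1 n₀)
    (h_neutral : ∫ x, n₀ x = ∫ x, D x) :
    ∃ d : Data, d.T = T ∧ d.B = B ∧ Compat c d ∧ D =ᵐ[volume] d.D ∧ n₀ =ᵐ[volume] d.n₀ ∧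
      Integrable fun x => ‖fderiv ℝ d.w x‖ := by
  obtain ⟨Dr, CD, MD, hDr, hDb, hDe⟩ := exists_bounded_lipschitz_rep hD_reg
  obtain ⟨nr, Cn, Mn, hnr, hnb, hne⟩ := exists_bounded_lipschitz_rep hn₀_reg'
  have hpos : ∀ x, 0 < B x := fun x => hB₀.trans_le (hge x)
  -- Nonnegativity almost everywhere is expressed as an equality of continuous functions and thus
  -- holds everywhere.
  have hnr0 : ∀ x, 0 ≤ nr x := fun x => by
    have : (fun x => max (nr x) 0) =ᵐ[volume] nr := by
      filter_upwards [hn₀, hne] with x h1 h2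
      exact max_eq_left (h2 ▸ h1)
    exact max_eq_left_iff.1 (congrFun ((Continuous.ae_eq_iff_eq volume
      (hnr.continuous.max continuous_const) hnr.continuous).1 this) x)
  have hinv := hB.inv hB₀ hge
  obtain ⟨CB, hCB⟩ := hB.of_succ.exists_lipschitzWith
  obtain ⟨Ci, hCi⟩ := hinv.of_succ.exists_lipschitzWith
  obtain ⟨MB, hMB⟩ := hB.bound
  have hib : ∀ x, |(B x)⁻¹| ≤ B₀⁻¹ := fun x => by
    rw [abs_of_pos (inv_pos.2 (hpos x))]
    exact inv_anti₀ hB₀ (hge x)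
  obtain ⟨Cw, hCw⟩ := LipschitzWith.mul_bounded hnr hCi hnb hib
  obtain ⟨⟨A₀, hA₀⟩, A₁, hA₁⟩ := field_bounds (derivBounded_drift hB₀ hB hge (c.σ * c.m / c.q))
  have hBw : ∀ x, B x * (nr x * (B x)⁻¹) = nr x := fun x => by
    have := (hpos x).ne'
    field_simp
  have hint : Integrable n₀ := by
    have := hn₀_reg.1
    rwa [Measure.restrict_univ, memLp_one_iff_integrable] at this
  have hnint : Integrable nr := hint.congr hne
  refine ⟨{
    T := T
    B := B
    a := fun x => (c.σ * c.m / c.q * (B x)⁻¹ ^ 2) • rot (grad B x)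
    w := fun x => nr x * (B x)⁻¹
    D := Dr
    c₀ := c.q / (2 * Real.pi * c.ε₀)
    B₀ := B₀
    B₁ := MB
    LB := CB
    A₀ := A₀
    A₁ := A₁
    W := Mn * B₀⁻¹
    Lw := Cw
    RD := MD
    LD := CD
    T_pos := hT
    B₀_pos := hB₀
    B_ge := hge
    B_le := fun x => (le_abs_self _).trans (hMB x)
    B_lip := abs_sub_le_of_lipschitzWith hCB
    a_bound := hA₀
    a_lip := hA₁
    -- The weighted drift is `B a = (σ m / q) rot ∇ log B`, a rotated gradient.
    a_sol := by
      have h1 := (hB.log hB₀ hge).isSolenoidal_rot_grad.smul (c.σ * c.m / c.q)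
      refine (congrArg IsSolenoidal (funext fun x => ?_)).mp h1
      have e : grad (fun x => Real.log (B x)) x = (B x)⁻¹ • grad B x := by
        ext i
        simp only [grad, DerivBounded.fderiv_log hB₀ hB.1 hge]
        rfl
      have := (hpos x).ne'
      rw [e, map_smul, smul_smul, smul_smul]
      congr 1
      field_simp
    w_nonneg := fun x => mul_nonneg (hnr0 x) (inv_pos.2 (hpos x)).le
    w_le := fun x => mul_le_mul ((le_abs_self _).trans (hnb x)) ((le_abs_self _).trans (hib x))
      (inv_pos.2 (hpos x)).le ((abs_nonneg _).trans (hnb x))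
    w_lip := abs_sub_le_of_lipschitzWith hCw
    n_int := by simpa only [hBw] using hnint
    n_mom := by
      simp only [hBw]
      exact hn₀_mom.congr (hne.mono fun x hx => by simp only [hx])
    D_bound := hDb
    D_lip := abs_sub_le_of_lipschitzWith hDr
    D_int := hD.congr hDe
    D_mom := hD_mom.congr (hDe.mono fun x hx => by simp only [hx])
    neutral := by
      simp only [hBw]
      rw [← integral_congr_ae hne, h_neutral, integral_congr_ae hDe] }, rfl, rfl,
    ⟨hB.1, fun x => rfl, rfl⟩, hDe, ?_, ?_⟩
  · filter_upwards [hne] with x hx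
    rw [hx]
    exact (hBw x).symm
  -- The gradient of `n₀ / B` is integrable by the product rule: `n₀` and `∇n₀` are integrable,
  -- while `B⁻¹` and its gradient are bounded.
  · have hv : ∀ v, Integrable fun x => fderiv ℝ (fun x => nr x * (B x)⁻¹) x v := fun v => by
      have h1 := integrable_norm_fderiv_of_memSobolev hnr hne hn₀_reg v
      obtain ⟨Cv, hCv⟩ := (hinv.2.2 v).bound
      have i1 : Integrable fun x => nr x * fderiv ℝ (fun x => (B x)⁻¹) x v :=
        hnint.mul_bdd (hinv.2.2 v).continuous.aestronglyMeasurable (Eventually.of_forall hCv)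
      have i2 : Integrable fun x => (B x)⁻¹ * fderiv ℝ nr x v :=
        h1.bdd_mul hinv.continuous.aestronglyMeasurable (Eventually.of_forall hib)
      refine (i1.add i2).congr ?_
      filter_upwards [hnr.ae_differentiableAt (μ := volume)] with x hx
      rw [fderiv_fun_mul hx (hinv.1 x)]
      rfl
    refine ((hv (basisVec 0)).abs.add (hv (basisVec 1)).abs).mono'
      (measurable_fderiv ℝ _).norm.aestronglyMeasurable (Eventually.of_forall fun x => ?_)
    rw [norm_norm]
    refine ContinuousLinearMap.opNorm_le_bound _ (add_nonneg (abs_nonneg _) (abs_nonneg _))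
      fun v => ?_
    rw [fderiv_apply_plane, Pi.add_apply, add_mul]
    refine (_root_.norm_add_le _ _).trans (add_le_add ?_ ?_)
    all_goals
      rw [norm_mul, mul_comm, Real.norm_eq_abs, Real.norm_eq_abs]
      exact mul_le_mul_of_nonneg_left (abs_coord_le v _) (abs_nonneg _)

variable {d : Data}

/-- Only `w` needs an argument: it is the product of `B⁻¹` and the initial density, so the discrete
Leibniz rule applies. The sum of absolute values in `S` dominates every individual constant. -/
theorem exists_isSmooth (hc : Compat c d) (hB : DerivBounded 3 d.B) {D n₀ : Plane → ℝ}
    (hD : D =ᵐ[volume] d.D) (hn₀ : n₀ =ᵐ[volume] d.n₀) (hD2 : MemSobolev ⊤ univ 2 D)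
    (hn2 : MemSobolev ⊤ univ 2 n₀) : ∃ S, d.IsSmooth S := by
  have hinv := hB.inv d.B₀_pos d.B_ge
  obtain ⟨m₁, h₁⟩ := hB.of_succ.abs_diff2_le
  obtain ⟨m₂, h₂⟩ := hinv.of_succ.abs_diff2_le
  obtain ⟨m₃, h₃⟩ := field_diff2_le (derivBounded_drift d.B₀_pos hB d.B_ge (c.σ * c.m / c.q))
  simp only [← hc.a_eq] at h₃
  obtain ⟨m₄, h₄⟩ := abs_diff2_le_of_memSobolev (d.continuous_B.mul d.continuous_w) hn₀ hn2.2
  obtain ⟨m₅, h₅⟩ := abs_diff2_le_of_memSobolev d.continuous_D hD hD2.2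
  obtain ⟨Ln, hLn⟩ := LipschitzWith.mul_bounded (lipschitz_of_norm_le (f := d.B) d.B_lip)
    lipschitzWith_w d.B_abs fun x => (abs_of_nonneg (d.w_nonneg x)).trans_le (d.w_le x)
  have hw := norm_diff2_smul_le (f := fun x => (d.B x)⁻¹) (g := fun x => d.B x * d.w x)
    (fun x => by rw [abs_of_pos (inv_pos.2 (d.B_pos x))]; exact d.inv_B_le x) d.inv_B_sub_le h₂
    (fun x => (abs_of_nonneg (dens_nonneg (d := d) id x)).trans_le (dens_le id x))
    (abs_sub_le_of_lipschitzWith hLn) h₄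
  have e : (fun x => (d.B x)⁻¹ • (d.B x * d.w x)) = d.w := funext fun x => by
    rw [smul_eq_mul, inv_mul_cancel_left₀ (d.B_pos x).ne']
  rw [e] at hw
  have hm : ∀ {F : Type} [NormedAddCommGroup F] {f : Plane → F} {m : ℝ},
      (∀ x p q, ‖diff2 f x p q‖ ≤ m * ‖p‖ * ‖q‖) → ∀ {S}, m ≤ S →
      ∀ x p q, ‖diff2 f x p q‖ ≤ S * ‖p‖ * ‖q‖ := fun hf S hS x p q =>
    (hf x p q).trans (by gcongr)
  set m₆ := m₂ * (d.B₁ * d.W) + 2 * (d.LB * d.B₀⁻¹ ^ 2) * Ln + d.B₀⁻¹ * m₄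
  have a₁ := le_abs_self m₁
  have a₂ := le_abs_self m₂
  have a₃ := le_abs_self m₃
  have a₅ := le_abs_self m₅
  have a₆ := le_abs_self m₆
  have b₁ := abs_nonneg m₁
  have b₂ := abs_nonneg m₂
  have b₃ := abs_nonneg m₃
  have b₅ := abs_nonneg m₅
  have b₆ := abs_nonneg m₆
  exact ⟨|m₁| + |m₂| + |m₃| + |m₅| + |m₆|,
    { nonneg := by positivity
      B := hm (f := d.B) h₁ (by linarith)
      invB := hm (f := fun x => (d.B x)⁻¹) h₂ (by linarith)
      a := hm h₃ (by linarith)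
      w := hm (f := d.w) hw (by linarith)
      D := hm (f := d.D) h₅ (by linarith) }⟩

/-- The logarithm of the initial value, with its second differences. -/
theorem exists_log_w (hB : DerivBounded 2 d.B) {n₀ : Plane → ℝ} (hn₀ : n₀ =ᵐ[volume] d.n₀)
    (hpos : ∀ᵐ x, 0 < n₀ x)
    (hlog : ∀ v, ∃ g, HasWeakDeriv univ v (fun x => Real.log (n₀ x)) g ∧ MemSobolev ⊤ univ 1 g) :
    ∃ (ℓ : Plane → ℝ) (C : ℝ≥0) (m : ℝ), (∀ x, d.w x = Real.exp (ℓ x)) ∧ LipschitzWith C ℓ ∧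
      ∀ x p q, |diff2 ℓ x p q| ≤ m * ‖p‖ * ‖q‖ := by
  -- The direction zero serves only to extract the local integrability contained in the definition
  -- of a weak derivative.
  have hloc : LocallyIntegrable fun x => Real.log (n₀ x) := by
    obtain ⟨g, hg, -⟩ := hlog 0
    exact locallyIntegrableOn_univ.1 hg.1
  obtain ⟨ℓ, C, hℓ, hℓe⟩ := exists_lipschitz_rep_univ hloc fun v => by
    obtain ⟨g, hg, hg'⟩ := hlog v
    exact ⟨g, hg, hg'.1⟩
  obtain ⟨m, hm⟩ := abs_diff2_le_of_memSobolev hℓ.continuous hℓe hlog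
  have hlB := hB.log d.B₀_pos d.B_ge
  obtain ⟨C', hC'⟩ := hlB.of_succ.exists_lipschitzWith
  obtain ⟨m', hm'⟩ := hlB.abs_diff2_le
  have hexp : ∀ x, d.n₀ x = Real.exp (ℓ x) := fun x => by
    have : d.n₀ =ᵐ[volume] fun x => Real.exp (ℓ x) := by
      filter_upwards [hn₀, hpos, hℓe] with x h1 h2 h3
      rw [← h3, Real.exp_log h2, h1]
    exact congrFun ((Continuous.ae_eq_iff_eq volume (d.continuous_B.mul d.continuous_w)
      (Real.continuous_exp.comp hℓ.continuous)).1 this) x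
  -- Since `w = n₀ / B`, its logarithm is that of `n₀` minus that of `B`, and both have bounded
  -- second differences.
  refine ⟨fun x => ℓ x - Real.log (d.B x), C + C', m + m', fun x => ?_, hℓ.sub hC', fun x p q => ?_⟩
  · rw [Real.exp_sub, Real.exp_log (d.B_pos x), ← hexp, Data.n₀, mul_div_cancel_left₀ _ (d.B_pos x).ne']
  · have e : diff2 (fun x => ℓ x - Real.log (d.B x)) x p q
        = diff2 ℓ x p q - diff2 (fun x => Real.log (d.B x)) x p q := by
      simp only [diff2]; abel
    rw [e, add_mul, add_mul]
    exact (abs_sub _ _).trans (add_le_add (hm x p q) (hm' x p q))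

end Data

end DriftLimit

end

/-! ### The main theorem. -/

theorem proposition4p1 (c : DriftLimit.Constants) (T : ℝ) (hT : 0 < T)
    (B D n₀ : DriftLimit.Plane → ℝ) (B₀ : ℝ)
    (hB : DriftLimit.IsCkBounded 2 B) (hB₀ : 0 < B₀) (hB_inf : IsGLB (Set.range B) B₀)
    (hD_mom : Integrable (fun x => ‖x‖ * D x)) (hD : Integrable D)
    (hD_reg : DriftLimit.MemSobolev ∞ Set.univ 1 D)
    (hn₀ : ∀ᵐ x, 0 ≤ n₀ x) (hn₀_mom : Integrable (fun x => ‖x‖ * n₀ x))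
    (hn₀_reg : DriftLimit.MemSobolev 1 Set.univ 1 n₀)
    (hn₀_reg' : DriftLimit.MemSobolev ∞ Set.univ 1 n₀)
    (h_neutral : ∫ x, n₀ x = ∫ x, D x) :
    ∃ (n : ℝ → DriftLimit.Plane → ℝ) (E : ℝ → DriftLimit.Plane → DriftLimit.Plane),
      c.IsRegularSolution T B D n₀ n E ∧
      (∀ n' E', c.IsRegularSolution T B D n₀ n' E' →
        ∀ t ∈ Set.Icc 0 T, ∀ x, n' t x = n t x ∧ E' t x = E t x) ∧
      (∀ t ∈ Set.Icc 0 T, Integrable (n t) ∧ ∫ x, n t x = ∫ x, D x) ∧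
      DriftLimit.MemTimeSobolev T 1 1 n ∧
      DriftLimit.MemSobolev ∞ (DriftLimit.slab T) 1 (Function.uncurry n) ∧
      DriftLimit.MemTimeSobolev T 0 1 (fun t x => ‖x‖ * n t x) ∧
      DriftLimit.MemSobolev ∞ (DriftLimit.slab T) 1 (Function.uncurry E) ∧
      DriftLimit.MemTimeSobolev T 0 2 E ∧
      (∃ E_t : ℝ → DriftLimit.Plane → DriftLimit.Plane,
        DriftLimit.HasWeakTimeDeriv T E E_t ∧ DriftLimit.MemTimeSobolev T 0 2 E_t) ∧
      (DriftLimit.IsCkBounded 3 B →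
        DriftLimit.MemSobolev 1 Set.univ 1 D → DriftLimit.MemSobolev ∞ Set.univ 2 D →
        DriftLimit.MemSobolev 1 Set.univ 2 n₀ → DriftLimit.MemSobolev ∞ Set.univ 2 n₀ →
        (∀ᵐ x, 0 < n₀ x) →
        (∀ v : DriftLimit.Plane, ∃ g : DriftLimit.Plane → ℝ,
          DriftLimit.HasWeakDeriv Set.univ v (fun x => Real.log (n₀ x)) g ∧
            DriftLimit.MemSobolev ∞ Set.univ 1 g) →
        (∀ t ∈ Set.Icc 0 T, ∀ x, 0 < n t x) ∧
        ∃ g : ℝ → DriftLimit.Plane → DriftLimit.Plane,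
          DriftLimit.HasWeakSpaceGrad T n g ∧
          DriftLimit.MemSobolev ∞ (DriftLimit.slab T) 1
            (Function.uncurry (c.kField n g E))) := by
  -- Of the infimum only the lower bound `B₀ ≤ B` enters.
  obtain ⟨d, rfl, rfl, hc, hDe, hne, hw⟩ := DriftLimit.Data.exists_compat c hT hB.derivBounded hB₀
    (fun x => hB_inf.1 ⟨x, rfl⟩) hD_mom hD hD_reg hn₀ hn₀_mom hn₀_reg hn₀_reg' h_neutral
  obtain ⟨E, X, hadm, hX, hfix, hsm⟩ := d.exists_fixed_field
  have h := hadm.isField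
  have hreg := DriftLimit.Data.isRegularSolution hc h hX hfix hDe hne
  refine ⟨fun t x => d.nLag X (t, x), E, hreg,
    fun n' E' hs t ht x => DriftLimit.Data.eq_of_isRegularSolution hc h hX hfix hDe hne hs ht x,
    fun t ht => ?_, DriftLimit.Data.memTimeSobolev_density hc h hX hfix hw, hreg.n_mem,
    DriftLimit.Data.memTimeSobolev_moment h hX hfix, hreg.E_mem, hreg.E_energy,
    DriftLimit.Data.exists_time_derivative hc h hX hfix hw,
    fun hB3 _ hD2 _ hn2 hpos hlog => ?_⟩
  · have e : (fun x => d.nLag X (t, x)) = d.dens (X 0 t) := by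
      rw [DriftLimit.Data.nLag_eq, DriftLimit.clamp_of_mem ht]
    simp only [e]
    exact ⟨DriftLimit.Data.integrable_dens h hX ht, by
      rw [DriftLimit.Data.integral_dens h hX ht, DriftLimit.Data.mass, ← integral_congr_ae hne,
        h_neutral]⟩
  · have hB2 := hB.derivBounded
    obtain ⟨S, hS⟩ := DriftLimit.Data.exists_isSmooth hc hB3.derivBounded hDe hne hD2 hn2
    obtain ⟨m, hm, hE⟩ := hsm S hS
    obtain ⟨ℓ, Cℓ, mℓ, hwℓ, hℓ, hℓ2⟩ := DriftLimit.Data.exists_log_w hB2 hne hpos hlog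
    have hlB := hB2.log d.B₀_pos d.B_ge
    obtain ⟨Cb, hb⟩ := hlB.of_succ.exists_lipschitzWith
    obtain ⟨mb, hb2⟩ := hlB.abs_diff2_le
    -- Positivity of `n₀` almost everywhere has become positivity of `w` at every point, because `w`
    -- is the exponential of a finite Lipschitz function.
    have hn : ∀ z, 0 < d.nLag X z := fun z =>
      mul_pos (d.B_pos _) ((Real.exp_pos _).trans_eq (hwℓ _).symm)
    obtain ⟨G, C, R, hG, hR, he⟩ := DriftLimit.Data.exists_lipschitz_logGrad h hX hS hm hE
      (fun x => (Real.exp_log (d.B_pos x)).symm) hwℓ hb hℓ hb2 hℓ2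
    exact ⟨fun t _ x => hn (t, x), DriftLimit.Data.exists_kField_memSobolev h hX hfix hG hR hn he⟩
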